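/- Let $U\subset\mathbb C$ be a connected open set, let $\alpha_0,\dots,\alpha_4$ be analytic on $U$, and consider the Hamiltonian system $y'=\partial H/\partial x$, $x'=-\partial H/\partial y$ with $$H=\tfrac12x^2y-\tfrac12y^5-\tfrac{\alpha_4}{4}y^4-\tfrac{\alpha_3}{3}y^3-\tfrac{\alpha_2}{2}y^2-\alpha_1y-\alpha_0x .$$ *Blow-ups.* Compactify the phase space to $\mathbb{CP}^2$ by $[1:x:y]=[u_0:1:v_0]=[V_0:U_0:1]$. Blowing up a point $(a,b)$ of a chart $(u_i,v_i)$ introduces charts $(u_j,v_j)$, $(U_j,V_j)$ with $u_i=u_j+a=U_jV_j+a$, $v_i=u_jv_j+b=V_j+b$ and an exceptional curve $E_j=\{u_j=0\}\cup\{V_j=0\}$. Blow up successively $p_1:(u_0,v_0)=(0,0)$; $p_2:(U_1,V_1)=(0,0)$; for $\varepsilon=\pm1$ the points $p_3^\varepsilon:(u_2,v_2)=(0,\varepsilon)$, $p_4^\varepsilon:(u_3,v_3)=(0,-\varepsilon\frac{\alpha_4}{4})$, $p_5^\varepsilon:(u_4,v_4)=(0,\varepsilon(\frac{3}{32}\alpha_4^2-\frac13\alpha_3))$,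 $p_6^\varepsilon:(u_5,v_5)=(0,f_6^\varepsilon)$, $p_7^\varepsilon:(u_6,v_6)=(0,f_7^\varepsilon)$ with $$f_6^\varepsilon=\tfrac18\alpha_4'-\alpha_0+\varepsilon\big(-\tfrac12\alpha_2+\tfrac14\alpha_4\alpha_3-\tfrac5{128}\alpha_4^3\big),$$ $$f_7^\varepsilon=\tfrac12\alpha_4\alpha_0+\tfrac13\alpha_3'-\tfrac5{32}\alpha_4\alpha_4'+\varepsilon\big(-\alpha_1+\tfrac38\alpha_4\alpha_2+\tfrac16\alpha_3^2-\tfrac5{32}\alpha_4^2\alpha_3+\tfrac{35}{2048}\alpha_4^4\big);$$ and $p_8:(u_1,v_1)=(0,0)$, $p_9:(u_8,v_8)=(0,2\alpha_0)$. The final curves are $E_7^{\pm}$ and $E_9$; the other exceptional curves $E_1,E_2,E_3^\pm,\dots,E_6^\pm,E_8$ are called intermediate. **(1)** The following are equivalent: (a) $\alpha_4''=0$, $\big(\tfrac13\alpha_4^3-\tfrac{32}{9}\alpha_4\alpha_3+\tfrac{64}{3}\alpha_2\big)'=0$ on $U$, and $\alpha_0$ is constant; (b) the blow-ups regularise the system: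 at every point of $E_7^{\pm}$, over every $z_0\in U$, it becomes a regular (analytic) initial value problem when $u_7$ (in the chart $(u_7,v_7)$) or $V_7$ (in the chart $(U_7,V_7)$) is taken as the independent variable; along $E_9$ it is regular in the chart $(u_9,v_9)$ with independent variable $z$, and in the chart $(U_9,V_9)$ with independent variable $V_9$; (c) for every $z_0\in U$ and every $v_0\in\mathbb C$ there are solutions given by (finite-principal-part) series in powers of $(z-z_0)^{1/2}$ that pass at $z_0$ through the point $(u_7,v_7)=(0,v_0)$ of $E_7^+$, respectively of $E_7^-$, and a solution given by a Laurent series in $z-z_0$ that passes at $z_0$ through the point $(u_9,v_9)=(0,v_0)$ of $E_9$. **(2)** If $\alpha_4(z)=4z$, then (a) holds if and only if $\alpha_0$ is constant and $\alpha_2=c+\frac{2z}{3}\alpha_3-z^3$ for some $c\in\mathbb C$. If (a) holds and $\alpha_4$ is not constant, then a change of variables $z=\mu Z+\nu$, $X=\mu x$, $Y=y/\lambda$ with constants $\mu,\lambda\ne0$, $\nu$ brings the system to this normalised form. **(3)** Let $\alpha_1,\alpha_3$ be arbitrary analytic functions on $U$, $\alpha_0,c\in\mathbb C$, $\alpha_4=4z$,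 $\alpha_2=c+\frac{2z}3\alpha_3-z^3$. Then: (i) where $y\neq0$, the system is equivalent, with $x=(y'+\alpha_0)/y$, to $$y''=\frac{(y')^2}{2y}+\frac52y^5+4zy^4+\alpha_3y^3+\Big(c+\frac{2z}{3}\alpha_3-z^3\Big)y^2+\alpha_1y-\frac{\alpha_0^2}{2y}.$$ (ii) For every $z_0\in U$ and every $v_0\in\mathbb C$ there are solutions with a square-root algebraic pole at $z_0$ passing through the point $(0,v_0)$ of $E_7^{+}$, respectively $E_7^-$; every such solution satisfies $x\sim-\frac{1}{2(z-z_0)}$, $y\sim\frac{\sigma}{\sqrt2\,(z-z_0)^{1/2}}$ with $\sigma^2=-1$ on $E_7^+$ and $\sigma^2=1$ on $E_7^-$. There are also solutions with an ordinary pole at $z_0$ passing through the point $(0,v_0)$ of $E_9$; every such solution has $x$ with a simple pole, $x\sim\frac{2}{z-z_0}$, and $y/(z-z_0)\to\alpha_0$, so that $y$ has a simple zero if $\alpha_0\ne0$. (iii) If a local analytic solution is continued analytically along a path of finite length in $U$ up to, but excluding, its end point $z_*\in U$, then either it continues analytically to $z_*$, or it has at $z_*$ a square-root algebraic pole passing through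 a point $(0,v_0)$ of $E_7^{+}$ or $E_7^-$, or an ordinary pole passing through a point $(0,v_0)$ of $E_9$, as in (ii). (iv) The line at infinity and the intermediate exceptional curves are inaccessible: no solution continued along a path of finite length in $U$ with end point $z_*\in U$ tends, as $z\to z_*$, to a point of these curves other than a base point $p_1,\dots,p_9$ (the points in which $E_7^\pm$ and $E_9$ meet $E_6^\pm$ and $E_8$ included). (v) The auxiliary function $$W=H+\frac12\,\frac{x\,y^2}{y^2+A_1y-1},\qquad A_1=3z-\tfrac23\alpha_3',$$ tends to infinity at every point of the line at infinity and of the intermediate exceptional curves, as they arise in the respective blow-up, other than the base points and the points where $y^2+A_1y-1$ vanishes (these lie on $E_1$); the logarithmic derivative $W'/W$ along the system is bounded near every such point; and $W$ is bounded near every point $(0,v_0)$ of the final curves $E_7^\pm$, $E_9$ in the charts $(u_7,v_7)$, $(u_9,v_9)$. -/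

import Mathlib

open Set Filter Topology

noncomputable section

namespace QP4

/-! ### The Hamiltonian system -/

/-- The Hamiltonian in the dependent variables `p = (x, y)`, with coefficients `α₀, …, α₄`. -/
def hamiltonian (α : Fin 5 → ℂ → ℂ) (z : ℂ) (p : ℂ × ℂ) : ℂ :=
  1 / 2 * p.1 ^ 2 * p.2 - 1 / 2 * p.2 ^ 5 - α 4 z / 4 * p.2 ^ 4 - α 3 z / 3 * p.2 ^ 3
    - α 2 z / 2 * p.2 ^ 2 - α 1 z * p.2 - α 0 z * p.1

/-- The right-hand side `(x', y')` of the system, at the point `p = (x, y)`. -/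
def field (α : Fin 5 → ℂ → ℂ) (z : ℂ) (p : ℂ × ℂ) : ℂ × ℂ :=
  (5 / 2 * p.2 ^ 4 - 1 / 2 * p.1 ^ 2 + α 4 z * p.2 ^ 3 + α 3 z * p.2 ^ 2 + α 2 z * p.2 + α 1 z,
    p.1 * p.2 - α 0 z)

/-- The system is the Hamiltonian one: `x' = -∂H/∂y`, `y' = ∂H/∂x`. -/
theorem field_eq_hamiltonian (α : Fin 5 → ℂ → ℂ) (z x y : ℂ) :
    HasDerivAt (fun t => hamiltonian α z (x, t)) (-(field α z (x, y)).1) y ∧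
      HasDerivAt (fun t => hamiltonian α z (t, y)) (field α z (x, y)).2 x := by
  constructor
  · have h := (((((((hasDerivAt_id y).const_mul (1 / 2 * x ^ 2)).sub
      (((hasDerivAt_id y).pow 5).const_mul (1 / 2))).sub
      (((hasDerivAt_id y).pow 4).const_mul (α 4 z / 4))).sub
      (((hasDerivAt_id y).pow 3).const_mul (α 3 z / 3))).sub
      (((hasDerivAt_id y).pow 2).const_mul (α 2 z / 2))).sub
      ((hasDerivAt_id y).const_mul (α 1 z))).sub (hasDerivAt_const y (α 0 z * x))
    refine (h.congr_deriv ?_).congr_of_eventuallyEq (Eventually.of_forall fun t => ?_)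
    · simp only [field, id]; push_cast; ring
    · simp only [hamiltonian, Pi.sub_apply, Pi.pow_apply, id]
  · have h := ((((hasDerivAt_id x).pow 2).const_mul (1 / 2 * y)).sub
      (hasDerivAt_const x (1 / 2 * y ^ 5 + α 4 z / 4 * y ^ 4 + α 3 z / 3 * y ^ 3
        + α 2 z / 2 * y ^ 2 + α 1 z * y))).sub ((hasDerivAt_id x).const_mul (α 0 z))
    refine (h.congr_deriv ?_).congr_of_eventuallyEq (Eventually.of_forall fun t => ?_)
    · simp only [field, id]; push_cast; ring
    · simp only [hamiltonian, Pi.sub_apply, Pi.pow_apply, id]; ring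

/-- `(x, y)` solves the system at every point of the set `S`. -/
def SolvesOn (α : Fin 5 → ℂ → ℂ) (S : Set ℂ) (x y : ℂ → ℂ) : Prop :=
  ∀ z ∈ S, HasDerivAt x (field α z (x z, y z)).1 z ∧ HasDerivAt y (field α z (x z, y z)).2 z

/-- The conditions on the coefficients:
`α₄'' = 0`, `(α₄³/3 - (32/9) α₄ α₃ + (64/3) α₂)' = 0`, and `α₀` is constant. -/
def Conditions (U : Set ℂ) (α : Fin 5 → ℂ → ℂ) : Prop :=
  (∀ z ∈ U, deriv (deriv (α 4)) z = 0) ∧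
  (∀ z ∈ U, deriv (fun w => α 4 w ^ 3 / 3 - 32 / 9 * (α 4 w * α 3 w) + 64 / 3 * α 2 w) z = 0) ∧
  (∃ a : ℂ, ∀ z ∈ U, α 0 z = a)

/-- The normalised coefficients `α₀ = a₀`, `α₁`, `α₂ = c + (2z/3) α₃ - z³`, `α₃`, `α₄ = 4z`. -/
def normalised (a₀ c : ℂ) (α₁ α₃ : ℂ → ℂ) : Fin 5 → ℂ → ℂ :=
  ![fun _ => a₀, α₁, fun z => c + 2 * z / 3 * α₃ z - z ^ 3, α₃, fun z => 4 * z]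

/-! ### The blow-ups of the projective plane

The phase space is compactified to `ℂP²`, with `(x, y) = [1 : x : y]`. A (possibly `z`-dependent)
coordinate chart is given by the homogeneous coordinates of the point with chart coordinates `q`.
The first homogeneous coordinate vanishes exactly on the total transform of the line at
infinity. -/

/-- A chart: `z ↦ q ↦ [h₀ : h₁ : h₂]`. -/
abbrev Chart := ℂ → ℂ × ℂ → ℂ × ℂ × ℂ

/-- The phase-space point `(x, y) = (h₁ / h₀, h₂ / h₀)` of a point `(z, q)` off the line at
infinity. -/
def affine (c : Chart) (p : ℂ × ℂ × ℂ) : ℂ × ℂ :=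
  ((c p.1 p.2).2.1 / (c p.1 p.2).1, (c p.1 p.2).2.2 / (c p.1 p.2).1)

/-- The points `(z, q)` of a chart that are not mapped to the line at infinity. -/
def finitePart (c : Chart) : Set (ℂ × ℂ × ℂ) := {p | (c p.1 p.2).1 ≠ 0}

/-- `(u₀, v₀)` with `[1 : x : y] = [u₀ : 1 : v₀]`. -/
def chart0 : Chart := fun _ q => (q.1, 1, q.2)

/-- `(U₀, V₀)` with `[1 : x : y] = [V₀ : U₀ : 1]`. -/
def chart0' : Chart := fun _ q => (q.2, q.1, 1)

/-- First chart `(u, v)` of the blow-up of the chart `c` in the point `b z`; the exceptional curve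
is `u = 0`. -/
def blowUp (c : Chart) (b : ℂ → ℂ × ℂ) : Chart :=
  fun z q => c z (q.1 + (b z).1, q.1 * q.2 + (b z).2)

/-- Second chart `(U, V)` of the blow-up of the chart `c` in the point `b z`; the exceptional curve
is `V = 0`. -/
def blowUp' (c : Chart) (b : ℂ → ℂ × ℂ) : Chart :=
  fun z q => c z (q.1 * q.2 + (b z).1, q.2 + (b z).2)

/-- The chart `(u₁, v₁)` on `E₁`, which arises from `p₁ : (u₀, v₀) = (0, 0)`. -/
def chartE1 : Chart := blowUp chart0 (fun _ => (0, 0))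
/-- The chart `(U₁, V₁)` on `E₁`. -/
def chartE1' : Chart := blowUp' chart0 (fun _ => (0, 0))

/-- The chart `(u₂, v₂)` on `E₂`, which arises from `p₂ : (U₁, V₁) = (0, 0)`. -/
def chartE2 : Chart := blowUp chartE1' (fun _ => (0, 0))
/-- The chart `(U₂, V₂)` on `E₂`. -/
def chartE2' : Chart := blowUp' chartE1' (fun _ => (0, 0))

/-- The base points of the two branches `ε = 1` and `ε = -1` over `E₂`: the point
`p^ε_{n+3}` is `(u_{n+2}, v_{n+2}) = (0, branchPoint α ε n z)`, `n = 0, …, 4`. -/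
def branchPoint (α : Fin 5 → ℂ → ℂ) (ε : ℂ) : ℕ → ℂ → ℂ
  | 0, _ => ε
  | 1, z => -ε * (α 4 z / 4)
  | 2, z => ε * (3 / 2 * (α 4 z ^ 2 / 16) - 1 / 3 * α 3 z)
  | 3, z => 1 / 2 * (deriv (α 4) z / 4) - α 0 z
      + ε * (-(1 / 2) * α 2 z + α 4 z / 4 * α 3 z - 5 / 2 * (α 4 z ^ 3 / 64))
  | 4, z => 2 * (α 4 z / 4) * α 0 z + 1 / 3 * deriv (α 3) z
      - 5 / 2 * (α 4 z / 4) * (deriv (α 4) z / 4)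
      + ε * (-α 1 z + 3 / 2 * (α 4 z / 4) * α 2 z + 1 / 6 * α 3 z ^ 2
        - 5 / 2 * (α 4 z ^ 2 / 16) * α 3 z + 35 / 8 * (α 4 z ^ 4 / 256))
  | _, _ => 0

/-- The chart `(u_{n+2}, v_{n+2})` on `E₂` (`n = 0`) or on `E^ε_{n+2}` (`1 ≤ n ≤ 5`). -/
def branchChart (α : Fin 5 → ℂ → ℂ) (ε : ℂ) : ℕ → Chart
  | 0 => chartE2
  | n + 1 => blowUp (branchChart α ε n) (fun z => (0, branchPoint α ε n z))

/-- The chart `(U_{n+3}, V_{n+3})` on `E^ε_{n+3}`, `0 ≤ n ≤ 4`. -/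
def branchChart' (α : Fin 5 → ℂ → ℂ) (ε : ℂ) (n : ℕ) : Chart :=
  blowUp' (branchChart α ε n) (fun z => (0, branchPoint α ε n z))

/-- The chart `(u₇, v₇)` on the final curve `E₇^ε`. -/
def chartE7 (α : Fin 5 → ℂ → ℂ) (ε : ℂ) : Chart := branchChart α ε 5
/-- The chart `(U₇, V₇)` on the final curve `E₇^ε`. -/
def chartE7' (α : Fin 5 → ℂ → ℂ) (ε : ℂ) : Chart := branchChart' α ε 4

/-- The chart `(u₈, v₈)` on `E₈`, which arises from `p₈ : (u₁, v₁) = (0, 0)`. -/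
def chartE8 : Chart := blowUp chartE1 (fun _ => (0, 0))
/-- The chart `(U₈, V₈)` on `E₈`. -/
def chartE8' : Chart := blowUp' chartE1 (fun _ => (0, 0))

/-- The chart `(u₉, v₉)` on the final curve `E₉`, which arises from
`p₉ : (u₈, v₈) = (0, 2 α₀)`. -/
def chartE9 (α : Fin 5 → ℂ → ℂ) : Chart := blowUp chartE8 (fun z => (0, 2 * α 0 z))
/-- The chart `(U₉, V₉)` on the final curve `E₉`. -/
def chartE9' (α : Fin 5 → ℂ → ℂ) : Chart := blowUp' chartE8 (fun z => (0, 2 * α 0 z))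

/-- The points, over a given `z`, of the line at infinity and of the intermediate exceptional
curves `E₁, E₂, E₃^±, …, E₆^±, E₈`, other than the base points `p₁, …, p₉`. -/
inductive IntermediatePoint (α : Fin 5 → ℂ → ℂ) (z : ℂ) : Chart → ℂ × ℂ → Prop
  | line (v : ℂ) (hv : v ≠ 0) : IntermediatePoint α z chart0 (0, v)
  | line' (U : ℂ) : IntermediatePoint α z chart0' (U, 0)
  | E1 (v : ℂ) (hv : v ≠ 0) : IntermediatePoint α z chartE1 (0, v)
  | E1' (U : ℂ) (hU : U ≠ 0) : IntermediatePoint α z chartE1' (U, 0)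
  | E2 (v : ℂ) (hv : v ≠ 1) (hv' : v ≠ -1) : IntermediatePoint α z chartE2 (0, v)
  | E2' (U : ℂ) (hU : U ≠ 1) (hU' : U ≠ -1) : IntermediatePoint α z chartE2' (U, 0)
  | branch (ε : ℂ) (hε : ε = 1 ∨ ε = -1) (n : ℕ) (hn : 1 ≤ n) (hn' : n ≤ 4) (v : ℂ)
      (hv : v ≠ branchPoint α ε n z) : IntermediatePoint α z (branchChart α ε n) (0, v)
  | branch' (ε : ℂ) (hε : ε = 1 ∨ ε = -1) (n : ℕ) (hn : 1 ≤ n) (hn' : n ≤ 4) (U : ℂ)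
      (hU : U * branchPoint α ε n z ≠ 1) :
      IntermediatePoint α z (branchChart' α ε (n - 1)) (U, 0)
  | E8 (v : ℂ) (hv : v ≠ 2 * α 0 z) : IntermediatePoint α z chartE8 (0, v)
  | E8' (U : ℂ) (hU : U * (2 * α 0 z) ≠ 1) : IntermediatePoint α z chartE8' (U, 0)

/-- The points in which the final curves `E₇^±`, `E₉` meet the strict transforms of the intermediate
curves `E₆^±`, `E₈`. -/
inductive CornerPoint (α : Fin 5 → ℂ → ℂ) : Chart → ℂ × ℂ → Prop
  | E7 (ε : ℂ) (hε : ε = 1 ∨ ε = -1) : CornerPoint α (chartE7' α ε) (0, 0)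
  | E9 : CornerPoint α (chartE9' α) (0, 0)

/-! ### Regularity in the final charts -/

/-- In the chart `c`, near `(z₀, q)`, the system is a regular initial value problem for `(q₁, q₂)`
as functions of `z`. -/
def RegularInTime (α : Fin 5 → ℂ → ℂ) (c : Chart) (z₀ : ℂ) (q : ℂ × ℂ) : Prop :=
  ∃ ξ η : ℂ × ℂ × ℂ → ℂ, AnalyticAt ℂ ξ (z₀, q) ∧ AnalyticAt ℂ η (z₀, q) ∧
    ∀ᶠ p in 𝓝 (z₀, q), p ∈ finitePart c →
      fderiv ℂ (affine c) p (1, ξ p, η p) = field α p.1 (affine c p)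

/-- In the chart `c`, near `(z₀, q)`, the system is a regular initial value problem
`dz/dq₁ = ζ`, `dq₂/dq₁ = η` for `(z, q₂)` as functions of the first coordinate `q₁`. -/
def RegularInFst (α : Fin 5 → ℂ → ℂ) (c : Chart) (z₀ : ℂ) (q : ℂ × ℂ) : Prop :=
  ∃ ζ η : ℂ × ℂ × ℂ → ℂ, AnalyticAt ℂ ζ (z₀, q) ∧ AnalyticAt ℂ η (z₀, q) ∧
    ∀ᶠ p in 𝓝 (z₀, q), p ∈ finitePart c →
      fderiv ℂ (affine c) p (ζ p, 1, η p) = ζ p • field α p.1 (affine c p)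

/-- In the chart `c`, near `(z₀, q)`, the system is a regular initial value problem
`dz/dq₂ = ζ`, `dq₁/dq₂ = ξ` for `(z, q₁)` as functions of the second coordinate `q₂`. -/
def RegularInSnd (α : Fin 5 → ℂ → ℂ) (c : Chart) (z₀ : ℂ) (q : ℂ × ℂ) : Prop :=
  ∃ ζ ξ : ℂ × ℂ × ℂ → ℂ, AnalyticAt ℂ ζ (z₀, q) ∧ AnalyticAt ℂ ξ (z₀, q) ∧
    ∀ᶠ p in 𝓝 (z₀, q), p ∈ finitePart c →
      fderiv ℂ (affine c) p (ζ p, ξ p, 1) = ζ p • field α p.1 (affine c p)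

/-- The blow-ups regularise the system: at every point of the final curves `E₇^±` it becomes a
regular initial value problem after taking the coordinate that vanishes on the curve as the
independent variable; at the points of `E₉` in the chart `(u₉, v₉)` it is regular as it stands, and
in the chart `(U₉, V₉)` after such an exchange. -/
def Regularises (U : Set ℂ) (α : Fin 5 → ℂ → ℂ) : Prop :=
  ∀ z₀ ∈ U, ∀ w : ℂ,
    (∀ ε : ℂ, ε = 1 ∨ ε = -1 →
      RegularInFst α (chartE7 α ε) z₀ (0, w) ∧ RegularInSnd α (chartE7' α ε) z₀ (w, 0)) ∧
    RegularInTime α (chartE9 α) z₀ (0, w) ∧ RegularInSnd α (chartE9' α) z₀ (w, 0)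

/-! ### Algebraic series expansions -/

/-- `x(z) = X(s)`, `y(z) = Y(s)` with `s ^ k = z - z₀` is a solution given by Laurent series `X`, `Y`
in `s`, i.e. by Puiseux series in `(z - z₀) ^ (1/k)`, and in the chart `c` it passes, at `z = z₀`,
through the point `(0, v₀)`. -/
def SeriesThrough (α : Fin 5 → ℂ → ℂ) (c : Chart) (k : ℕ) (z₀ v₀ : ℂ) (X Y : ℂ → ℂ) : Prop :=
  MeromorphicAt X 0 ∧ MeromorphicAt Y 0 ∧
  (∀ᶠ s in 𝓝[≠] (0 : ℂ),
    HasDerivAt X (k * s ^ (k - 1) * (field α (z₀ + s ^ k) (X s, Y s)).1) s ∧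
    HasDerivAt Y (k * s ^ (k - 1) * (field α (z₀ + s ^ k) (X s, Y s)).2) s) ∧
  ∃ u v : ℂ → ℂ, AnalyticAt ℂ u 0 ∧ AnalyticAt ℂ v 0 ∧ u 0 = 0 ∧ v 0 = v₀ ∧
    ∀ᶠ s in 𝓝[≠] (0 : ℂ), (z₀ + s ^ k, u s, v s) ∈ finitePart c ∧
      affine c (z₀ + s ^ k, u s, v s) = (X s, Y s)

/-- Through every point of the final curves there is a solution given by an algebraic series: in
powers of `(z - z₀) ^ (1/2)` on `E₇^±` and in powers of `z - z₀` on `E₉`. -/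
def HasAlgebraicSeries (U : Set ℂ) (α : Fin 5 → ℂ → ℂ) : Prop :=
  ∀ z₀ ∈ U, ∀ v₀ : ℂ,
    (∀ ε : ℂ, ε = 1 ∨ ε = -1 → ∃ X Y, SeriesThrough α (chartE7 α ε) 2 z₀ v₀ X Y) ∧
    ∃ X Y, SeriesThrough α (chartE9 α) 1 z₀ v₀ X Y

/-! ### Continuation of solutions along paths of finite length -/

/-- `γ : [0, 1] → U` is a continuous path of finite length. -/
def FinitePath (U : Set ℂ) (γ : ℝ → ℂ) : Prop :=
  ContinuousOn γ (Icc 0 1) ∧ MapsTo γ (Icc 0 1) U ∧ BoundedVariationOn γ (Icc 0 1)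

/-- The function elements `(x τ, y τ)` at `γ τ`, `0 ≤ τ < 1`, are the analytic continuation of a
local analytic solution along `γ` up to, but excluding, the end point. -/
def IsContinuation (α : Fin 5 → ℂ → ℂ) (γ : ℝ → ℂ) (x y : ℝ → ℂ → ℂ) : Prop :=
  ∀ τ ∈ Ico (0 : ℝ) 1,
    (∀ᶠ z in 𝓝 (γ τ), HasDerivAt (x τ) (field α z (x τ z, y τ z)).1 z ∧
      HasDerivAt (y τ) (field α z (x τ z, y τ z)).2 z) ∧
    ∀ᶠ τ' in 𝓝[Ico 0 1] τ, x τ' =ᶠ[𝓝 (γ τ')] x τ ∧ y τ' =ᶠ[𝓝 (γ τ')] y τ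

/-- The continuation along `γ` extends analytically to the end point of `γ`. -/
def EndsRegularly (γ : ℝ → ℂ) (x y : ℝ → ℂ → ℂ) : Prop :=
  ∃ X Y : ℂ → ℂ, AnalyticAt ℂ X (γ 1) ∧ AnalyticAt ℂ Y (γ 1) ∧
    ∀ᶠ τ in 𝓝[<] (1 : ℝ), x τ =ᶠ[𝓝 (γ τ)] X ∧ y τ =ᶠ[𝓝 (γ τ)] Y

/-- Near the end point `γ 1` the continuation along `γ` is given by an algebraic series in
`s = (z - γ 1) ^ (1/k)` that passes through a point `(0, v₀)` of the chart `c`. -/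
def EndsInSeries (α : Fin 5 → ℂ → ℂ) (c : Chart) (k : ℕ) (γ : ℝ → ℂ) (x y : ℝ → ℂ → ℂ) : Prop :=
  ∃ (v₀ : ℂ) (X Y : ℂ → ℂ), SeriesThrough α c k (γ 1) v₀ X Y ∧
    ∃ s : ℝ → ℂ, Tendsto s (𝓝[<] 1) (𝓝 0) ∧
      ∀ᶠ τ in 𝓝[<] (1 : ℝ), ContinuousAt s τ ∧ s τ ^ k = γ τ - γ 1 ∧
        ∀ᶠ w in 𝓝 (s τ), x τ (γ 1 + w ^ k) = X w ∧ y τ (γ 1 + w ^ k) = Y w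

/-- No solution, continued along a path of finite length in `U` that ends in `z₀`, tends in the
chart `c` to the point `q`. -/
def Inaccessible (U : Set ℂ) (α : Fin 5 → ℂ → ℂ) (c : Chart) (z₀ : ℂ) (q : ℂ × ℂ) : Prop :=
  ∀ (γ : ℝ → ℂ) (x y : ℝ → ℂ → ℂ) (r : ℝ → ℂ × ℂ), FinitePath U γ → γ 1 = z₀ →
    IsContinuation α γ x y →
    (∀ᶠ τ in 𝓝[<] (1 : ℝ), (γ τ, r τ) ∈ finitePart c ∧
      affine c (γ τ, r τ) = (x τ (γ τ), y τ (γ τ))) →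
    ¬ Tendsto r (𝓝[<] 1) (𝓝 q)

/-! ### The auxiliary function -/

/-- The denominator `y² + A₁ y - 1`, `A₁ = 3 z - (2/3) α₃'`. -/
def auxDenom (α : Fin 5 → ℂ → ℂ) (z : ℂ) (p : ℂ × ℂ) : ℂ :=
  p.2 ^ 2 + (3 * z - 2 / 3 * deriv (α 3) z) * p.2 - 1

/-- The auxiliary function `W = H + (1/2) x y² / (y² + A₁ y - 1)`. -/
def aux (α : Fin 5 → ℂ → ℂ) (z : ℂ) (p : ℂ × ℂ) : ℂ :=
  hamiltonian α z p + 1 / 2 * (p.1 * p.2 ^ 2 / auxDenom α z p)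

/-- The total derivative `W'` of the auxiliary function along the system. -/
def auxDeriv (α : Fin 5 → ℂ → ℂ) (z : ℂ) (p : ℂ × ℂ) : ℂ :=
  fderiv ℂ (fun r : ℂ × ℂ × ℂ => aux α r.1 r.2) (z, p) (1, field α z p)

/-- Approach, in the chart `c`, to the point `(z₀, q)` from within the phase space. -/
def approach (c : Chart) (z₀ : ℂ) (q : ℂ × ℂ) : Filter (ℂ × ℂ × ℂ) :=
  𝓝 (z₀, q) ⊓ 𝓟 (finitePart c)

end QP4

end

open QP4

/-! The proof has three parts.

*Regularity and series.* In the final chart on `E₇^ε` the system takes the form `dz/du = u ζ`,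
`u dv/du = R_ε(z) + u N`, with `ζ = -ε` on the curve: the base points are chosen so that all terms of
lower order cancel (`e7_division`), and what remains is the residue `R_ε` (`resonance`). On `E₉` the
residue is `-2 α₀'`. Regularity therefore means that `R₁`, `R₋₁` and `α₀'` vanish, and this is
condition (a) (`conditions_iff`, `regularises_iff`). If they vanish, the holomorphic existence theorem
(`exists_holomorphic_solution`) gives solutions through every point of the final curves. On `E₇^ε` the
function `z - z₀` has a double zero in `u`, so that `u` is an analytic function of `(z - z₀)^{1/2}`; on
`E₉` the independent variable is `z` itself. Conversely, the existence of a series through one point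
over `z₀` makes the residue vanish at `z₀` and determines the leading terms (`SeriesThrough.e7`,
`SeriesThrough.e9`, `hasAlgebraicSeries_iff`).

*A modified Hamiltonian.* For the normalised system and large `y`, add to `H` the terms
`x (1/2 - A₁/(2y) + g/y³) + k/y`, with coefficients chosen so that the derivative of the sum `G` along
the system is a bounded multiple of `G` plus terms at most linear in `w = x/y²` (`rate_identity`). Since
`w² = O(1 + |G|)`, the sum grows at most exponentially. A smooth cut-off in `|y|` turns it into a
function `modifiedEnergy` on the whole phase space with the same property, because both `H'` and
the added terms are controlled where `|y|` is bounded (`exists_modified_growth`). It hence stays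
bounded along paths of finite length (`exists_bound_modifiedEnergy`). No denominator occurs in it, so
that, unlike the auxiliary function `W`, it serves at all points.

*Behaviour at the curves.* Functions that differ from `H` by terms of this shape are captured by
`EnergyAtInfinity` (for large `y`) and `EnergyAt` (for `y` near a finite value). With `u = 1/y` and
`v₂ = y²/x`, such a function is, up to bounded factors, `u⁻⁵` times the distance of `v₂` from the
branches determined by the base points (`EnergyAtInfinity.branch`); for bounded `y` it is
`x (x y - 2 α₀)/2` up to lower order (`EnergyAt.approx`). So it is infinite on the line at infinity and
on the intermediate curves (`IntermediatePoint.tendsto_atTop`, `CornerPoint.tendsto_atTop`) and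
bounded on the final ones. Inaccessibility follows. Conversely, a solution that becomes infinite with
bounded energy has a cluster point on a final curve (`EnergyAtInfinity.exists_e7_limit`,
`EnergyAt.exists_e9_limit`). The solutions through nearby points exist on a disc of fixed size, so that
the given solution is one of them and ends in a series (`IsContinuation.ends`). The auxiliary function
`W` is another energy of this kind, off the zeros of its denominator. Its derivative is compared with
that of the modified Hamiltonian, and the lower bounds of `IntermediatePoint.lower` bound `W'/W`. -/

open scoped ContDiff

/-! ### Holomorphic ordinary differential equations -/

open Metric in
/-- Local existence for holomorphic ordinary differential equations, with a disc of existence that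
is uniform in the initial data. -/
theorem exists_holomorphic_solution {E : Type*} [NormedAddCommGroup E] [NormedSpace ℂ E]
    [CompleteSpace E] {F : ℂ × E → E} {t₀ : ℂ} {w₀ : E} (hF : AnalyticAt ℂ F (t₀, w₀))
    {N : Set E} (hN : N ∈ 𝓝 w₀) :
    ∃ ρ > 0, ∀ᶠ p in 𝓝 (t₀, w₀), ∃ w : ℂ → E, w p.1 = p.2 ∧
      ∀ t ∈ ball t₀ ρ, HasDerivAt w (F (t, w t)) t ∧ w t ∈ N := by
  obtain ⟨L, s, hs, hLip⟩ := hF.contDiffAt (n := 1) |>.exists_lipschitzOnWith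
  have hbd : ∀ᶠ p in 𝓝 (t₀, w₀), ‖F p‖ ≤ ‖F (t₀, w₀)‖ + 1 :=
    (hF.continuousAt.norm.tendsto.eventually (gt_mem_nhds (lt_add_one _))).mono fun _ h => h.le
  obtain ⟨δ, hδ, hball⟩ := Metric.nhds_basis_closedBall.eventually_iff.1
    ((hF.eventually_analyticAt.and hbd).and
      ((eventually_mem_set.2 hs).and (continuous_snd.continuousAt.eventually_mem hN)))
  set M : ℝ := ‖F (t₀, w₀)‖ + 1 with hM
  have hMpos : 0 < M := by positivity
  have hmem : ∀ t ∈ ball t₀ δ, ∀ w ∈ closedBall w₀ δ, (t, w) ∈ closedBall (t₀, w₀) δ := by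
    intro t ht w hw
    rw [mem_closedBall, Prod.dist_eq]
    exact max_le (mem_ball.1 ht).le (mem_closedBall.1 hw)
  -- the bounds on `ρ` keep the Picard iterates in the ball and make the iteration contract
  obtain ⟨ρ, hρ, hρδ, hρM, hρL⟩ : ∃ ρ > 0, ρ ≤ δ ∧ M * (2 * ρ) ≤ δ / 2 ∧ L * (2 * ρ) ≤ 1 / 2 := by
    refine ⟨min δ (min (δ / (4 * M)) (1 / (4 * (L + 1)))), by positivity, min_le_left _ _, ?_, ?_⟩
    · have : min δ (min (δ / (4 * M)) (1 / (4 * (L + 1)))) ≤ δ / (4 * M) :=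
        (min_le_right _ _).trans (min_le_left _ _)
      calc M * (2 * _) ≤ M * (2 * (δ / (4 * M))) := by gcongr
        _ = δ / 2 := by field_simp; ring
    · have : min δ (min (δ / (4 * M)) (1 / (4 * ((L : ℝ) + 1)))) ≤ 1 / (4 * (L + 1)) :=
        (min_le_right _ _).trans (min_le_right _ _)
      calc (L : ℝ) * (2 * _) ≤ (L + 1) * (2 * (1 / (4 * (L + 1)))) := by
            gcongr; exact le_add_of_nonneg_right zero_le_one
        _ = 1 / 2 := by field_simp; ring
  refine ⟨ρ, hρ, ?_⟩
  -- all initial times and values below share the disc of radius `ρ`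
  filter_upwards [prod_mem_nhds (ball_mem_nhds t₀ hρ) (closedBall_mem_nhds w₀ (half_pos hδ))]
  rintro ⟨t₁, w₁⟩ ⟨ht₁, hw₁⟩
  -- the Picard iterates, as holomorphic functions on the disc with values near `w₀`
  let S := {w : ℂ → E // DifferentiableOn ℂ w (ball t₀ ρ) ∧ ∀ t ∈ ball t₀ ρ, w t ∈ closedBall w₀ δ}
  have hsub : ball t₀ ρ ⊆ ball t₀ δ := ball_subset_ball hρδ
  have hdiam : ∀ t ∈ ball t₀ ρ, ‖t - t₁‖ ≤ 2 * ρ := by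
    intro t ht
    have := dist_triangle_right t t₁ t₀
    rw [← dist_eq_norm]
    linarith [mem_ball.1 ht, mem_ball.1 ht₁]
  have step : ∀ w : S, ∃ w' : S, w'.1 t₁ = w₁ ∧
      ∀ t ∈ ball t₀ ρ, HasDerivAt w'.1 (F (t, w.1 t)) t := by
    rintro ⟨w, hw, hwm⟩
    have hd : DifferentiableOn ℂ (fun t => F (t, w t)) (ball t₀ ρ) := by
      intro t ht
      have h1 := (hball (hmem t (hsub ht) _ (hwm t ht))).1.1.differentiableAt
      exact (h1.comp_differentiableWithinAt (f := fun t => (t, w t)) t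
        (differentiableWithinAt_id.prodMk (hw t ht)))
    -- holomorphic functions on a disc have primitives, which replace the integral
    obtain ⟨g, hg1, hg⟩ := hd.isExactOn_ball.with_val_at t₁ w₁
    refine ⟨⟨g, fun t ht => (hg t ht).differentiableAt.differentiableWithinAt, fun t ht => ?_⟩,
      hg1, hg⟩
    have h2 := (convex_ball t₀ ρ).norm_image_sub_le_of_norm_hasDerivWithin_le
      (fun t ht => (hg t ht).hasDerivWithinAt)
      (fun t ht => (hball (hmem t (hsub ht) _ (hwm t ht))).1.2) ht₁ ht
    rw [hg1] at h2
    have h3 : ‖g t - w₁‖ ≤ δ / 2 :=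
      h2.trans ((mul_le_mul_of_nonneg_left (hdiam t ht) hMpos.le).trans hρM)
    rw [mem_closedBall]
    have := dist_triangle (g t) w₁ w₀
    rw [← dist_eq_norm] at h3
    linarith [mem_closedBall.1 hw₁]
  choose T hT1 hT using step
  let w0 : S := ⟨fun _ => w₁, differentiableOn_const _, fun _ _ =>
    closedBall_subset_closedBall (by linarith) hw₁⟩
  let w : ℕ → S := fun n => T^[n] w0
  have hwsucc : ∀ n, w (n + 1) = T (w n) := fun n => Function.iterate_succ_apply' T n w0
  have hcontr : ∀ n, ∀ t ∈ ball t₀ ρ, ‖(w (n + 1)).1 t - (w n).1 t‖ ≤ 2 * δ * (1 / 2) ^ n := by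
    intro n
    induction n with
    | zero =>
      intro t ht
      have h1 := (w 1).2.2 t ht
      have h2 := (w 0).2.2 t ht
      have := dist_triangle_right ((w 1).1 t) ((w 0).1 t) w₀
      rw [dist_eq_norm] at this
      simp only [zero_add, pow_zero, mul_one]
      linarith [mem_closedBall.1 h1, mem_closedBall.1 h2]
    | succ n ih =>
      intro t ht
      have hb : ∀ t ∈ ball t₀ ρ, ‖F (t, (w (n + 1)).1 t) - F (t, (w n).1 t)‖
          ≤ L * (2 * δ * (1 / 2) ^ n) := by
        intro t ht
        have h := hLip.dist_le_mul _ (hball (hmem t (hsub ht) _ ((w (n + 1)).2.2 t ht))).2.1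
          _ (hball (hmem t (hsub ht) _ ((w n).2.2 t ht))).2.1
        rw [dist_eq_norm, Prod.dist_eq, dist_self, max_eq_right dist_nonneg, dist_eq_norm] at h
        exact h.trans (by gcongr; exact ih t ht)
      have h2 := (convex_ball t₀ ρ).norm_image_sub_le_of_norm_hasDerivWithin_le
        (f := fun t => (w (n + 2)).1 t - (w (n + 1)).1 t)
        (f' := fun t => F (t, (w (n + 1)).1 t) - F (t, (w n).1 t))
        (fun t ht => ?_) hb ht₁ ht
      · rw [hwsucc (n + 1), hwsucc n, hT1, hT1, sub_self, sub_zero] at h2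
        rw [hwsucc (n + 1), hwsucc n]
        refine h2.trans ?_
        calc _ ≤ L * (2 * δ * (1 / 2) ^ n) * (2 * ρ) := by gcongr; exact hdiam t ht
          _ = L * (2 * ρ) * (2 * δ * (1 / 2) ^ n) := by ring
          _ ≤ 1 / 2 * (2 * δ * (1 / 2) ^ n) := by gcongr
          _ = _ := by ring
      · have h3 := hT (w (n + 1)) t ht
        have h4 := hT (w n) t ht
        rw [← hwsucc] at h3 h4
        exact (h3.sub h4).hasDerivWithinAt
  have hdist : ∀ t ∈ ball t₀ ρ, ∀ n,
      dist ((w n).1 t) ((w (n + 1)).1 t) ≤ 2 * δ * (1 / 2) ^ n := by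
    intro t ht n
    rw [dist_comm, dist_eq_norm]
    exact hcontr n t ht
  have hlim : ∀ t, ∃ y, t ∈ ball t₀ ρ → Tendsto (fun n => (w n).1 t) atTop (𝓝 y) := by
    intro t
    by_cases ht : t ∈ ball t₀ ρ
    · obtain ⟨y, hy⟩ := cauchySeq_tendsto_of_complete
        (cauchySeq_of_le_geometric _ _ (by norm_num) (hdist t ht))
      exact ⟨y, fun _ => hy⟩
    · exact ⟨0, fun h => absurd h ht⟩
  choose φ hφ using hlim
  have hunif : TendstoUniformlyOn (fun n => (w n).1) φ atTop (ball t₀ ρ) := by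
    rw [Metric.tendstoUniformlyOn_iff]
    intro ε hε
    have h0 : Tendsto (fun n : ℕ => 2 * δ * (1 / 2 : ℝ) ^ n / (1 - 1 / 2)) atTop (𝓝 0) := by
      have := (tendsto_pow_atTop_nhds_zero_of_lt_one (r := (1 / 2 : ℝ)) (by norm_num)
        (by norm_num)).const_mul (2 * δ)
      simpa using this.div_const (1 - 1 / 2)
    filter_upwards [h0.eventually (gt_mem_nhds hε)] with n hn t ht
    rw [dist_comm]
    exact (dist_le_of_le_geometric_of_tendsto _ _ (by norm_num) (hdist t ht) (hφ t ht) n).trans_lt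
      hn
  have hmemφ : ∀ t ∈ ball t₀ ρ, φ t ∈ closedBall w₀ δ := fun t ht =>
    isClosed_closedBall.mem_of_tendsto (hφ t ht) (Eventually.of_forall fun n => (w n).2.2 t ht)
  refine ⟨φ, ?_, fun t ht => ⟨?_, ?_⟩⟩
  · refine tendsto_nhds_unique ((hφ t₁ ht₁).comp (tendsto_add_atTop_nat 1)) ?_
    refine tendsto_const_nhds.congr fun n => ?_
    simp only [Function.comp, hwsucc, hT1]
  -- derivatives of locally uniform limits of holomorphic functions converge
  · have hdif := hunif.tendstoLocallyUniformlyOn.differentiableOn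
      (Eventually.of_forall fun n => (w n).2.1) isOpen_ball
    have hder := (hunif.tendstoLocallyUniformlyOn.deriv
      (Eventually.of_forall fun n => (w n).2.1) isOpen_ball).tendsto_at ht
    have h1 : Tendsto (fun n => F (t, (w n).1 t)) atTop (𝓝 (F (t, φ t))) :=
      ((hball (hmem t (hsub ht) _ (hmemφ t ht))).1.1.continuousAt.tendsto).comp
        (tendsto_const_nhds.prodMk_nhds (hφ t ht))
    have h2 : deriv φ t = F (t, φ t) := by
      refine tendsto_nhds_unique (hder.comp (tendsto_add_atTop_nat 1)) (h1.congr fun n => ?_)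
      simp only [Function.comp, hwsucc]
      exact (hT (w n) t ht).deriv.symm
    rw [← h2]
    exact ((hdif t ht).differentiableAt (isOpen_ball.mem_nhds ht)).hasDerivAt
  · exact (hball (hmem t (hsub ht) _ (hmemφ t ht))).2.2

open Metric in
/-- Local uniqueness for holomorphic ordinary differential equations. -/
theorem eventuallyEq_of_hasDerivAt {E : Type*} [NormedAddCommGroup E] [NormedSpace ℂ E]
    [CompleteSpace E] {F : ℂ × E → E} {t₀ : ℂ} {a b : ℂ → E} (hF : AnalyticAt ℂ F (t₀, a t₀))
    (ha : ∀ᶠ t in 𝓝 t₀, HasDerivAt a (F (t, a t)) t)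
    (hb : ∀ᶠ t in 𝓝 t₀, HasDerivAt b (F (t, b t)) t) (hab : a t₀ = b t₀) : a =ᶠ[𝓝 t₀] b := by
  obtain ⟨L, s, hs, hLip⟩ := hF.contDiffAt (n := 1) |>.exists_lipschitzOnWith
  have hca : Tendsto (fun t => (t, a t)) (𝓝 t₀) (𝓝 (t₀, a t₀)) :=
    continuousAt_id.prodMk ha.self_of_nhds.continuousAt
  have hcb : Tendsto (fun t => (t, b t)) (𝓝 t₀) (𝓝 (t₀, a t₀)) :=
    hab ▸ continuousAt_id.prodMk hb.self_of_nhds.continuousAt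
  have hbd : ∀ᶠ t in 𝓝 t₀, ‖a t - b t‖ ≤ 1 := by
    have : ContinuousAt (fun t => ‖a t - b t‖) t₀ :=
      (ha.self_of_nhds.continuousAt.sub hb.self_of_nhds.continuousAt).norm
    exact (this.eventually_lt continuousAt_const (by simp [hab])).mono fun _ h => le_of_lt h
  obtain ⟨δ, hδ, hball⟩ := Metric.nhds_basis_ball.eventually_iff.1
    (((ha.and hb).and hbd).and ((hca.eventually_mem hs).and (hcb.eventually_mem hs)))
  obtain ⟨r, hr, hrδ, hrL⟩ : ∃ r > 0, r ≤ δ ∧ L * r ≤ 1 / 2 := by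
    refine ⟨min δ (1 / (2 * (L + 1))), by positivity, min_le_left _ _, ?_⟩
    calc (L : ℝ) * min δ (1 / (2 * (L + 1))) ≤ (L + 1) * (1 / (2 * (L + 1))) := by
          gcongr
          · exact le_add_of_nonneg_right zero_le_one
          · exact min_le_right _ _
      _ = 1 / 2 := by field_simp
  -- integrating the Lipschitz bound halves the difference at every step
  have key : ∀ n : ℕ, ∀ t ∈ ball t₀ r, ‖a t - b t‖ ≤ (1 / 2) ^ n := by
    intro n
    induction n with
    | zero => intro t ht; simpa using (hball (ball_subset_ball hrδ ht)).1.2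
    | succ n ih =>
      intro t ht
      have h2 := (convex_ball t₀ r).norm_image_sub_le_of_norm_hasDerivWithin_le
        (f := fun t => a t - b t) (f' := fun t => F (t, a t) - F (t, b t))
        (fun t ht => ((hball (ball_subset_ball hrδ ht)).1.1.1.sub
          (hball (ball_subset_ball hrδ ht)).1.1.2).hasDerivWithinAt) (C := L * (1 / 2) ^ n)
        (fun t ht => ?_) (mem_ball_self hr) ht
      · rw [hab, sub_self, sub_zero] at h2
        have h3 : ‖t - t₀‖ ≤ r := by rw [← dist_eq_norm]; exact (mem_ball.1 ht).le
        calc _ ≤ _ := h2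
          _ ≤ L * (1 / 2) ^ n * r := by gcongr
          _ = L * r * (1 / 2) ^ n := by ring
          _ ≤ 1 / 2 * (1 / 2) ^ n := by gcongr
          _ = _ := by ring
      · have h := hLip.dist_le_mul _ (hball (ball_subset_ball hrδ ht)).2.1
          _ (hball (ball_subset_ball hrδ ht)).2.2
        rw [dist_eq_norm, Prod.dist_eq, dist_self, max_eq_right dist_nonneg, dist_eq_norm] at h
        exact h.trans (by gcongr; exact ih t ht)
  filter_upwards [ball_mem_nhds t₀ hr] with t ht
  have h0 := ge_of_tendsto' (tendsto_pow_atTop_nhds_zero_of_lt_one (r := (1 / 2 : ℝ))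
    (by norm_num) (by norm_num)) fun n => key n t ht
  exact sub_eq_zero.1 (norm_le_zero_iff.1 h0)

/-! ### Analytic continuation along paths -/

namespace QP4

/-- The position in phase space of a continuation depends continuously on the parameter. -/
theorem IsContinuation.continuousOn {α : Fin 5 → ℂ → ℂ} {γ : ℝ → ℂ} {x y : ℝ → ℂ → ℂ}
    (h : IsContinuation α γ x y) (hγ : ContinuousOn γ (Icc 0 1)) :
    ContinuousOn (fun τ => (x τ (γ τ), y τ (γ τ))) (Ico 0 1) := by
  intro τ hτ
  obtain ⟨h1, h2⟩ := h τ hτ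
  have hγτ : ContinuousWithinAt γ (Ico 0 1) τ :=
    (hγ τ (Ico_subset_Icc_self hτ)).mono Ico_subset_Icc_self
  have h3 : ContinuousWithinAt (fun τ' => (x τ (γ τ'), y τ (γ τ'))) (Ico 0 1) τ :=
    ContinuousWithinAt.prodMk
      (h1.self_of_nhds.1.continuousAt.comp_continuousWithinAt hγτ)
      (h1.self_of_nhds.2.continuousAt.comp_continuousWithinAt hγτ)
  refine h3.congr_of_eventuallyEq ?_ rfl
  filter_upwards [h2] with τ' h
  rw [h.1.self_of_nhds, h.2.self_of_nhds]

theorem analyticAt_field {α : Fin 5 → ℂ → ℂ} {z : ℂ} (hα : ∀ i, AnalyticAt ℂ (α i) z) (p : ℂ × ℂ) :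
    AnalyticAt ℂ (fun r : ℂ × ℂ × ℂ => field α r.1 r.2) (z, p) := by
  have h : ∀ i, ContDiffAt ℂ ω (α i) (z, p).1 := fun i => (hα i).contDiffAt
  have h' : ContDiffAt ℂ ω (fun r : ℂ × ℂ × ℂ => field α r.1 r.2) (z, p) := by
    unfold field
    fun_prop
  exact h'.analyticAt

/-- A function element of a continuation that agrees at one point with a solution `P` of the
system, parametrised by `z = Z u`, agrees with it nearby. -/
theorem IsContinuation.eventually_eq {α : Fin 5 → ℂ → ℂ} {γ : ℝ → ℂ} {x y : ℝ → ℂ → ℂ}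
    (h : IsContinuation α γ x y) {Z : ℂ → ℂ} {P : ℂ → ℂ × ℂ} {τ : ℝ} (hτ : τ ∈ Ico (0 : ℝ) 1)
    {u : ℂ} (hZ : AnalyticAt ℂ Z u) (hα : ∀ i, AnalyticAt ℂ (α i) (Z u))
    (hP : ∀ᶠ v in 𝓝 u, HasDerivAt P (deriv Z v • field α (Z v) (P v)) v)
    (hu : Z u = γ τ) (hu' : P u = (x τ (γ τ), y τ (γ τ))) :
    ∀ᶠ v in 𝓝 u, (x τ (Z v), y τ (Z v)) = P v := by
  refine eventuallyEq_of_hasDerivAt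
    (F := fun r : ℂ × ℂ × ℂ => deriv Z r.1 • field α (Z r.1) r.2) ?_ ?_ hP (by simp [hu, hu'])
  · refine AnalyticAt.smul (hZ.deriv.comp_of_eq analyticAt_fst rfl) ?_
    exact (analyticAt_field hα _).comp_of_eq
      (f := fun r : ℂ × ℂ × ℂ => (Z r.1, r.2))
      ((hZ.comp_of_eq analyticAt_fst rfl).prod analyticAt_snd) rfl
  · have h1 := (h τ hτ).1
    rw [← hu] at h1
    filter_upwards [hZ.continuousAt.eventually h1, hZ.eventually_analyticAt] with v hv hZv
    have h2 := hv.1.comp v hZv.differentiableAt.hasDerivAt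
    have h3 := hv.2.comp v hZv.differentiableAt.hasDerivAt
    refine (h2.prodMk h3).congr_deriv ?_
    ext <;> simp [mul_comm]

/-- Let `P` be a solution parametrised by `z = Z u`, with `u` in an open set `R`, that becomes
infinite at the points outside `R` of a compact set `K`. If a continuation along `γ` agrees with
it at one parameter `τ₀`, and `Z` takes the later values of `γ` in `K` only, then the continuation
stays on this solution. -/
theorem IsContinuation.exists_param {α : Fin 5 → ℂ → ℂ} {γ : ℝ → ℂ} {x y : ℝ → ℂ → ℂ}
    (h : IsContinuation α γ x y) (hγ : ContinuousOn γ (Icc 0 1)) {Z : ℂ → ℂ} {P : ℂ → ℂ × ℂ}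
    {R K : Set ℂ} (hR : IsOpen R) (hK : IsCompact K) (hZc : ContinuousOn Z K)
    (hZ : ∀ u ∈ R, AnalyticAt ℂ Z u ∧ deriv Z u ≠ 0)
    (hP : ∀ u ∈ R, HasDerivAt P (deriv Z u • field α (Z u) (P u)) u)
    (hα : ∀ u ∈ R, ∀ i, AnalyticAt ℂ (α i) (Z u))
    (hpole : ∀ u ∈ K \ R, Tendsto (fun v => ‖P v‖) (𝓝[R] u) atTop)
    {τ₀ : ℝ} (hτ₀ : τ₀ ∈ Ico (0 : ℝ) 1)
    (hG : ∀ τ ∈ Ico τ₀ 1, ∀ u ∈ R, Z u = γ τ → u ∈ K)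
    (hstart : ∃ u ∈ R, Z u = γ τ₀ ∧ P u = (x τ₀ (γ τ₀), y τ₀ (γ τ₀))) :
    ∀ τ ∈ Ico τ₀ 1, ∃ u ∈ R, Z u = γ τ ∧ P u = (x τ (γ τ), y τ (γ τ)) := by
  intro τ₁ hτ₁
  have hsub : Icc τ₀ τ₁ ⊆ Ico 0 1 := fun τ hτ => ⟨hτ₀.1.trans hτ.1, hτ.2.trans_lt hτ₁.2⟩
  have hpos := h.continuousOn hγ
  suffices hs : Icc τ₀ τ₁ ⊆ {τ | ∃ u ∈ R, Z u = γ τ ∧ P u = (x τ (γ τ), y τ (γ τ))} from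
    hs ⟨hτ₁.1, le_rfl⟩
  refine IsClosed.Icc_subset_of_forall_exists_gt ?_ hstart ?_
  -- closed: by compactness the parameters `u` accumulate in `K`, and not at a pole of `P`;
  -- open to the right: the two solutions have the same germ, and `Z` is locally surjective
  · refine isClosed_of_closure_subset fun τ hτ => ?_
    obtain ⟨t, ht, htτ⟩ := mem_closure_iff_seq_limit.1 hτ
    have hτI : τ ∈ Icc τ₀ τ₁ := isClosed_Icc.mem_of_tendsto htτ
      (Eventually.of_forall fun n => (ht n).2)
    refine ⟨?_, hτI⟩
    choose u huR huZ huP using fun n => (ht n).1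
    have huK : ∀ n, u n ∈ K := fun n =>
      hG (t n) ⟨(ht n).2.1, (ht n).2.2.trans_lt hτ₁.2⟩ (u n) (huR n) (huZ n)
    obtain ⟨v, hvK, φ, hφ, hv⟩ := hK.tendsto_subseq huK
    have htw : Tendsto (t ∘ φ) atTop (𝓝[Ico 0 1] τ) :=
      tendsto_nhdsWithin_iff.2 ⟨htτ.comp hφ.tendsto_atTop,
        Eventually.of_forall fun n => hsub (ht _).2⟩
    have hvZ : Z v = γ τ := by
      have h1 : Tendsto (fun n => Z (u (φ n))) atTop (𝓝 (Z v)) := (hZc v hvK).tendsto.comp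
        (tendsto_nhdsWithin_iff.2 ⟨hv, Eventually.of_forall fun n => huK _⟩)
      have h2 : Tendsto (fun n => γ (t (φ n))) atTop (𝓝 (γ τ)) :=
        ((hγ τ (Ico_subset_Icc_self (hsub hτI))).mono Ico_subset_Icc_self).tendsto.comp htw
      exact tendsto_nhds_unique (h1.congr fun n => huZ _) h2
    have hlim : Tendsto (fun n => P (u (φ n))) atTop (𝓝 (x τ (γ τ), y τ (γ τ))) :=
      ((hpos τ (hsub hτI)).tendsto.comp htw).congr fun n => (huP _).symm
    by_cases hvR : v ∈ R
    · exact ⟨v, hvR, hvZ, tendsto_nhds_unique ((hP v hvR).continuousAt.tendsto.comp hv) hlim⟩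
    · have := (hpole v ⟨hvK, hvR⟩).comp (tendsto_nhdsWithin_iff.2
        ⟨hv, Eventually.of_forall fun n => huR _⟩)
      exact absurd this (not_tendsto_atTop_of_tendsto_nhds hlim.norm)
  · rintro τ ⟨⟨u, huR, huZ, huP⟩, hτ⟩ τ' hτ'
    have hτ01 : τ ∈ Ico (0 : ℝ) 1 := hsub (Ico_subset_Icc_self hτ)
    have hgerm := h.eventually_eq hτ01 (hZ u huR).1 (hα u huR)
      ((hR.eventually_mem huR).mono hP) huZ huP
    have hmap : map Z (𝓝 u) = 𝓝 (γ τ) := by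
      rw [← huZ]
      exact ((hZ u huR).1.hasStrictDerivAt).map_nhds_eq (hZ u huR).2
    have hnear : ∀ᶠ z in 𝓝 (γ τ), ∃ v ∈ R, Z v = z ∧ P v = (x τ z, y τ z) := by
      rw [← hmap]
      rw [eventually_map]
      filter_upwards [hgerm, hR.eventually_mem huR] with v hv hvR
      exact ⟨v, hvR, rfl, hv.symm⟩
    have hγτ : ContinuousWithinAt γ (Ico 0 1) τ :=
      (hγ τ (Ico_subset_Icc_self hτ01)).mono Ico_subset_Icc_self
    have hgood : ∀ᶠ t in 𝓝[Ico 0 1] τ, ∃ v ∈ R, Z v = γ t ∧ P v = (x t (γ t), y t (γ t)) := by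
      filter_upwards [hγτ.eventually hnear, (h τ hτ01).2] with t ⟨v, hv1, hv2, hv3⟩ ht
      exact ⟨v, hv1, hv2, by rw [hv3, ht.1.self_of_nhds, ht.2.self_of_nhds]⟩
    have hle : 𝓝[>] τ ≤ 𝓝[Ico 0 1] τ := by
      refine nhdsWithin_le_of_mem ?_
      filter_upwards [Ioo_mem_nhdsGT hτ01.2] with t ht
      exact ⟨hτ01.1.trans ht.1.le, ht.2⟩
    have hgood' : ∀ᶠ t in 𝓝[>] τ, ∃ v ∈ R, Z v = γ t ∧ P v = (x t (γ t), y t (γ t)) := hle hgood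
    obtain ⟨t, ht, ht'⟩ := (hgood'.and (Ioc_mem_nhdsGT hτ')).exists
    exact ⟨t, ht, ht'⟩

/-- A function of the parameter whose increments are locally controlled by those of a path of
finite length is bounded. -/
theorem exists_bound_of_locally_lipschitz {γ : ℝ → ℂ} (hγ : BoundedVariationOn γ (Icc 0 1))
    {f : ℝ → ℝ} {C : ℝ} (hC : 0 ≤ C) {τ₀ : ℝ} (hτ₀ : 0 ≤ τ₀)
    (hf : ∀ τ ∈ Ico τ₀ 1, ∀ᶠ τ' in 𝓝[Ico 0 1] τ, |f τ' - f τ| ≤ C * ‖γ τ' - γ τ‖) :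
    ∃ B, ∀ τ ∈ Ico τ₀ 1, f τ ≤ B := by
  have hloc : LocallyBoundedVariationOn γ (Icc 0 1) := hγ.locallyBoundedVariationOn
  set V : ℝ → ℝ := variationOnFromTo γ (Icc 0 1) τ₀ with hV
  have hVle : ∀ a ∈ Icc (0 : ℝ) 1, ∀ b ∈ Icc (0 : ℝ) 1, τ₀ ∈ Icc (0 : ℝ) 1 → a ≤ b →
      ‖γ b - γ a‖ ≤ V b - V a := by
    intro a ha b hb h0 hab
    rw [← dist_eq_norm, dist_comm]
    have h1 : V b - V a = variationOnFromTo γ (Icc 0 1) a b := by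
      rw [hV, ← variationOnFromTo.add hloc h0 ha hb]; ring
    rw [h1, variationOnFromTo.eq_of_le _ _ hab, dist_edist]
    exact ENNReal.toReal_mono (hloc a b ha hb)
      (eVariationOn.edist_le γ ⟨ha, le_rfl, hab⟩ ⟨hb, hab, le_rfl⟩)
  have hle1 : ∀ τ ∈ Ico τ₀ 1, f τ ≤ f τ₀ + C * V τ := by
    intro τ₁ hτ₁
    have h0 : τ₀ ∈ Icc (0 : ℝ) 1 := ⟨hτ₀, (hτ₁.1.trans_lt hτ₁.2).le⟩
    have hI : ∀ τ ∈ Icc τ₀ τ₁, τ ∈ Ico τ₀ 1 := fun τ h => ⟨h.1, h.2.trans_lt hτ₁.2⟩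
    have hI' : ∀ τ ∈ Icc τ₀ τ₁, τ ∈ Icc (0 : ℝ) 1 := fun τ h => ⟨hτ₀.trans h.1, (hI τ h).2.le⟩
    have hnear : ∀ τ ∈ Icc τ₀ τ₁, ∃ δ > 0, ∀ t ∈ Icc τ₀ τ₁, |t - τ| < δ →
        |f t - f τ| ≤ C * ‖γ t - γ τ‖ := by
      intro τ hτ
      obtain ⟨δ, hδ, h⟩ := Metric.mem_nhdsWithin_iff.1 (hf τ (hI τ hτ))
      exact ⟨δ, hδ, fun t ht htδ => h ⟨htδ, hτ₀.trans ht.1, (hI t ht).2⟩⟩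
    -- the initial segments on which the bound holds exhaust the interval
    suffices hs : Icc τ₀ τ₁ ⊆ {τ | ∀ t ∈ Icc τ₀ τ, f t ≤ f τ₀ + C * V t} from
      hs ⟨hτ₁.1, le_rfl⟩ τ₁ ⟨hτ₁.1, le_rfl⟩
    refine IsClosed.Icc_subset_of_forall_exists_gt ?_ ?_ ?_
    · refine isClosed_of_closure_subset fun τ hτ => ?_
      have hτI : τ ∈ Icc τ₀ τ₁ := closure_minimal inter_subset_right isClosed_Icc hτ
      refine ⟨fun t ht => ?_, hτI⟩
      obtain ⟨δ, hδ, h⟩ := hnear τ hτI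
      have hlow : ∀ s ∈ Icc τ₀ τ₁, s < τ → f s ≤ f τ₀ + C * V s := by
        intro s hs hsτ
        obtain ⟨τ', ⟨h1, -⟩, h2⟩ := Metric.mem_closure_iff.1 hτ (τ - s) (sub_pos.2 hsτ)
        refine h1 s ⟨hs.1, ?_⟩
        rw [Real.dist_eq] at h2
        linarith [(abs_lt.1 h2).2]
      rcases ht.2.lt_or_eq with hlt | rfl
      · exact hlow t ⟨ht.1, ht.2.trans hτI.2⟩ hlt
      rcases ht.1.lt_or_eq with hlt | rfl
      · obtain ⟨s, hs1, hs2⟩ := exists_between (max_lt hlt (sub_lt_self t hδ))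
        have hsI : s ∈ Icc τ₀ τ₁ :=
          ⟨(le_max_left _ _).trans hs1.le, hs2.le.trans hτI.2⟩
        have h3 := h s hsI (by
          rw [abs_lt]; constructor <;> linarith [(le_max_right τ₀ (t - δ)).trans_lt hs1])
        have h4 := hVle s (hI' s hsI) t (hI' t hτI) h0 hs2.le
        have h5 := hlow s hsI hs2
        rw [norm_sub_rev] at h3
        have h6 := mul_le_mul_of_nonneg_left h4 hC
        linarith [(abs_le.1 h3).1]
      · simp [hV, variationOnFromTo.self]
    · intro t ht
      obtain rfl : t = τ₀ := le_antisymm ht.2 ht.1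
      simp [hV, variationOnFromTo.self]
    · rintro τ ⟨h1, h2⟩ τ' hτ'
      obtain ⟨δ, hδ, h⟩ := hnear τ (Ico_subset_Icc_self h2)
      obtain ⟨s, hs1, hs2⟩ := exists_between (lt_min (lt_min h2.2 hτ') (lt_add_of_pos_right τ hδ))
      have hs3 := lt_min_iff.1 hs2
      have hs4 := lt_min_iff.1 hs3.1
      refine ⟨s, fun t ht => ?_, hs1, hs4.2.le⟩
      rcases le_or_gt t τ with htτ | htτ
      · exact h1 t ⟨ht.1, htτ⟩
      · have htI : t ∈ Icc τ₀ τ₁ := ⟨ht.1, ht.2.trans hs4.1.le⟩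
        have h3 := h t htI (by rw [abs_lt]; constructor <;> linarith [ht.2])
        have h4 := hVle τ (hI' τ (Ico_subset_Icc_self h2)) t (hI' t htI) h0 htτ.le
        have h5 := h1 τ ⟨h2.1, le_rfl⟩
        have h6 := mul_le_mul_of_nonneg_left h4 hC
        linarith [(abs_le.1 h3).2]
  refine ⟨f τ₀ + C * V 1, fun τ hτ => (hle1 τ hτ).trans ?_⟩
  have h0 : τ₀ ∈ Icc (0 : ℝ) 1 := ⟨hτ₀, (hτ.1.trans_lt hτ.2).le⟩
  have := (norm_nonneg _).trans (hVle τ ⟨hτ₀.trans hτ.1, hτ.2.le⟩ 1 ⟨zero_le_one, le_rfl⟩ h0 hτ.2.le)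
  gcongr
  linarith

/-! ### The charts on the curves over `E₂` -/

/-- The second coordinate `v₂ = y² / x` of the chart `(u₂, v₂)`, as a function of `z` and the
coordinates `(u, v)` of the `n`-th chart of the branch `ε`. -/
noncomputable def vTwo (α : Fin 5 → ℂ → ℂ) (ε : ℂ) : ℕ → ℂ → ℂ × ℂ → ℂ
  | 0, _, q => q.2
  | n + 1, z, q => vTwo α ε n z (q.1, q.1 * q.2 + branchPoint α ε n z)

theorem chartE2_apply (z u w : ℂ) : chartE2 z (u, w) = (u * (u * w), 1, u * w) := by
  simp [chartE2, blowUp, chartE1', blowUp', chart0]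

theorem branchChart_eq (α : Fin 5 → ℂ → ℂ) (ε : ℂ) (n : ℕ) (z : ℂ) (q : ℂ × ℂ) :
    branchChart α ε n z q = chartE2 z (q.1, vTwo α ε n z q) := by
  induction n generalizing q with
  | zero => rfl
  | succ n ih => simp [branchChart, blowUp, ih, vTwo]

theorem branchChart'_eq (α : Fin 5 → ℂ → ℂ) (ε : ℂ) (n : ℕ) (z U V : ℂ) :
    branchChart' α ε n z (U, V) = chartE2 z (U * V, vTwo α ε n z (U * V, V + branchPoint α ε n z)) := by
  simp [branchChart', blowUp', branchChart_eq]

/-- The second chart of a blow-up of a branch is the first one in the coordinates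
`(u, v) = (U V, 1 / U)`. -/
theorem branchChart'_eq_branchChart (α : Fin 5 → ℂ → ℂ) (ε : ℂ) (n : ℕ) (z : ℂ) {U : ℂ} (hU : U ≠ 0)
    (V : ℂ) : branchChart' α ε n z (U, V) = branchChart α ε (n + 1) z (U * V, 1 / U) := by
  have : U * V * (1 / U) = V := by field_simp
  simp only [branchChart', blowUp', branchChart, blowUp, add_zero, this]

theorem mem_finitePart_branchChart {α : Fin 5 → ℂ → ℂ} {ε : ℂ} {n : ℕ} {z : ℂ} {q : ℂ × ℂ} :
    (z, q) ∈ finitePart (branchChart α ε n) ↔ q.1 ≠ 0 ∧ vTwo α ε n z q ≠ 0 := by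
  simp [finitePart, branchChart_eq, chartE2_apply]

theorem affine_branchChart {α : Fin 5 → ℂ → ℂ} {ε : ℂ} {n : ℕ} {z : ℂ} {q : ℂ × ℂ}
    (h : (z, q) ∈ finitePart (branchChart α ε n)) :
    affine (branchChart α ε n) (z, q) = (1 / (q.1 ^ 2 * vTwo α ε n z q), 1 / q.1) := by
  obtain ⟨h1, h2⟩ := mem_finitePart_branchChart.1 h
  simp only [affine, branchChart_eq, chartE2_apply, Prod.mk.injEq]
  constructor
  · congr 1; ring
  · field_simp

theorem vTwo_five (α : Fin 5 → ℂ → ℂ) (ε z u v : ℂ) : vTwo α ε 5 z (u, v) =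
    ε + branchPoint α ε 1 z * u + branchPoint α ε 2 z * u ^ 2 + branchPoint α ε 3 z * u ^ 3
      + branchPoint α ε 4 z * u ^ 4 + u ^ 5 * v := by
  simp only [vTwo, branchPoint]; ring

/-- The part of `v₂` at the final curve that does not depend on `v₇`, with coefficients `bᵢ`. -/
noncomputable def e7Base (ε b₁ b₂ b₃ b₄ u : ℂ) : ℂ := ε + b₁ * u + b₂ * u ^ 2 + b₃ * u ^ 3 + b₄ * u ^ 4

/-- The part of the numerator of `u dv₇/du` of order at least one in `u` and of degree zero in
`v₇`, divided by `u`. -/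
noncomputable def e7Rem (ε b₁ b₂ b₃ b₄ d₁ d₂ d₃ d₄ a₀ a₁ a₂ a₃ a₄ u : ℂ) : ℂ :=
    7 * a₀ * b₁ * b₂ + 7 * a₀ * b₃ * ε + 3 * a₁ * b₁ ^ 2 * ε + 3 * a₁ * b₂ * ε ^ 2 + 6 * a₂ * b₁
      * b₂ * ε + a₂ * b₁ ^ 3 + 3 * a₂ * b₃ * ε ^ 2 + 6 * a₃ * b₁ * b₃ * ε + 3 * a₃ * b₁ ^ 2 * b₂
      + 3 * a₃ * b₂ ^ 2 * ε + 3 * a₃ * b₄ * ε ^ 2 + 3 * a₄ * b₁ * b₂ ^ 2 + 6 * a₄ * b₁ * b₄ * ε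
      + 3 * a₄ * b₁ ^ 2 * b₃ + 6 * a₄ * b₂ * b₃ * ε + 15 * b₁ * b₂ * b₃ + b₁ * d₃ + 15 / 2 * b₁
      ^ 2 * b₄ + 15 * b₂ * b₄ * ε + b₂ * d₂ + 5 / 2 * b₂ ^ 3 + b₃ * d₁ + 15 / 2 * b₃ ^ 2 * ε +
      d₄ * ε
          + u * (8 * a₀ * b₁ * b₃ + 4 * a₀ * b₂ ^ 2 + 8 * a₀ * b₄ * ε + 6 * a₁ * b₁ * b₂ * ε +
      a₁ * b₁ ^ 3 + 3 * a₁ * b₃ * ε ^ 2 + 6 * a₂ * b₁ * b₃ * ε + 3 * a₂ * b₁ ^ 2 * b₂ + 3 * a₂ *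
      b₂ ^ 2 * ε + 3 * a₂ * b₄ * ε ^ 2 + 3 * a₃ * b₁ * b₂ ^ 2 + 6 * a₃ * b₁ * b₄ * ε + 3 * a₃ *
      b₁ ^ 2 * b₃ + 6 * a₃ * b₂ * b₃ * ε + 6 * a₄ * b₁ * b₂ * b₃ + 3 * a₄ * b₁ ^ 2 * b₄ + 6 * a₄
      * b₂ * b₄ * ε + a₄ * b₂ ^ 3 + 3 * a₄ * b₃ ^ 2 * ε + 15 * b₁ * b₂ * b₄ + 15 / 2 * b₁ * b₃ ^
      2 + b₁ * d₄ + b₂ * d₃ + 15 / 2 * b₂ ^ 2 * b₃ + 15 * b₃ * b₄ * ε + b₃ * d₂ + b₄ * d₁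
          + u * (9 * a₀ * b₁ * b₄ + 9 * a₀ * b₂ * b₃ + 6 * a₁ * b₁ * b₃ * ε + 3 * a₁ * b₁ ^ 2 *
      b₂ + 3 * a₁ * b₂ ^ 2 * ε + 3 * a₁ * b₄ * ε ^ 2 + 3 * a₂ * b₁ * b₂ ^ 2 + 6 * a₂ * b₁ * b₄ *
      ε + 3 * a₂ * b₁ ^ 2 * b₃ + 6 * a₂ * b₂ * b₃ * ε + 6 * a₃ * b₁ * b₂ * b₃ + 3 * a₃ * b₁ ^ 2
      * b₄ + 6 * a₃ * b₂ * b₄ * ε + a₃ * b₂ ^ 3 + 3 * a₃ * b₃ ^ 2 * ε + 6 * a₄ * b₁ * b₂ * b₄ +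
      3 * a₄ * b₁ * b₃ ^ 2 + 3 * a₄ * b₂ ^ 2 * b₃ + 6 * a₄ * b₃ * b₄ * ε + 15 * b₁ * b₃ * b₄ +
      15 / 2 * b₂ * b₃ ^ 2 + b₂ * d₄ + 15 / 2 * b₂ ^ 2 * b₄ + b₃ * d₃ + b₄ * d₂ + 15 / 2 * b₄ ^
      2 * ε
          + u * (10 * a₀ * b₂ * b₄ + 5 * a₀ * b₃ ^ 2 + 3 * a₁ * b₁ * b₂ ^ 2 + 6 * a₁ * b₁ * b₄ *
      ε + 3 * a₁ * b₁ ^ 2 * b₃ + 6 * a₁ * b₂ * b₃ * ε + 6 * a₂ * b₁ * b₂ * b₃ + 3 * a₂ * b₁ ^ 2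
      * b₄ + 6 * a₂ * b₂ * b₄ * ε + a₂ * b₂ ^ 3 + 3 * a₂ * b₃ ^ 2 * ε + 6 * a₃ * b₁ * b₂ * b₄ +
      3 * a₃ * b₁ * b₃ ^ 2 + 3 * a₃ * b₂ ^ 2 * b₃ + 6 * a₃ * b₃ * b₄ * ε + 6 * a₄ * b₁ * b₃ * b₄
      + 3 * a₄ * b₂ * b₃ ^ 2 + 3 * a₄ * b₂ ^ 2 * b₄ + 3 * a₄ * b₄ ^ 2 * ε + 15 / 2 * b₁ * b₄ ^ 2
      + 15 * b₂ * b₃ * b₄ + b₃ * d₄ + 5 / 2 * b₃ ^ 3 + b₄ * d₃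
          + u * (11 * a₀ * b₃ * b₄ + 6 * a₁ * b₁ * b₂ * b₃ + 3 * a₁ * b₁ ^ 2 * b₄ + 6 * a₁ * b₂
      * b₄ * ε + a₁ * b₂ ^ 3 + 3 * a₁ * b₃ ^ 2 * ε + 6 * a₂ * b₁ * b₂ * b₄ + 3 * a₂ * b₁ * b₃ ^
      2 + 3 * a₂ * b₂ ^ 2 * b₃ + 6 * a₂ * b₃ * b₄ * ε + 6 * a₃ * b₁ * b₃ * b₄ + 3 * a₃ * b₂ * b₃
      ^ 2 + 3 * a₃ * b₂ ^ 2 * b₄ + 3 * a₃ * b₄ ^ 2 * ε + 3 * a₄ * b₁ * b₄ ^ 2 + 6 * a₄ * b₂ * b₃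
      * b₄ + a₄ * b₃ ^ 3 + 15 / 2 * b₂ * b₄ ^ 2 + 15 / 2 * b₃ ^ 2 * b₄ + b₄ * d₄
          + u * (6 * a₀ * b₄ ^ 2 + 6 * a₁ * b₁ * b₂ * b₄ + 3 * a₁ * b₁ * b₃ ^ 2 + 3 * a₁ * b₂ ^
      2 * b₃ + 6 * a₁ * b₃ * b₄ * ε + 6 * a₂ * b₁ * b₃ * b₄ + 3 * a₂ * b₂ * b₃ ^ 2 + 3 * a₂ * b₂
      ^ 2 * b₄ + 3 * a₂ * b₄ ^ 2 * ε + 3 * a₃ * b₁ * b₄ ^ 2 + 6 * a₃ * b₂ * b₃ * b₄ + a₃ * b₃ ^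
      3 + 3 * a₄ * b₂ * b₄ ^ 2 + 3 * a₄ * b₃ ^ 2 * b₄ + 15 / 2 * b₃ * b₄ ^ 2
          + u * (6 * a₁ * b₁ * b₃ * b₄ + 3 * a₁ * b₂ * b₃ ^ 2 + 3 * a₁ * b₂ ^ 2 * b₄ + 3 * a₁ *
      b₄ ^ 2 * ε + 3 * a₂ * b₁ * b₄ ^ 2 + 6 * a₂ * b₂ * b₃ * b₄ + a₂ * b₃ ^ 3 + 3 * a₃ * b₂ * b₄
      ^ 2 + 3 * a₃ * b₃ ^ 2 * b₄ + 3 * a₄ * b₃ * b₄ ^ 2 + 5 / 2 * b₄ ^ 3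
          + u * (3 * a₁ * b₁ * b₄ ^ 2 + 6 * a₁ * b₂ * b₃ * b₄ + a₁ * b₃ ^ 3 + 3 * a₂ * b₂ * b₄ ^
      2 + 3 * a₂ * b₃ ^ 2 * b₄ + 3 * a₃ * b₃ * b₄ ^ 2 + a₄ * b₄ ^ 3
          + u * (3 * a₁ * b₂ * b₄ ^ 2 + 3 * a₁ * b₃ ^ 2 * b₄ + 3 * a₂ * b₃ * b₄ ^ 2 + a₃ * b₄ ^
      3
          + u * (3 * a₁ * b₃ * b₄ ^ 2 + a₂ * b₄ ^ 3
          + u * (a₁ * b₄ ^ 3))))))))))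

/-- The coefficient of `v₇` in the numerator of `dv₇/du`. -/
noncomputable def e7Lin (ε b₁ b₂ b₃ b₄ d₁ d₂ d₃ d₄ a₀ a₁ a₂ a₃ a₄ u : ℂ) : ℂ :=
  15 / 2 * (b₁ + b₂ * u + b₃ * u ^ 2 + b₄ * u ^ 3) * (e7Base ε b₁ b₂ b₃ b₄ u + ε)
    + 3 * e7Base ε b₁ b₂ b₃ b₄ u ^ 2 * (a₄ + a₃ * u + a₂ * u ^ 2 + a₁ * u ^ 3)
    + 9 * a₀ * u ^ 2 * e7Base ε b₁ b₂ b₃ b₄ u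
    + u ^ 2 * (d₁ + d₂ * u + d₃ * u ^ 2 + d₄ * u ^ 3)
    + a₀ * u ^ 3 * (b₁ + 2 * b₂ * u + 3 * b₃ * u ^ 2 + 4 * b₄ * u ^ 3)

/-- The coefficient of `u⁴ v₇²` in the numerator of `dv₇/du`. -/
noncomputable def e7Quad (ε b₁ b₂ b₃ b₄ a₀ a₁ a₂ a₃ a₄ u : ℂ) : ℂ :=
  15 / 2 * e7Base ε b₁ b₂ b₃ b₄ u
    + 3 * u * e7Base ε b₁ b₂ b₃ b₄ u * (a₄ + a₃ * u + a₂ * u ^ 2 + a₁ * u ^ 3) + 7 * a₀ * u ^ 3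

/-- The division of the numerator of `u⁶ dv₇/du` by powers of `u`. -/
theorem e7_division (ε b₁ b₂ b₃ b₄ d₁ d₂ d₃ d₄ a₀ a₁ a₂ a₃ a₄ u v : ℂ) (hε : ε = 1 ∨ ε = -1)
    (h₁ : 4 * b₁ + a₄ * ε = 0)
    (h₂ : 3 * b₂ + a₃ * ε + 3 * a₄ * b₁ + 15 / 2 * b₁ ^ 2 * ε = 0)
    (h₃ : 2 * b₃ + 2 * a₀ + a₂ * ε + 3 * a₃ * b₁ + 3 * a₄ * b₁ ^ 2 * ε + 3 * a₄ * b₂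
      + 15 * b₁ * b₂ * ε + 5 / 2 * b₁ ^ 3 + d₁ * ε = 0)
    (h₄ : b₄ + 5 * a₀ * b₁ * ε + a₁ * ε + 3 * a₂ * b₁ + 3 * a₃ * b₁ ^ 2 * ε + 3 * a₃ * b₂
      + 6 * a₄ * b₁ * b₂ * ε + a₄ * b₁ ^ 3 + 3 * a₄ * b₃ + 15 * b₁ * b₃ * ε + b₁ * d₁
      + 15 / 2 * b₁ ^ 2 * b₂ + 15 / 2 * b₂ ^ 2 * ε + d₂ * ε = 0)
    (C : ℂ) (h₅ : C =
    3 * a₀ * b₁ ^ 2 + 6 * a₀ * b₂ * ε + 3 * a₁ * b₁ * ε ^ 2 + 3 * a₂ * b₁ ^ 2 * ε + 3 * a₂ * b₂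
      * ε ^ 2 + 6 * a₃ * b₁ * b₂ * ε + a₃ * b₁ ^ 3 + 3 * a₃ * b₃ * ε ^ 2 + 6 * a₄ * b₁ * b₃ * ε
      + 3 * a₄ * b₁ ^ 2 * b₂ + 3 * a₄ * b₂ ^ 2 * ε + 3 * a₄ * b₄ * ε ^ 2 + 15 / 2 * b₁ * b₂ ^ 2
      + 15 * b₁ * b₄ * ε + b₁ * d₂ + 15 / 2 * b₁ ^ 2 * b₃ + 15 * b₂ * b₃ * ε + b₂ * d₁ + d₃ * ε)
    (w : ℂ) (hw : w = e7Base ε b₁ b₂ b₃ b₄ u + u ^ 5 * v) :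
    -(5 / 2) * w * (1 - w ^ 2) + u * w ^ 3 * (a₄ + a₃ * u + a₂ * u ^ 2 + a₁ * u ^ 3)
      + 2 * a₀ * u ^ 3 * w ^ 2 + u ^ 2 * w * (d₁ * u + d₂ * u ^ 2 + d₃ * u ^ 3 + d₄ * u ^ 4)
      - u * (b₁ + 2 * b₂ * u + 3 * b₃ * u ^ 2 + 4 * b₄ * u ^ 3 + 5 * u ^ 4 * v)
        * (1 - a₀ * u ^ 3 * w) =
    u ^ 5 * (C + u * (e7Rem ε b₁ b₂ b₃ b₄ d₁ d₂ d₃ d₄ a₀ a₁ a₂ a₃ a₄ u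
      + v * e7Lin ε b₁ b₂ b₃ b₄ d₁ d₂ d₃ d₄ a₀ a₁ a₂ a₃ a₄ u
      + u ^ 4 * v ^ 2 * e7Quad ε b₁ b₂ b₃ b₄ a₀ a₁ a₂ a₃ a₄ u
      + u ^ 9 * v ^ 3 * (5 / 2 + u * (a₄ + a₃ * u + a₂ * u ^ 2 + a₁ * u ^ 3)))) := by
  subst h₅ hw
  unfold e7Rem e7Lin e7Quad e7Base
  rcases hε with rfl | rfl
  · linear_combination u * h₁ + u ^ 2 * h₂ + u ^ 3 * h₃ + u ^ 4 * h₄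
  · linear_combination u * h₁ + u ^ 2 * h₂ + u ^ 3 * h₃ + u ^ 4 * h₄

/-! ### The system in the charts on `E₇` -/

theorem analyticAt_branchPoint {α : Fin 5 → ℂ → ℂ} {z : ℂ} (hα : ∀ i, AnalyticAt ℂ (α i) z) (ε : ℂ)
    (n : ℕ) : AnalyticAt ℂ (branchPoint α ε n) z := by
  have h : ∀ i, ContDiffAt ℂ ω (α i) z := fun i => (hα i).contDiffAt
  have h' : ∀ i, ContDiffAt ℂ ω (deriv (α i)) z := fun i => (hα i).deriv.contDiffAt
  refine ContDiffAt.analyticAt ?_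
  match n with
  | 0 => exact contDiffAt_const
  | 1 =>
    change ContDiffAt ℂ ω (fun z => branchPoint α ε 1 z) z
    simp only [branchPoint]
    fun_prop
  | 2 =>
    change ContDiffAt ℂ ω (fun z => branchPoint α ε 2 z) z
    simp only [branchPoint]
    fun_prop
  | 3 =>
    change ContDiffAt ℂ ω (fun z => branchPoint α ε 3 z) z
    simp only [branchPoint]
    fun_prop
  | 4 =>
    change ContDiffAt ℂ ω (fun z => branchPoint α ε 4 z) z
    simp only [branchPoint]
    fun_prop
  | n + 5 => exact contDiffAt_const

/-- The obstruction to regularity at `E₇^ε`: the residue at `u₇ = 0` of `dv₇/du₇`. -/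
noncomputable def resonance (α : Fin 5 → ℂ → ℂ) (ε z : ℂ) : ℂ :=
  ε * (deriv (deriv (α 4)) z / 8 - deriv (α 0) z) - 1 / 2 * deriv (α 2) z
    + 1 / 12 * (deriv (α 3) z * α 4 z + α 3 z * deriv (α 4) z)
    - 3 / 128 * α 4 z ^ 2 * deriv (α 4) z

/-- The numerator of `dv₇/du₇` without its residue. -/
noncomputable def e7Num (α : Fin 5 → ℂ → ℂ) (ε z u v : ℂ) : ℂ :=
  e7Rem ε (branchPoint α ε 1 z) (branchPoint α ε 2 z) (branchPoint α ε 3 z) (branchPoint α ε 4 z)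
    (deriv (branchPoint α ε 1) z) (deriv (branchPoint α ε 2) z) (deriv (branchPoint α ε 3) z)
    (deriv (branchPoint α ε 4) z) (α 0 z) (α 1 z) (α 2 z) (α 3 z) (α 4 z) u
  + v * e7Lin ε (branchPoint α ε 1 z) (branchPoint α ε 2 z) (branchPoint α ε 3 z)
    (branchPoint α ε 4 z) (deriv (branchPoint α ε 1) z) (deriv (branchPoint α ε 2) z)
    (deriv (branchPoint α ε 3) z) (deriv (branchPoint α ε 4) z) (α 0 z) (α 1 z) (α 2 z) (α 3 z)
    (α 4 z) u
  + u ^ 4 * v ^ 2 * e7Quad ε (branchPoint α ε 1 z) (branchPoint α ε 2 z) (branchPoint α ε 3 z)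
    (branchPoint α ε 4 z) (α 0 z) (α 1 z) (α 2 z) (α 3 z) (α 4 z) u
  + u ^ 9 * v ^ 3 * (5 / 2 + u * (α 4 z + α 3 z * u + α 2 z * u ^ 2 + α 1 z * u ^ 3))

theorem branchPoint_derivs {α : Fin 5 → ℂ → ℂ} {z : ℂ} (hα : ∀ i, AnalyticAt ℂ (α i) z) (ε : ℂ) :
    deriv (branchPoint α ε 1) z = -ε * (deriv (α 4) z / 4) ∧
    deriv (branchPoint α ε 2) z
      = ε * (3 / 16 * (α 4 z * deriv (α 4) z) - 1 / 3 * deriv (α 3) z) ∧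
    deriv (branchPoint α ε 3) z = 1 / 2 * (deriv (deriv (α 4)) z / 4) - deriv (α 0) z
      + ε * (-(1 / 2) * deriv (α 2) z + (deriv (α 4) z * α 3 z + α 4 z * deriv (α 3) z) / 4
        - 15 / 128 * (α 4 z ^ 2 * deriv (α 4) z)) := by
  have h : ∀ i, HasDerivAt (α i) (deriv (α i) z) z := fun i => (hα i).differentiableAt.hasDerivAt
  have h' := (hα 4).deriv.differentiableAt.hasDerivAt
  refine ⟨?_, ?_, ?_⟩
  · exact (((h 4).div_const 4).const_mul (-ε)).deriv
  · refine HasDerivAt.deriv (((((((h 4).pow 2).div_const 16).const_mul (3 / 2)).sub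
      ((h 3).const_mul (1 / 3))).const_mul ε).congr_deriv ?_)
    push_cast; ring
  · refine HasDerivAt.deriv ((((((h'.div_const 4).const_mul (1 / 2)).sub (h 0)).add
      (((((h 2).const_mul (-(1 / 2))).add (((h 4).div_const 4).mul (h 3))).sub
        ((((h 4).pow 3).div_const 64).const_mul (5 / 2))).const_mul ε))).congr_deriv ?_)
    push_cast; ring

/-- The vector field in the chart on `E₇^ε`: the base points are chosen so that all terms of
negative order in `u` cancel, except for the residue. -/
theorem e7_numerator {α : Fin 5 → ℂ → ℂ} {ε z : ℂ} (hε : ε = 1 ∨ ε = -1)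
    (hα : ∀ i, AnalyticAt ℂ (α i) z) (u v w : ℂ) (hw : w = vTwo α ε 5 z (u, v)) :
    -(5 / 2) * w * (1 - w ^ 2) + u * w ^ 3 * (α 4 z + α 3 z * u + α 2 z * u ^ 2 + α 1 z * u ^ 3)
      + 2 * α 0 z * u ^ 3 * w ^ 2
      + u ^ 2 * w * (deriv (branchPoint α ε 1) z * u + deriv (branchPoint α ε 2) z * u ^ 2
        + deriv (branchPoint α ε 3) z * u ^ 3 + deriv (branchPoint α ε 4) z * u ^ 4)
      - u * (branchPoint α ε 1 z + 2 * branchPoint α ε 2 z * u + 3 * branchPoint α ε 3 z * u ^ 2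
        + 4 * branchPoint α ε 4 z * u ^ 3 + 5 * u ^ 4 * v) * (1 - α 0 z * u ^ 3 * w) =
    u ^ 5 * (resonance α ε z + u * e7Num α ε z u v) := by
  obtain ⟨h1, h2, h3⟩ := branchPoint_derivs hα ε
  refine e7_division ε (branchPoint α ε 1 z) (branchPoint α ε 2 z) (branchPoint α ε 3 z)
    (branchPoint α ε 4 z) (deriv (branchPoint α ε 1) z) (deriv (branchPoint α ε 2) z)
    (deriv (branchPoint α ε 3) z) (deriv (branchPoint α ε 4) z) (α 0 z) (α 1 z) (α 2 z) (α 3 z)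
    (α 4 z) u v hε ?_ ?_ ?_ ?_ _ ?_ w (by rw [hw, vTwo_five]; rfl)
  · simp only [branchPoint]; ring
  · simp only [branchPoint]; rcases hε with rfl | rfl <;> ring
  · rw [h1]; simp only [branchPoint]; rcases hε with rfl | rfl <;> ring
  · rw [h1, h2]; simp only [branchPoint]; rcases hε with rfl | rfl <;> ring
  · rw [h1, h2, h3]; simp only [branchPoint, resonance]; rcases hε with rfl | rfl <;> ring

theorem contDiffAt_vTwo {α : Fin 5 → ℂ → ℂ} {z : ℂ} (hα : ∀ i, AnalyticAt ℂ (α i) z) (ε : ℂ)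
    (n : ℕ) (q : ℂ × ℂ) :
    ContDiffAt ℂ ω (fun r : ℂ × ℂ × ℂ => vTwo α ε n r.1 r.2) (z, q) := by
  induction n generalizing q with
  | zero => simp only [vTwo]; fun_prop
  | succ n ih =>
    simp only [vTwo]
    have hb : ContDiffAt ℂ ω (branchPoint α ε n) (z, q).1 :=
      (analyticAt_branchPoint hα ε n).contDiffAt
    have h1 : ContDiffAt ℂ ω (fun r : ℂ × ℂ × ℂ =>
        ((r.1, r.2.1, r.2.1 * r.2.2 + branchPoint α ε n r.1) : ℂ × ℂ × ℂ)) (z, q) := by fun_prop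
    exact (ih (q.1, q.1 * q.2 + branchPoint α ε n z)).comp (z, q) h1

theorem eventually_mem_finitePart {α : Fin 5 → ℂ → ℂ} {ε z : ℂ} {n : ℕ} {q : ℂ × ℂ}
    (hα : ∀ i, AnalyticAt ℂ (α i) z) (h : (z, q) ∈ finitePart (branchChart α ε n)) :
    ∀ᶠ r in 𝓝 (z, q), r ∈ finitePart (branchChart α ε n) := by
  obtain ⟨h1, h2⟩ := mem_finitePart_branchChart.1 h
  have h3 : ContinuousAt (fun r : ℂ × ℂ × ℂ => r.2.1) (z, q) := by fun_prop
  filter_upwards [h3.eventually_ne h1, (contDiffAt_vTwo hα ε n q).continuousAt.eventually_ne h2]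
    with r hr1 hr2
  exact mem_finitePart_branchChart.2 ⟨hr1, hr2⟩

theorem differentiableAt_affine_e7 {α : Fin 5 → ℂ → ℂ} {ε z u v : ℂ} (hα : ∀ i, AnalyticAt ℂ (α i) z)
    (h : (z, u, v) ∈ finitePart (chartE7 α ε)) :
    DifferentiableAt ℂ (affine (chartE7 α ε)) (z, u, v) := by
  obtain ⟨h1, h2⟩ := mem_finitePart_branchChart.1 h
  have hw := (contDiffAt_vTwo hα ε 5 (u, v)).differentiableAt (by simp)
  have h3 : DifferentiableAt ℂ (fun r : ℂ × ℂ × ℂ =>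
      (1 / (r.2.1 ^ 2 * vTwo α ε 5 r.1 r.2), 1 / r.2.1)) (z, u, v) := by
    have h4 : (u : ℂ) ^ 2 * vTwo α ε 5 z (u, v) ≠ 0 := mul_ne_zero (pow_ne_zero 2 h1) h2
    have h5 : DifferentiableAt ℂ (fun r : ℂ × ℂ × ℂ => 1 / (r.2.1 ^ 2 * vTwo α ε 5 r.1 r.2))
        (z, u, v) := by fun_prop (disch := exact h4)
    have h6 : DifferentiableAt ℂ (fun r : ℂ × ℂ × ℂ => 1 / r.2.1) (z, u, v) := by
      fun_prop (disch := exact h1)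
    exact h5.prodMk h6
  refine h3.congr_of_eventuallyEq ?_
  filter_upwards [eventually_mem_finitePart hα h] with r hr
  exact affine_branchChart hr

/-- The differential of the chart on `E₇^ε`; here `w` is the coordinate `v₂` and `dw` its differential. -/
theorem fderiv_affine_e7 {α : Fin 5 → ℂ → ℂ} {ε z u v : ℂ} (hα : ∀ i, AnalyticAt ℂ (α i) z)
    (h : (z, u, v) ∈ finitePart (chartE7 α ε)) (dz du dv : ℂ) (w dw : ℂ)
    (hw : w = vTwo α ε 5 z (u, v))
    (hdw : dw = dz * (deriv (branchPoint α ε 1) z * u + deriv (branchPoint α ε 2) z * u ^ 2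
        + deriv (branchPoint α ε 3) z * u ^ 3 + deriv (branchPoint α ε 4) z * u ^ 4)
      + du * (branchPoint α ε 1 z + 2 * branchPoint α ε 2 z * u + 3 * branchPoint α ε 3 z * u ^ 2
        + 4 * branchPoint α ε 4 z * u ^ 3 + 5 * u ^ 4 * v) + u ^ 5 * dv) :
    fderiv ℂ (affine (chartE7 α ε)) (z, u, v) (dz, du, dv) =
      (-(2 * u * du * w + u ^ 2 * dw) / (u ^ 2 * w) ^ 2, -du / u ^ 2) := by
  obtain ⟨h1, h2⟩ := mem_finitePart_branchChart.1 h
  simp only at h1 h2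
  have hline : HasDerivAt (fun t : ℂ => ((z, u, v) : ℂ × ℂ × ℂ) + t • ((dz, du, dv) : ℂ × ℂ × ℂ))
      (dz, du, dv) 0 := by
    simpa using ((hasDerivAt_id (0 : ℂ)).smul_const ((dz, du, dv) : ℂ × ℂ × ℂ)).const_add (z, u, v)
  have hline' := hline
  have hz0 : ((z, u, v) : ℂ × ℂ × ℂ) + (0 : ℂ) • ((dz, du, dv) : ℂ × ℂ × ℂ) = (z, u, v) := by simp
  have h3 := (differentiableAt_affine_e7 hα h).hasFDerivAt
  rw [← hz0] at h3
  have h4 := h3.comp_hasDerivAt (0 : ℂ) hline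
  rw [hz0] at h4
  refine h4.unique ?_
  have hb : ∀ n, HasDerivAt (fun t : ℂ => branchPoint α ε n (z + t * dz))
      (deriv (branchPoint α ε n) z * dz) 0 := by
    intro n
    have hl : HasDerivAt (fun t : ℂ => z + t * dz) dz 0 := by
      simpa using ((hasDerivAt_id (0 : ℂ)).mul_const dz).const_add z
    have := (analyticAt_branchPoint hα ε n).differentiableAt.hasDerivAt
    exact HasDerivAt.comp_of_eq 0 this hl (by simp)
  have hu : HasDerivAt (fun t : ℂ => u + t * du) du 0 := by
    simpa using ((hasDerivAt_id (0 : ℂ)).mul_const du).const_add u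
  have hv : HasDerivAt (fun t : ℂ => v + t * dv) dv 0 := by
    simpa using ((hasDerivAt_id (0 : ℂ)).mul_const dv).const_add v
  have hwd : HasDerivAt (fun t : ℂ => vTwo α ε 5 (z + t * dz) (u + t * du, v + t * dv)) dw 0 := by
    simp only [vTwo_five]
    refine ((((((hasDerivAt_const (0 : ℂ) ε).add ((hb 1).mul hu)).add ((hb 2).mul (hu.pow 2))).add
      ((hb 3).mul (hu.pow 3))).add ((hb 4).mul (hu.pow 4))).add ((hu.pow 5).mul hv)).congr_deriv ?_
    rw [hdw]
    simp
    ring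
  have hX : HasDerivAt (fun t : ℂ => 1 / ((u + t * du) ^ 2 *
      vTwo α ε 5 (z + t * dz) (u + t * du, v + t * dv)))
      (-(2 * u * du * w + u ^ 2 * dw) / (u ^ 2 * w) ^ 2) 0 := by
    refine ((hasDerivAt_const (0 : ℂ) (1 : ℂ)).div ((hu.pow 2).mul hwd) ?_).congr_deriv ?_
    · simp [h1, h2]
    · simp [hw]
  have hY : HasDerivAt (fun t : ℂ => 1 / (u + t * du)) (-du / u ^ 2) 0 := by
    refine ((hasDerivAt_const (0 : ℂ) (1 : ℂ)).div hu (by simpa using h1)).congr_deriv ?_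
    simp
  refine (hX.prodMk hY).congr_of_eventuallyEq ?_
  have hcont := hline.continuousAt.tendsto
  rw [hz0] at hcont
  filter_upwards [hcont.eventually (eventually_mem_finitePart hα h)] with t ht
  exact affine_branchChart ht

/-- The equations of the system in the chart on `E₇^ε`, in terms of a tangent vector
`(dz, du, dv)`. -/
theorem e7_relation {α : Fin 5 → ℂ → ℂ} {ε z u v : ℂ} (hε : ε = 1 ∨ ε = -1)
    (hα : ∀ i, AnalyticAt ℂ (α i) z) (h : (z, u, v) ∈ finitePart (chartE7 α ε)) {dz du dv : ℂ}
    (heq : fderiv ℂ (affine (chartE7 α ε)) (z, u, v) (dz, du, dv) =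
      dz • field α z (affine (chartE7 α ε) (z, u, v))) (w : ℂ) (hw : w = vTwo α ε 5 z (u, v)) :
    du * u * w = -(dz * (1 - α 0 z * u ^ 3 * w)) ∧
    u * dv * (1 - α 0 z * u ^ 3 * w) = du * (resonance α ε z + u * e7Num α ε z u v) := by
  obtain ⟨h1, h2⟩ := mem_finitePart_branchChart.1 h
  simp only at h1 h2
  rw [← hw] at h2
  rw [fderiv_affine_e7 hα h dz du dv w _ hw rfl, chartE7, affine_branchChart h] at heq
  obtain ⟨e1, e2⟩ := Prod.ext_iff.1 heq
  simp only [field, Prod.smul_fst, Prod.smul_snd, smul_eq_mul, ← hw] at e1 e2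
  have hN := e7_numerator hε hα u v w hw
  have e3 : du * u * w = -(dz * (1 - α 0 z * u ^ 3 * w)) := by
    field_simp at e2
    linear_combination -e2
  refine ⟨e3, ?_⟩
  have e4 : 2 * u * du * w + u ^ 2 * (dz * (deriv (branchPoint α ε 1) z * u
        + deriv (branchPoint α ε 2) z * u ^ 2 + deriv (branchPoint α ε 3) z * u ^ 3
        + deriv (branchPoint α ε 4) z * u ^ 4)
      + du * (branchPoint α ε 1 z + 2 * branchPoint α ε 2 z * u + 3 * branchPoint α ε 3 z * u ^ 2
        + 4 * branchPoint α ε 4 z * u ^ 3 + 5 * u ^ 4 * v) + u ^ 5 * dv)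
      = -(dz * (5 / 2 * w ^ 2 - 1 / 2
        + w ^ 2 * (α 4 z * u + α 3 z * u ^ 2 + α 2 z * u ^ 3 + α 1 z * u ^ 4))) := by
    field_simp at e1
    linear_combination -e1 / 2
  -- `e3` exchanges `dz` for `du`, and the numerator is then divisible by `u⁶`
  have h6 : u ^ 6 ≠ 0 := pow_ne_zero 6 h1
  refine mul_left_cancel₀ h6 ?_
  linear_combination (1 - α 0 z * u ^ 3 * w) * e4
    - (u ^ 2 * (deriv (branchPoint α ε 1) z * u
        + deriv (branchPoint α ε 2) z * u ^ 2 + deriv (branchPoint α ε 3) z * u ^ 3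
        + deriv (branchPoint α ε 4) z * u ^ 4) + 5 / 2 * w ^ 2 - 1 / 2
        + w ^ 2 * (α 4 z * u + α 3 z * u ^ 2 + α 2 z * u ^ 3 + α 1 z * u ^ 4)) * e3
    + u * du * hN

/-- Conversely, these equations in the chart on `E₇^ε` say that the tangent vector is mapped to the
vector field. -/
theorem e7_of_relation {α : Fin 5 → ℂ → ℂ} {ε z u v : ℂ} (hε : ε = 1 ∨ ε = -1)
    (hα : ∀ i, AnalyticAt ℂ (α i) z) (h : (z, u, v) ∈ finitePart (chartE7 α ε)) {dz du dv : ℂ}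
    (w : ℂ) (hw : w = vTwo α ε 5 z (u, v)) (hD : 1 - α 0 z * u ^ 3 * w ≠ 0)
    (e3 : du * u * w = -(dz * (1 - α 0 z * u ^ 3 * w)))
    (e5 : u * dv * (1 - α 0 z * u ^ 3 * w) = du * (resonance α ε z + u * e7Num α ε z u v)) :
    fderiv ℂ (affine (chartE7 α ε)) (z, u, v) (dz, du, dv) =
      dz • field α z (affine (chartE7 α ε) (z, u, v)) := by
  obtain ⟨h1, h2⟩ := mem_finitePart_branchChart.1 h
  simp only at h1 h2
  rw [← hw] at h2
  have hN := e7_numerator hε hα u v w hw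
  rw [fderiv_affine_e7 hα h dz du dv w _ hw rfl, chartE7, affine_branchChart h]
  have e4 : 2 * u * du * w + u ^ 2 * (dz * (deriv (branchPoint α ε 1) z * u
        + deriv (branchPoint α ε 2) z * u ^ 2 + deriv (branchPoint α ε 3) z * u ^ 3
        + deriv (branchPoint α ε 4) z * u ^ 4)
      + du * (branchPoint α ε 1 z + 2 * branchPoint α ε 2 z * u + 3 * branchPoint α ε 3 z * u ^ 2
        + 4 * branchPoint α ε 4 z * u ^ 3 + 5 * u ^ 4 * v) + u ^ 5 * dv)
      = -(dz * (5 / 2 * w ^ 2 - 1 / 2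
        + w ^ 2 * (α 4 z * u + α 3 z * u ^ 2 + α 2 z * u ^ 3 + α 1 z * u ^ 4))) := by
    refine mul_left_cancel₀ hD ?_
    linear_combination u ^ 6 * e5 - u * du * hN
      + (u ^ 2 * (deriv (branchPoint α ε 1) z * u
        + deriv (branchPoint α ε 2) z * u ^ 2 + deriv (branchPoint α ε 3) z * u ^ 3
        + deriv (branchPoint α ε 4) z * u ^ 4) + 5 / 2 * w ^ 2 - 1 / 2
        + w ^ 2 * (α 4 z * u + α 3 z * u ^ 2 + α 2 z * u ^ 3 + α 1 z * u ^ 4)) * e3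
  refine Prod.ext ?_ ?_
  · simp only [field, Prod.smul_fst, smul_eq_mul, ← hw]
    rw [e4]
    field_simp
    ring
  · simp only [field, Prod.smul_snd, smul_eq_mul, ← hw]
    field_simp
    linear_combination -e3

/-! ### The charts on `E₉` -/

theorem chartE8_apply (z u v : ℂ) : chartE8 z (u, v) = (u, 1, u * (u * v)) := by
  simp [chartE8, chartE1, blowUp, chart0]

theorem chartE9_apply (α : Fin 5 → ℂ → ℂ) (z u v : ℂ) :
    chartE9 α z (u, v) = (u, 1, u * (u * (u * v + 2 * α 0 z))) := by
  simp [chartE9, blowUp, chartE8_apply]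

theorem chartE9'_apply (α : Fin 5 → ℂ → ℂ) (z U V : ℂ) :
    chartE9' α z (U, V) = (U * V, 1, U * V * (U * V * (V + 2 * α 0 z))) := by
  simp [chartE9', blowUp', chartE8_apply]

theorem mem_finitePart_e9 {α : Fin 5 → ℂ → ℂ} {p : ℂ × ℂ × ℂ} :
    p ∈ finitePart (chartE9 α) ↔ p.2.1 ≠ 0 := by
  obtain ⟨z, u, v⟩ := p
  simp [finitePart, chartE9_apply]

theorem affine_e9 {α : Fin 5 → ℂ → ℂ} {p : ℂ × ℂ × ℂ} (h : p.2.1 ≠ 0) :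
    affine (chartE9 α) p = (1 / p.2.1, p.2.1 * (p.2.1 * p.2.2 + 2 * α 0 p.1)) := by
  obtain ⟨z, u, v⟩ := p
  simp only at h
  simp only [affine, chartE9_apply, Prod.mk.injEq, true_and]
  field_simp

/-- The polynomial part `5/2 y⁴ + α₄ y³ + α₃ y² + α₂ y + α₁` of `x'`. -/
noncomputable def quartic (α : Fin 5 → ℂ → ℂ) (z y : ℂ) : ℂ :=
  5 / 2 * y ^ 4 + α 4 z * y ^ 3 + α 3 z * y ^ 2 + α 2 z * y + α 1 z

theorem differentiableAt_affine_e9 {α : Fin 5 → ℂ → ℂ} {z u v : ℂ} (hα : ∀ i, AnalyticAt ℂ (α i) z)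
    (h : u ≠ 0) : DifferentiableAt ℂ (affine (chartE9 α)) (z, u, v) := by
  have h0 : DifferentiableAt ℂ (α 0) (z, u, v).1 := (hα 0).differentiableAt
  have h3 : DifferentiableAt ℂ (fun p : ℂ × ℂ × ℂ =>
      (1 / p.2.1, p.2.1 * (p.2.1 * p.2.2 + 2 * α 0 p.1))) (z, u, v) := by
    fun_prop (disch := exact h)
  refine h3.congr_of_eventuallyEq ?_
  have h4 : ContinuousAt (fun r : ℂ × ℂ × ℂ => r.2.1) (z, u, v) := by fun_prop
  filter_upwards [h4.eventually_ne h] with r hr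
  exact affine_e9 hr

theorem fderiv_affine_e9 {α : Fin 5 → ℂ → ℂ} {z u v : ℂ} (hα : ∀ i, AnalyticAt ℂ (α i) z)
    (h : u ≠ 0) (dz du dv : ℂ) :
    fderiv ℂ (affine (chartE9 α)) (z, u, v) (dz, du, dv) =
      (-du / u ^ 2, 2 * u * v * du + u ^ 2 * dv + 2 * α 0 z * du + 2 * deriv (α 0) z * u * dz) := by
  have hline : HasDerivAt (fun t : ℂ => ((z, u, v) : ℂ × ℂ × ℂ) + t • ((dz, du, dv) : ℂ × ℂ × ℂ))
      (dz, du, dv) 0 := by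
    simpa using ((hasDerivAt_id (0 : ℂ)).smul_const ((dz, du, dv) : ℂ × ℂ × ℂ)).const_add (z, u, v)
  have hz0 : ((z, u, v) : ℂ × ℂ × ℂ) + (0 : ℂ) • ((dz, du, dv) : ℂ × ℂ × ℂ) = (z, u, v) := by simp
  have h3 := (differentiableAt_affine_e9 (v := v) hα h).hasFDerivAt
  rw [← hz0] at h3
  have h4 := h3.comp_hasDerivAt (0 : ℂ) hline
  rw [hz0] at h4
  refine h4.unique ?_
  have hb : HasDerivAt (fun t : ℂ => α 0 (z + t * dz)) (deriv (α 0) z * dz) 0 := by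
    have hl : HasDerivAt (fun t : ℂ => z + t * dz) dz 0 := by
      simpa using ((hasDerivAt_id (0 : ℂ)).mul_const dz).const_add z
    exact HasDerivAt.comp_of_eq 0 (hα 0).differentiableAt.hasDerivAt hl (by simp)
  have hu : HasDerivAt (fun t : ℂ => u + t * du) du 0 := by
    simpa using ((hasDerivAt_id (0 : ℂ)).mul_const du).const_add u
  have hv : HasDerivAt (fun t : ℂ => v + t * dv) dv 0 := by
    simpa using ((hasDerivAt_id (0 : ℂ)).mul_const dv).const_add v
  have hX : HasDerivAt (fun t : ℂ => 1 / (u + t * du)) (-du / u ^ 2) 0 := by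
    refine ((hasDerivAt_const (0 : ℂ) (1 : ℂ)).div hu (by simpa using h)).congr_deriv ?_
    simp
  have hY : HasDerivAt (fun t : ℂ => (u + t * du) * ((u + t * du) * (v + t * dv)
      + 2 * α 0 (z + t * dz)))
      (2 * u * v * du + u ^ 2 * dv + 2 * α 0 z * du + 2 * deriv (α 0) z * u * dz) 0 := by
    refine (hu.mul ((hu.mul hv).add (hb.const_mul 2))).congr_deriv ?_
    simp
    ring
  refine (hX.prodMk hY).congr_of_eventuallyEq ?_
  filter_upwards [hu.continuousAt.eventually_ne (by simpa using h)] with t ht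
  exact affine_e9 (p := (z, u, v) + t • (dz, du, dv)) ht

/-- The equations of the system in the chart on `E₉`, in terms of a tangent vector
`(dz, du, dv)`. -/
theorem e9_relation {α : Fin 5 → ℂ → ℂ} {z u v : ℂ} (hα : ∀ i, AnalyticAt ℂ (α i) z)
    (h : u ≠ 0) {dz du dv : ℂ} (y : ℂ) (hy : y = u * (u * v + 2 * α 0 z)) :
    fderiv ℂ (affine (chartE9 α)) (z, u, v) (dz, du, dv) =
      dz • field α z (affine (chartE9 α) (z, u, v)) ↔
    du = dz * (1 / 2 - u ^ 2 * quartic α z y) ∧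
    u * dv = dz * (-(2 * deriv (α 0) z) + 2 * u * (u * v + α 0 z) * quartic α z y) := by
  rw [fderiv_affine_e9 hα h, affine_e9 h, Prod.ext_iff]
  simp only [field, Prod.smul_fst, Prod.smul_snd, smul_eq_mul, ← hy]
  have hq : 5 / 2 * y ^ 4 - 1 / 2 * (1 / u) ^ 2 + α 4 z * y ^ 3 + α 3 z * y ^ 2 + α 2 z * y + α 1 z
      = quartic α z y - 1 / (2 * u ^ 2) := by
    unfold quartic; field_simp; ring
  have hyu : 1 / u * y = u * v + 2 * α 0 z := by rw [hy]; field_simp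
  rw [hq, hyu]
  have e1 : -du / u ^ 2 = dz * (quartic α z y - 1 / (2 * u ^ 2)) ↔
      du = dz * (1 / 2 - u ^ 2 * quartic α z y) := by
    constructor
    · intro e
      field_simp at e
      linear_combination -e / 2
    · intro e
      rw [e]
      field_simp
      ring
  rw [e1]
  refine and_congr_right fun e2 => ?_
  constructor
  · intro e
    refine mul_left_cancel₀ h ?_
    linear_combination e - 2 * (u * v + α 0 z) * e2
  · intro e
    linear_combination u * e + 2 * (u * v + α 0 z) * e2

/-! ### The second charts of the final blow-ups -/

/-- If two charts are related by `(u, v) = (U V, 1 / U)`, then so are the differentials of their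
maps to the phase space. -/
theorem fderiv_affine_secondChart {c c' : Chart} (hc : ∀ z U V, U ≠ 0 → c' z (U, V) = c z (U * V, 1 / U))
    {z U V : ℂ} (hU : U ≠ 0) (hd : DifferentiableAt ℂ (affine c) (z, U * V, 1 / U)) (dz dU dV : ℂ) :
    affine c' (z, U, V) = affine c (z, U * V, 1 / U) ∧
    fderiv ℂ (affine c') (z, U, V) (dz, dU, dV) =
      fderiv ℂ (affine c) (z, U * V, 1 / U) (dz, V * dU + U * dV, -dU / U ^ 2) := by
  have haff : ∀ z U V, U ≠ 0 → affine c' (z, U, V) = affine c (z, U * V, 1 / U) := by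
    intro z U V hU
    simp only [affine, hc z U V hU]
  refine ⟨haff z U V hU, ?_⟩
  have h4 : ContinuousAt (fun r : ℂ × ℂ × ℂ => r.2.1) (z, U, V) := by fun_prop
  have heq : affine c' =ᶠ[𝓝 (z, U, V)] fun r => affine c (r.1, r.2.1 * r.2.2, 1 / r.2.1) := by
    filter_upwards [h4.eventually_ne hU] with r hr
    exact haff r.1 r.2.1 r.2.2 hr
  have hψ : DifferentiableAt ℂ (fun r : ℂ × ℂ × ℂ => (r.1, r.2.1 * r.2.2, 1 / r.2.1)) (z, U, V) := by
    fun_prop (disch := exact hU)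
  have hcomp : DifferentiableAt ℂ (fun r : ℂ × ℂ × ℂ =>
      affine c (r.1, r.2.1 * r.2.2, 1 / r.2.1)) (z, U, V) :=
    DifferentiableAt.comp (z, U, V) (g := affine c)
      (f := fun r : ℂ × ℂ × ℂ => (r.1, r.2.1 * r.2.2, 1 / r.2.1)) hd hψ
  rw [heq.fderiv_eq]
  have hline : HasDerivAt (fun t : ℂ => ((z, U, V) : ℂ × ℂ × ℂ) + t • ((dz, dU, dV) : ℂ × ℂ × ℂ))
      (dz, dU, dV) 0 := by
    simpa using ((hasDerivAt_id (0 : ℂ)).smul_const ((dz, dU, dV) : ℂ × ℂ × ℂ)).const_add (z, U, V)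
  have hz0 : ((z, U, V) : ℂ × ℂ × ℂ) + (0 : ℂ) • ((dz, dU, dV) : ℂ × ℂ × ℂ) = (z, U, V) := by simp
  have h1 := hcomp.hasFDerivAt
  rw [← hz0] at h1
  have h2 := h1.comp_hasDerivAt (0 : ℂ) hline
  rw [hz0] at h2
  refine h2.unique ?_
  have hu : HasDerivAt (fun t : ℂ => U + t * dU) dU 0 := by
    simpa using ((hasDerivAt_id (0 : ℂ)).mul_const dU).const_add U
  have hv : HasDerivAt (fun t : ℂ => V + t * dV) dV 0 := by
    simpa using ((hasDerivAt_id (0 : ℂ)).mul_const dV).const_add V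
  have hz : HasDerivAt (fun t : ℂ => z + t * dz) dz 0 := by
    simpa using ((hasDerivAt_id (0 : ℂ)).mul_const dz).const_add z
  have hX : HasDerivAt (fun t : ℂ => 1 / (U + t * dU)) (-dU / U ^ 2) 0 := by
    refine ((hasDerivAt_const (0 : ℂ) (1 : ℂ)).div hu (by simpa using hU)).congr_deriv ?_
    simp
  have hY : HasDerivAt (fun t : ℂ => (U + t * dU) * (V + t * dV)) (V * dU + U * dV) 0 := by
    refine (hu.mul hv).congr_deriv ?_
    simp
    ring
  have hcurve := hz.prodMk (hY.prodMk hX)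
  have hd' : HasFDerivAt (affine c) (fderiv ℂ (affine c) (z, U * V, 1 / U))
      (z + 0 * dz, (U + 0 * dU) * (V + 0 * dV), 1 / (U + 0 * dU)) := by
    simpa using hd.hasFDerivAt
  have h5 := hd'.comp_hasDerivAt (0 : ℂ) hcurve
  exact h5

/-- The product of `U²` with `e7Num` at `u = U V`, `v = 1 / U`, which is a polynomial in `U` and `V`
and thus extends to the point `U = 0` of the second chart on `E₇^ε`. -/
noncomputable def e7Num' (α : Fin 5 → ℂ → ℂ) (ε z U V : ℂ) : ℂ :=
  U ^ 2 * e7Rem ε (branchPoint α ε 1 z) (branchPoint α ε 2 z) (branchPoint α ε 3 z)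
    (branchPoint α ε 4 z)
    (deriv (branchPoint α ε 1) z) (deriv (branchPoint α ε 2) z) (deriv (branchPoint α ε 3) z)
    (deriv (branchPoint α ε 4) z) (α 0 z) (α 1 z) (α 2 z) (α 3 z) (α 4 z) (U * V)
  + U * e7Lin ε (branchPoint α ε 1 z) (branchPoint α ε 2 z) (branchPoint α ε 3 z)
    (branchPoint α ε 4 z) (deriv (branchPoint α ε 1) z) (deriv (branchPoint α ε 2) z)
    (deriv (branchPoint α ε 3) z) (deriv (branchPoint α ε 4) z) (α 0 z) (α 1 z) (α 2 z) (α 3 z)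
    (α 4 z) (U * V)
  + (U * V) ^ 4 * e7Quad ε (branchPoint α ε 1 z) (branchPoint α ε 2 z) (branchPoint α ε 3 z)
    (branchPoint α ε 4 z) (α 0 z) (α 1 z) (α 2 z) (α 3 z) (α 4 z) (U * V)
  + U ^ 8 * V ^ 9 * (5 / 2 + (U * V) * (α 4 z + α 3 z * (U * V) + α 2 z * (U * V) ^ 2
    + α 1 z * (U * V) ^ 3))

theorem e7Num'_eq (α : Fin 5 → ℂ → ℂ) (ε z : ℂ) {U : ℂ} (hU : U ≠ 0) (V : ℂ) :
    e7Num' α ε z U V = U ^ 2 * e7Num α ε z (U * V) (1 / U) := by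
  unfold e7Num' e7Num
  field_simp

theorem contDiffAt_e7Num {α : Fin 5 → ℂ → ℂ} {z : ℂ} (hα : ∀ i, AnalyticAt ℂ (α i) z) (ε u v : ℂ) :
    ContDiffAt ℂ ω (fun r : ℂ × ℂ × ℂ => e7Num α ε r.1 r.2.1 r.2.2) (z, u, v) ∧
    ContDiffAt ℂ ω (fun r : ℂ × ℂ × ℂ => e7Num' α ε r.1 r.2.1 r.2.2) (z, u, v) := by
  have hd : ∀ f : ℂ → ℂ, AnalyticAt ℂ f z →
      ContDiffAt ℂ ω (fun r : ℂ × ℂ × ℂ => f r.1) (z, u, v) := by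
    intro f hf
    have hf' : ContDiffAt ℂ ω f (z, u, v).1 := hf.contDiffAt
    fun_prop
  have hR : ∀ {f : ℂ × ℂ × ℂ → ℂ} {p}, ContDiffAt ℂ ω f p →
      ∀ {b₁ b₂ b₃ b₄ d₁ d₂ d₃ d₄ a₀ a₁ a₂ a₃ a₄ : ℂ × ℂ × ℂ → ℂ}, ContDiffAt ℂ ω b₁ p →
      ContDiffAt ℂ ω b₂ p → ContDiffAt ℂ ω b₃ p → ContDiffAt ℂ ω b₄ p → ContDiffAt ℂ ω d₁ p →
      ContDiffAt ℂ ω d₂ p → ContDiffAt ℂ ω d₃ p → ContDiffAt ℂ ω d₄ p → ContDiffAt ℂ ω a₀ p →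
      ContDiffAt ℂ ω a₁ p → ContDiffAt ℂ ω a₂ p → ContDiffAt ℂ ω a₃ p → ContDiffAt ℂ ω a₄ p →
      ContDiffAt ℂ ω (fun r => e7Rem ε (b₁ r) (b₂ r) (b₃ r) (b₄ r) (d₁ r) (d₂ r) (d₃ r) (d₄ r)
        (a₀ r) (a₁ r) (a₂ r) (a₃ r) (a₄ r) (f r)) p ∧
      ContDiffAt ℂ ω (fun r => e7Lin ε (b₁ r) (b₂ r) (b₃ r) (b₄ r) (d₁ r) (d₂ r) (d₃ r) (d₄ r)
        (a₀ r) (a₁ r) (a₂ r) (a₃ r) (a₄ r) (f r)) p ∧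
      ContDiffAt ℂ ω (fun r => e7Quad ε (b₁ r) (b₂ r) (b₃ r) (b₄ r)
        (a₀ r) (a₁ r) (a₂ r) (a₃ r) (a₄ r) (f r)) p := by
    intro f p hf b₁ b₂ b₃ b₄ d₁ d₂ d₃ d₄ a₀ a₁ a₂ a₃ a₄ _ _ _ _ _ _ _ _ _ _ _ _ _
    unfold e7Rem e7Lin e7Quad e7Base
    refine ⟨?_, ?_, ?_⟩ <;> fun_prop
  have hb := fun n => hd _ (analyticAt_branchPoint hα ε n)
  have hb' := fun n => hd _ (analyticAt_branchPoint hα ε n).deriv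
  have ha := fun i => hd _ (hα i)
  have hu : ContDiffAt ℂ ω (fun r : ℂ × ℂ × ℂ => r.2.1) (z, u, v) := by fun_prop
  have hv : ContDiffAt ℂ ω (fun r : ℂ × ℂ × ℂ => r.2.2) (z, u, v) := by fun_prop
  obtain ⟨h1, h2, h3⟩ := hR hu (hb 1) (hb 2) (hb 3) (hb 4) (hb' 1) (hb' 2) (hb' 3) (hb' 4)
    (ha 0) (ha 1) (ha 2) (ha 3) (ha 4)
  obtain ⟨k1, k2, k3⟩ := hR (hu.mul hv) (hb 1) (hb 2) (hb 3) (hb 4) (hb' 1) (hb' 2) (hb' 3) (hb' 4)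
    (ha 0) (ha 1) (ha 2) (ha 3) (ha 4)
  have ha1 := ha 1
  have ha2 := ha 2
  have ha3 := ha 3
  have ha4 := ha 4
  constructor
  · unfold e7Num
    exact (((h1.add (hv.mul h2)).add (((hu.pow 4).mul (hv.pow 2)).mul h3))).add
      (((hu.pow 9).mul (hv.pow 3)).mul (contDiffAt_const.add (hu.mul
        (((ha4.add (ha3.mul hu)).add (ha2.mul (hu.pow 2))).add (ha1.mul (hu.pow 3))))))
  · unfold e7Num'
    have huv := hu.mul hv
    exact ((((hu.pow 2).mul k1).add (hu.mul k2)).add ((huv.pow 4).mul k3)).add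
      (((hu.pow 8).mul (hv.pow 9)).mul (contDiffAt_const.add (huv.mul
        (((ha4.add (ha3.mul huv)).add (ha2.mul (huv.pow 2))).add (ha1.mul (huv.pow 3))))))

/-! ### Regularity and the vanishing of the residues -/

/-- If the residue vanishes, the system at `E₇^ε` is `dz/du = u ζ`, `dv/du = η`, with analytic
`ζ`, `η`, and `ζ = -ε` on the curve. -/
theorem exists_e7_system {α : Fin 5 → ℂ → ℂ} {ε z₀ : ℂ} (hε : ε = 1 ∨ ε = -1)
    (hα : ∀ i, AnalyticAt ℂ (α i) z₀) (hres : ∀ᶠ z in 𝓝 z₀, resonance α ε z = 0) (v₀ : ℂ) :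
    ∃ ζ η : ℂ × ℂ × ℂ → ℂ, AnalyticAt ℂ ζ (z₀, 0, v₀) ∧ AnalyticAt ℂ η (z₀, 0, v₀) ∧
      ζ (z₀, 0, v₀) = -ε ∧ ∀ᶠ p in 𝓝 (z₀, (0 : ℂ), v₀),
        (p.2.1 ≠ 0 → p ∈ finitePart (chartE7 α ε)) ∧ (p ∈ finitePart (chartE7 α ε) →
          DifferentiableAt ℂ (affine (chartE7 α ε)) p ∧
          fderiv ℂ (affine (chartE7 α ε)) p (p.2.1 * ζ p, 1, η p) =
            (p.2.1 * ζ p) • field α p.1 (affine (chartE7 α ε) p)) := by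
  have hw := contDiffAt_vTwo hα ε 5 (0, v₀)
  have h0 : ContDiffAt ℂ ω (α 0) (z₀, (0 : ℂ), v₀).1 := (hα 0).contDiffAt
  have hN := (contDiffAt_e7Num hα ε 0 v₀).1
  have hD : ContDiffAt ℂ ω (fun r : ℂ × ℂ × ℂ =>
      1 - α 0 r.1 * r.2.1 ^ 3 * vTwo α ε 5 r.1 r.2) (z₀, 0, v₀) := by fun_prop
  have hD0 : (fun r : ℂ × ℂ × ℂ => 1 - α 0 r.1 * r.2.1 ^ 3 * vTwo α ε 5 r.1 r.2) (z₀, 0, v₀) ≠ 0 := by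
    simp
  have hw0 : vTwo α ε 5 z₀ (0, v₀) = ε := by rw [vTwo_five]; simp
  have hwne : (fun r : ℂ × ℂ × ℂ => vTwo α ε 5 r.1 r.2) (z₀, 0, v₀) ≠ 0 := by
    simp only [hw0]
    rcases hε with rfl | rfl <;> norm_num
  refine ⟨fun r => -(vTwo α ε 5 r.1 r.2) / (1 - α 0 r.1 * r.2.1 ^ 3 * vTwo α ε 5 r.1 r.2),
    fun r => e7Num α ε r.1 r.2.1 r.2.2 / (1 - α 0 r.1 * r.2.1 ^ 3 * vTwo α ε 5 r.1 r.2),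
    (hw.neg.div hD hD0).analyticAt, (hN.div hD hD0).analyticAt, by simp [hw0], ?_⟩
  have hα' : ∀ᶠ z in 𝓝 z₀, ∀ i, AnalyticAt ℂ (α i) z :=
    eventually_all.2 fun i => (hα i).eventually_analyticAt
  have hfst : Tendsto (fun r : ℂ × ℂ × ℂ => r.1) (𝓝 (z₀, 0, v₀)) (𝓝 z₀) := continuousAt_fst
  filter_upwards [hfst.eventually hres, hfst.eventually hα', hD.continuousAt.eventually_ne hD0,
    hw.continuousAt.eventually_ne hwne] with r h1 h2 h3 h5
  refine ⟨fun h => mem_finitePart_branchChart.2 ⟨h, h5⟩, fun h4 => ?_⟩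
  obtain ⟨z, u, v⟩ := r
  refine ⟨differentiableAt_affine_e7 h2 h4, e7_of_relation hε h2 h4 _ rfl h3 ?_ ?_⟩
  · simp only at h3 ⊢
    generalize vTwo α ε 5 z (u, v) = W at h3
    rw [mul_assoc u, div_mul_cancel₀ _ h3]
    ring
  · simp only at h1 h3 ⊢
    rw [h1, mul_assoc, div_mul_cancel₀ _ h3]
    ring

theorem regularInFst_e7 {α : Fin 5 → ℂ → ℂ} {ε z₀ : ℂ} (hε : ε = 1 ∨ ε = -1)
    (hα : ∀ i, AnalyticAt ℂ (α i) z₀) (hres : ∀ᶠ z in 𝓝 z₀, resonance α ε z = 0) (v₀ : ℂ) :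
    RegularInFst α (chartE7 α ε) z₀ (0, v₀) := by
  obtain ⟨ζ, η, hζ, hη, -, h⟩ := exists_e7_system hε hα hres v₀
  exact ⟨fun p => p.2.1 * ζ p, η, (analyticAt_fst.comp analyticAt_snd).mul hζ, hη,
    h.mono fun p hp h' => (hp.2 h').2⟩

theorem regularInSnd_e7' {α : Fin 5 → ℂ → ℂ} {ε z₀ : ℂ} (hε : ε = 1 ∨ ε = -1)
    (hα : ∀ i, AnalyticAt ℂ (α i) z₀) (hres : ∀ᶠ z in 𝓝 z₀, resonance α ε z = 0) (U₀ : ℂ) :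
    RegularInSnd α (chartE7' α ε) z₀ (U₀, 0) := by
  -- `w` is the coordinate `v₂` in the second chart
  set w : ℂ × ℂ × ℂ → ℂ := fun r =>
    vTwo α ε 4 r.1 (r.2.1 * r.2.2, r.2.2 + branchPoint α ε 4 r.1) with hwdef
  have hw : ContDiffAt ℂ ω w (z₀, U₀, 0) := by
    have hb : ContDiffAt ℂ ω (branchPoint α ε 4) (z₀, U₀, (0 : ℂ)).1 :=
      (analyticAt_branchPoint hα ε 4).contDiffAt
    have h1 : ContDiffAt ℂ ω (fun r : ℂ × ℂ × ℂ =>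
        ((r.1, r.2.1 * r.2.2, r.2.2 + branchPoint α ε 4 r.1) : ℂ × ℂ × ℂ)) (z₀, U₀, 0) := by
      fun_prop
    exact ContDiffAt.comp (z₀, U₀, 0) (g := fun r : ℂ × ℂ × ℂ => vTwo α ε 4 r.1 r.2)
      (contDiffAt_vTwo hα ε 4 (U₀ * 0, 0 + branchPoint α ε 4 z₀)) h1
  have h0 : ContDiffAt ℂ ω (α 0) (z₀, U₀, (0 : ℂ)).1 := (hα 0).contDiffAt
  have hN := (contDiffAt_e7Num hα ε U₀ 0).2
  have hE : ContDiffAt ℂ ω (fun r : ℂ × ℂ × ℂ => 1 - α 0 r.1 * (r.2.1 * r.2.2) ^ 3 * w r)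
      (z₀, U₀, 0) := by fun_prop
  have hE0 : (fun r : ℂ × ℂ × ℂ => 1 - α 0 r.1 * (r.2.1 * r.2.2) ^ 3 * w r) (z₀, U₀, 0) ≠ 0 := by
    simp
  -- `u = U V`, `v = 1 / U`: taking `V` as independent variable produces this denominator
  have hD : ContDiffAt ℂ ω (fun r : ℂ × ℂ × ℂ =>
      1 - α 0 r.1 * (r.2.1 * r.2.2) ^ 3 * w r + r.2.2 * e7Num' α ε r.1 r.2.1 r.2.2)
      (z₀, U₀, 0) := hE.add (ContDiffAt.mul (by fun_prop) hN)
  have hD0 : (fun r : ℂ × ℂ × ℂ =>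
      1 - α 0 r.1 * (r.2.1 * r.2.2) ^ 3 * w r + r.2.2 * e7Num' α ε r.1 r.2.1 r.2.2)
      (z₀, U₀, 0) ≠ 0 := by simp
  refine ⟨fun r => -(r.2.1 * (r.2.1 * r.2.2) * w r) /
      (1 - α 0 r.1 * (r.2.1 * r.2.2) ^ 3 * w r + r.2.2 * e7Num' α ε r.1 r.2.1 r.2.2),
    fun r => -(r.2.1 * e7Num' α ε r.1 r.2.1 r.2.2) /
      (1 - α 0 r.1 * (r.2.1 * r.2.2) ^ 3 * w r + r.2.2 * e7Num' α ε r.1 r.2.1 r.2.2),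
    ContDiffAt.analyticAt ?_, ContDiffAt.analyticAt ?_, ?_⟩
  · refine ContDiffAt.div ?_ hD hD0
    fun_prop
  · exact (ContDiffAt.neg (ContDiffAt.mul (by fun_prop) hN)).div hD hD0
  · have hα' : ∀ᶠ z in 𝓝 z₀, ∀ i, AnalyticAt ℂ (α i) z :=
      eventually_all.2 fun i => (hα i).eventually_analyticAt
    have hfst : Tendsto (fun r : ℂ × ℂ × ℂ => r.1) (𝓝 (z₀, U₀, 0)) (𝓝 z₀) := continuousAt_fst
    filter_upwards [hfst.eventually hres, hfst.eventually hα', hD.continuousAt.eventually_ne hD0,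
      hE.continuousAt.eventually_ne hE0] with r h1 h2 h3 h3' h4
    obtain ⟨z, U, V⟩ := r
    have hUV : U * V ≠ 0 := by
      intro h
      apply h4
      simp [chartE7', branchChart'_eq, chartE2_apply, h]
    have hU : U ≠ 0 := left_ne_zero_of_mul hUV
    have hch := fun z U V (hU : U ≠ 0) => branchChart'_eq_branchChart α ε 4 z hU V
    have h5 : (z, U * V, 1 / U) ∈ finitePart (chartE7 α ε) := by
      have : (chartE7 α ε z (U * V, 1 / U)) = chartE7' α ε z (U, V) := (hch z U V hU).symm
      simp only [finitePart, mem_ofPred_eq, this]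
      exact h4
    have hww : w (z, U, V) = vTwo α ε 5 z (U * V, 1 / U) := by
      have : U * V * (1 / U) = V := by field_simp
      change vTwo α ε 4 z (U * V, V + branchPoint α ε 4 z) =
        vTwo α ε 4 z (U * V, U * V * (1 / U) + branchPoint α ε 4 z)
      rw [this]
    obtain ⟨h6, h7⟩ := fderiv_affine_secondChart (c' := chartE7' α ε) (c := chartE7 α ε) hch hU
      (differentiableAt_affine_e7 h2 h5)
      (-(U * (U * V) * w (z, U, V)) /
        (1 - α 0 z * (U * V) ^ 3 * w (z, U, V) + V * e7Num' α ε z U V))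
      (-(U * e7Num' α ε z U V) /
        (1 - α 0 z * (U * V) ^ 3 * w (z, U, V) + V * e7Num' α ε z U V)) 1
    simp only at h1 h3 h3' ⊢
    rw [h6, h7]
    refine e7_of_relation hε h2 h5 (w (z, U, V)) hww h3' ?_ ?_
    · generalize 1 - α 0 z * (U * V) ^ 3 * w (z, U, V) = A at h3 h3'
      generalize hB : A + V * e7Num' α ε z U V = B at h3
      field_simp
      rw [← hB]
      ring
    · generalize 1 - α 0 z * (U * V) ^ 3 * w (z, U, V) = A at h3 h3'
      rw [h1, e7Num'_eq α ε z hU V]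
      rw [e7Num'_eq α ε z hU V] at h3
      generalize hB : A + V * (U ^ 2 * e7Num α ε z (U * V) (1 / U)) = B at h3
      field_simp
      rw [← hB]
      ring

/-- If `α₀` is constant, the system at `E₉` is `u' = ξ`, `v' = η`, with analytic `ξ`, `η`, and
`ξ = 1/2` on the curve. -/
theorem exists_e9_system {α : Fin 5 → ℂ → ℂ} {z₀ : ℂ}
    (hα : ∀ i, AnalyticAt ℂ (α i) z₀) (hres : ∀ᶠ z in 𝓝 z₀, deriv (α 0) z = 0) (v₀ : ℂ) :
    ∃ ξ η : ℂ × ℂ × ℂ → ℂ, AnalyticAt ℂ ξ (z₀, 0, v₀) ∧ AnalyticAt ℂ η (z₀, 0, v₀) ∧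
      ξ (z₀, 0, v₀) = 1 / 2 ∧ ∀ᶠ p in 𝓝 (z₀, (0 : ℂ), v₀), p ∈ finitePart (chartE9 α) →
        DifferentiableAt ℂ (affine (chartE9 α)) p ∧
        fderiv ℂ (affine (chartE9 α)) p (1, ξ p, η p) = field α p.1 (affine (chartE9 α) p) := by
  have h : ∀ i, ContDiffAt ℂ ω (α i) (z₀, (0 : ℂ), v₀).1 := fun i => (hα i).contDiffAt
  refine ⟨fun r => 1 / 2 - r.2.1 ^ 2 * quartic α r.1 (r.2.1 * (r.2.1 * r.2.2 + 2 * α 0 r.1)),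
    fun r => 2 * (r.2.1 * r.2.2 + α 0 r.1) *
      quartic α r.1 (r.2.1 * (r.2.1 * r.2.2 + 2 * α 0 r.1)),
    ContDiffAt.analyticAt ?_, ContDiffAt.analyticAt ?_, by simp, ?_⟩
  · unfold quartic; fun_prop
  · unfold quartic; fun_prop
  · have hα' : ∀ᶠ z in 𝓝 z₀, ∀ i, AnalyticAt ℂ (α i) z :=
      eventually_all.2 fun i => (hα i).eventually_analyticAt
    have hfst : Tendsto (fun r : ℂ × ℂ × ℂ => r.1) (𝓝 (z₀, 0, v₀)) (𝓝 z₀) := continuousAt_fst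
    filter_upwards [hfst.eventually hres, hfst.eventually hα'] with r h1 h2 h3
    obtain ⟨z, u, v⟩ := r
    have h4 := (e9_relation (v := v) (du := 1 / 2 - u ^ 2 * quartic α z (u * (u * v + 2 * α 0 z)))
      (dv := 2 * (u * v + α 0 z) * quartic α z (u * (u * v + 2 * α 0 z))) (dz := 1) h2
      (mem_finitePart_e9.1 h3) _ rfl).2
      ⟨by ring, by simp only at h1; rw [h1]; ring⟩
    rw [one_smul] at h4
    exact ⟨differentiableAt_affine_e9 h2 (mem_finitePart_e9.1 h3), h4⟩

theorem regularInTime_e9 {α : Fin 5 → ℂ → ℂ} {z₀ : ℂ}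
    (hα : ∀ i, AnalyticAt ℂ (α i) z₀) (hres : ∀ᶠ z in 𝓝 z₀, deriv (α 0) z = 0) (v₀ : ℂ) :
    RegularInTime α (chartE9 α) z₀ (0, v₀) := by
  obtain ⟨ξ, η, hξ, hη, -, h⟩ := exists_e9_system hα hres v₀
  exact ⟨ξ, η, hξ, hη, h.mono fun p hp h' => (hp h').2⟩

theorem regularInSnd_e9' {α : Fin 5 → ℂ → ℂ} {z₀ : ℂ}
    (hα : ∀ i, AnalyticAt ℂ (α i) z₀) (hres : ∀ᶠ z in 𝓝 z₀, deriv (α 0) z = 0) (U₀ : ℂ) :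
    RegularInSnd α (chartE9' α) z₀ (U₀, 0) := by
  have h : ∀ i, ContDiffAt ℂ ω (α i) (z₀, U₀, (0 : ℂ)).1 := fun i => (hα i).contDiffAt
  set y : ℂ × ℂ × ℂ → ℂ := fun r => r.2.1 * r.2.2 * (r.2.2 + 2 * α 0 r.1) with hy
  have hyd : ContDiffAt ℂ ω y (z₀, U₀, 0) := by fun_prop
  have hq : ContDiffAt ℂ ω (fun r => quartic α r.1 (y r)) (z₀, U₀, 0) := by
    unfold quartic; fun_prop
  -- with `u = U V` and `v = 1 / U`, this is `U` times `dV/dz`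
  set D : ℂ × ℂ × ℂ → ℂ := fun r => 1 / 2 - (r.2.1 * r.2.2) ^ 2 * quartic α r.1 (y r)
    + r.2.1 ^ 2 * r.2.2 * (2 * (r.2.2 + α 0 r.1) * quartic α r.1 (y r)) with hDdef
  have hD : ContDiffAt ℂ ω D (z₀, U₀, 0) := by fun_prop
  have hD0 : D (z₀, U₀, 0) ≠ 0 := by simp [hDdef]
  refine ⟨fun r => r.2.1 / D r,
    fun r => -(r.2.1 ^ 3 * (2 * (r.2.2 + α 0 r.1) * quartic α r.1 (y r))) / D r,
    ContDiffAt.analyticAt (ContDiffAt.div (by fun_prop) hD hD0),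
    ContDiffAt.analyticAt (ContDiffAt.div (by fun_prop) hD hD0), ?_⟩
  have hα' : ∀ᶠ z in 𝓝 z₀, ∀ i, AnalyticAt ℂ (α i) z :=
    eventually_all.2 fun i => (hα i).eventually_analyticAt
  have hfst : Tendsto (fun r : ℂ × ℂ × ℂ => r.1) (𝓝 (z₀, U₀, 0)) (𝓝 z₀) := continuousAt_fst
  filter_upwards [hfst.eventually hres, hfst.eventually hα', hD.continuousAt.eventually_ne hD0]
    with r h1 h2 h3 h4
  obtain ⟨z, U, V⟩ := r
  have hUV : U * V ≠ 0 := by simpa [finitePart, chartE9'_apply] using h4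
  have hU : U ≠ 0 := left_ne_zero_of_mul hUV
  have hch : ∀ z U V, U ≠ 0 → chartE9' α z (U, V) = chartE9 α z (U * V, 1 / U) := by
    intro z U V hU
    have : U * V * (1 / U) = V := by field_simp
    rw [chartE9'_apply, chartE9_apply, this]
  obtain ⟨h6, h7⟩ := fderiv_affine_secondChart hch hU (differentiableAt_affine_e9 h2 hUV)
    (U / D (z, U, V)) (-(U ^ 3 * (2 * (V + α 0 z) * quartic α z (y (z, U, V)))) / D (z, U, V)) 1
  have hyy : y (z, U, V) = U * V * (U * V * (1 / U) + 2 * α 0 z) := by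
    simp only [hy]; field_simp
  simp only at h1 h3 ⊢
  rw [h6, h7]
  refine (e9_relation h2 hUV _ hyy).2 ⟨?_, ?_⟩
  · field_simp
    simp only [hDdef]
    ring
  · rw [h1]
    field_simp
    ring

/-- Along `v = 0` the relation `u dv/du (1 + O(u³)) = resonance + O(u)` forces the residue to vanish in the
limit `u → 0`. -/
theorem resonance_eq_zero_of_regularInFst {α : Fin 5 → ℂ → ℂ} {ε z₀ : ℂ} (hε : ε = 1 ∨ ε = -1)
    (hα : ∀ i, AnalyticAt ℂ (α i) z₀) (h : RegularInFst α (chartE7 α ε) z₀ (0, 0)) :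
    resonance α ε z₀ = 0 := by
  obtain ⟨ζ, η, -, hη, heq⟩ := h
  have hcurve : Tendsto (fun u : ℂ => ((z₀, u, 0) : ℂ × ℂ × ℂ)) (𝓝[≠] 0) (𝓝 (z₀, 0, 0)) := by
    have : ContinuousAt (fun u : ℂ => ((z₀, u, 0) : ℂ × ℂ × ℂ)) 0 := by fun_prop
    exact this.tendsto.mono_left nhdsWithin_le_nhds
  have hu : Tendsto (fun u : ℂ => u) (𝓝[≠] 0) (𝓝 0) := tendsto_id.mono_left nhdsWithin_le_nhds
  have hw' : ∀ n, Tendsto (fun u : ℂ => vTwo α ε n z₀ (u, 0)) (𝓝[≠] 0)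
      (𝓝 (vTwo α ε n z₀ (0, 0))) := fun n =>
    Tendsto.comp (g := fun r : ℂ × ℂ × ℂ => vTwo α ε n r.1 r.2)
      (contDiffAt_vTwo hα ε n (0, 0)).continuousAt.tendsto hcurve
  have hw := hw' 5
  have hw0 : vTwo α ε 5 z₀ (0, 0) ≠ 0 := by
    rw [vTwo_five]
    rcases hε with rfl | rfl <;> simp
  obtain ⟨N, hNr, hNc⟩ : ∃ N : ℂ × ℂ × ℂ → ℂ, (∀ r, e7Num α ε r.1 r.2.1 r.2.2 = N r) ∧
      ContinuousAt N (z₀, 0, 0) := ⟨_, fun _ => rfl, (contDiffAt_e7Num hα ε 0 0).1.continuousAt⟩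
  have hN : Tendsto (fun u : ℂ => N (z₀, u, 0)) (𝓝[≠] 0) (𝓝 (N (z₀, 0, 0))) :=
    hNc.tendsto.comp hcurve
  have hη' : Tendsto (fun u : ℂ => η (z₀, u, 0)) (𝓝[≠] 0) (𝓝 (η (z₀, 0, 0))) :=
    hη.continuousAt.tendsto.comp hcurve
  have hev : ∀ᶠ u in 𝓝[≠] (0 : ℂ), u * η (z₀, u, 0) * (1 - α 0 z₀ * u ^ 3 * vTwo α ε 5 z₀ (u, 0)) =
      resonance α ε z₀ + u * N (z₀, u, 0) := by
    filter_upwards [hcurve.eventually heq, hw.eventually_ne hw0, self_mem_nhdsWithin] with u h1 h2 h3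
    have h4 : (z₀, u, (0 : ℂ)) ∈ finitePart (chartE7 α ε) :=
      mem_finitePart_branchChart.2 ⟨h3, h2⟩
    have h5 := (e7_relation hε hα h4 (h1 h4) _ rfl).2
    rw [one_mul, hNr (z₀, u, 0)] at h5
    exact h5
  have hL : Tendsto (fun u => u * η (z₀, u, 0) * (1 - α 0 z₀ * u ^ 3 * vTwo α ε 5 z₀ (u, 0)))
      (𝓝[≠] 0) (𝓝 (0 * η (z₀, 0, 0) * (1 - α 0 z₀ * 0 ^ 3 * vTwo α ε 5 z₀ (0, 0)))) :=
    (hu.mul hη').mul (tendsto_const_nhds.sub ((tendsto_const_nhds.mul (hu.pow 3)).mul hw))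
  have hR : Tendsto (fun u => resonance α ε z₀ + u * N (z₀, u, 0)) (𝓝[≠] 0)
      (𝓝 (resonance α ε z₀ + 0 * N (z₀, 0, 0))) :=
    tendsto_const_nhds.add (hu.mul hN)
  have := tendsto_nhds_unique (hL.congr' hev) hR
  simpa using this.symm

/-- Along `v = 0` the relation `u v' = -2 α₀' + O(u)` forces `α₀'` to vanish in the limit `u → 0`. -/
theorem deriv_eq_zero_of_regularInTime {α : Fin 5 → ℂ → ℂ} {z₀ : ℂ}
    (hα : ∀ i, AnalyticAt ℂ (α i) z₀) (h : RegularInTime α (chartE9 α) z₀ (0, 0)) :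
    deriv (α 0) z₀ = 0 := by
  obtain ⟨ξ, η, -, hη, heq⟩ := h
  have hcurve : Tendsto (fun u : ℂ => ((z₀, u, 0) : ℂ × ℂ × ℂ)) (𝓝[≠] 0) (𝓝 (z₀, 0, 0)) := by
    have : ContinuousAt (fun u : ℂ => ((z₀, u, 0) : ℂ × ℂ × ℂ)) 0 := by fun_prop
    exact this.tendsto.mono_left nhdsWithin_le_nhds
  have hu : Tendsto (fun u : ℂ => u) (𝓝[≠] 0) (𝓝 0) := tendsto_id.mono_left nhdsWithin_le_nhds
  have hη' := hη.continuousAt.tendsto.comp hcurve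
  have hev : ∀ᶠ u in 𝓝[≠] (0 : ℂ), u * η (z₀, u, 0) =
      -(2 * deriv (α 0) z₀) + 2 * u * α 0 z₀ * quartic α z₀ (u * (2 * α 0 z₀)) := by
    filter_upwards [hcurve.eventually heq, self_mem_nhdsWithin] with u h1 h3
    have h4 := h1 (mem_finitePart_e9.2 h3)
    rw [← one_smul ℂ (field α _ _)] at h4
    have := ((e9_relation (α := α) hα h3 _ rfl).1 h4).2
    simpa using this
  have hL := hu.mul hη'
  have hc : ContinuousAt (fun u => -(2 * deriv (α 0) z₀)
      + 2 * u * α 0 z₀ * quartic α z₀ (u * (2 * α 0 z₀))) 0 := by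
    unfold quartic; fun_prop
  have := tendsto_nhds_unique (hL.congr' hev) (hc.tendsto.mono_left nhdsWithin_le_nhds)
  simpa using this

/-- The conditions say exactly that the residues on the three final curves vanish. -/
theorem conditions_iff {U : Set ℂ} (hU : IsOpen U) (hU' : IsPreconnected U) {α : Fin 5 → ℂ → ℂ}
    (hα : ∀ i, DifferentiableOn ℂ (α i) U) :
    Conditions U α ↔ ∀ z ∈ U, resonance α 1 z = 0 ∧ resonance α (-1) z = 0 ∧ deriv (α 0) z = 0 := by
  have hA : ∀ z ∈ U, ∀ i, AnalyticAt ℂ (α i) z := fun z hz i => (hα i).analyticAt (hU.mem_nhds hz)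
  have hder : ∀ z ∈ U,
      deriv (fun w => α 4 w ^ 3 / 3 - 32 / 9 * (α 4 w * α 3 w) + 64 / 3 * α 2 w) z =
      α 4 z ^ 2 * deriv (α 4) z - 32 / 9 * (deriv (α 4) z * α 3 z + α 4 z * deriv (α 3) z)
        + 64 / 3 * deriv (α 2) z := by
    intro z hz
    have h : ∀ i, HasDerivAt (α i) (deriv (α i) z) z :=
      fun i => (hA z hz i).differentiableAt.hasDerivAt
    refine HasDerivAt.deriv ((((((h 4).pow 3).div_const 3).sub
      (((h 4).mul (h 3)).const_mul (32 / 9))).add ((h 2).const_mul (64 / 3))).congr_deriv ?_)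
    push_cast; ring
  constructor
  · rintro ⟨h1, h2, a, h3⟩ z hz
    have h4 : deriv (α 0) z = 0 := by
      have : α 0 =ᶠ[𝓝 z] fun _ => a := by
        filter_upwards [hU.mem_nhds hz] with w hw using h3 w hw
      rw [this.deriv_eq, deriv_const]
    have h5 := h1 z hz
    have h6 := h2 z hz
    rw [hder z hz] at h6
    unfold resonance
    rw [h4, h5]
    refine ⟨?_, ?_, rfl⟩ <;> linear_combination -(3 / 128) * h6
  · intro h
    refine ⟨fun z hz => ?_, fun z hz => ?_, ?_⟩
    · obtain ⟨h1, h2, h3⟩ := h z hz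
      unfold resonance at h1 h2
      linear_combination 4 * h1 - 4 * h2 + 8 * h3
    · obtain ⟨h1, h2, h3⟩ := h z hz
      rw [hder z hz]
      unfold resonance at h1 h2
      linear_combination -(64 / 3) * h1 - 64 / 3 * h2
    · exact hU.exists_is_const_of_deriv_eq_zero hU' (hα 0) fun z hz => (h z hz).2.2

theorem regularises_iff {U : Set ℂ} (hU : IsOpen U) (hU' : IsPreconnected U) {α : Fin 5 → ℂ → ℂ}
    (hα : ∀ i, DifferentiableOn ℂ (α i) U) : Regularises U α ↔ Conditions U α := by
  have hA : ∀ z ∈ U, ∀ i, AnalyticAt ℂ (α i) z := fun z hz i => (hα i).analyticAt (hU.mem_nhds hz)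
  rw [conditions_iff hU hU' hα]
  constructor
  · intro h z hz
    obtain ⟨h1, h2, -⟩ := h z hz 0
    exact ⟨resonance_eq_zero_of_regularInFst (Or.inl rfl) (hA z hz) (h1 1 (Or.inl rfl)).1,
      resonance_eq_zero_of_regularInFst (Or.inr rfl) (hA z hz) (h1 (-1) (Or.inr rfl)).1,
      deriv_eq_zero_of_regularInTime (hA z hz) h2⟩
  · intro h z₀ hz₀ w
    have hev := fun {p : ℂ → Prop} (hp : ∀ z ∈ U, p z) =>
      (hU.eventually_mem hz₀).mono fun z hz => hp z hz
    have h0 := hev fun z hz => (h z hz).2.2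
    refine ⟨fun ε hε => ?_, regularInTime_e9 (hA z₀ hz₀) h0 w, regularInSnd_e9' (hA z₀ hz₀) h0 w⟩
    have hres : ∀ᶠ z in 𝓝 z₀, resonance α ε z = 0 := hev fun z hz => by
      rcases hε with rfl | rfl
      exacts [(h z hz).1, (h z hz).2.1]
    exact ⟨regularInFst_e7 hε (hA z₀ hz₀) hres w, regularInSnd_e7' hε (hA z₀ hz₀) hres w⟩

/-! ### Algebraic series through points of the final curves -/

/-- An analytic function with a zero at the origin is divisible by the variable. -/
theorem exists_eq_mul_of_analyticAt {u : ℂ → ℂ} (hu : AnalyticAt ℂ u 0) (h0 : u 0 = 0) :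
    ∃ p : ℂ → ℂ, AnalyticAt ℂ p 0 ∧ p 0 = deriv u 0 ∧ ∀ s, u s = s * p s := by
  obtain ⟨P, hP⟩ := hu
  refine ⟨dslope u 0, hP.has_fpower_series_dslope_fslope.analyticAt, dslope_same u 0, fun s => ?_⟩
  rcases eq_or_ne s 0 with rfl | hs
  · simp [h0]
  · rw [dslope_of_ne u hs, slope_def_field, h0, sub_zero, sub_zero]
    field_simp

/-- A series solution satisfies the equations of the chart. -/
theorem SeriesThrough.exists_curve {α : Fin 5 → ℂ → ℂ} {c : Chart} {k : ℕ} {z₀ v₀ : ℂ}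
    {X Y : ℂ → ℂ} (h : SeriesThrough α c k z₀ v₀ X Y) (hk : k ≠ 0)
    (hd : ∀ᶠ p in 𝓝 (z₀, (0 : ℂ), v₀), p ∈ finitePart c → DifferentiableAt ℂ (affine c) p) :
    ∃ u v : ℂ → ℂ, AnalyticAt ℂ u 0 ∧ AnalyticAt ℂ v 0 ∧ u 0 = 0 ∧ v 0 = v₀ ∧
      ∀ᶠ s in 𝓝[≠] (0 : ℂ), (z₀ + s ^ k, u s, v s) ∈ finitePart c ∧
        affine c (z₀ + s ^ k, u s, v s) = (X s, Y s) ∧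
        fderiv ℂ (affine c) (z₀ + s ^ k, u s, v s) (k * s ^ (k - 1), deriv u s, deriv v s) =
          (k * s ^ (k - 1) : ℂ) • field α (z₀ + s ^ k) (affine c (z₀ + s ^ k, u s, v s)) := by
  obtain ⟨-, -, hXY, u, v, hu, hv, hu0, hv0, hc⟩ := h
  refine ⟨u, v, hu, hv, hu0, hv0, ?_⟩
  have hcurve : Tendsto (fun s => (z₀ + s ^ k, u s, v s)) (𝓝[≠] 0) (𝓝 (z₀, (0 : ℂ), v₀)) := by
    have h1 : ContinuousAt (fun s : ℂ => z₀ + s ^ k) 0 := by fun_prop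
    have h2 := h1.prodMk (hu.continuousAt.prodMk hv.continuousAt)
    have h3 := h2.tendsto
    simp only [hu0, hv0, zero_pow hk, add_zero] at h3
    exact h3.mono_left nhdsWithin_le_nhds
  have hua := hu.eventually_analyticAt.filter_mono (nhdsWithin_le_nhds (s := {(0 : ℂ)}ᶜ))
  have hva := hv.eventually_analyticAt.filter_mono (nhdsWithin_le_nhds (s := {(0 : ℂ)}ᶜ))
  filter_upwards [hXY, eventually_eventually_nhdsWithin.2 hc, hc, hcurve.eventually hd, hua, hva,
    self_mem_nhdsWithin] with s h1 h2 h3 h4 h5 h6 hs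
  refine ⟨h3.1, h3.2, ?_⟩
  have hz : HasDerivAt (fun s : ℂ => z₀ + s ^ k) (k * s ^ (k - 1)) s :=
    (hasDerivAt_pow k s).const_add z₀
  have h8 := (h4 h3.1).hasFDerivAt.comp_hasDerivAt s
    (hz.prodMk (h5.differentiableAt.hasDerivAt.prodMk h6.differentiableAt.hasDerivAt))
  have h9 := h1.1.prodMk h1.2
  have h10 : (fun s => affine c (z₀ + s ^ k, u s, v s)) =ᶠ[𝓝 s] fun s => (X s, Y s) := by
    have h11 : ∀ᶠ t in 𝓝[{0}ᶜ] s, affine c (z₀ + t ^ k, u t, v t) = (X t, Y t) :=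
      h2.mono fun _ h => h.2
    rwa [isOpen_compl_singleton.nhdsWithin_eq hs] at h11
  have h12 := (h9.congr_of_eventuallyEq h10).unique h8
  refine h12.symm.trans ?_
  rw [h3.2]
  rfl

/-- Along a series in powers of `(z - z₀) ^ (1/2)` through a point of `E₇^ε` the residue on `E₇^ε`
vanishes at `z₀`, and the leading terms are determined. -/
theorem SeriesThrough.e7 {α : Fin 5 → ℂ → ℂ} {ε z₀ v₀ : ℂ} {X Y : ℂ → ℂ} (hε : ε = 1 ∨ ε = -1)
    (hα : ∀ i, AnalyticAt ℂ (α i) z₀) (h : SeriesThrough α (chartE7 α ε) 2 z₀ v₀ X Y) :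
    resonance α ε z₀ = 0 ∧
    Tendsto (fun s => s ^ 2 * X s) (𝓝[≠] 0) (𝓝 (-(1 / 2))) ∧
    ∃ σ : ℂ, σ ^ 2 = -ε ∧ Tendsto (fun s => s * Y s) (𝓝[≠] 0) (𝓝 (σ / (Real.sqrt 2 : ℂ))) := by
  have hα' : ∀ᶠ z in 𝓝 z₀, ∀ i, AnalyticAt ℂ (α i) z :=
    eventually_all.2 fun i => (hα i).eventually_analyticAt
  have hfst : Tendsto (fun r : ℂ × ℂ × ℂ => r.1) (𝓝 (z₀, 0, v₀)) (𝓝 z₀) := continuousAt_fst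
  obtain ⟨u, v, hu, hv, hu0, hv0, hc⟩ := h.exists_curve two_ne_zero (by
    filter_upwards [hfst.eventually hα'] with p hp hpc
    exact differentiableAt_affine_e7 hp hpc)
  have hcurve' : ContinuousAt (fun s => (z₀ + s ^ 2, u s, v s)) (0 : ℂ) := by
    have h1 : ContinuousAt (fun s : ℂ => z₀ + s ^ 2) 0 := by fun_prop
    exact h1.prodMk (hu.continuousAt.prodMk hv.continuousAt)
  have hcurve : Tendsto (fun s => (z₀ + s ^ 2, u s, v s)) (𝓝[≠] 0) (𝓝 (z₀, (0 : ℂ), v₀)) := by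
    have h3 := hcurve'.tendsto
    simp only [hu0, hv0, zero_pow two_ne_zero, add_zero] at h3
    exact h3.mono_left nhdsWithin_le_nhds
  obtain ⟨p, hp, hp0, hup⟩ := exists_eq_mul_of_analyticAt hu hu0
  obtain ⟨w, hwr, hwc⟩ : ∃ w : ℂ × ℂ × ℂ → ℂ, (∀ r, w r = vTwo α ε 5 r.1 r.2) ∧
      ContinuousAt w (z₀, 0, v₀) := ⟨_, fun _ => rfl, (contDiffAt_vTwo hα ε 5 (0, v₀)).continuousAt⟩
  obtain ⟨N, hNr, hNc⟩ : ∃ N : ℂ × ℂ × ℂ → ℂ, (∀ r, resonance α ε r.1 + r.2.1 *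
      e7Num α ε r.1 r.2.1 r.2.2 = resonance α ε r.1 + r.2.1 * N r) ∧
      ContinuousAt N (z₀, 0, v₀) := ⟨_, fun _ => rfl, (contDiffAt_e7Num hα ε 0 v₀).1.continuousAt⟩
  have hw0 : w (z₀, 0, v₀) = ε := by rw [hwr, vTwo_five]; simp
  have hwt := hwc.tendsto.comp hcurve
  rw [hw0] at hwt
  have hNt := hNc.tendsto.comp hcurve
  have hC : ContinuousAt (resonance α ε) z₀ := by
    have h1 := fun i => (hα i).continuousAt
    have h2 := fun i => (hα i).deriv.continuousAt
    have h3 := (hα 4).deriv.deriv.continuousAt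
    unfold resonance
    fun_prop
  have hzt : Tendsto (fun s : ℂ => z₀ + s ^ 2) (𝓝[≠] 0) (𝓝 z₀) := hfst.comp hcurve
  have hCt := hC.tendsto.comp hzt
  have ha0t := (hα 0).continuousAt.tendsto.comp hzt
  have hut : Tendsto u (𝓝[≠] 0) (𝓝 0) := by
    have := hu.continuousAt.tendsto; rw [hu0] at this; exact this.mono_left nhdsWithin_le_nhds
  have hpt : Tendsto p (𝓝[≠] 0) (𝓝 (p 0)) := hp.continuousAt.tendsto.mono_left nhdsWithin_le_nhds
  have hu't : Tendsto (deriv u) (𝓝[≠] 0) (𝓝 (p 0)) := by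
    rw [hp0]; exact hu.deriv.continuousAt.tendsto.mono_left nhdsWithin_le_nhds
  have hv't : Tendsto (deriv v) (𝓝[≠] 0) (𝓝 (deriv v 0)) :=
    hv.deriv.continuousAt.tendsto.mono_left nhdsWithin_le_nhds
  have hεε : ε * ε = 1 := by rcases hε with rfl | rfl <;> norm_num
  have hfac : Tendsto (fun s => 1 - α 0 (z₀ + s ^ 2) * u s ^ 3 * w (z₀ + s ^ 2, u s, v s)) (𝓝[≠] 0)
      (𝓝 (1 - α 0 z₀ * 0 ^ 3 * ε)) :=
    tendsto_const_nhds.sub ((ha0t.mul (hut.pow 3)).mul hwt)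
  have hrel : ∀ᶠ s in 𝓝[≠] (0 : ℂ),
      (deriv u s * p s * w (z₀ + s ^ 2, u s, v s) =
        -(2 * (1 - α 0 (z₀ + s ^ 2) * u s ^ 3 * w (z₀ + s ^ 2, u s, v s)))) ∧
      (u s * deriv v s * (1 - α 0 (z₀ + s ^ 2) * u s ^ 3 * w (z₀ + s ^ 2, u s, v s)) =
        deriv u s * (resonance α ε (z₀ + s ^ 2) + u s * N (z₀ + s ^ 2, u s, v s))) := by
    filter_upwards [hc, hzt.eventually hα', self_mem_nhdsWithin] with s h1 h2 hs
    have h3 := e7_relation hε h2 h1.1 h1.2.2 _ rfl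
    have h4 := hNr (z₀ + s ^ 2, u s, v s)
    simp only at h4
    rw [h4, ← hwr (z₀ + s ^ 2, u s, v s)] at h3
    refine ⟨mul_left_cancel₀ hs ?_, h3.2⟩
    have h5 := h3.1
    norm_num at h5
    linear_combination h5 - deriv u s * w (z₀ + s ^ 2, u s, v s) * hup s
  -- with `u = s p`, the limit of the first relation determines `p 0`, and that of the second the residue
  have hpε : p 0 * p 0 * ε = -(2 * (1 - α 0 z₀ * 0 ^ 3 * ε)) :=
    tendsto_nhds_unique (((hu't.mul hpt).mul hwt).congr' (hrel.mono fun _ h => h.1))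
      (hfac.const_mul 2).neg
  have hp2 : p 0 ^ 2 = -(2 * ε) := by linear_combination ε * hpε - p 0 ^ 2 * hεε
  have hpne : p 0 ≠ 0 := by
    intro h0
    rw [h0] at hp2
    rcases hε with rfl | rfl <;> norm_num at hp2
  refine ⟨?_, ?_, ?_⟩
  · have h1 : 0 * deriv v 0 * (1 - α 0 z₀ * 0 ^ 3 * ε) =
        p 0 * (resonance α ε z₀ + 0 * N (z₀, 0, v₀)) :=
      tendsto_nhds_unique (((hut.mul hv't).mul hfac).congr' (hrel.mono fun _ h => h.2))
        (hu't.mul (hCt.add (hut.mul hNt)))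
    have h2 : p 0 * resonance α ε z₀ = 0 := by linear_combination -h1
    exact (mul_eq_zero.1 h2).resolve_left hpne
  · have h1 : Tendsto (fun s => 1 / (p s ^ 2 * w (z₀ + s ^ 2, u s, v s))) (𝓝[≠] 0)
        (𝓝 (1 / (p 0 ^ 2 * ε))) := by
      refine tendsto_const_nhds.div ((hpt.pow 2).mul hwt) ?_
      rw [hp2]
      rcases hε with rfl | rfl <;> norm_num
    have h2 : (1 : ℂ) / (p 0 ^ 2 * ε) = -(1 / 2) := by
      have h3 : p 0 ^ 2 * ε = -2 := by rw [hp2]; linear_combination -2 * hεε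
      rw [h3]; norm_num
    rw [h2] at h1
    refine h1.congr' ?_
    filter_upwards [hc, self_mem_nhdsWithin] with s h3 hs
    have h4 := h3.2.1
    rw [chartE7, affine_branchChart h3.1] at h4
    have h6 := (mem_finitePart_branchChart.1 h3.1)
    simp only at h6
    have hX := (Prod.ext_iff.1 h4).1
    simp only at hX
    rw [← hX]
    rw [← hwr (z₀ + s ^ 2, u s, v s)] at h6 ⊢
    have h5 := hup s
    have hs' : s ≠ 0 := hs
    have h7 : p s ≠ 0 := fun h => h6.1 (by rw [h5, h, mul_zero])
    rw [h5]
    generalize hW : w (z₀ + s ^ 2, s * p s, v s) = W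
    rw [← h5] at hW
    rw [hW] at h6
    have h8 := h6.2
    field_simp
  · refine ⟨(Real.sqrt 2 : ℂ) / p 0, ?_, ?_⟩
    · have h3 : ((Real.sqrt 2 : ℝ) : ℂ) ^ 2 = 2 := by
        rw [← Complex.ofReal_pow, Real.sq_sqrt (by norm_num)]; norm_num
      rw [div_pow, h3, hp2]
      rcases hε with rfl | rfl <;> norm_num
    · have h3 : ((Real.sqrt 2 : ℝ) : ℂ) ≠ 0 := by
        rw [Complex.ofReal_ne_zero]; positivity
      have h4 : (Real.sqrt 2 : ℂ) / p 0 / (Real.sqrt 2 : ℂ) = 1 / p 0 := by field_simp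
      rw [h4]
      refine (tendsto_const_nhds.div hpt hpne).congr' ?_
      filter_upwards [hc, self_mem_nhdsWithin] with s h5 hs
      have h6 := h5.2.1
      rw [chartE7, affine_branchChart h5.1] at h6
      have hY := (Prod.ext_iff.1 h6).2
      simp only at hY
      rw [← hY]
      have hs' : s ≠ 0 := hs
      have h7 := (mem_finitePart_branchChart.1 h5.1).1
      simp only at h7
      rw [hup s] at h7 ⊢
      have h8 := right_ne_zero_of_mul h7
      simp only [Pi.div_apply]
      field_simp

/-- Along a Laurent series through a point of `E₉` the derivative of `α₀` vanishes at `z₀`, and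
the leading terms are determined. -/
theorem SeriesThrough.e9 {α : Fin 5 → ℂ → ℂ} {z₀ v₀ : ℂ} {X Y : ℂ → ℂ}
    (hα : ∀ i, AnalyticAt ℂ (α i) z₀) (h : SeriesThrough α (chartE9 α) 1 z₀ v₀ X Y) :
    deriv (α 0) z₀ = 0 ∧ Tendsto (fun s => s * X s) (𝓝[≠] 0) (𝓝 2) ∧
    Tendsto (fun s => Y s / s) (𝓝[≠] 0) (𝓝 (α 0 z₀)) ∧
    meromorphicOrderAt X 0 = -1 ∧ (α 0 z₀ ≠ 0 → meromorphicOrderAt Y 0 = 1) := by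
  have hα' : ∀ᶠ z in 𝓝 z₀, ∀ i, AnalyticAt ℂ (α i) z :=
    eventually_all.2 fun i => (hα i).eventually_analyticAt
  have hfst : Tendsto (fun r : ℂ × ℂ × ℂ => r.1) (𝓝 (z₀, 0, v₀)) (𝓝 z₀) := continuousAt_fst
  obtain ⟨u, v, hu, hv, hu0, hv0, hc⟩ := h.exists_curve one_ne_zero (by
    filter_upwards [hfst.eventually hα'] with p hp hpc
    exact differentiableAt_affine_e9 hp (mem_finitePart_e9.1 hpc))
  obtain ⟨hX, hY, -⟩ := h
  have hzt : Tendsto (fun s : ℂ => z₀ + s) (𝓝[≠] 0) (𝓝 z₀) := by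
    have h1 : ContinuousAt (fun s : ℂ => z₀ + s) 0 := by fun_prop
    have h2 := h1.tendsto
    rw [add_zero] at h2
    exact h2.mono_left nhdsWithin_le_nhds
  obtain ⟨p, hp, hp0, hup⟩ := exists_eq_mul_of_analyticAt hu hu0
  have hut : Tendsto u (𝓝[≠] 0) (𝓝 0) := by
    have := hu.continuousAt.tendsto; rw [hu0] at this; exact this.mono_left nhdsWithin_le_nhds
  have hvt : Tendsto v (𝓝[≠] 0) (𝓝 v₀) := by
    have := hv.continuousAt.tendsto; rw [hv0] at this; exact this.mono_left nhdsWithin_le_nhds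
  have hpt : Tendsto p (𝓝[≠] 0) (𝓝 (p 0)) := hp.continuousAt.tendsto.mono_left nhdsWithin_le_nhds
  have hu't : Tendsto (deriv u) (𝓝[≠] 0) (𝓝 (p 0)) := by
    rw [hp0]; exact hu.deriv.continuousAt.tendsto.mono_left nhdsWithin_le_nhds
  have hv't : Tendsto (deriv v) (𝓝[≠] 0) (𝓝 (deriv v 0)) :=
    hv.deriv.continuousAt.tendsto.mono_left nhdsWithin_le_nhds
  have hat := fun i => (hα i).continuousAt.tendsto.comp hzt
  have ha0't := (hα 0).deriv.continuousAt.tendsto.comp hzt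
  have hyt : Tendsto (fun s => u s * (u s * v s + 2 * α 0 (z₀ + s))) (𝓝[≠] 0)
      (𝓝 (0 * (0 * v₀ + 2 * α 0 z₀))) :=
    hut.mul ((hut.mul hvt).add ((hat 0).const_mul 2))
  rw [zero_mul] at hyt
  have hqt : Tendsto (fun s => quartic α (z₀ + s) (u s * (u s * v s + 2 * α 0 (z₀ + s)))) (𝓝[≠] 0)
      (𝓝 (quartic α z₀ 0)) :=
    (((((hyt.pow 4).const_mul (5 / 2)).add ((hat 4).mul (hyt.pow 3))).add
      ((hat 3).mul (hyt.pow 2))).add ((hat 2).mul hyt)).add (hat 1)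
  have hrel : ∀ᶠ s in 𝓝[≠] (0 : ℂ), u s ≠ 0 ∧ X s = 1 / u s ∧
      Y s = u s * (u s * v s + 2 * α 0 (z₀ + s)) ∧
      deriv u s = 1 / 2 - u s ^ 2 * quartic α (z₀ + s) (u s * (u s * v s + 2 * α 0 (z₀ + s))) ∧
      u s * deriv v s = -(2 * deriv (α 0) (z₀ + s)) + 2 * u s * (u s * v s + α 0 (z₀ + s))
        * quartic α (z₀ + s) (u s * (u s * v s + 2 * α 0 (z₀ + s))) := by
    filter_upwards [hc, hzt.eventually hα'] with s h1 h2
    simp only [pow_one] at h1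
    obtain ⟨h3, h4, h5⟩ := h1
    have h3' : u s ≠ 0 := mem_finitePart_e9.1 h3
    rw [affine_e9 h3'] at h4
    have h6 := (e9_relation h2 h3' _ rfl).1 h5
    simp only [tsub_self, pow_zero, Nat.cast_one, mul_one, one_mul] at h6
    exact ⟨h3', (Prod.ext_iff.1 h4).1.symm, (Prod.ext_iff.1 h4).2.symm, h6.1, h6.2⟩
  have hp0' : p 0 = 1 / 2 - 0 ^ 2 * quartic α z₀ 0 :=
    tendsto_nhds_unique (hu't.congr' (hrel.mono fun _ h => h.2.2.2.1))
      (tendsto_const_nhds.sub ((hut.pow 2).mul hqt))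
  have hp1 : p 0 = 1 / 2 := by rw [hp0']; ring
  have hYp : ∀ᶠ s in 𝓝[≠] (0 : ℂ), Y s = s * (p s * (u s * v s + 2 * α 0 (z₀ + s))) := by
    filter_upwards [hrel] with s h1
    rw [h1.2.2.1]; linear_combination (u s * v s + 2 * α 0 (z₀ + s)) * hup s
  have hg : AnalyticAt ℂ (fun s => p s * (u s * v s + 2 * α 0 (z₀ + s))) 0 := by
    have h1 : AnalyticAt ℂ (fun s => α 0 (z₀ + s)) 0 :=
      (hα 0).comp_of_eq (analyticAt_const.add analyticAt_id) (by simp)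
    exact hp.mul ((hu.mul hv).add (analyticAt_const.mul h1))
  refine ⟨?_, ?_, ?_, ?_, ?_⟩
  · have h1 : 0 * deriv v 0 = -(2 * deriv (α 0) z₀) + 2 * 0 * (0 * v₀ + α 0 z₀) * quartic α z₀ 0 :=
      tendsto_nhds_unique ((hut.mul hv't).congr' (hrel.mono fun _ h => h.2.2.2.2))
        ((ha0't.const_mul 2).neg.add (((hut.const_mul 2).mul ((hut.mul hvt).add (hat 0))).mul hqt))
    linear_combination h1 / 2
  · have h1 : Tendsto (fun s => 1 / p s) (𝓝[≠] 0) (𝓝 2) := by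
      have := (tendsto_const_nhds (x := (1 : ℂ))).div hpt (by rw [hp1]; norm_num)
      rw [hp1] at this
      norm_num at this
      exact this
    refine h1.congr' ?_
    filter_upwards [hrel, self_mem_nhdsWithin] with s h2 hs
    have hs' : s ≠ 0 := hs
    have h3 := h2.1
    rw [h2.2.1]
    rw [hup s] at h3 ⊢
    have h4 := right_ne_zero_of_mul h3
    field_simp
  · have h1 := hg.continuousAt.tendsto.mono_left (nhdsWithin_le_nhds (s := {(0 : ℂ)}ᶜ))
    have h2 : p 0 * (u 0 * v 0 + 2 * α 0 (z₀ + 0)) = α 0 z₀ := by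
      rw [hp1, hu0, add_zero]; ring
    rw [h2] at h1
    refine h1.congr' ?_
    filter_upwards [hYp, self_mem_nhdsWithin] with s h3 hs
    have hs' : s ≠ 0 := hs
    rw [h3]
    field_simp
  · rw [show (-1 : WithTop ℤ) = ((-1 : ℤ) : WithTop ℤ) from rfl, meromorphicOrderAt_eq_int_iff hX]
    have hpne : p 0 ≠ 0 := by rw [hp1]; norm_num
    refine ⟨fun s => (p s)⁻¹, hp.inv hpne, inv_ne_zero hpne, ?_⟩
    filter_upwards [hrel] with s h2
    rw [h2.2.1, hup s]
    simp [mul_comm]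
  · intro ha
    rw [show (1 : WithTop ℤ) = ((1 : ℤ) : WithTop ℤ) from rfl, meromorphicOrderAt_eq_int_iff hY]
    refine ⟨_, hg, ?_, ?_⟩
    · simp [hp1, hu0, ha]
    · filter_upwards [hYp] with s h2
      rw [h2]
      simp

/-! ### Solutions through the points of the final curves -/

/-- A solution `u ↦ (Z u, u, V u)` of the system in the chart on `E₇^ε`, on the disc of radius `ρ`,
with `dZ/du = u g` and `g` close to its value `-ε` on the curve. -/
structure E7Curve (α : Fin 5 → ℂ → ℂ) (ε : ℂ) (ρ : ℝ) (Z V g : ℂ → ℂ) : Prop where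
  pos : 0 < ρ
  sign : ε = 1 ∨ ε = -1
  analytic_Z : ∀ u ∈ Metric.ball (0 : ℂ) ρ, AnalyticAt ℂ Z u
  analytic_V : ∀ u ∈ Metric.ball (0 : ℂ) ρ, AnalyticAt ℂ V u
  analytic_g : ∀ u ∈ Metric.ball (0 : ℂ) ρ, AnalyticAt ℂ g u
  deriv_Z : ∀ u ∈ Metric.ball (0 : ℂ) ρ, deriv Z u = u * g u
  norm_g : ∀ u ∈ Metric.ball (0 : ℂ) ρ, ‖g u + ε‖ ≤ 1 / 4
  mem : ∀ u ∈ Metric.ball (0 : ℂ) ρ, u ≠ 0 → (Z u, u, V u) ∈ finitePart (chartE7 α ε)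
  solves : ∀ u ∈ Metric.ball (0 : ℂ) ρ, u ≠ 0 →
    HasDerivAt (fun u => affine (chartE7 α ε) (Z u, u, V u))
      (deriv Z u • field α (Z u) (affine (chartE7 α ε) (Z u, u, V u))) u

/-- Solutions in the chart on `E₇^ε` through all points near `(z₀, 0, v₀)`, with a common radius; the initial
value is prescribed at the value `r.1` of the coordinate `u`, which need not be `0`. -/
theorem exists_e7_curve {α : Fin 5 → ℂ → ℂ} {ε z₀ : ℂ} (hε : ε = 1 ∨ ε = -1)
    (hα : ∀ i, AnalyticAt ℂ (α i) z₀) (hres : ∀ᶠ z in 𝓝 z₀, resonance α ε z = 0) (v₀ : ℂ)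
    {N : Set (ℂ × ℂ)} (hN : N ∈ 𝓝 (z₀, v₀)) :
    ∃ ρ > 0, ∀ᶠ r in 𝓝 ((0 : ℂ), z₀, v₀), ∃ Z V g : ℂ → ℂ, Z r.1 = r.2.1 ∧ V r.1 = r.2.2 ∧
      E7Curve α ε ρ Z V g ∧ ∀ u ∈ Metric.ball (0 : ℂ) ρ, (Z u, V u) ∈ N := by
  obtain ⟨ζ, η, hζ, hη, hζ0, hsys⟩ := exists_e7_system hε hα hres v₀
  have hclose : ∀ᶠ p in 𝓝 (z₀, (0 : ℂ), v₀), ‖ζ p + ε‖ < 1 / 4 := by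
    have h1 : ContinuousAt (fun p => ‖ζ p + ε‖) (z₀, (0 : ℂ), v₀) := by
      have := hζ.continuousAt; fun_prop
    refine h1.eventually_lt continuousAt_const ?_
    simp [hζ0]
  have hswap : Tendsto (fun r : ℂ × ℂ × ℂ => (r.2.1, r.1, r.2.2)) (𝓝 (0, z₀, v₀))
      (𝓝 (z₀, (0 : ℂ), v₀)) := by
    have : ContinuousAt (fun r : ℂ × ℂ × ℂ => (r.2.1, r.1, r.2.2)) (0, z₀, v₀) := by fun_prop
    exact this
  have hev := hswap.eventually (hsys.and (hclose.and (hζ.eventually_analyticAt)))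
  rw [nhds_prod_eq] at hev
  obtain ⟨pa, hpa, pb, hpb, hab⟩ := eventually_prod_iff.1 hev
  obtain ⟨δ, hδ, hball⟩ := Metric.eventually_nhds_iff_ball.1 hpa
  have hswapA : AnalyticAt ℂ (fun r : ℂ × ℂ × ℂ => (r.2.1, r.1, r.2.2)) (0, z₀, v₀) := by
    refine ContDiffAt.analyticAt ?_
    fun_prop
  obtain ⟨ρ, hρ, hsol⟩ := exists_holomorphic_solution
    (F := fun r : ℂ × ℂ × ℂ => (r.1 * ζ (r.2.1, r.1, r.2.2), η (r.2.1, r.1, r.2.2)))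
    (t₀ := 0) (w₀ := (z₀, v₀))
    ((analyticAt_fst.mul (hζ.comp_of_eq hswapA rfl)).prod (hη.comp_of_eq hswapA rfl))
    (inter_mem hN hpb)
  refine ⟨min ρ δ, lt_min hρ hδ, ?_⟩
  filter_upwards [hsol] with r ⟨w, hw, hwd⟩
  have hρ' : ∀ u ∈ Metric.ball (0 : ℂ) (min ρ δ), u ∈ Metric.ball (0 : ℂ) ρ :=
    fun u hu => Metric.ball_subset_ball (min_le_left _ _) hu
  have hP : ∀ u ∈ Metric.ball (0 : ℂ) (min ρ δ), _ := fun u hu =>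
    hab (hball u (Metric.ball_subset_ball (min_le_right _ _) hu)) (hwd u (hρ' u hu)).2.2
  have hdZ : ∀ u ∈ Metric.ball (0 : ℂ) ρ, HasDerivAt (fun u => (w u).1)
      (u * ζ ((w u).1, u, (w u).2)) u := fun u hu => (hwd u hu).1.fst
  have hdV : ∀ u ∈ Metric.ball (0 : ℂ) ρ, HasDerivAt (fun u => (w u).2)
      (η ((w u).1, u, (w u).2)) u := fun u hu => (hwd u hu).1.snd
  have hAZ : ∀ u ∈ Metric.ball (0 : ℂ) ρ, AnalyticAt ℂ (fun u => (w u).1) u := fun u hu =>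
    DifferentiableOn.analyticAt (s := Metric.ball (0 : ℂ) ρ)
      (fun t ht => (hdZ t ht).differentiableAt.differentiableWithinAt)
      (Metric.isOpen_ball.mem_nhds hu)
  have hAV : ∀ u ∈ Metric.ball (0 : ℂ) ρ, AnalyticAt ℂ (fun u => (w u).2) u := fun u hu =>
    DifferentiableOn.analyticAt (s := Metric.ball (0 : ℂ) ρ)
      (fun t ht => (hdV t ht).differentiableAt.differentiableWithinAt)
      (Metric.isOpen_ball.mem_nhds hu)
  refine ⟨fun u => (w u).1, fun u => (w u).2, fun u => ζ ((w u).1, u, (w u).2),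
    by simp only [hw], by simp only [hw], ⟨lt_min hρ hδ, hε, fun u hu => hAZ u (hρ' u hu),
      fun u hu => hAV u (hρ' u hu), fun u hu => ?_, fun u hu => (hdZ u (hρ' u hu)).deriv,
      fun u hu => (hP u hu).2.1.le, fun u hu h0 => (hP u hu).1.1 h0, fun u hu h0 => ?_⟩,
      fun u hu => (hwd u (hρ' u hu)).2.1⟩
  · exact (hP u hu).2.2.comp_of_eq
      ((hAZ u (hρ' u hu)).prod (analyticAt_id.prod (hAV u (hρ' u hu)))) rfl
  · have hd := (hdZ u (hρ' u hu)).prodMk ((hasDerivAt_id u).prodMk (hdV u (hρ' u hu)))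
    obtain ⟨h1, h2⟩ := (hP u hu).1.2 ((hP u hu).1.1 h0)
    have h3 := h1.hasFDerivAt.comp_hasDerivAt u hd
    rw [(hdZ u (hρ' u hu)).deriv]
    exact h3.congr_deriv h2

/-- As `dZ/du` is within `|u| / 4` of `-ε u`, the difference `Z u - Z 0` is within `|u|² / 4` of `-ε u² / 2`. -/
theorem E7Curve.norm_sub {α : Fin 5 → ℂ → ℂ} {ε : ℂ} {ρ : ℝ} {Z V g : ℂ → ℂ}
    (h : E7Curve α ε ρ Z V g) {u : ℂ} (hu : u ∈ Metric.ball (0 : ℂ) ρ) :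
    ‖u‖ ^ 2 / 4 ≤ ‖Z u - Z 0‖ ∧ ‖Z u - Z 0‖ ≤ ‖u‖ ^ 2 := by
  have hsub : Metric.closedBall (0 : ℂ) ‖u‖ ⊆ Metric.ball 0 ρ :=
    Metric.closedBall_subset_ball (by simpa using hu)
  have hε1 : ‖ε‖ = 1 := by rcases h.sign with rfl | rfl <;> simp
  have hd : ∀ t ∈ Metric.closedBall (0 : ℂ) ‖u‖,
      HasDerivWithinAt (fun t => Z t + ε * t ^ 2 / 2) (t * (g t + ε)) (Metric.closedBall 0 ‖u‖) t := by
    intro t ht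
    have h1 := (h.analytic_Z t (hsub ht)).differentiableAt.hasDerivAt
    rw [h.deriv_Z t (hsub ht)] at h1
    refine (h1.add ((((hasDerivAt_id t).pow 2).const_mul ε).div_const 2)).hasDerivWithinAt.congr_deriv ?_
    simp
    ring
  have hb : ∀ t ∈ Metric.closedBall (0 : ℂ) ‖u‖, ‖t * (g t + ε)‖ ≤ ‖u‖ * (1 / 4) := by
    intro t ht
    rw [norm_mul]
    exact mul_le_mul (by simpa using ht) (h.norm_g t (hsub ht)) (norm_nonneg _) (norm_nonneg _)
  have h2 := Convex.norm_image_sub_le_of_norm_hasDerivWithin_le hd hb (convex_closedBall 0 ‖u‖)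
    (Metric.mem_closedBall_self (norm_nonneg u)) (by simp : u ∈ Metric.closedBall (0 : ℂ) ‖u‖)
  have h3 : Z u + ε * u ^ 2 / 2 - (Z 0 + ε * 0 ^ 2 / 2) = (Z u - Z 0) + ε * u ^ 2 / 2 := by ring
  rw [h3, sub_zero] at h2
  have h4 : ‖ε * u ^ 2 / 2‖ = ‖u‖ ^ 2 / 2 := by simp [hε1]
  constructor
  · have h5 : ‖ε * u ^ 2 / 2‖ ≤ ‖(Z u - Z 0) + ε * u ^ 2 / 2‖ + ‖Z u - Z 0‖ := by
      have := norm_sub_le ((Z u - Z 0) + ε * u ^ 2 / 2) (Z u - Z 0)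
      rwa [add_sub_cancel_left] at this
    rw [h4] at h5
    nlinarith
  · have h5 := norm_sub_le ((Z u - Z 0) + ε * u ^ 2 / 2) (ε * u ^ 2 / 2)
    rw [add_sub_cancel_right, h4] at h5
    nlinarith

theorem E7Curve.deriv_ne_zero {α : Fin 5 → ℂ → ℂ} {ε : ℂ} {ρ : ℝ} {Z V g : ℂ → ℂ}
    (h : E7Curve α ε ρ Z V g) {u : ℂ} (hu : u ∈ Metric.ball (0 : ℂ) ρ) (h0 : u ≠ 0) :
    g u ≠ 0 ∧ deriv Z u ≠ 0 := by
  have hg : g u ≠ 0 := by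
    intro hg
    have h1 := h.norm_g u hu
    have hε1 : ‖ε‖ = 1 := by rcases h.sign with rfl | rfl <;> simp
    rw [hg, zero_add, hε1] at h1
    norm_num at h1
  exact ⟨hg, by rw [h.deriv_Z u hu]; exact mul_ne_zero h0 hg⟩

/-- A function with a double point has an analytic square root there, which is a local
coordinate. -/
theorem exists_sqrt_coordinate {Z g : ℂ → ℂ} (hZ : AnalyticAt ℂ Z 0) (hg : AnalyticAt ℂ g 0)
    (hd : ∀ᶠ u in 𝓝 (0 : ℂ), deriv Z u = u * g u) (hg0 : g 0 ≠ 0) :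
    ∃ s T : ℂ → ℂ, AnalyticAt ℂ s 0 ∧ AnalyticAt ℂ T 0 ∧ s 0 = 0 ∧ T 0 = 0 ∧
      (∀ᶠ u in 𝓝 (0 : ℂ), s u ^ 2 = Z u - Z 0 ∧ T (s u) = u) ∧
      ∀ᶠ w in 𝓝 (0 : ℂ), Z (T w) = Z 0 + w ^ 2 ∧ s (T w) = w := by
  have hZ' : AnalyticAt ℂ (fun u => Z u - Z 0) 0 := hZ.sub analyticAt_const
  obtain ⟨p, hp, hp0, hpu⟩ := exists_eq_mul_of_analyticAt hZ' (by simp)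
  have hZ0 : deriv Z 0 = 0 := by simpa using hd.self_of_nhds
  rw [deriv_sub_const, hZ0] at hp0
  obtain ⟨m, hm, -, hmu⟩ := exists_eq_mul_of_analyticAt hp hp0
  have hZm : ∀ u, Z u - Z 0 = u ^ 2 * m u := fun u => by rw [hpu, hmu]; ring
  -- differentiating `Z = Z 0 + u² m` gives `2 m 0 = g 0`
  have hm0 : m 0 ≠ 0 := by
    have h1 : ∀ᶠ u in 𝓝[≠] (0 : ℂ), 2 * m u + u * deriv m u = g u := by
      filter_upwards [hd.filter_mono nhdsWithin_le_nhds,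
        hm.eventually_analyticAt.filter_mono nhdsWithin_le_nhds, self_mem_nhdsWithin] with u h1 h2 h3
      have h4 : HasDerivAt (fun u => Z 0 + u ^ 2 * m u) (2 * u * m u + u ^ 2 * deriv m u) u := by
        refine ((((hasDerivAt_id u).pow 2).mul h2.differentiableAt.hasDerivAt).const_add
          (Z 0)).congr_deriv ?_
        simp
      have h5 : (fun u => Z 0 + u ^ 2 * m u) = Z := by
        funext t; rw [← hZm]; ring
      rw [h5] at h4
      rw [h4.deriv] at h1
      exact mul_left_cancel₀ (h3 : u ≠ 0) (by linear_combination h1)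
    have h2 : Tendsto (fun u => 2 * m u + u * deriv m u) (𝓝[≠] 0) (𝓝 (2 * m 0 + 0 * deriv m 0)) :=
      ((hm.continuousAt.tendsto.const_mul 2).add
        (tendsto_id.mul hm.deriv.continuousAt.tendsto)).mono_left nhdsWithin_le_nhds
    have h3 := tendsto_nhds_unique (h2.congr' h1)
      (hg.continuousAt.tendsto.mono_left nhdsWithin_le_nhds)
    intro h4
    rw [h4] at h3
    exact hg0 (by rw [← h3]; ring)
  obtain ⟨r, hr⟩ := IsAlgClosed.exists_pow_nat_eq (m 0) (n := 2) (by norm_num)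
  have hr0 : r ≠ 0 := by rintro rfl; exact hm0 (by rw [← hr]; norm_num)
  set q : ℂ → ℂ := fun u => (m u / m 0) ^ (((2 : ℕ) : ℂ)⁻¹) with hq
  have hqA : AnalyticAt ℂ q 0 := by
    refine AnalyticAt.cpow (hm.div analyticAt_const hm0) analyticAt_const ?_
    rw [div_self hm0]
    exact Complex.one_mem_slitPlane
  have hq2 : ∀ u, q u ^ 2 = m u / m 0 := fun u => Complex.cpow_nat_inv_pow _ two_ne_zero
  have hq0 : q 0 ≠ 0 := by
    intro h
    have := hq2 0
    rw [h, div_self hm0] at this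
    norm_num at this
  set s : ℂ → ℂ := fun u => u * (r * q u) with hs
  have hsA : AnalyticAt ℂ s 0 := analyticAt_id.mul (analyticAt_const.mul hqA)
  have hs2 : ∀ u, s u ^ 2 = Z u - Z 0 := by
    intro u
    have : s u ^ 2 = u ^ 2 * (r ^ 2 * q u ^ 2) := by simp only [hs]; ring
    rw [this, hq2, hr, hZm]
    field_simp
  have hs0 : s 0 = 0 := by simp [hs]
  have hs' : deriv s 0 ≠ 0 := by
    have h1 : HasDerivAt s (1 * (r * q 0) + 0 * (r * deriv q 0)) 0 :=
      (hasDerivAt_id (0 : ℂ)).mul (hqA.differentiableAt.hasDerivAt.const_mul r)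
    rw [h1.deriv, one_mul, zero_mul, add_zero]
    exact mul_ne_zero hr0 hq0
  have hst := hsA.hasStrictDerivAt
  refine ⟨s, hst.localInverse s _ 0 hs', hsA, ?_, hs0, ?_, ?_, ?_⟩
  · have := hsA.analyticAt_localInverse hs'
    rwa [hs0] at this
  · have : hst.localInverse s _ 0 hs' (s 0) = 0 :=
      HasStrictFDerivAt.localInverse_apply_image ..
    rwa [hs0] at this
  · filter_upwards [hst.eventually_left_inverse hs'] with u h1
    exact ⟨hs2 u, h1⟩
  · have h1 := hst.eventually_right_inverse hs'
    rw [hs0] at h1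
    filter_upwards [h1] with w h2
    refine ⟨?_, h2⟩
    have := hs2 (hst.localInverse s _ 0 hs' w)
    rw [h2] at this
    rw [this]; ring

/-- A solution through a point of `E₇^ε` is a series in powers of `(z - z₀) ^ (1/2)`; `T` is the
coordinate `u` as a function of the square root. -/
theorem E7Curve.seriesThrough {α : Fin 5 → ℂ → ℂ} {ε : ℂ} {ρ : ℝ} {Z V g : ℂ → ℂ}
    (h : E7Curve α ε ρ Z V g) {s T : ℂ → ℂ} (hT : AnalyticAt ℂ T 0) (hT0 : T 0 = 0)
    (hs0 : s 0 = 0) (hZT : ∀ᶠ w in 𝓝 (0 : ℂ), Z (T w) = Z 0 + w ^ 2 ∧ s (T w) = w)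
    (hα : ∀ i, AnalyticAt ℂ (α i) (Z 0)) :
    SeriesThrough α (chartE7 α ε) 2 (Z 0) (V 0)
      (fun w => (affine (chartE7 α ε) (Z (T w), T w, V (T w))).1)
      (fun w => (affine (chartE7 α ε) (Z (T w), T w, V (T w))).2) := by
  have hTt : Tendsto T (𝓝 0) (𝓝 0) := by have := hT.continuousAt.tendsto; rwa [hT0] at this
  have hmem : ∀ᶠ w in 𝓝[≠] (0 : ℂ), T w ∈ Metric.ball (0 : ℂ) ρ ∧ T w ≠ 0 ∧ AnalyticAt ℂ T w := by
    filter_upwards [(hTt.eventually (Metric.ball_mem_nhds 0 h.pos)).filter_mono nhdsWithin_le_nhds,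
      hZT.filter_mono nhdsWithin_le_nhds, self_mem_nhdsWithin,
      hT.eventually_analyticAt.filter_mono nhdsWithin_le_nhds] with w h1 h2 h3 h4
    refine ⟨h1, fun h0 => h3 ?_, h4⟩
    rw [mem_singleton_iff, ← h2.2, h0, hs0]
  have h0ρ : (0 : ℂ) ∈ Metric.ball (0 : ℂ) ρ := Metric.mem_ball_self h.pos
  have hZTA : AnalyticAt ℂ (fun w => Z (T w)) 0 :=
    (h.analytic_Z 0 h0ρ).comp_of_eq hT hT0
  have hVTA : AnalyticAt ℂ (fun w => V (T w)) 0 := (h.analytic_V 0 h0ρ).comp_of_eq hT hT0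
  have hWA : AnalyticAt ℂ (fun w => vTwo α ε 5 (Z (T w)) (T w, V (T w))) 0 := by
    have h1 := (contDiffAt_vTwo (z := Z 0) hα ε 5 (0, V 0)).analyticAt
    exact h1.comp_of_eq (f := fun w => (Z (T w), T w, V (T w))) (hZTA.prod (hT.prod hVTA))
      (by simp [hT0])
  have haff : ∀ᶠ w in 𝓝[≠] (0 : ℂ), affine (chartE7 α ε) (Z (T w), T w, V (T w)) =
      (1 / (T w ^ 2 * vTwo α ε 5 (Z (T w)) (T w, V (T w))), 1 / T w) := by
    filter_upwards [hmem] with w h1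
    exact affine_branchChart (h.mem _ h1.1 h1.2.1)
  refine ⟨?_, ?_, ?_, T, fun w => V (T w), hT, hVTA, hT0, by simp only [hT0], ?_⟩
  · have h1 : MeromorphicAt (fun w => 1 / (T w ^ 2 * vTwo α ε 5 (Z (T w)) (T w, V (T w)))) 0 :=
      (MeromorphicAt.const 1 0).div ((hT.pow 2).mul hWA).meromorphicAt
    exact h1.congr (haff.mono fun w h2 => by simp only [h2])
  · have h1 : MeromorphicAt (fun w => 1 / T w) 0 := (MeromorphicAt.const 1 0).div hT.meromorphicAt
    exact h1.congr (haff.mono fun w h2 => by simp only [h2])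
  · have hev : ∀ᶠ w in 𝓝[≠] (0 : ℂ), ∀ᶠ t in 𝓝 w, Z (T t) = Z 0 + t ^ 2 ∧ s (T t) = t :=
      (eventually_eventually_nhds.2 hZT).filter_mono nhdsWithin_le_nhds
    filter_upwards [hmem, hev] with w ⟨h1, h2, h3⟩ h4
    have h5 := (h.solves _ h1 h2).scomp w h3.differentiableAt.hasDerivAt
    have h6 : deriv Z (T w) * deriv T w = 2 * w := by
      have h7 := (h.analytic_Z _ h1).differentiableAt.hasDerivAt.comp w
        h3.differentiableAt.hasDerivAt
      have h8 : HasDerivAt (fun t => Z 0 + t ^ 2) (2 * w) w := by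
        simpa using (hasDerivAt_pow 2 w).const_add (Z 0)
      exact h7.unique (h8.congr_of_eventuallyEq (h4.mono fun t ht => ht.1))
    have h9 : deriv T w • deriv Z (T w) • field α (Z (T w))
        (affine (chartE7 α ε) (Z (T w), T w, V (T w))) = (((2 : ℕ) : ℂ) * w ^ (2 - 1)) •
        field α (Z 0 + w ^ 2) (affine (chartE7 α ε) (Z (T w), T w, V (T w))) := by
      rw [smul_smul, mul_comm, h6, h4.self_of_nhds.1]
      norm_num
    rw [h9] at h5
    exact ⟨h5.fst, h5.snd⟩
  · filter_upwards [hmem, hZT.filter_mono nhdsWithin_le_nhds] with w ⟨h1, h2, h3⟩ h4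
    rw [← h4.1]
    exact ⟨h.mem _ h1 h2, rfl⟩

theorem exists_seriesThrough_e7 {α : Fin 5 → ℂ → ℂ} {ε z₀ : ℂ} (hε : ε = 1 ∨ ε = -1)
    (hα : ∀ i, AnalyticAt ℂ (α i) z₀) (hres : ∀ᶠ z in 𝓝 z₀, resonance α ε z = 0) (v₀ : ℂ) :
    ∃ X Y, SeriesThrough α (chartE7 α ε) 2 z₀ v₀ X Y := by
  obtain ⟨ρ, hρ, h⟩ := exists_e7_curve hε hα hres v₀ univ_mem
  obtain ⟨Z, V, g, hZ, hV, hc, -⟩ := h.self_of_nhds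
  simp only at hZ hV
  have h0ρ : (0 : ℂ) ∈ Metric.ball (0 : ℂ) ρ := Metric.mem_ball_self hρ
  have hg : g 0 ≠ 0 := by
    intro hg
    have h1 := hc.norm_g 0 h0ρ
    have hε1 : ‖ε‖ = 1 := by rcases hε with rfl | rfl <;> simp
    rw [hg, zero_add, hε1] at h1
    norm_num at h1
  obtain ⟨s, T, -, hT, hs0, hT0, -, hZT⟩ := exists_sqrt_coordinate (hc.analytic_Z 0 h0ρ)
    (hc.analytic_g 0 h0ρ) ((Metric.ball_mem_nhds 0 hρ : _ ∈ 𝓝 (0 : ℂ)) |> fun h =>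
      Filter.mem_of_superset h hc.deriv_Z) hg
  have := hc.seriesThrough hT hT0 hs0 hZT (by rwa [hZ])
  rw [hZ, hV] at this
  exact ⟨_, _, this⟩

/-- A solution `z ↦ (z, u z, v z)` of the system in the chart on `E₉`, on the disc of radius `ρ`
around `z₀`. -/
structure E9Curve (α : Fin 5 → ℂ → ℂ) (z₀ : ℂ) (ρ : ℝ) (u v : ℂ → ℂ) : Prop where
  pos : 0 < ρ
  analytic_u : ∀ z ∈ Metric.ball z₀ ρ, AnalyticAt ℂ u z
  analytic_v : ∀ z ∈ Metric.ball z₀ ρ, AnalyticAt ℂ v z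
  deriv_u : ∀ z ∈ Metric.ball z₀ ρ, deriv u z ≠ 0
  solves : ∀ z ∈ Metric.ball z₀ ρ, u z ≠ 0 → HasDerivAt (fun z => affine (chartE9 α) (z, u z, v z))
    (field α z (affine (chartE9 α) (z, u z, v z))) z

/-- Solutions in the chart on `E₉` through all points near `(z₀, 0, v₀)`, with a common radius. -/
theorem exists_e9_curve {α : Fin 5 → ℂ → ℂ} {z₀ : ℂ}
    (hα : ∀ i, AnalyticAt ℂ (α i) z₀) (hres : ∀ᶠ z in 𝓝 z₀, deriv (α 0) z = 0) (v₀ : ℂ)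
    {N : Set (ℂ × ℂ)} (hN : N ∈ 𝓝 ((0 : ℂ), v₀)) :
    ∃ ρ > 0, ∀ᶠ r in 𝓝 (z₀, (0 : ℂ), v₀), ∃ u v : ℂ → ℂ, u r.1 = r.2.1 ∧ v r.1 = r.2.2 ∧
      E9Curve α z₀ ρ u v ∧ ∀ z ∈ Metric.ball z₀ ρ, (u z, v z) ∈ N := by
  obtain ⟨ξ, η, hξ, hη, hξ0, hsys⟩ := exists_e9_system hα hres v₀
  have hne : ∀ᶠ p in 𝓝 (z₀, (0 : ℂ), v₀), ξ p ≠ 0 :=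
    hξ.continuousAt.eventually_ne (by rw [hξ0]; norm_num)
  have hev := hsys.and hne
  rw [nhds_prod_eq] at hev
  obtain ⟨pa, hpa, pb, hpb, hab⟩ := eventually_prod_iff.1 hev
  obtain ⟨δ, hδ, hball⟩ := Metric.eventually_nhds_iff_ball.1 hpa
  obtain ⟨ρ, hρ, hsol⟩ := exists_holomorphic_solution
    (F := fun r : ℂ × ℂ × ℂ => (ξ r, η r)) (t₀ := z₀) (w₀ := (0, v₀)) (hξ.prod hη) (inter_mem hN hpb)
  refine ⟨min ρ δ, lt_min hρ hδ, ?_⟩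
  filter_upwards [hsol] with r ⟨w, hw, hwd⟩
  have hρ' : ∀ u ∈ Metric.ball z₀ (min ρ δ), u ∈ Metric.ball z₀ ρ :=
    fun u hu => Metric.ball_subset_ball (min_le_left _ _) hu
  have hP : ∀ u ∈ Metric.ball z₀ (min ρ δ), _ := fun u hu =>
    hab (hball u (Metric.ball_subset_ball (min_le_right _ _) hu)) (hwd u (hρ' u hu)).2.2
  have hdu : ∀ z ∈ Metric.ball z₀ ρ, HasDerivAt (fun z => (w z).1) (ξ (z, w z)) z :=
    fun z hz => (hwd z hz).1.fst
  have hdv : ∀ z ∈ Metric.ball z₀ ρ, HasDerivAt (fun z => (w z).2) (η (z, w z)) z :=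
    fun z hz => (hwd z hz).1.snd
  refine ⟨fun z => (w z).1, fun z => (w z).2, by simp only [hw], by simp only [hw],
    ⟨lt_min hρ hδ, fun z hz => ?_, fun z hz => ?_, fun z hz => ?_, fun z hz h0 => ?_⟩,
    fun z hz => (hwd z (hρ' z hz)).2.1⟩
  · exact DifferentiableOn.analyticAt (s := Metric.ball z₀ ρ)
      (fun t ht => (hdu t ht).differentiableAt.differentiableWithinAt)
      (Metric.isOpen_ball.mem_nhds (hρ' z hz))
  · exact DifferentiableOn.analyticAt (s := Metric.ball z₀ ρ)
      (fun t ht => (hdv t ht).differentiableAt.differentiableWithinAt)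
      (Metric.isOpen_ball.mem_nhds (hρ' z hz))
  · rw [(hdu z (hρ' z hz)).deriv]
    exact (hP z hz).2
  · have hd := (hasDerivAt_id z).prodMk ((hdu z (hρ' z hz)).prodMk (hdv z (hρ' z hz)))
    obtain ⟨h1, h2⟩ := (hP z hz).1 (mem_finitePart_e9.2 h0)
    have h3 := h1.hasFDerivAt.comp_hasDerivAt z hd
    exact h3.congr_deriv h2

/-- A solution through a point of `E₉` is a Laurent series in `z - z₀`. -/
theorem E9Curve.seriesThrough {α : Fin 5 → ℂ → ℂ} {z₀ : ℂ} {ρ : ℝ} {u v : ℂ → ℂ}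
    (h : E9Curve α z₀ ρ u v) (hu0 : u z₀ = 0) (hα : ∀ i, AnalyticAt ℂ (α i) z₀) :
    SeriesThrough α (chartE9 α) 1 z₀ (v z₀)
      (fun s => (affine (chartE9 α) (z₀ + s, u (z₀ + s), v (z₀ + s))).1)
      (fun s => (affine (chartE9 α) (z₀ + s, u (z₀ + s), v (z₀ + s))).2) := by
  have h0ρ : z₀ ∈ Metric.ball z₀ ρ := Metric.mem_ball_self h.pos
  have hsh : AnalyticAt ℂ (fun s : ℂ => z₀ + s) 0 := analyticAt_const.add analyticAt_id
  have huA : AnalyticAt ℂ (fun s => u (z₀ + s)) 0 := (h.analytic_u z₀ h0ρ).comp_of_eq hsh (by simp)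
  have hvA : AnalyticAt ℂ (fun s => v (z₀ + s)) 0 := (h.analytic_v z₀ h0ρ).comp_of_eq hsh (by simp)
  have haA : AnalyticAt ℂ (fun s => α 0 (z₀ + s)) 0 := (hα 0).comp_of_eq hsh (by simp)
  have hsht : Tendsto (fun s : ℂ => z₀ + s) (𝓝[≠] 0) (𝓝 z₀) := by
    have := hsh.continuousAt.tendsto
    rw [add_zero] at this
    exact this.mono_left nhdsWithin_le_nhds
  have hne : ∀ᶠ s in 𝓝[≠] (0 : ℂ), u (z₀ + s) ≠ 0 := by
    have h1 : HasDerivAt (fun s => u (z₀ + s)) (deriv u z₀ * 1) 0 :=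
      HasDerivAt.comp_of_eq 0 (h.analytic_u z₀ h0ρ).differentiableAt.hasDerivAt
        ((hasDerivAt_id (0 : ℂ)).const_add z₀) (by simp)
    have h2 := h1.eventually_ne (c := 0) (by simpa using h.deriv_u z₀ h0ρ)
    simpa [hu0] using h2
  have haff : ∀ᶠ s in 𝓝[≠] (0 : ℂ), affine (chartE9 α) (z₀ + s, u (z₀ + s), v (z₀ + s)) =
      (1 / u (z₀ + s), u (z₀ + s) * (u (z₀ + s) * v (z₀ + s) + 2 * α 0 (z₀ + s))) :=
    hne.mono fun s hs => affine_e9 hs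
  refine ⟨?_, ?_, ?_, _, _, huA, hvA, by simp [hu0], by simp, ?_⟩
  · have h1 : MeromorphicAt (fun s => 1 / u (z₀ + s)) 0 :=
      (MeromorphicAt.const 1 0).div huA.meromorphicAt
    exact h1.congr (haff.mono fun s h2 => by simp only [h2])
  · have h1 : AnalyticAt ℂ (fun s =>
        u (z₀ + s) * (u (z₀ + s) * v (z₀ + s) + 2 * α 0 (z₀ + s))) 0 :=
      huA.mul ((huA.mul hvA).add (analyticAt_const.mul haA))
    exact h1.meromorphicAt.congr (haff.mono fun s h2 => by simp only [h2])
  · filter_upwards [hne, hsht.eventually (Metric.ball_mem_nhds z₀ h.pos)] with s h1 h2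
    have h3 := (h.solves _ h2 h1).scomp s ((hasDerivAt_id s).const_add z₀)
    rw [one_smul] at h3
    simp only [pow_one, tsub_self, pow_zero, Nat.cast_one, mul_one, one_mul]
    exact ⟨h3.fst, h3.snd⟩
  · filter_upwards [hne] with s h1
    simp only [pow_one]
    exact ⟨mem_finitePart_e9.2 h1, trivial⟩

theorem exists_seriesThrough_e9 {α : Fin 5 → ℂ → ℂ} {z₀ : ℂ}
    (hα : ∀ i, AnalyticAt ℂ (α i) z₀) (hres : ∀ᶠ z in 𝓝 z₀, deriv (α 0) z = 0) (v₀ : ℂ) :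
    ∃ X Y, SeriesThrough α (chartE9 α) 1 z₀ v₀ X Y := by
  obtain ⟨ρ, hρ, h⟩ := exists_e9_curve hα hres v₀ univ_mem
  obtain ⟨u, v, hu, hv, hc, -⟩ := h.self_of_nhds
  simp only at hu hv
  have := hc.seriesThrough hu hα
  rw [hv] at this
  exact ⟨_, _, this⟩

theorem hasAlgebraicSeries_iff {U : Set ℂ} (hU : IsOpen U) (hU' : IsPreconnected U)
    {α : Fin 5 → ℂ → ℂ} (hα : ∀ i, DifferentiableOn ℂ (α i) U) :
    HasAlgebraicSeries U α ↔ Conditions U α := by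
  have hA : ∀ z ∈ U, ∀ i, AnalyticAt ℂ (α i) z := fun z hz i => (hα i).analyticAt (hU.mem_nhds hz)
  rw [conditions_iff hU hU' hα]
  constructor
  · intro h z hz
    obtain ⟨h1, X, Y, h2⟩ := h z hz 0
    obtain ⟨X₁, Y₁, h3⟩ := h1 1 (Or.inl rfl)
    obtain ⟨X₂, Y₂, h4⟩ := h1 (-1) (Or.inr rfl)
    exact ⟨(h3.e7 (Or.inl rfl) (hA z hz)).1, (h4.e7 (Or.inr rfl) (hA z hz)).1, (h2.e9 (hA z hz)).1⟩
  · intro h z₀ hz₀ v₀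
    have hev := fun {p : ℂ → Prop} (hp : ∀ z ∈ U, p z) =>
      (hU.eventually_mem hz₀).mono fun z hz => hp z hz
    refine ⟨fun ε hε => exists_seriesThrough_e7 hε (hA z₀ hz₀) (hev fun z hz => ?_) v₀,
      exists_seriesThrough_e9 (hA z₀ hz₀) (hev fun z hz => (h z hz).2.2) v₀⟩
    rcases hε with rfl | rfl
    exacts [(h z hz).1, (h z hz).2.1]

/-! ### The normalised system -/

/-- If `α₄ = 4 z`, the second of the conditions integrates to the formula for `α₂`; its constant of
integration is `64 c / 3`. -/
theorem conditions_iff_normalised {U : Set ℂ} (hU : IsOpen U) (hU' : IsPreconnected U)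
    {α : Fin 5 → ℂ → ℂ} (hα : ∀ i, DifferentiableOn ℂ (α i) U) (h4 : ∀ z ∈ U, α 4 z = 4 * z) :
    Conditions U α ↔ ∃ a₀ c : ℂ, ∀ z ∈ U, ∀ i, α i z = normalised a₀ c (α 1) (α 3) i z := by
  constructor
  · rintro ⟨-, h2, a, h3⟩
    have hd : DifferentiableOn ℂ
        (fun w => α 4 w ^ 3 / 3 - 32 / 9 * (α 4 w * α 3 w) + 64 / 3 * α 2 w) U := by
      have := hα 2; have := hα 3; have := hα 4
      fun_prop
    obtain ⟨C, hC⟩ := hU.exists_is_const_of_deriv_eq_zero hU' hd h2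
    refine ⟨a, 3 / 64 * C, fun z hz i => ?_⟩
    have h5 := hC z hz
    simp only [h4 z hz] at h5
    fin_cases i
    · exact h3 z hz
    · rfl
    · change α 2 z = 3 / 64 * C + 2 * z / 3 * α 3 z - z ^ 3
      linear_combination 3 / 64 * h5
    · rfl
    · exact h4 z hz
  · rintro ⟨a, c, h⟩
    refine ⟨fun z hz => ?_, fun z hz => ?_, a, fun z hz => h z hz 0⟩
    · have h5 : ∀ z ∈ U, deriv (α 4) z = 4 := fun z hz => by
        have h6 : α 4 =ᶠ[𝓝 z] fun w => 4 * w := by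
          filter_upwards [hU.mem_nhds hz] with w hw using h4 w hw
        rw [h6.deriv_eq]
        simp
      have h6 : deriv (α 4) =ᶠ[𝓝 z] fun _ => (4 : ℂ) := by
        filter_upwards [hU.mem_nhds hz] with w hw using h5 w hw
      rw [h6.deriv_eq, deriv_const]
    · have h6 : (fun w => α 4 w ^ 3 / 3 - 32 / 9 * (α 4 w * α 3 w) + 64 / 3 * α 2 w) =ᶠ[𝓝 z]
          fun _ => 64 / 3 * c := by
        filter_upwards [hU.mem_nhds hz] with w hw
        have h2 : α 2 w = c + 2 * w / 3 * α 3 w - w ^ 3 := h w hw 2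
        rw [h4 w hw, h2]
        ring
      rw [h6.deriv_eq, deriv_const]

/-- The conditions make `α₄` a polynomial `k z + m`; the normalisation has `λ³ = k / 4`, `μ = λ⁻²` and
`ν = -m / k`. -/
theorem exists_normalisation {U : Set ℂ} (hU : IsOpen U) (hU' : IsPreconnected U)
    {α : Fin 5 → ℂ → ℂ} (hα : ∀ i, DifferentiableOn ℂ (α i) U) (h : Conditions U α)
    (hne : ∃ z ∈ U, deriv (α 4) z ≠ 0) :
    ∃ (μ ν lam a₀ c : ℂ) (β₁ β₃ : ℂ → ℂ), μ ≠ 0 ∧ lam ≠ 0 ∧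
      DifferentiableOn ℂ β₁ {Z | μ * Z + ν ∈ U} ∧ DifferentiableOn ℂ β₃ {Z | μ * Z + ν ∈ U} ∧
      ∀ S ⊆ U, ∀ x y : ℂ → ℂ, SolvesOn α S x y ↔
        SolvesOn (normalised a₀ c β₁ β₃) {Z | μ * Z + ν ∈ S}
          (fun Z => μ * x (μ * Z + ν)) (fun Z => lam⁻¹ * y (μ * Z + ν)) := by
  obtain ⟨h1, h2, a, h3⟩ := h
  obtain ⟨k, hk⟩ := hU.exists_is_const_of_deriv_eq_zero hU' ((hα 4).deriv hU) h1
  obtain ⟨m, hm⟩ := hU.exists_is_const_of_deriv_eq_zero hU' (f := fun z => α 4 z - k * z)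
    ((hα 4).sub (by fun_prop)) (fun z hz => by
      have h5 := ((hα 4).differentiableAt (hU.mem_nhds hz)).hasDerivAt
      rw [hk z hz] at h5
      have h6 : HasDerivAt (fun z => α 4 z - k * z) (k - k * 1) z :=
        h5.sub ((hasDerivAt_id z).const_mul k)
      rw [h6.deriv]
      simp)
  have hk0 : k ≠ 0 := by
    obtain ⟨z, hz, hz'⟩ := hne
    rwa [hk z hz] at hz'
  have hd : DifferentiableOn ℂ
      (fun w => α 4 w ^ 3 / 3 - 32 / 9 * (α 4 w * α 3 w) + 64 / 3 * α 2 w) U := by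
    have := hα 2; have := hα 3; have := hα 4
    fun_prop
  obtain ⟨C, hC⟩ := hU.exists_is_const_of_deriv_eq_zero hU' hd h2
  -- `λ` and `μ` make the leading coefficients equal to `5/2` and `4 Z`
  obtain ⟨l, hl⟩ := IsAlgClosed.exists_pow_nat_eq (k / 4) (n := 3) (by norm_num)
  have hl0 : l ≠ 0 := by
    rintro rfl
    apply hk0
    linear_combination -4 * hl
  set μ : ℂ := (l ^ 2)⁻¹ with hμ
  have hμ0 : μ ≠ 0 := inv_ne_zero (pow_ne_zero 2 hl0)
  set ν : ℂ := -m / k with hν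
  have hφd : ∀ i, DifferentiableOn ℂ (fun Z => α i (μ * Z + ν)) {Z | μ * Z + ν ∈ U} := fun i =>
    (hα i).comp (by fun_prop) fun Z hZ => hZ
  refine ⟨μ, ν, l, μ * a / l, 3 * C / 64 / l ^ 3, fun Z => μ ^ 2 * α 1 (μ * Z + ν),
    fun Z => μ ^ 2 * l ^ 2 * α 3 (μ * Z + ν), hμ0, hl0, (hφd 1).const_mul _, (hφd 3).const_mul _, ?_⟩
  have hfield : ∀ Z, μ * Z + ν ∈ U → ∀ x y : ℂ,
      field (normalised (μ * a / l) (3 * C / 64 / l ^ 3) (fun Z => μ ^ 2 * α 1 (μ * Z + ν))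
        (fun Z => μ ^ 2 * l ^ 2 * α 3 (μ * Z + ν))) Z (μ * x, l⁻¹ * y) =
      (μ * ((field α (μ * Z + ν) (x, y)).1 * μ), l⁻¹ * ((field α (μ * Z + ν) (x, y)).2 * μ)) := by
    intro Z hZ x y
    have e0 := h3 _ hZ
    have e4 : α 4 (μ * Z + ν) = 4 * l * Z := by
      have h5 := hm _ hZ
      have hk' : k = 4 * l ^ 3 := by linear_combination -4 * hl
      have h6 : k * ν = -m := by rw [hν]; field_simp
      have h7 : k * (μ * Z) = 4 * l * Z := by rw [hk', hμ]; field_simp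
      linear_combination h5 + h6 + h7
    have e2 : α 2 (μ * Z + ν) = 3 / 64 * C + 2 / 3 * l * Z * α 3 (μ * Z + ν) - l ^ 3 * Z ^ 3 := by
      have h5 := hC _ hZ
      simp only [e4] at h5
      linear_combination 3 / 64 * h5
    simp only [field, normalised, Matrix.cons_val_zero, Matrix.cons_val_one, Matrix.cons_val]
    rw [e0, e2, e4, Prod.mk.injEq]
    generalize α 3 (μ * Z + ν) = A3
    generalize α 1 (μ * Z + ν) = A1
    rw [hμ]
    constructor
    · field_simp
    · field_simp
  intro S hS x y
  have hφ : ∀ Z, HasDerivAt (fun Z : ℂ => μ * Z + ν) μ Z := fun Z => by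
    simpa using ((hasDerivAt_id Z).const_mul μ).add_const ν
  constructor
  · intro hs Z hZ
    obtain ⟨hx, hy⟩ := hs _ hZ
    simp only [hfield Z (hS hZ)]
    exact ⟨(hx.comp Z (hφ Z)).const_mul μ, (hy.comp Z (hφ Z)).const_mul l⁻¹⟩
  · intro hs z hz
    have hψ : HasDerivAt (fun z : ℂ => μ⁻¹ * (z - ν)) μ⁻¹ z := by
      simpa using ((hasDerivAt_id z).sub_const ν).const_mul μ⁻¹
    have hinv : ∀ z, μ * (μ⁻¹ * (z - ν)) + ν = z := fun z => by field_simp; ring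
    obtain ⟨hx, hy⟩ := hs (μ⁻¹ * (z - ν)) (by simpa only [mem_ofPred_eq, hinv] using hz)
    simp only [hfield (μ⁻¹ * (z - ν)) (by rw [hinv]; exact hS hz)] at hx hy
    have hx' := (hx.comp z hψ).const_mul μ⁻¹
    have hy' := (hy.comp z hψ).const_mul l
    rw [hinv] at hx' hy'
    refine ⟨(hx'.congr_deriv ?_).congr_of_eventuallyEq (Eventually.of_forall fun t => ?_),
      (hy'.congr_deriv ?_).congr_of_eventuallyEq (Eventually.of_forall fun t => ?_)⟩
    · field_simp
    · simp only [Function.comp_apply, hinv]; field_simp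
    · field_simp
    · simp only [Function.comp_apply, hinv]; field_simp

theorem second_order_of_solvesOn {a₀ c : ℂ} {α₁ α₃ : ℂ → ℂ} {S : Set ℂ} (hS : IsOpen S)
    {x y : ℂ → ℂ} (h : SolvesOn (normalised a₀ c α₁ α₃) S x y) {z : ℂ} (hz : z ∈ S) (hy : y z ≠ 0) :
    deriv (deriv y) z = deriv y z ^ 2 / (2 * y z) + 5 / 2 * y z ^ 5 + 4 * z * y z ^ 4
      + α₃ z * y z ^ 3 + (c + 2 * z / 3 * α₃ z - z ^ 3) * y z ^ 2 + α₁ z * y z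
      - a₀ ^ 2 / (2 * y z) := by
  have h1 : deriv y =ᶠ[𝓝 z] fun w => x w * y w - a₀ := by
    filter_upwards [hS.mem_nhds hz] with w hw using (h w hw).2.deriv
  rw [h1.deriv_eq, h1.self_of_nhds]
  obtain ⟨hx', hy'⟩ := h z hz
  have h3 : HasDerivAt (fun w => x w * y w - a₀) _ z := (hx'.mul hy').sub_const a₀
  rw [h3.deriv]
  simp only [field, normalised, Matrix.cons_val_zero, Matrix.cons_val_one, Matrix.cons_val]
  field_simp
  ring

theorem solvesOn_of_second_order {a₀ c : ℂ} {α₁ α₃ : ℂ → ℂ} {S : Set ℂ} (hS : IsOpen S)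
    {y : ℂ → ℂ} (hd : DifferentiableOn ℂ y S)
    (h : ∀ z ∈ S, y z ≠ 0 ∧
      deriv (deriv y) z = deriv y z ^ 2 / (2 * y z) + 5 / 2 * y z ^ 5 + 4 * z * y z ^ 4
        + α₃ z * y z ^ 3 + (c + 2 * z / 3 * α₃ z - z ^ 3) * y z ^ 2 + α₁ z * y z
        - a₀ ^ 2 / (2 * y z)) :
    SolvesOn (normalised a₀ c α₁ α₃) S (fun z => (deriv y z + a₀) / y z) y := by
  intro z hz
  obtain ⟨hy, h2⟩ := h z hz
  have hy' := (hd.differentiableAt (hS.mem_nhds hz)).hasDerivAt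
  have hy'' := ((hd.deriv hS).differentiableAt (hS.mem_nhds hz)).hasDerivAt
  constructor
  · refine ((hy''.add_const a₀).div hy' hy).congr_deriv ?_
    rw [h2]
    simp only [field, normalised, Matrix.cons_val_zero, Matrix.cons_val_one, Matrix.cons_val]
    field_simp
    ring
  · refine hy'.congr_deriv ?_
    simp only [field, normalised, Matrix.cons_val_zero]
    field_simp
    ring

/-! ### Modified Hamiltonians -/

/-- Bounds that are uniform in `z` near `z₀` and in `u` on a disc. -/
theorem exists_bound_of_continuousAt {F : ℂ → ℂ → ℂ} {z₀ : ℂ}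
    (hF : ∀ u, ContinuousAt (fun r : ℂ × ℂ => F r.1 r.2) (z₀, u)) (R : ℝ) :
    ∃ M : ℝ, 0 < M ∧ ∀ᶠ z in 𝓝 z₀, ∀ u, ‖u‖ ≤ R → ‖F z u‖ ≤ M := by
  suffices h : ∃ M : ℝ, ∀ᶠ z in 𝓝 z₀, ∀ u ∈ Metric.closedBall (0 : ℂ) R, ‖F z u‖ ≤ M by
    obtain ⟨M, hM⟩ := h
    refine ⟨max M 1, by positivity, hM.mono fun z hz u hu => (hz u (by simpa using hu)).trans
      (le_max_left _ _)⟩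
  refine (isCompact_closedBall (0 : ℂ) R).induction_on
    (p := fun s => ∃ M : ℝ, ∀ᶠ z in 𝓝 z₀, ∀ u ∈ s, ‖F z u‖ ≤ M) ⟨0, by simp⟩ ?_ ?_ ?_
  · rintro s t hst ⟨M, hM⟩
    exact ⟨M, hM.mono fun z hz u hu => hz u (hst hu)⟩
  · rintro s t ⟨M, hM⟩ ⟨M', hM'⟩
    refine ⟨max M M', ?_⟩
    filter_upwards [hM, hM'] with z h1 h2 u hu
    rcases hu with hu | hu
    exacts [(h1 u hu).trans (le_max_left _ _), (h2 u hu).trans (le_max_right _ _)]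
  · intro u _
    have h1 : ∀ᶠ r in 𝓝 (z₀, u), ‖F r.1 r.2‖ ≤ ‖F z₀ u‖ + 1 :=
      ((hF u).norm.eventually_lt continuousAt_const (lt_add_one _)).mono fun r h => h.le
    rw [nhds_prod_eq] at h1
    obtain ⟨pa, hpa, pb, hpb, hab⟩ := eventually_prod_iff.1 h1
    exact ⟨{u | pb u}, mem_nhdsWithin_of_mem_nhds hpb, _,
      hpa.mono fun z hz u hu => hab hz hu⟩

/-- The coefficient `A₁ = 3 z - (2/3) α₃'`. -/
noncomputable def auxCoeff (α₃ : ℂ → ℂ) (z : ℂ) : ℂ := 3 * z - 2 / 3 * deriv α₃ z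

/-- The coefficient of `x / y³` in the modified Hamiltonian. -/
noncomputable def gCoeff (c : ℂ) (α₁ α₃ : ℂ → ℂ) (z : ℂ) : ℂ :=
  -deriv α₁ z + α₃ z * z / 6 + c / 4 - z ^ 3 / 4

/-- The coefficient of `1 / y` in the modified Hamiltonian. -/
noncomputable def kCoeff (a₀ : ℂ) (α₃ : ℂ → ℂ) (z : ℂ) : ℂ :=
  -(5 / 4) + deriv (deriv α₃) z / 3 - a₀ / 2

/-- The terms added to the Hamiltonian for large `y`, chosen such that the sum grows at most
exponentially along solutions. -/
noncomputable def outerTerm (a₀ c : ℂ) (α₁ α₃ : ℂ → ℂ) (z : ℂ) (p : ℂ × ℂ) : ℂ :=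
  p.1 * (1 / 2 - auxCoeff α₃ z / 2 * p.2⁻¹ + gCoeff c α₁ α₃ z * p.2⁻¹ ^ 3)
    + kCoeff a₀ α₃ z * p.2⁻¹

theorem hamiltonian_normalised (a₀ c : ℂ) (α₁ α₃ : ℂ → ℂ) (z x y : ℂ) :
    hamiltonian (normalised a₀ c α₁ α₃) z (x, y) =
      1 / 2 * x ^ 2 * y - 1 / 2 * y ^ 5 - z * y ^ 4 - α₃ z / 3 * y ^ 3
        - (c + 2 * z / 3 * α₃ z - z ^ 3) / 2 * y ^ 2 - α₁ z * y - a₀ * x := by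
  simp only [hamiltonian, normalised, Matrix.cons_val_zero, Matrix.cons_val_one, Matrix.cons_val]
  ring

theorem field_normalised (a₀ c : ℂ) (α₁ α₃ : ℂ → ℂ) (z x y : ℂ) :
    field (normalised a₀ c α₁ α₃) z (x, y) =
      (5 / 2 * y ^ 4 - 1 / 2 * x ^ 2 + 4 * z * y ^ 3 + α₃ z * y ^ 2
        + (c + 2 * z / 3 * α₃ z - z ^ 3) * y + α₁ z, x * y - a₀) := by
  simp only [field, normalised, Matrix.cons_val_zero, Matrix.cons_val_one, Matrix.cons_val]

theorem analyticAt_normalised {α₁ α₃ : ℂ → ℂ} {z : ℂ} (h1 : AnalyticAt ℂ α₁ z)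
    (h3 : AnalyticAt ℂ α₃ z) (a₀ c : ℂ) (i : Fin 5) : AnalyticAt ℂ (normalised a₀ c α₁ α₃ i) z := by
  have h1' := h1.contDiffAt (n := ω)
  have h3' := h3.contDiffAt (n := ω)
  fin_cases i
  · exact analyticAt_const
  · exact h1
  · refine ContDiffAt.analyticAt (f := fun z => c + 2 * z / 3 * α₃ z - z ^ 3) ?_
    fun_prop
  · exact h3
  · exact analyticAt_const.mul analyticAt_id

/-- The data of a curve `(Z, X, Y)` that is tangent to the system at the parameter `t`. -/
structure Tangent (a₀ c : ℂ) (α₁ α₃ Z X Y : ℂ → ℂ) (t : ℂ) : Prop where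
  dZ : HasDerivAt Z 1 t
  dX : HasDerivAt X (field (normalised a₀ c α₁ α₃) (Z t) (X t, Y t)).1 t
  dY : HasDerivAt Y (field (normalised a₀ c α₁ α₃) (Z t) (X t, Y t)).2 t
  analytic₁ : AnalyticAt ℂ α₁ (Z t)
  analytic₃ : AnalyticAt ℂ α₃ (Z t)

section

variable {a₀ c : ℂ} {α₁ α₃ Z X Y : ℂ → ℂ} {t : ℂ}

theorem Tangent.comp (h : Tangent a₀ c α₁ α₃ Z X Y t) {f : ℂ → ℂ} (hf : AnalyticAt ℂ f (Z t)) :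
    HasDerivAt (fun s => f (Z s)) (deriv f (Z t)) t := by
  have := HasDerivAt.comp t hf.differentiableAt.hasDerivAt h.dZ
  rwa [mul_one] at this

theorem Tangent.hamiltonian (h : Tangent a₀ c α₁ α₃ Z X Y t) :
    HasDerivAt (fun s => hamiltonian (normalised a₀ c α₁ α₃) (Z s) (X s, Y s))
      (-(Y t ^ 4 + deriv α₃ (Z t) / 3 * Y t ^ 3 + (2 / 3 * α₃ (Z t) + 2 / 3 * Z t * deriv α₃ (Z t)
        - 3 * Z t ^ 2) / 2 * Y t ^ 2 + deriv α₁ (Z t) * Y t)) t := by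
  have h1 := h.comp h.analytic₁
  have h3 := h.comp h.analytic₃
  obtain ⟨dZ, dX, dY, -, -⟩ := h
  rw [field_normalised] at dX dY
  simp only [hamiltonian_normalised]
  have e1 := ((dX.pow 2).const_mul (1 / 2)).mul dY
  have e2 := (dY.pow 5).const_mul (1 / 2)
  have e3 := dZ.mul (dY.pow 4)
  have e4 := (h3.div_const 3).mul (dY.pow 3)
  have e5 := (((((dZ.const_mul 2).div_const 3).mul h3).const_add c).sub (dZ.pow 3)).div_const 2 |>.mul
    (dY.pow 2)
  have e6 := h1.mul dY
  have e7 := dX.const_mul a₀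
  have e := (((((e1.sub e2).sub e3).sub e4).sub e5).sub e6).sub e7
  refine (e.congr_deriv ?_).congr_of_eventuallyEq (Eventually.of_forall fun s => ?_)
  · simp only [Pi.mul_apply, Pi.pow_apply, Pi.sub_apply]
    push_cast
    ring
  · simp only [Pi.mul_apply, Pi.pow_apply, Pi.sub_apply]

theorem analyticAt_gCoeff {z : ℂ} (h1 : AnalyticAt ℂ α₁ z) (h3 : AnalyticAt ℂ α₃ z) (c : ℂ) :
    AnalyticAt ℂ (gCoeff c α₁ α₃) z := by
  have h1' := h1.deriv.contDiffAt (n := ω)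
  have h3' := h3.contDiffAt (n := ω)
  refine ContDiffAt.analyticAt ?_
  unfold gCoeff
  fun_prop

theorem analyticAt_kCoeff {z : ℂ} (h3 : AnalyticAt ℂ α₃ z) (a₀ : ℂ) :
    AnalyticAt ℂ (kCoeff a₀ α₃) z := by
  have h3' := h3.deriv.deriv.contDiffAt (n := ω)
  refine ContDiffAt.analyticAt ?_
  unfold kCoeff
  fun_prop

theorem analyticAt_auxCoeff {z : ℂ} (h3 : AnalyticAt ℂ α₃ z) : AnalyticAt ℂ (auxCoeff α₃) z := by
  have h3' := h3.deriv.contDiffAt (n := ω)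
  refine ContDiffAt.analyticAt ?_
  unfold auxCoeff
  fun_prop

theorem Tangent.outerTerm (h : Tangent a₀ c α₁ α₃ Z X Y t) (hy : Y t ≠ 0) :
    HasDerivAt (fun s => outerTerm a₀ c α₁ α₃ (Z s) (X s, Y s))
      ((5 / 2 * Y t ^ 4 - 1 / 2 * X t ^ 2 + 4 * Z t * Y t ^ 3 + α₃ (Z t) * Y t ^ 2
        + (c + 2 * Z t / 3 * α₃ (Z t) - Z t ^ 3) * Y t + α₁ (Z t)) *
          (1 / 2 - auxCoeff α₃ (Z t) / 2 * (Y t)⁻¹ + gCoeff c α₁ α₃ (Z t) * (Y t)⁻¹ ^ 3)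
        + X t * (-(3 - 2 / 3 * deriv (deriv α₃) (Z t)) / 2 * (Y t)⁻¹
          + auxCoeff α₃ (Z t) / 2 * (Y t)⁻¹ ^ 2 * (X t * Y t - a₀)
          + deriv (gCoeff c α₁ α₃) (Z t) * (Y t)⁻¹ ^ 3
          - 3 * gCoeff c α₁ α₃ (Z t) * (Y t)⁻¹ ^ 4 * (X t * Y t - a₀))
        + deriv (kCoeff a₀ α₃) (Z t) * (Y t)⁻¹
        - kCoeff a₀ α₃ (Z t) * (Y t)⁻¹ ^ 2 * (X t * Y t - a₀)) t := by
  have hA' : deriv (auxCoeff α₃) (Z t) = 3 - 2 / 3 * deriv (deriv α₃) (Z t) := by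
    have := ((hasDerivAt_id (Z t)).const_mul 3).sub
      (h.analytic₃.deriv.differentiableAt.hasDerivAt.const_mul (2 / 3))
    rw [mul_one] at this
    exact this.deriv
  have hA := h.comp (analyticAt_auxCoeff h.analytic₃)
  have hg := h.comp (analyticAt_gCoeff h.analytic₁ h.analytic₃ c)
  have hk := h.comp (analyticAt_kCoeff h.analytic₃ a₀)
  rw [hA'] at hA
  obtain ⟨dZ, dX, dY, -, -⟩ := h
  rw [field_normalised] at dX dY
  have du := dY.inv hy
  have e := (dX.mul ((((hA.div_const 2).mul du).const_sub (1 / 2)).add (hg.mul (du.pow 3)))).add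
    (hk.mul du)
  refine e.congr_deriv ?_
  simp only [Pi.mul_apply, Pi.pow_apply, Pi.add_apply, Pi.inv_apply]
  have hu : -(X t * Y t - a₀) / Y t ^ 2 = -((Y t)⁻¹ ^ 2 * (X t * Y t - a₀)) := by
    field_simp
  rw [hu]
  push_cast
  ring

end

/-- The coefficient of the modified Hamiltonian in its derivative along the system. -/
noncomputable def rateM (g D3 z u : ℂ) : ℂ :=
  -(1 / 2) * u + (-D3 + 9 / 2 * z) * u ^ 2 - 7 * g * u ^ 4

/-- The part of the derivative of the modified Hamiltonian that does not depend on `w = x / y²`. -/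
noncomputable def rateN₀ (a₀ c g k k' a₁ a₃ D3 z u : ℂ) : ℂ :=
  (-(1 / 9) * D3 * a₃ * z - 1 / 6 * D3 * c + 1 / 6 * D3 * z ^ 3 + 1 / 2 * a₃ * z ^ 2
    + 3 / 4 * c * z - 3 * g * z - 3 / 4 * z ^ 4)
  + u * (-(2 / 3) * D3 * a₁ + 3 * a₁ * z - 4 / 3 * a₃ * g + k')
  + u ^ 2 * (a₀ * k - 5 / 3 * a₃ * g * z - 5 / 2 * c * g + 5 / 2 * g * z ^ 3 + 1 / 2 * k)
  + u ^ 3 * (D3 * k - 6 * a₁ * g - 9 / 2 * k * z) + u ^ 5 * (7 * g * k)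

/-- The coefficient of `w = x / y²` in the derivative of the modified Hamiltonian. -/
noncomputable def rateN₁ (a₀ g g' D3 z u : ℂ) : ℂ :=
  (2 / 3 * D3 - 2 / 3 * D3 * a₀ + 3 * a₀ * z - 3 * z)
  + u * (-3 * D3 * z + 1 / 3 * D3 ^ 2 + g' + 27 / 4 * z ^ 2) + u ^ 2 * (-4 * a₀ * g + 4 * g)
  + u ^ 3 * (10 / 3 * D3 * g - 15 * g * z) + u ^ 5 * (7 * g ^ 2)

/-- The polynomial identity behind the growth estimate for the modified Hamiltonian. -/
theorem rate_identity (a₀ c g g' k k' a₁ a₃ D1 D3 E3 A z x y : ℂ) (hy : y ≠ 0)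
    (hA : A = 3 * z - 2 / 3 * D3) (hg : g = -D1 + a₃ * z / 6 + c / 4 - z ^ 3 / 4)
    (hk : k = -(5 / 4) + E3 / 3 - a₀ / 2) :
    -(y ^ 4 + D3 / 3 * y ^ 3 + (2 / 3 * a₃ + 2 / 3 * z * D3 - 3 * z ^ 2) / 2 * y ^ 2 + D1 * y)
      + ((5 / 2 * y ^ 4 - 1 / 2 * x ^ 2 + 4 * z * y ^ 3 + a₃ * y ^ 2
        + (c + 2 * z / 3 * a₃ - z ^ 3) * y + a₁) * (1 / 2 - A / 2 * y⁻¹ + g * y⁻¹ ^ 3)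
        + x * (-(3 - 2 / 3 * E3) / 2 * y⁻¹ + A / 2 * y⁻¹ ^ 2 * (x * y - a₀)
          + g' * y⁻¹ ^ 3 - 3 * g * y⁻¹ ^ 4 * (x * y - a₀))
        + k' * y⁻¹ - k * y⁻¹ ^ 2 * (x * y - a₀)) =
    rateM g D3 z y⁻¹ * (1 / 2 * x ^ 2 * y - 1 / 2 * y ^ 5 - z * y ^ 4 - a₃ / 3 * y ^ 3
        - (c + 2 * z / 3 * a₃ - z ^ 3) / 2 * y ^ 2 - a₁ * y - a₀ * x
        + (x * (1 / 2 - A / 2 * y⁻¹ + g * y⁻¹ ^ 3) + k * y⁻¹))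
      + (rateN₀ a₀ c g k k' a₁ a₃ D3 z y⁻¹ + x * y⁻¹ ^ 2 * rateN₁ a₀ g g' D3 z y⁻¹) := by
  have hD1 : D1 = -g + a₃ * z / 6 + c / 4 - z ^ 3 / 4 := by rw [hg]; ring
  have hE3 : E3 = 3 * (k + 5 / 4 + a₀ / 2) := by rw [hk]; ring
  rw [hA, hD1, hE3]
  unfold rateM rateN₀ rateN₁
  clear hA hg hk hD1 hE3
  field_simp
  ring

/-! ### Growth of the modified Hamiltonian -/

section

variable {a₀ c : ℂ} {α₁ α₃ Z X Y : ℂ → ℂ} {t z₀ : ℂ}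

/-- The Hamiltonian with the added terms, for large `y`. -/
noncomputable def outerEnergy (a₀ c : ℂ) (α₁ α₃ : ℂ → ℂ) (z : ℂ) (p : ℂ × ℂ) : ℂ :=
  hamiltonian (normalised a₀ c α₁ α₃) z p + outerTerm a₀ c α₁ α₃ z p

theorem Tangent.outerEnergy (h : Tangent a₀ c α₁ α₃ Z X Y t) (hy : Y t ≠ 0) :
    HasDerivAt (fun s => outerEnergy a₀ c α₁ α₃ (Z s) (X s, Y s))
      (rateM (gCoeff c α₁ α₃ (Z t)) (deriv α₃ (Z t)) (Z t) (Y t)⁻¹ *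
          outerEnergy a₀ c α₁ α₃ (Z t) (X t, Y t)
        + (rateN₀ a₀ c (gCoeff c α₁ α₃ (Z t)) (kCoeff a₀ α₃ (Z t)) (deriv (kCoeff a₀ α₃) (Z t))
            (α₁ (Z t)) (α₃ (Z t)) (deriv α₃ (Z t)) (Z t) (Y t)⁻¹
          + X t * (Y t)⁻¹ ^ 2 * rateN₁ a₀ (gCoeff c α₁ α₃ (Z t)) (deriv (gCoeff c α₁ α₃) (Z t))
            (deriv α₃ (Z t)) (Z t) (Y t)⁻¹)) t := by
  refine (h.hamiltonian.add (h.outerTerm hy)).congr_deriv ?_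
  refine (rate_identity a₀ c (gCoeff c α₁ α₃ (Z t)) (deriv (gCoeff c α₁ α₃) (Z t))
    (kCoeff a₀ α₃ (Z t)) (deriv (kCoeff a₀ α₃) (Z t)) (α₁ (Z t)) (α₃ (Z t)) (deriv α₁ (Z t))
    (deriv α₃ (Z t)) (deriv (deriv α₃) (Z t)) (auxCoeff α₃ (Z t)) (Z t) (X t) (Y t) hy rfl rfl
    rfl).trans ?_
  simp only [QP4.outerEnergy, hamiltonian_normalised, QP4.outerTerm]

/-- For large `y` the quantity `w = x / y²` is controlled by any energy that differs from the
Hamiltonian by a term linear in `x` with bounded coefficients. -/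
theorem exists_ratio_bound (h1 : AnalyticAt ℂ α₁ z₀) (h3 : AnalyticAt ℂ α₃ z₀) (a₀ c : ℂ) (T : ℝ) :
    ∃ C : ℝ, 0 < C ∧ ∀ᶠ z in 𝓝 z₀, ∀ x y θ κ : ℂ, 1 ≤ ‖y‖ → ‖θ‖ ≤ T → ‖κ‖ ≤ T →
      ‖x * y⁻¹ ^ 2‖ ^ 2 ≤ C * (1 + ‖x * y⁻¹ ^ 2‖ + ‖y⁻¹‖ ^ 5 *
        ‖hamiltonian (normalised a₀ c α₁ α₃) z (x, y) + (x * θ + κ)‖) ∧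
      ‖x * y⁻¹ ^ 2‖ ≤ C * (1 + ‖y⁻¹‖ ^ 5 *
        ‖hamiltonian (normalised a₀ c α₁ α₃) z (x, y) + (x * θ + κ)‖) := by
  obtain ⟨M, hM, hMz⟩ := exists_bound_of_continuousAt (z₀ := z₀) (F := fun z u =>
    1 / 2 + z * u + α₃ z / 3 * u ^ 2 + (c + 2 * z / 3 * α₃ z - z ^ 3) / 2 * u ^ 3 + α₁ z * u ^ 4)
    (fun u => by
      have h1' : ContinuousAt α₁ (z₀, u).1 := h1.continuousAt
      have h3' : ContinuousAt α₃ (z₀, u).1 := h3.continuousAt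
      fun_prop) 1
  refine ⟨2 * (M + |T| + ‖a₀‖ + 1) + 1, by positivity, hMz.mono fun z hz x y θ κ hy hθ hκ => ?_⟩
  have hy0 : y ≠ 0 := fun h => by rw [h, norm_zero] at hy; linarith
  have hu : ‖y⁻¹‖ ≤ 1 := by rw [norm_inv]; exact inv_le_one_of_one_le₀ hy
  have hB := hz y⁻¹ hu
  set E := hamiltonian (normalised a₀ c α₁ α₃) z (x, y) + (x * θ + κ) with hE
  set w := x * y⁻¹ ^ 2 with hw
  set B := 1 / 2 + z * y⁻¹ + α₃ z / 3 * y⁻¹ ^ 2 + (c + 2 * z / 3 * α₃ z - z ^ 3) / 2 * y⁻¹ ^ 3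
    + α₁ z * y⁻¹ ^ 4 with hBdef
  have hid : w ^ 2 = 2 * (y⁻¹ ^ 5 * E + B + w * (y⁻¹ ^ 3 * (a₀ - θ)) - y⁻¹ ^ 5 * κ) := by
    rw [hw, hE, hBdef, hamiltonian_normalised]
    field_simp
    ring
  have hT : ‖θ‖ ≤ |T| := hθ.trans (le_abs_self T)
  have hT' : ‖κ‖ ≤ |T| := hκ.trans (le_abs_self T)
  have h5 : ‖w‖ ^ 2 ≤ 2 * (‖y⁻¹‖ ^ 5 * ‖E‖ + M + ‖w‖ * (‖a₀‖ + |T|) + |T|) := by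
    have e1 : ‖w‖ ^ 2 = ‖w ^ 2‖ := (norm_pow w 2).symm
    rw [e1, hid, norm_mul, Complex.norm_ofNat]
    have e2 : ‖w * (y⁻¹ ^ 3 * (a₀ - θ))‖ ≤ ‖w‖ * (‖a₀‖ + |T|) := by
      rw [norm_mul]
      have e3 : ‖a₀ - θ‖ ≤ ‖a₀‖ + |T| := (norm_sub_le _ _).trans (by linarith)
      have e4 : ‖y⁻¹‖ ^ 3 * ‖a₀ - θ‖ ≤ 1 * (‖a₀‖ + |T|) :=
        mul_le_mul (pow_le_one₀ (norm_nonneg _) hu) e3 (norm_nonneg _) zero_le_one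
      rw [one_mul] at e4
      refine mul_le_mul_of_nonneg_left ?_ (norm_nonneg w)
      rwa [norm_mul, norm_pow]
    have e5 : ‖y⁻¹ ^ 5 * κ‖ ≤ |T| := by
      rw [norm_mul, norm_pow]
      have e4 : ‖y⁻¹‖ ^ 5 * ‖κ‖ ≤ 1 * |T| :=
        mul_le_mul (pow_le_one₀ (norm_nonneg _) hu) hT' (norm_nonneg _) zero_le_one
      rwa [one_mul] at e4
    have e6 : ‖y⁻¹ ^ 5 * E‖ = ‖y⁻¹‖ ^ 5 * ‖E‖ := by rw [norm_mul, norm_pow]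
    have e7 := norm_sub_le (y⁻¹ ^ 5 * E + B + w * (y⁻¹ ^ 3 * (a₀ - θ))) (y⁻¹ ^ 5 * κ)
    have e8 := norm_add₃_le (a := y⁻¹ ^ 5 * E) (b := B) (c := w * (y⁻¹ ^ 3 * (a₀ - θ)))
    rw [e6] at e8
    linarith
  have hE0 : 0 ≤ ‖y⁻¹‖ ^ 5 * ‖E‖ := by positivity
  have hw0 := norm_nonneg w
  have hT0 := abs_nonneg T
  have ha0 := norm_nonneg a₀
  constructor
  · nlinarith [mul_nonneg hw0 hM.le, mul_nonneg hE0 hM.le, mul_nonneg hE0 hT0, mul_nonneg hE0 ha0]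
  · rcases le_or_gt ‖w‖ 1 with h6 | h6
    · nlinarith [mul_nonneg hE0 hM.le, mul_nonneg hE0 hT0, mul_nonneg hE0 ha0]
    · have h7 : ‖w‖ * ‖w‖ ≤ (2 * (‖y⁻¹‖ ^ 5 * ‖E‖ + M + (‖a₀‖ + |T|) + |T|)) * ‖w‖ := by
        nlinarith [mul_nonneg hE0 hM.le]
      have h8 := le_of_mul_le_mul_right h7 (by linarith)
      nlinarith [mul_nonneg hE0 hM.le, mul_nonneg hE0 hT0, mul_nonneg hE0 ha0]

/-- Uniform bounds for the coefficients of the modified Hamiltonian. -/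
theorem exists_coeff_bound (h1 : AnalyticAt ℂ α₁ z₀) (h3 : AnalyticAt ℂ α₃ z₀) (a₀ c : ℂ) :
    ∃ M : ℝ, 1 ≤ M ∧ ∀ᶠ z in 𝓝 z₀, ‖auxCoeff α₃ z‖ ≤ M ∧ ‖gCoeff c α₁ α₃ z‖ ≤ M ∧
      ‖kCoeff a₀ α₃ z‖ ≤ M ∧ ‖deriv (gCoeff c α₁ α₃) z‖ ≤ M ∧ ‖deriv (kCoeff a₀ α₃) z‖ ≤ M ∧
      ‖deriv (deriv α₃) z‖ ≤ M ∧ ‖a₀‖ ≤ M := by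
  have hb : ∀ f : ℂ → ℂ, AnalyticAt ℂ f z₀ → ∃ M : ℝ, ∀ᶠ z in 𝓝 z₀, ‖f z‖ ≤ M := fun f hf =>
    ⟨_, (hf.continuousAt.norm.eventually_lt continuousAt_const (lt_add_one _)).mono fun _ h => h.le⟩
  have hg := analyticAt_gCoeff h1 h3 c
  have hk := analyticAt_kCoeff h3 a₀
  obtain ⟨m1, e1⟩ := hb _ (analyticAt_auxCoeff h3)
  obtain ⟨m2, e2⟩ := hb _ hg
  obtain ⟨m3, e3⟩ := hb _ hk
  obtain ⟨m4, e4⟩ := hb _ hg.deriv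
  obtain ⟨m5, e5⟩ := hb _ hk.deriv
  obtain ⟨m6, e6⟩ := hb _ h3.deriv.deriv
  refine ⟨1 + |m1| + |m2| + |m3| + |m4| + |m5| + |m6| + ‖a₀‖, ?_, ?_⟩
  · have := norm_nonneg a₀
    linarith [abs_nonneg m1, abs_nonneg m2, abs_nonneg m3, abs_nonneg m4, abs_nonneg m5,
      abs_nonneg m6]
  · filter_upwards [e1, e2, e3, e4, e5, e6] with z f1 f2 f3 f4 f5 f6
    have := norm_nonneg a₀
    refine ⟨?_, ?_, ?_, ?_, ?_, ?_, ?_⟩ <;>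
    linarith [abs_nonneg m1, abs_nonneg m2, abs_nonneg m3, abs_nonneg m4, abs_nonneg m5,
      abs_nonneg m6, le_abs_self m1, le_abs_self m2, le_abs_self m3, le_abs_self m4, le_abs_self m5,
      le_abs_self m6]

/-- For large `y` the modified Hamiltonian grows at most exponentially along solutions. -/
theorem exists_outer_growth (h1 : AnalyticAt ℂ α₁ z₀) (h3 : AnalyticAt ℂ α₃ z₀) (a₀ c : ℂ) :
    ∃ C : ℝ, 0 < C ∧ ∀ᶠ z in 𝓝 z₀, ∀ x y : ℂ, 1 ≤ ‖y‖ →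
      ‖rateM (gCoeff c α₁ α₃ z) (deriv α₃ z) z y⁻¹ * outerEnergy a₀ c α₁ α₃ z (x, y)
        + (rateN₀ a₀ c (gCoeff c α₁ α₃ z) (kCoeff a₀ α₃ z) (deriv (kCoeff a₀ α₃) z)
            (α₁ z) (α₃ z) (deriv α₃ z) z y⁻¹
          + x * y⁻¹ ^ 2 * rateN₁ a₀ (gCoeff c α₁ α₃ z) (deriv (gCoeff c α₁ α₃) z)
            (deriv α₃ z) z y⁻¹)‖ ≤ C * (1 + ‖outerEnergy a₀ c α₁ α₃ z (x, y)‖) := by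
  have hg := analyticAt_gCoeff h1 h3 c
  have hk := analyticAt_kCoeff h3 a₀
  have cont : ∀ {f : ℂ → ℂ} (u : ℂ), AnalyticAt ℂ f z₀ → ContinuousAt f (z₀, u).1 :=
    fun _ hf => hf.continuousAt
  obtain ⟨M₁, hM₁, e1⟩ := exists_bound_of_continuousAt (z₀ := z₀) (F := fun z u =>
    rateM (gCoeff c α₁ α₃ z) (deriv α₃ z) z u) (fun u => by
      have := cont u hg; have := cont u h3.deriv
      unfold rateM; fun_prop) 1
  obtain ⟨M₂, hM₂, e2⟩ := exists_bound_of_continuousAt (z₀ := z₀) (F := fun z u =>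
    rateN₀ a₀ c (gCoeff c α₁ α₃ z) (kCoeff a₀ α₃ z) (deriv (kCoeff a₀ α₃) z)
            (α₁ z) (α₃ z) (deriv α₃ z) z u) (fun u => by
      have := cont u hg; have := cont u h3.deriv; have := cont u hk; have := cont u hk.deriv
      have := cont u h1; have := cont u h3
      unfold rateN₀; fun_prop) 1
  obtain ⟨M₃, hM₃, e3⟩ := exists_bound_of_continuousAt (z₀ := z₀) (F := fun z u =>
    rateN₁ a₀ (gCoeff c α₁ α₃ z) (deriv (gCoeff c α₁ α₃) z) (deriv α₃ z) z u) (fun u => by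
      have := cont u hg; have := cont u h3.deriv; have := cont u hg.deriv
      unfold rateN₁; fun_prop) 1
  obtain ⟨M, hM, e4⟩ := exists_coeff_bound h1 h3 a₀ c
  obtain ⟨C, hC, e5⟩ := exists_ratio_bound h1 h3 a₀ c (1 / 2 + M / 2 + M)
  refine ⟨M₁ + M₂ + C * M₃, by positivity, ?_⟩
  filter_upwards [e1, e2, e3, e4, e5] with z f1 f2 f3 f4 f5 x y hy
  obtain ⟨g1, g2, g3, -⟩ := f4
  have hu : ‖y⁻¹‖ ≤ 1 := by rw [norm_inv]; exact inv_le_one_of_one_le₀ hy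
  have hu0 := norm_nonneg y⁻¹
  have hθ : ‖(1 / 2 - auxCoeff α₃ z / 2 * y⁻¹ + gCoeff c α₁ α₃ z * y⁻¹ ^ 3)‖ ≤ 1 / 2 + M / 2 + M := by
    refine (norm_add_le _ _).trans (add_le_add ((norm_sub_le _ _).trans (add_le_add ?_ ?_)) ?_)
    · norm_num
    · rw [norm_mul, norm_div, Complex.norm_ofNat]
      nlinarith [norm_nonneg (auxCoeff α₃ z)]
    · rw [norm_mul, norm_pow]
      have := pow_le_one₀ (n := 3) hu0 hu
      nlinarith [norm_nonneg (gCoeff c α₁ α₃ z)]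
  have hκ : ‖kCoeff a₀ α₃ z * y⁻¹‖ ≤ 1 / 2 + M / 2 + M := by
    rw [norm_mul]
    nlinarith [norm_nonneg (kCoeff a₀ α₃ z)]
  have h7 := (f5 x y _ _ hy hθ hκ).2
  change ‖x * y⁻¹ ^ 2‖ ≤ C * (1 + ‖y⁻¹‖ ^ 5 * ‖outerEnergy a₀ c α₁ α₃ z (x, y)‖) at h7
  set G := outerEnergy a₀ c α₁ α₃ z (x, y)
  have h8 : ‖x * y⁻¹ ^ 2‖ ≤ C * (1 + ‖G‖) := by
    refine h7.trans ?_
    have := pow_le_one₀ (n := 5) hu0 hu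
    gcongr
    nlinarith [norm_nonneg G]
  refine (norm_add_le _ _).trans ?_
  refine (add_le_add (norm_mul_le _ _) (norm_add_le _ _)).trans ?_
  have k1 := f1 _ hu
  have k2 := f2 _ hu
  have k3 := f3 _ hu
  have k4 : ‖x * y⁻¹ ^ 2 * rateN₁ a₀ (gCoeff c α₁ α₃ z) (deriv (gCoeff c α₁ α₃) z)
            (deriv α₃ z) z y⁻¹‖ ≤ C * (1 + ‖G‖) * M₃ := by
    rw [norm_mul]
    exact mul_le_mul h8 k3 (norm_nonneg _) (by positivity)
  have k5 := mul_le_mul_of_nonneg_right k1 (norm_nonneg G)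
  have hG := norm_nonneg G
  nlinarith [mul_nonneg hM₂.le hG]

end

section

variable {a₀ c : ℂ} {α₁ α₃ Z X Y : ℂ → ℂ} {t z₀ : ℂ}

/-- The modified Hamiltonian: the added terms are switched off, by a smooth cut-off, where `y` is
small. It is not holomorphic. -/
noncomputable def modifiedEnergy (a₀ c : ℂ) (α₁ α₃ : ℂ → ℂ) (z : ℂ) (p : ℂ × ℂ) : ℂ :=
  hamiltonian (normalised a₀ c α₁ α₃) z p
    + (Real.smoothTransition (‖p.2‖ ^ 2 - 1) : ℂ) * outerTerm a₀ c α₁ α₃ z p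

theorem modifiedEnergy_of_norm_le {z : ℂ} {p : ℂ × ℂ} (h : ‖p.2‖ ^ 2 ≤ 1) :
    modifiedEnergy a₀ c α₁ α₃ z p = hamiltonian (normalised a₀ c α₁ α₃) z p := by
  rw [modifiedEnergy, Real.smoothTransition.zero_of_nonpos (by linarith)]
  simp

theorem modifiedEnergy_of_le_norm {z : ℂ} {p : ℂ × ℂ} (h : 2 ≤ ‖p.2‖ ^ 2) :
    modifiedEnergy a₀ c α₁ α₃ z p = outerEnergy a₀ c α₁ α₃ z p := by
  rw [modifiedEnergy, Real.smoothTransition.one_of_one_le (by linarith)]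
  simp [outerEnergy]

theorem norm_outer_coeff_le {A g u : ℂ} {M : ℝ} (hM : 1 ≤ M) (hA : ‖A‖ ≤ M) (hg : ‖g‖ ≤ M)
    (hu : ‖u‖ ≤ 1) : ‖1 / 2 - A / 2 * u + g * u ^ 3‖ ≤ 2 * M := by
  have hu0 := norm_nonneg u
  have h1 : ‖(1 / 2 : ℂ)‖ = 1 / 2 := by norm_num
  have h2 : ‖A / 2 * u‖ ≤ M / 2 := by
    rw [norm_mul, norm_div, Complex.norm_ofNat]
    nlinarith [norm_nonneg A]
  have h3 : ‖g * u ^ 3‖ ≤ M := by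
    rw [norm_mul, norm_pow]
    have := pow_le_one₀ (n := 3) hu0 hu
    nlinarith [norm_nonneg g]
  have h4 := norm_add_le (1 / 2 - A / 2 * u) (g * u ^ 3)
  have h5 := norm_sub_le (1 / 2) (A / 2 * u)
  linarith

/-- A solution of a quadratic inequality, with `r = |x|` and `E` the size of the energy. -/
theorem sq_le_of_quadratic {r E M : ℝ} (hM : 1 ≤ M) (hE : 0 ≤ E)
    (h : 1 / 2 * r ^ 2 ≤ E + M * r + 3 * M * (1 + r) + M) :
    (1 + r) ^ 2 ≤ 170 * M ^ 2 * (1 + E) := by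
  have h1 : r ^ 2 ≤ 4 * E + 64 * M ^ 2 + 16 * M := by nlinarith [sq_nonneg (r - 8 * M)]
  have h2 : (1 + r) ^ 2 ≤ 2 + 2 * r ^ 2 := by nlinarith [sq_nonneg (r - 1)]
  have h3 : M ≤ M ^ 2 := by nlinarith
  have h4 : 1 * E ≤ M ^ 2 * E := mul_le_mul_of_nonneg_right (by linarith) hE
  nlinarith

/-- A bound, quadratic in `x`, for the derivative along the system of the terms added to the
Hamiltonian; here `u` stands for `1 / y` and `F` for the part of `x'` that does not depend on
`x`. -/
theorem norm_deriv_outerTerm_le {A g k g' k' E a₀ F x y u : ℂ} {M : ℝ} (hM : 1 ≤ M) (hA : ‖A‖ ≤ M)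
    (hg : ‖g‖ ≤ M) (hk : ‖k‖ ≤ M) (hg' : ‖g'‖ ≤ M) (hk' : ‖k'‖ ≤ M) (hE : ‖E‖ ≤ M) (hF : ‖F‖ ≤ M)
    (hu : ‖u‖ ≤ 1) (hy' : ‖x * y - a₀‖ ≤ 3 * M * (1 + ‖x‖)) :
    ‖(F - 1 / 2 * x ^ 2) * (1 / 2 - A / 2 * u + g * u ^ 3)
        + x * (-(3 - 2 / 3 * E) / 2 * u + A / 2 * u ^ 2 * (x * y - a₀) + g' * u ^ 3
          - 3 * g * u ^ 4 * (x * y - a₀))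
        + k' * u - k * u ^ 2 * (x * y - a₀)‖ ≤ 22 * M ^ 2 * (1 + ‖x‖) ^ 2 := by
  have hu0 := norm_nonneg u
  have hup : ∀ n, ‖u ^ n‖ ≤ 1 := fun n => by rw [norm_pow]; exact pow_le_one₀ hu0 hu
  have hQ := norm_outer_coeff_le hM hA hg hu
  have hr0 : 0 ≤ ‖x‖ := norm_nonneg x
  have hM2 : M ≤ M ^ 2 := by nlinarith
  have hin : ‖-(3 - 2 / 3 * E) / 2 * u + A / 2 * u ^ 2 * (x * y - a₀) + g' * u ^ 3
          - 3 * g * u ^ 4 * (x * y - a₀)‖ ≤ 14 * M ^ 2 * (1 + ‖x‖) := by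
    have k1 : ‖-(3 - 2 / 3 * E) / 2 * u‖ ≤ 2 * M := by
      rw [norm_mul, norm_div, norm_neg, Complex.norm_ofNat]
      have h6 := norm_sub_le 3 (2 / 3 * E)
      rw [norm_mul, norm_div, Complex.norm_ofNat, Complex.norm_ofNat] at h6
      have h7 : ‖3 - 2 / 3 * E‖ / 2 ≤ 2 * M := by linarith
      exact (mul_le_of_le_one_right (by positivity) hu).trans h7
    have k2 : ‖A / 2 * u ^ 2 * (x * y - a₀)‖ ≤ (M / 2 * 1) * (3 * M * (1 + ‖x‖)) := by
      rw [norm_mul, norm_mul, norm_div, Complex.norm_ofNat]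
      have := hup 2
      gcongr
    have k3 : ‖g' * u ^ 3‖ ≤ M * 1 := by
      rw [norm_mul]
      have := hup 3
      gcongr
    have k4 : ‖3 * g * u ^ 4 * (x * y - a₀)‖ ≤ (3 * M * 1) * (3 * M * (1 + ‖x‖)) := by
      rw [norm_mul, norm_mul, norm_mul, Complex.norm_ofNat]
      have := hup 4
      gcongr
    refine (norm_sub_le _ _).trans ?_
    have k5 := norm_add₃_le (a := -(3 - 2 / 3 * E) / 2 * u)
      (b := A / 2 * u ^ 2 * (x * y - a₀)) (c := g' * u ^ 3)
    have h1 : 0 ≤ M ^ 2 * ‖x‖ := by positivity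
    generalize hR : ‖x‖ = R at *
    nlinarith
  have k1 : ‖F - 1 / 2 * x ^ 2‖ ≤ 2 * M * (1 + ‖x‖) ^ 2 := by
    have h6 := norm_sub_le F (1 / 2 * x ^ 2)
    have h9 : ‖1 / 2 * x ^ 2‖ = 1 / 2 * ‖x‖ ^ 2 := by rw [norm_mul, norm_pow]; norm_num
    rw [h9] at h6
    have h1 : 0 ≤ M * ‖x‖ := by positivity
    have h2 : 1 * ‖x‖ ^ 2 ≤ M * ‖x‖ ^ 2 := mul_le_mul_of_nonneg_right hM (by positivity)
    nlinarith
  have k2 := mul_le_mul k1 hQ (norm_nonneg _) (by positivity)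
  rw [← norm_mul] at k2
  have k3 := mul_le_mul_of_nonneg_left hin hr0
  rw [← norm_mul] at k3
  have k4 : ‖k' * u‖ ≤ M * 1 := by
    rw [norm_mul]
    gcongr
  have k5 : ‖k * u ^ 2 * (x * y - a₀)‖ ≤ (M * 1) * (3 * M * (1 + ‖x‖)) := by
    rw [norm_mul, norm_mul]
    have := hup 2
    gcongr
  refine (norm_sub_le _ _).trans ?_
  refine (add_le_add (norm_add₃_le) le_rfl).trans ?_
  refine (add_le_add (add_le_add (add_le_add k2 k3) k4) k5).trans ?_
  have h1 : 0 ≤ M ^ 2 * ‖x‖ := by positivity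
  have h2 : 0 ≤ M ^ 2 * ‖x‖ ^ 2 := by positivity
  nlinarith

set_option maxHeartbeats 1000000 in
/-- The modified Hamiltonian grows at most exponentially along solutions. -/
theorem exists_modified_growth (h1 : AnalyticAt ℂ α₁ z₀) (h3 : AnalyticAt ℂ α₃ z₀) (a₀ c : ℂ) :
    ∃ K : ℝ, 0 < K ∧ ∀ᶠ z in 𝓝 z₀, ∀ (Z X Y : ℂ → ℂ) (ζ : ℝ → ℂ) (s : ℝ) (e : ℂ),
      Tangent a₀ c α₁ α₃ Z X Y (ζ s) → Z (ζ s) = z → HasDerivAt ζ e s →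
      ∃ D : ℂ, HasDerivAt (fun s => modifiedEnergy a₀ c α₁ α₃ (Z (ζ s)) (X (ζ s), Y (ζ s))) D s ∧
        ‖D‖ ≤ K * (1 + ‖modifiedEnergy a₀ c α₁ α₃ z (X (ζ s), Y (ζ s))‖) * ‖e‖ := by
  have cont : ∀ {f : ℂ → ℂ} (u : ℂ), AnalyticAt ℂ f z₀ → ContinuousAt f (z₀, u).1 :=
    fun _ hf => hf.continuousAt
  obtain ⟨M₁, hM₁, e1⟩ := exists_bound_of_continuousAt (z₀ := z₀) (F := fun z y =>
    -(y ^ 4 + deriv α₃ z / 3 * y ^ 3 + (2 / 3 * α₃ z + 2 / 3 * z * deriv α₃ z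
        - 3 * z ^ 2) / 2 * y ^ 2 + deriv α₁ z * y)) (fun u => by
      have := cont u h3; have := cont u h3.deriv; have := cont u h1.deriv
      fun_prop) 2
  obtain ⟨M₂, hM₂, e2⟩ := exists_bound_of_continuousAt (z₀ := z₀) (F := fun z y =>
    5 / 2 * y ^ 4 + 4 * z * y ^ 3 + α₃ z * y ^ 2
        + (c + 2 * z / 3 * α₃ z - z ^ 3) * y + α₁ z) (fun u => by
      have := cont u h3; have := cont u h1
      fun_prop) 2
  obtain ⟨M₃, hM₃, e3⟩ := exists_bound_of_continuousAt (z₀ := z₀) (F := fun z y =>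
    1 / 2 * y ^ 5 + z * y ^ 4 + α₃ z / 3 * y ^ 3
        + (c + 2 * z / 3 * α₃ z - z ^ 3) / 2 * y ^ 2 + α₁ z * y) (fun u => by
      have := cont u h3; have := cont u h1
      fun_prop) 2
  obtain ⟨M₄, hM₄, e4⟩ := exists_coeff_bound h1 h3 a₀ c
  obtain ⟨C, hC, e5⟩ := exists_outer_growth h1 h3 a₀ c
  obtain ⟨Cχ, hCχ⟩ : ∃ Cχ : ℝ, ∀ s ∈ Icc (0 : ℝ) 1, ‖deriv Real.smoothTransition s‖ ≤ Cχ :=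
    isCompact_Icc.exists_bound_of_continuousOn
      ((Real.smoothTransition.contDiff (n := 1)).continuous_deriv le_rfl).continuousOn
  set M : ℝ := M₁ + M₂ + M₃ + M₄ with hMdef
  have hM : 1 ≤ M := by linarith
  have hCχ0 : 0 ≤ Cχ := (norm_nonneg _).trans (hCχ 0 (by simp))
  set K₂ : ℝ := (M + 36 * Cχ * M ^ 2 + 22 * M ^ 2) * (170 * M ^ 2) with hK₂
  have hK₂0 : 0 < K₂ := by positivity
  refine ⟨M + C + K₂, by positivity, ?_⟩
  filter_upwards [e1, e2, e3, e4, e5] with z f1 f2 f3 f4 f5 Z X Y ζ s e hT hz hζ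
  obtain ⟨g1, g2, g3, g4, g5, g6, g7⟩ := f4
  have hH := hT.hamiltonian.scomp s hζ
  have hYc := (hT.dY.scomp s hζ)
  have hYcont : ContinuousAt (fun s => ‖Y (ζ s)‖ ^ 2) s := hYc.continuousAt.norm.pow 2
  have he := norm_nonneg e
  rw [hz] at hH
  set x := X (ζ s) with hx
  set y := Y (ζ s) with hy
  have hE0 := norm_nonneg (modifiedEnergy a₀ c α₁ α₃ z (x, y))
  -- for small `y`, the Hamiltonian has a bounded derivative
  rcases lt_or_ge (‖y‖ ^ 2) 1 with hlt | hge
  · refine ⟨_, hH.congr_of_eventuallyEq ?_, ?_⟩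
    · filter_upwards [hYcont.eventually_lt continuousAt_const hlt] with s' hs'
      exact modifiedEnergy_of_norm_le hs'.le
    · have hy1 : ‖y‖ ≤ 2 := (abs_le_of_sq_le_sq' (by linarith) (by norm_num)).2
      have h5 := f1 y hy1
      rw [norm_smul, mul_comm]
      refine mul_le_mul_of_nonneg_right ?_ he
      have : 0 ≤ (M + C + K₂) * ‖modifiedEnergy a₀ c α₁ α₃ z (x, y)‖ := by positivity
      refine h5.trans ?_
      rw [mul_add, mul_one]
      linarith
  -- for large `y`, all added terms are present
  rcases lt_or_ge 2 (‖y‖ ^ 2) with hgt | hle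
  · have hy1 : 1 ≤ ‖y‖ := (one_le_sq_iff₀ (norm_nonneg y)).1 (by linarith)
    have hy0 : y ≠ 0 := fun h => by rw [h, norm_zero] at hy1; linarith
    have hG := (hT.outerEnergy hy0).scomp s hζ
    rw [hz] at hG
    refine ⟨_, hG.congr_of_eventuallyEq ?_, ?_⟩
    · filter_upwards [continuousAt_const.eventually_lt hYcont hgt] with s' hs'
      exact modifiedEnergy_of_le_norm hs'.le
    · have h5 := f5 x y hy1
      rw [← modifiedEnergy_of_le_norm (p := (x, y)) hgt.le] at h5 ⊢
      rw [norm_smul, mul_comm]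
      refine mul_le_mul_of_nonneg_right (h5.trans ?_) he
      exact mul_le_mul_of_nonneg_right (by linarith) (by positivity)
  -- the annulus, where the cut-off varies
  have hy1 : 1 ≤ ‖y‖ := (one_le_sq_iff₀ (norm_nonneg y)).1 (by linarith)
  have hy2 : ‖y‖ ≤ 2 := (abs_le_of_sq_le_sq' (by linarith) (by norm_num)).2
  have hy0 : y ≠ 0 := fun h => by rw [h, norm_zero] at hy1; linarith
  have hΦ := (hT.outerTerm hy0).scomp s hζ
  have hχ : HasDerivAt (fun s => Real.smoothTransition (‖Y (ζ s)‖ ^ 2 - 1))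
      (deriv Real.smoothTransition (‖y‖ ^ 2 - 1) * (2 * inner ℝ y (e • (field
        (normalised a₀ c α₁ α₃) (Z (ζ s)) (x, y)).2))) s := by
    have h6 : HasDerivAt Real.smoothTransition (deriv Real.smoothTransition (‖y‖ ^ 2 - 1))
        (‖y‖ ^ 2 - 1) :=
      ((Real.smoothTransition.contDiff (n := 1)).differentiable one_ne_zero _).hasDerivAt
    exact h6.comp s (hYc.norm_sq.sub_const 1)
  rw [hz] at hΦ hχ
  have hD := hH.add (hχ.ofReal_comp.mul hΦ)
  refine ⟨_, hD, ?_⟩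
  simp only [Function.comp_apply, hz, ← hx, ← hy]
  -- all terms are bounded by multiples of `(1 + |x|)²`
  set r := ‖x‖ with hr
  have hr0 : 0 ≤ r := norm_nonneg x
  have hu : ‖y⁻¹‖ ≤ 1 := by rw [norm_inv]; exact inv_le_one_of_one_le₀ hy1
  have hu0 := norm_nonneg y⁻¹
  have hup : ∀ n, ‖y⁻¹ ^ n‖ ≤ 1 := fun n => by rw [norm_pow]; exact pow_le_one₀ hu0 hu
  have hQ := norm_outer_coeff_le (u := y⁻¹) hM (A := auxCoeff α₃ z) (g := gCoeff c α₁ α₃ z)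
    (by linarith) (by linarith) hu
  have hky : ‖kCoeff a₀ α₃ z * y⁻¹‖ ≤ M := by
    rw [norm_mul]
    exact (mul_le_of_le_one_right (norm_nonneg _) hu).trans (by linarith)
  have hy' : ‖x * y - a₀‖ ≤ 3 * M * (1 + r) := by
    have h6 := norm_sub_le (x * y) a₀
    rw [norm_mul] at h6
    have h7 : ‖x‖ * ‖y‖ ≤ r * 2 := mul_le_mul_of_nonneg_left hy2 hr0
    have h8 : 1 * r ≤ M * r := mul_le_mul_of_nonneg_right hM hr0
    linarith
  have hΦn : ‖outerTerm a₀ c α₁ α₃ z (x, y)‖ ≤ 3 * M * (1 + r) := by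
    unfold outerTerm
    refine (norm_add_le _ _).trans ?_
    rw [norm_mul]
    simp only
    have h6 : ‖x‖ * ‖1 / 2 - auxCoeff α₃ z / 2 * y⁻¹ + gCoeff c α₁ α₃ z * y⁻¹ ^ 3‖ ≤ r * (2 * M) :=
      mul_le_mul_of_nonneg_left hQ hr0
    have h8 : 0 ≤ M * r := by positivity
    linarith
  -- where `1 ≤ |y| ≤ 2`, the energy is quadratic in `x`
  have hs2 : (1 + r) ^ 2 ≤ 170 * M ^ 2 * (1 + ‖modifiedEnergy a₀ c α₁ α₃ z (x, y)‖) := by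
    set E := modifiedEnergy a₀ c α₁ α₃ z (x, y) with hE
    have h6 := f3 y hy2
    set B := 1 / 2 * y ^ 5 + z * y ^ 4 + α₃ z / 3 * y ^ 3
        + (c + 2 * z / 3 * α₃ z - z ^ 3) / 2 * y ^ 2 + α₁ z * y with hB
    set χ : ℂ := (Real.smoothTransition (‖y‖ ^ 2 - 1) : ℂ) with hχdef
    have hχ1 : ‖χ‖ ≤ 1 := by
      rw [hχdef, Complex.norm_real, Real.norm_of_nonneg (Real.smoothTransition.nonneg _)]
      exact Real.smoothTransition.le_one _
    have hid : 1 / 2 * x ^ 2 * y = E + a₀ * x - χ * outerTerm a₀ c α₁ α₃ z (x, y) + B := by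
      rw [hE, modifiedEnergy, hamiltonian_normalised, hB]
      ring
    have h7 : ‖1 / 2 * x ^ 2 * y‖ ≤ ‖E‖ + M * r + 3 * M * (1 + r) + M := by
      rw [hid]
      refine (norm_add_le _ _).trans (add_le_add ((norm_sub_le _ _).trans (add_le_add
        ((norm_add_le _ _).trans (add_le_add le_rfl ?_)) ?_)) (by linarith))
      · rw [norm_mul]; exact mul_le_mul_of_nonneg_right (by linarith) hr0
      · rw [norm_mul]
        exact (mul_le_mul hχ1 hΦn (norm_nonneg _) zero_le_one).trans_eq (one_mul _)
    have h8 : 1 / 2 * r ^ 2 ≤ ‖1 / 2 * x ^ 2 * y‖ := by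
      rw [norm_mul, norm_mul, norm_pow]
      have : ‖(1 / 2 : ℂ)‖ = 1 / 2 := by norm_num
      rw [this]
      nlinarith [sq_nonneg ‖x‖]
    exact sq_le_of_quadratic hM (norm_nonneg E) (h8.trans h7)
  have hΦ' := norm_deriv_outerTerm_le (u := y⁻¹) (k := kCoeff a₀ α₃ z) hM (g1.trans (by linarith))
    (g2.trans (by linarith)) (g3.trans (by linarith)) (g4.trans (by linarith))
    (g5.trans (by linarith)) (g6.trans (by linarith)) ((f2 y hy2).trans (by linarith)) hu hy'
  have hFeq : 5 / 2 * y ^ 4 - 1 / 2 * x ^ 2 + 4 * z * y ^ 3 + α₃ z * y ^ 2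
        + (c + 2 * z / 3 * α₃ z - z ^ 3) * y + α₁ z = 5 / 2 * y ^ 4 + 4 * z * y ^ 3 + α₃ z * y ^ 2
        + (c + 2 * z / 3 * α₃ z - z ^ 3) * y + α₁ z - 1 / 2 * x ^ 2 := by ring
  rw [← hFeq, ← hr] at hΦ'
  have hfy : (field (normalised a₀ c α₁ α₃) z (x, y)).2 = x * y - a₀ := by rw [field_normalised]
  rw [hfy]
  have hH' := f1 y hy2
  have hχ1 : ‖(Real.smoothTransition (‖y‖ ^ 2 - 1) : ℂ)‖ ≤ 1 := by
    rw [Complex.norm_real, Real.norm_of_nonneg (Real.smoothTransition.nonneg _)]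
    exact Real.smoothTransition.le_one _
  have hχ' : ‖((deriv Real.smoothTransition (‖y‖ ^ 2 - 1) * (2 * inner ℝ y (e • (x * y - a₀))) : ℝ) : ℂ)‖
      ≤ Cχ * (2 * (2 * (‖e‖ * (3 * M * (1 + r))))) := by
    rw [Complex.norm_real, norm_mul, norm_mul, Real.norm_ofNat]
    have h6 := hCχ (‖y‖ ^ 2 - 1) ⟨by linarith, by linarith⟩
    have h7 : ‖inner ℝ y (e • (x * y - a₀))‖ ≤ 2 * (‖e‖ * (3 * M * (1 + r))) := by
      refine (norm_inner_le_norm _ _).trans ?_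
      rw [norm_smul]
      gcongr
    gcongr
  refine (norm_add_le _ _).trans ?_
  refine (add_le_add le_rfl (norm_add_le _ _)).trans ?_
  rw [norm_smul, norm_mul, norm_mul, norm_smul]
  have m1 := mul_le_mul_of_nonneg_left hH' he
  have m2 := mul_le_mul hχ' hΦn (norm_nonneg _) (by positivity)
  have m3 := mul_le_mul hχ1 (mul_le_mul_of_nonneg_left hΦ' he) (by positivity) zero_le_one
  refine (add_le_add m1 (add_le_add m2 m3)).trans ?_
  have m4 : ‖e‖ * M₁ + (Cχ * (2 * (2 * (‖e‖ * (3 * M * (1 + r))))) * (3 * M * (1 + r)) +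
      1 * (‖e‖ * (22 * M ^ 2 * (1 + r) ^ 2))) ≤
      (M + 36 * Cχ * M ^ 2 + 22 * M ^ 2) * (1 + r) ^ 2 * ‖e‖ := by
    have h6 : M₁ ≤ M * (1 + r) ^ 2 := by
      have h8 : M * 1 ≤ M * (1 + r) ^ 2 :=
        mul_le_mul_of_nonneg_left (one_le_pow₀ (by linarith)) (by linarith)
      linarith
    have h7 := mul_le_mul_of_nonneg_left h6 he
    linear_combination h7
  refine m4.trans (mul_le_mul_of_nonneg_right ?_ he)
  have m5 := mul_le_mul_of_nonneg_left hs2 (by positivity :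
    0 ≤ M + 36 * Cχ * M ^ 2 + 22 * M ^ 2)
  refine m5.trans ?_
  rw [← mul_assoc, ← hK₂]
  exact mul_le_mul_of_nonneg_right (by linarith) (by positivity)

end

/-! ### Boundedness along paths of finite length -/

section

variable {a₀ c : ℂ} {α₁ α₃ : ℂ → ℂ}

theorem FinitePath.tendsto {U : Set ℂ} {γ : ℝ → ℂ} (hγ : FinitePath U γ) :
    Tendsto γ (𝓝[<] 1) (𝓝 (γ 1)) := by
  refine (hγ.1 1 ⟨zero_le_one, le_rfl⟩).tendsto.mono_left (nhdsWithin_le_of_mem ?_)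
  filter_upwards [Ioo_mem_nhdsLT zero_lt_one] with t ht using ⟨ht.1.le, ht.2.le⟩

/-- The modified Hamiltonian stays bounded along paths of finite length: the logarithm of
`1 + |E|²` has increments bounded by a multiple of the length. -/
theorem exists_bound_modifiedEnergy {U : Set ℂ} (hU : IsOpen U) (h1 : DifferentiableOn ℂ α₁ U)
    (h3 : DifferentiableOn ℂ α₃ U) {γ : ℝ → ℂ} {x y : ℝ → ℂ → ℂ} (hγ : FinitePath U γ)
    (h : IsContinuation (normalised a₀ c α₁ α₃) γ x y) :
    ∃ B : ℝ, ∀ᶠ τ in 𝓝[<] (1 : ℝ),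
      ‖modifiedEnergy a₀ c α₁ α₃ (γ τ) (x τ (γ τ), y τ (γ τ))‖ ≤ B := by
  have hγ1 := hγ.tendsto
  obtain ⟨hγc, hγU, hγv⟩ := hγ
  have hend : γ 1 ∈ U := hγU ⟨zero_le_one, le_rfl⟩
  have ha1 : ∀ z ∈ U, AnalyticAt ℂ α₁ z := fun z hz => h1.analyticAt (hU.mem_nhds hz)
  have ha3 : ∀ z ∈ U, AnalyticAt ℂ α₃ z := fun z hz => h3.analyticAt (hU.mem_nhds hz)
  obtain ⟨K, hK, hgrow⟩ := exists_modified_growth (ha1 _ hend) (ha3 _ hend) a₀ c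
  have hgrow' := (hgrow.and (hU.eventually_mem hend)).eventually_nhds
  obtain ⟨τ₁, hτ₁, hgood⟩ := (mem_nhdsLT_iff_exists_Ico_subset).1
    (hγ1.eventually hgrow')
  set τ₀ := max τ₁ 0 with hτ₀
  set E : ℝ → ℂ → ℂ := fun τ z => modifiedEnergy a₀ c α₁ α₃ z (x τ z, y τ z) with hE
  have hmain : ∀ τ ∈ Ico τ₀ 1, ∀ᶠ τ' in 𝓝[Ico 0 1] τ,
      |Real.log (1 + ‖E τ' (γ τ')‖ ^ 2) - Real.log (1 + ‖E τ (γ τ)‖ ^ 2)|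
        ≤ 4 * K * ‖γ τ' - γ τ‖ := by
    intro τ hτ
    have hτ01 : τ ∈ Ico (0 : ℝ) 1 := ⟨(le_max_right _ _).trans hτ.1, hτ.2⟩
    have hg : ∀ᶠ z in 𝓝 (γ τ), _ := hgood ⟨(le_max_left _ _).trans hτ.1, hτ.2⟩
    obtain ⟨hsol, hcont⟩ := h τ hτ01
    obtain ⟨δ, hδ, hball⟩ := Metric.eventually_nhds_iff_ball.1 (hg.and hsol)
    have hγτ : Tendsto γ (𝓝[Ico 0 1] τ) (𝓝 (γ τ)) :=
      (hγc τ (Ico_subset_Icc_self hτ01)).mono_left (nhdsWithin_mono _ Ico_subset_Icc_self)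
    filter_upwards [hcont, hγτ.eventually (Metric.ball_mem_nhds _ hδ)] with τ' hxy hmem
    -- the increment is estimated along the segment from `γ τ` to `γ τ'`, not along the path itself
    set e := γ τ' - γ τ with he
    set ζ : ℝ → ℂ := fun s => γ τ + s • e with hζ
    have hζd : ∀ s, HasDerivAt ζ e s := fun s =>
      (((hasDerivAt_id s).smul_const e).const_add (γ τ)).congr_deriv (one_smul _ _)
    have hζmem : ∀ s ∈ Icc (0 : ℝ) 1, ζ s ∈ Metric.ball (γ τ) δ := fun s hs => by
      rw [dist_eq_norm] at hmem
      rw [Metric.mem_ball, dist_eq_norm]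
      simp only [hζ, add_sub_cancel_left, norm_smul, Real.norm_eq_abs, abs_of_nonneg hs.1]
      exact (mul_le_of_le_one_left (norm_nonneg e) hs.2).trans_lt hmem
    have hder : ∀ s ∈ Icc (0 : ℝ) 1, ∃ D : ℝ,
        HasDerivAt (fun s => Real.log (1 + ‖E τ (ζ s)‖ ^ 2)) D s ∧ ‖D‖ ≤ 4 * K * ‖e‖ := by
      intro s hs
      obtain ⟨⟨hgr, hzU⟩, hx, hy⟩ := hball (ζ s) (hζmem s hs)
      obtain ⟨D, hD, hDn⟩ := hgr id (x τ) (y τ) ζ s e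
        ⟨hasDerivAt_id _, hx, hy, ha1 _ hzU, ha3 _ hzU⟩ rfl (hζd s)
      set w := E τ (ζ s) with hw
      have hpos : (0 : ℝ) < 1 + ‖w‖ ^ 2 := by positivity
      refine ⟨2 * inner ℝ w D / (1 + ‖w‖ ^ 2), (hD.norm_sq.const_add 1).log hpos.ne', ?_⟩
      rw [norm_div, Real.norm_of_nonneg hpos.le, div_le_iff₀ hpos, norm_mul, Real.norm_ofNat]
      have h5 : ‖inner ℝ w D‖ ≤ ‖w‖ * (K * (1 + ‖w‖) * ‖e‖) :=
        (norm_inner_le_norm w D).trans (mul_le_mul_of_nonneg_left hDn (norm_nonneg w))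
      have h6 : ‖w‖ * (1 + ‖w‖) ≤ 2 * (1 + ‖w‖ ^ 2) := by nlinarith [sq_nonneg (‖w‖ - 1)]
      have h7 := mul_le_mul_of_nonneg_left h6 (mul_nonneg hK.le (norm_nonneg e))
      calc 2 * ‖inner ℝ w D‖ ≤ 2 * (‖w‖ * (K * (1 + ‖w‖) * ‖e‖)) := by linarith
        _ = 2 * (K * ‖e‖ * (‖w‖ * (1 + ‖w‖))) := by ring
        _ ≤ 2 * (K * ‖e‖ * (2 * (1 + ‖w‖ ^ 2))) := by linarith
        _ = 4 * K * ‖e‖ * (1 + ‖w‖ ^ 2) := by ring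
    choose! D hD hDn using hder
    have h8 := (convex_Icc (0 : ℝ) 1).norm_image_sub_le_of_norm_hasDerivWithin_le
      (fun s hs => (hD s hs).hasDerivWithinAt) hDn (left_mem_Icc.2 zero_le_one)
      (right_mem_Icc.2 zero_le_one)
    have h9 : ζ 0 = γ τ := by simp [hζ]
    have h10 : ζ 1 = γ τ' := by simp [hζ, he]
    have h11 : E τ' (γ τ') = E τ (γ τ') := by
      simp only [hE]
      rw [hxy.1.self_of_nhds, hxy.2.self_of_nhds]
    rw [h9, h10, sub_zero, norm_one, mul_one] at h8
    rw [h11]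
    exact h8
  obtain ⟨B, hB⟩ := exists_bound_of_locally_lipschitz
    (f := fun τ => Real.log (1 + ‖E τ (γ τ)‖ ^ 2)) hγv (by positivity) (le_max_right τ₁ 0) hmain
  refine ⟨Real.exp B, ?_⟩
  filter_upwards [Ico_mem_nhdsLT (max_lt hτ₁ zero_lt_one)] with τ hτ
  have h5 := (Real.log_le_iff_le_exp (by positivity)).1 (hB τ hτ)
  have h6 : ‖E τ (γ τ)‖ ≤ 1 + ‖E τ (γ τ)‖ ^ 2 := by nlinarith [sq_nonneg (‖E τ (γ τ)‖ - 1)]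
  exact h6.trans h5

end

/-! ### Energies near the line at infinity and the exceptional curves -/

/-- The quotient by `u⁵` of the value at `v₂ = ε + b₁ u + ⋯ + b₄ u⁴` of the polynomial `branchPoly`. -/
noncomputable def branchQuot (ε b₁ b₂ b₃ b₄ z a₀ a₁ a₂ a₃ A u : ℂ) : ℂ :=
  -((2 * b₁ * b₄ + 2 * b₂ * b₃) * (1 / 2) + (2 * ε * b₄ + 2 * b₁ * b₃ + b₂ ^ 2) * (z) + (2 * ε
    * b₃ + 2 * b₁ * b₂) * (a₃ / 3) + (2 * ε * b₂ + b₁ ^ 2) * (a₂ / 2) + (2 * ε * b₁) * (a₁)) +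
    b₂ * (1 / 2 - a₀) - b₁ * A / 2  + u * (-((2 * b₂ * b₄ + b₃ ^ 2) * (1 / 2) + (2 * b₁ * b₄ +
    2 * b₂ * b₃) * (z) + (2 * ε * b₄ + 2 * b₁ * b₃ + b₂ ^ 2) * (a₃ / 3) + (2 * ε * b₃ + 2 * b₁
    * b₂) * (a₂ / 2) + (2 * ε * b₂ + b₁ ^ 2) * (a₁)) + b₃ * (1 / 2 - a₀) - b₂ * A / 2)  + u ^ 2
    * (-((2 * b₃ * b₄) * (1 / 2) + (2 * b₂ * b₄ + b₃ ^ 2) * (z) + (2 * b₁ * b₄ + 2 * b₂ * b₃) *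
    (a₃ / 3) + (2 * ε * b₄ + 2 * b₁ * b₃ + b₂ ^ 2) * (a₂ / 2) + (2 * ε * b₃ + 2 * b₁ * b₂) *
    (a₁)) + b₄ * (1 / 2 - a₀) - b₃ * A / 2)  + u ^ 3 * (-((b₄ ^ 2) * (1 / 2) + (2 * b₃ * b₄) *
    (z) + (2 * b₂ * b₄ + b₃ ^ 2) * (a₃ / 3) + (2 * b₁ * b₄ + 2 * b₂ * b₃) * (a₂ / 2) + (2 * ε *
    b₄ + 2 * b₁ * b₃ + b₂ ^ 2) * (a₁)) - b₄ * A / 2)  + u ^ 4 * (-((b₄ ^ 2) * (z) + (2 * b₃ *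
    b₄) * (a₃ / 3) + (2 * b₂ * b₄ + b₃ ^ 2) * (a₂ / 2) + (2 * b₁ * b₄ + 2 * b₂ * b₃) * (a₁)))
    + u ^ 5 * (-((b₄ ^ 2) * (a₃ / 3) + (2 * b₃ * b₄) * (a₂ / 2) + (2 * b₂ * b₄ + b₃ ^ 2) *
    (a₁)))  + u ^ 6 * (-((b₄ ^ 2) * (a₂ / 2) + (2 * b₃ * b₄) * (a₁)))  + u ^ 7 * (-((b₄ ^ 2) *
    (a₁)))

/-- The leading part of `v₂² u⁵ E`, for an energy `E`, as a polynomial in `u = 1 / y` and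
`v = v₂ = y² / x`. -/
noncomputable def branchPoly (z a₀ a₁ a₂ a₃ A u v : ℂ) : ℂ :=
  1 / 2 - v ^ 2 * (1 / 2 + z * u + a₃ / 3 * u ^ 2 + a₂ / 2 * u ^ 3 + a₁ * u ^ 4)
    + v * u ^ 3 * (1 / 2 - A / 2 * u - a₀)

/-- The base points of a branch are the coefficients of the expansion in `u` of a root of
`branchPoly`. -/
theorem branchPoly_branchPoint {ε : ℂ} (hε : ε = 1 ∨ ε = -1) (a₀ c : ℂ) (α₁ α₃ : ℂ → ℂ) (z u : ℂ) :
    branchPoly z a₀ (α₁ z) (c + 2 * z / 3 * α₃ z - z ^ 3) (α₃ z) (auxCoeff α₃ z) u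
        (vTwo (normalised a₀ c α₁ α₃) ε 5 z (u, 0)) =
      u ^ 5 * branchQuot ε (branchPoint (normalised a₀ c α₁ α₃) ε 1 z)
        (branchPoint (normalised a₀ c α₁ α₃) ε 2 z) (branchPoint (normalised a₀ c α₁ α₃) ε 3 z)
        (branchPoint (normalised a₀ c α₁ α₃) ε 4 z) z a₀ (α₁ z) (c + 2 * z / 3 * α₃ z - z ^ 3) (α₃ z)
        (auxCoeff α₃ z) u := by
  have n0 : normalised a₀ c α₁ α₃ 0 z = a₀ := rfl
  have n1 : normalised a₀ c α₁ α₃ 1 z = α₁ z := rfl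
  have n2 : normalised a₀ c α₁ α₃ 2 z = c + 2 * z / 3 * α₃ z - z ^ 3 := rfl
  have n3 : normalised a₀ c α₁ α₃ 3 = α₃ := rfl
  have n4 : normalised a₀ c α₁ α₃ 4 = fun z => 4 * z := rfl
  have n4' : deriv (normalised a₀ c α₁ α₃ 4) z = 4 := by
    rw [n4]
    exact ((hasDerivAt_id z).const_mul (4 : ℂ)).deriv.trans (mul_one _)
  have h1 : branchPoint (normalised a₀ c α₁ α₃) ε 1 z = -ε * z := by
    simp only [branchPoint, n4]; ring
  have h2 : branchPoint (normalised a₀ c α₁ α₃) ε 2 z = ε * (3 / 2 * z ^ 2 - 1 / 3 * α₃ z) := by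
    simp only [branchPoint, n3, n4]; ring
  have h3 : branchPoint (normalised a₀ c α₁ α₃) ε 3 z = 1 / 2 - a₀
      + ε * (-(1 / 2) * (c + 2 * z / 3 * α₃ z - z ^ 3) + z * α₃ z - 5 / 2 * z ^ 3) := by
    simp only [branchPoint, n4', n0, n2, n3]; simp only [n4]; ring
  have h5 : branchPoint (normalised a₀ c α₁ α₃) ε 4 z = 2 * z * a₀ + 1 / 3 * deriv α₃ z - 5 / 2 * z
      + ε * (-α₁ z + 3 / 2 * z * (c + 2 * z / 3 * α₃ z - z ^ 3) + 1 / 6 * α₃ z ^ 2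
        - 5 / 2 * z ^ 2 * α₃ z + 35 / 8 * z ^ 4) := by
    simp only [branchPoint, n4', n0, n1, n2, n3]; simp only [n4]; ring
  clear n0 n1 n2 n3 n4 n4'
  rw [vTwo_five, mul_zero, add_zero]
  generalize c + 2 * z / 3 * α₃ z - z ^ 3 = a₂ at *
  generalize branchPoint (normalised a₀ c α₁ α₃) ε 1 z = b₁ at *
  generalize branchPoint (normalised a₀ c α₁ α₃) ε 2 z = b₂ at *
  generalize branchPoint (normalised a₀ c α₁ α₃) ε 3 z = b₃ at *
  generalize branchPoint (normalised a₀ c α₁ α₃) ε 4 z = b₄ at *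
  generalize α₁ z = a₁ at *
  unfold auxCoeff
  generalize α₃ z = a₃ at *
  generalize deriv α₃ z = D at *
  have hε2 : ε ^ 2 = 1 := by rcases hε with rfl | rfl <;> norm_num
  -- the coefficients of order at most four vanish
  have k0 : 1 / 2 - ε ^ 2 * (1 / 2) = 0 := by rw [hε2]; ring
  have k1 : -(ε ^ 2 * z + 2 * ε * b₁ * (1 / 2)) = 0 := by
    rw [h1]; linear_combination 0 * hε2
  have k2 : -(ε ^ 2 * (a₃ / 3) + 2 * ε * b₁ * z + (2 * ε * b₂ + b₁ ^ 2) * (1 / 2)) = 0 := by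
    rw [h1, h2]; ring
  have k3 : -(ε ^ 2 * (a₂ / 2) + 2 * ε * b₁ * (a₃ / 3) + (2 * ε * b₂ + b₁ ^ 2) * z
      + (2 * ε * b₃ + 2 * b₁ * b₂) * (1 / 2)) + ε * (1 / 2 - a₀) = 0 := by
    rw [h1, h2, h3]; ring
  have k4 : -(ε ^ 2 * a₁ + 2 * ε * b₁ * (a₂ / 2) + (2 * ε * b₂ + b₁ ^ 2) * (a₃ / 3)
      + (2 * ε * b₃ + 2 * b₁ * b₂) * z + (2 * ε * b₄ + 2 * b₁ * b₃ + b₂ ^ 2) * (1 / 2))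
      + b₁ * (1 / 2 - a₀) - ε * (3 * z - 2 / 3 * D) / 2 = 0 := by
    rw [h1, h2, h3, h5]; ring
  unfold branchPoly branchQuot
  linear_combination k0 + u * k1 + u ^ 2 * k2 + u ^ 3 * k3 + u ^ 4 * k4

section

variable {a₀ c : ℂ} {α₁ α₃ : ℂ → ℂ} {z₀ : ℂ} {E : ℂ → ℂ × ℂ → ℂ}

/-- For large `y` and `z` near `z₀`, the function `E` differs from the Hamiltonian by
`x (1/2 - A₁/(2 y) + O(y⁻²)) + O(1)`. -/
def EnergyAtInfinity (a₀ c : ℂ) (α₁ α₃ : ℂ → ℂ) (z₀ : ℂ) (E : ℂ → ℂ × ℂ → ℂ) : Prop :=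
  ∃ T R : ℝ, ∀ᶠ z in 𝓝 z₀, ∀ x y : ℂ, R ≤ ‖y‖ → ∃ θ κ : ℂ, ‖θ‖ ≤ T ∧ ‖κ‖ ≤ T ∧
    E z (x, y) = hamiltonian (normalised a₀ c α₁ α₃) z (x, y)
      + (x * (1 / 2 - auxCoeff α₃ z / 2 * y⁻¹ + θ * y⁻¹ ^ 2) + κ)

/-- For large `y` a bounded energy forces `w = x / y²` to be close to `1` or `-1`. -/
theorem EnergyAtInfinity.ratio (h1 : AnalyticAt ℂ α₁ z₀) (h3 : AnalyticAt ℂ α₃ z₀)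
    (hE : EnergyAtInfinity a₀ c α₁ α₃ z₀ E) :
    ∃ C R : ℝ, 0 < C ∧ 1 ≤ R ∧ ∀ᶠ z in 𝓝 z₀, ∀ x y : ℂ, R ≤ ‖y‖ →
      ‖(x * y⁻¹ ^ 2) ^ 2 - 1‖ ≤ C * (‖y⁻¹‖ * (1 + ‖x * y⁻¹ ^ 2‖) + ‖y⁻¹‖ ^ 5 * ‖E z (x, y)‖) := by
  obtain ⟨T, R, hTR⟩ := hE
  obtain ⟨M, hM, hMz⟩ := exists_bound_of_continuousAt (z₀ := z₀) (F := fun z u =>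
    z + α₃ z / 3 * u + (c + 2 * z / 3 * α₃ z - z ^ 3) / 2 * u ^ 2 + α₁ z * u ^ 3)
    (fun u => by
      have h1' : ContinuousAt α₁ (z₀, u).1 := h1.continuousAt
      have h3' : ContinuousAt α₃ (z₀, u).1 := h3.continuousAt
      fun_prop) 1
  obtain ⟨N, hN, hNz⟩ := exists_coeff_bound h1 h3 a₀ c
  refine ⟨2 * (M + |T| + N + 1 / 2 + N / 2 + |T|) + 2, max R 1, by positivity, le_max_right _ _, ?_⟩
  filter_upwards [hTR, hMz, hNz] with z f1 f2 f3 x y hy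
  obtain ⟨θ, κ, hθ, hκ, hEq⟩ := f1 x y ((le_max_left _ _).trans hy)
  obtain ⟨g1, -, -, -, -, -, g2⟩ := f3
  have hy1 : 1 ≤ ‖y‖ := (le_max_right _ _).trans hy
  have hy0 : y ≠ 0 := fun h => by rw [h, norm_zero] at hy1; linarith
  have hu : ‖y⁻¹‖ ≤ 1 := by rw [norm_inv]; exact inv_le_one_of_one_le₀ hy1
  have hB := f2 y⁻¹ hu
  set u := y⁻¹ with hudef
  set w := x * u ^ 2 with hw
  set B := z + α₃ z / 3 * u + (c + 2 * z / 3 * α₃ z - z ^ 3) / 2 * u ^ 2 + α₁ z * u ^ 3 with hBdef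
  set t := 1 / 2 - auxCoeff α₃ z / 2 * u + θ * u ^ 2 with ht
  have hu0 := norm_nonneg u
  have hid : w ^ 2 - 1 = 2 * (u ^ 5 * E z (x, y) + u * B + w * u * (u ^ 2 * (a₀ - t))
      - u * (u ^ 4 * κ)) := by
    rw [hEq, hw, hBdef, hamiltonian_normalised, hudef]
    field_simp
    ring
  have hT : ‖θ‖ ≤ |T| := hθ.trans (le_abs_self T)
  have hT' : ‖κ‖ ≤ |T| := hκ.trans (le_abs_self T)
  have htn : ‖t‖ ≤ 1 / 2 + N / 2 + |T| := by
    refine (norm_add_le _ _).trans (add_le_add ((norm_sub_le _ _).trans (add_le_add ?_ ?_)) ?_)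
    · norm_num
    · rw [norm_mul, norm_div, Complex.norm_ofNat]
      exact (mul_le_of_le_one_right (by positivity) hu).trans (by linarith)
    · rw [norm_mul, norm_pow]
      exact (mul_le_of_le_one_right (by positivity) (pow_le_one₀ hu0 hu)).trans hT
  have e1 : ‖u ^ 5 * E z (x, y)‖ = ‖u‖ ^ 5 * ‖E z (x, y)‖ := by rw [norm_mul, norm_pow]
  have e2 : ‖u * B‖ ≤ ‖u‖ * M := by
    rw [norm_mul]; exact mul_le_mul_of_nonneg_left hB hu0
  have e3 : ‖w * u * (u ^ 2 * (a₀ - t))‖ ≤ ‖w‖ * ‖u‖ * (N + (1 / 2 + N / 2 + |T|)) := by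
    rw [norm_mul, norm_mul]
    refine mul_le_mul_of_nonneg_left ?_ (by positivity)
    rw [norm_mul, norm_pow]
    exact (mul_le_of_le_one_left (norm_nonneg _) (pow_le_one₀ hu0 hu)).trans
      ((norm_sub_le _ _).trans (by linarith))
  have e4 : ‖u * (u ^ 4 * κ)‖ ≤ ‖u‖ * |T| := by
    rw [norm_mul, norm_mul, norm_pow]
    exact mul_le_mul_of_nonneg_left
      ((mul_le_of_le_one_left (norm_nonneg _) (pow_le_one₀ hu0 hu)).trans hT') hu0
  rw [hid, norm_mul, Complex.norm_ofNat]
  have e5 := norm_sub_le (u ^ 5 * E z (x, y) + u * B + w * u * (u ^ 2 * (a₀ - t))) (u * (u ^ 4 * κ))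
  have e6 := norm_add₃_le (a := u ^ 5 * E z (x, y)) (b := u * B) (c := w * u * (u ^ 2 * (a₀ - t)))
  rw [e1] at e6
  have hX : 0 ≤ ‖u‖ ^ 5 * ‖E z (x, y)‖ := by positivity
  have hY : 0 ≤ ‖w‖ * ‖u‖ := by positivity
  have hT0 := abs_nonneg T
  generalize ‖u‖ ^ 5 * ‖E z (x, y)‖ = e at *
  have p1 : 0 ≤ (M + |T| + N + 1 / 2 + N / 2 + |T|) * e := by positivity
  have p2 : 0 ≤ (M + |T| + 1) * (‖w‖ * ‖u‖) := by positivity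
  have p3 : 0 ≤ (N + 1 / 2 + N / 2 + |T| + 1) * ‖u‖ := by positivity
  linarith

/-- Energies are large where `y` is large and `w = x / y²` stays away from `1` and `-1`. -/
theorem EnergyAtInfinity.lower (h1 : AnalyticAt ℂ α₁ z₀) (h3 : AnalyticAt ℂ α₃ z₀)
    (hE : EnergyAtInfinity a₀ c α₁ α₃ z₀ E) {ι : Type*} {l : Filter ι} {z x y : ι → ℂ}
    (hz : Tendsto z l (𝓝 z₀)) (hy : Tendsto (fun i => ‖y i‖) l atTop) {k : ℝ} (hk : 0 < k)
    (hw : ∀ᶠ i in l, k * (1 + ‖x i * (y i)⁻¹ ^ 2‖) ≤ ‖(x i * (y i)⁻¹ ^ 2) ^ 2 - 1‖) :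
    ∃ k' > 0, ∀ᶠ i in l, k' * (‖y i‖ * (1 + ‖x i * (y i)⁻¹ ^ 2‖)) ≤ ‖E (z i) (x i, y i)‖ := by
  obtain ⟨C, R, hC, hR, hCR⟩ := hE.ratio h1 h3
  refine ⟨k / (2 * C), by positivity, ?_⟩
  filter_upwards [hz.eventually hCR, hy.eventually_ge_atTop (max R (2 * C / k)), hw] with i f1 f2 f3
  have hyR : R ≤ ‖y i‖ := (le_max_left _ _).trans f2
  have hyk : 2 * C / k ≤ ‖y i‖ := (le_max_right _ _).trans f2
  have hy1 : 1 ≤ ‖y i‖ := hR.trans hyR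
  have hypos : 0 < ‖y i‖ := by linarith
  have f4 := f3.trans (f1 (x i) (y i) hyR)
  have hinv : ‖(y i)⁻¹‖ = ‖y i‖⁻¹ := norm_inv _
  rw [hinv] at f4
  set r := ‖y i‖ with hr
  set W := 1 + ‖x i * (y i)⁻¹ ^ 2‖ with hW
  have hW0 : 0 < W := by positivity
  set e := ‖E (z i) (x i, y i)‖ with he
  have he0 : 0 ≤ e := norm_nonneg _
  have f5 : C * (r⁻¹ * W) ≤ k / 2 * W := by
    rw [← mul_assoc]
    refine mul_le_mul_of_nonneg_right ?_ hW0.le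
    rw [div_le_iff₀ hk] at hyk
    rw [← div_eq_mul_inv, div_le_iff₀ hypos]
    linarith
  have f6 : r⁻¹ ^ 5 ≤ r⁻¹ := pow_le_of_le_one (by positivity) (inv_le_one_of_one_le₀ hy1) (by norm_num)
  have f7 : k / 2 * W ≤ C * (r⁻¹ * e) := by
    have := mul_le_mul_of_nonneg_left (mul_le_mul_of_nonneg_right f6 he0) hC.le
    rw [mul_add] at f4
    linarith
  have f8 : k / (2 * C) * (r * W) = (k / 2 * W) * r / C := by field_simp
  rw [f8, div_le_iff₀ hC]
  have f9 := mul_le_mul_of_nonneg_right f7 hypos.le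
  have f10 : C * (r⁻¹ * e) * r = e * C := by field_simp
  linarith

/-- Near `E₂` and the branch `ε` over it, the size of an energy is that of the distance of `v₂`
from the branch. -/
theorem EnergyAtInfinity.branch (h1 : AnalyticAt ℂ α₁ z₀) (h3 : AnalyticAt ℂ α₃ z₀)
    (hE : EnergyAtInfinity a₀ c α₁ α₃ z₀ E) {ε : ℂ} (hε : ε = 1 ∨ ε = -1) :
    ∃ C : ℝ, 0 < C ∧ ∀ᶠ p : ℂ × ℂ × ℂ in 𝓝 (z₀, 0, ε), p.2.1 ≠ 0 →
      ‖p.2.2 - vTwo (normalised a₀ c α₁ α₃) ε 5 p.1 (p.2.1, 0)‖ ≤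
          C * (‖p.2.1‖ ^ 5 * (1 + ‖E p.1 (1 / (p.2.1 ^ 2 * p.2.2), 1 / p.2.1)‖)) ∧
      ‖p.2.1‖ ^ 5 * ‖E p.1 (1 / (p.2.1 ^ 2 * p.2.2), 1 / p.2.1)‖ ≤
          C * (‖p.2.2 - vTwo (normalised a₀ c α₁ α₃) ε 5 p.1 (p.2.1, 0)‖ + ‖p.2.1‖ ^ 5) := by
  obtain ⟨T, R, hTR⟩ := hE
  have hε2 : ‖ε‖ = 1 := by rcases hε with rfl | rfl <;> simp
  have ca1 : ContinuousAt α₁ (z₀, (0 : ℂ), ε).1 := h1.continuousAt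
  have ca3 : ContinuousAt α₃ (z₀, (0 : ℂ), ε).1 := h3.continuousAt
  have cA : ContinuousAt (auxCoeff α₃) (z₀, (0 : ℂ), ε).1 := (analyticAt_auxCoeff h3).continuousAt
  have cb : ∀ n, ContinuousAt (branchPoint (normalised a₀ c α₁ α₃) ε n) (z₀, (0 : ℂ), ε).1 :=
    fun n => (analyticAt_branchPoint (analyticAt_normalised h1 h3 a₀ c) ε n).continuousAt
  have c1 := cb 1
  have c2 := cb 2
  have c3 := cb 3
  have c4 := cb 4
  -- the quotient of `branchPoly v - branchPoly P` by `v - P`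
  obtain ⟨F, hF, hFc⟩ : ∃ F : ℂ × ℂ × ℂ → ℂ, (∀ p, F p =
      -(p.2.2 + vTwo (normalised a₀ c α₁ α₃) ε 5 p.1 (p.2.1, 0)) * (1 / 2 + p.1 * p.2.1
        + α₃ p.1 / 3 * p.2.1 ^ 2 + (c + 2 * p.1 / 3 * α₃ p.1 - p.1 ^ 3) / 2 * p.2.1 ^ 3
        + α₁ p.1 * p.2.1 ^ 4) + p.2.1 ^ 3 * (1 / 2 - auxCoeff α₃ p.1 / 2 * p.2.1 - a₀)) ∧
      Tendsto F (𝓝 (z₀, 0, ε)) (𝓝 (-ε)) := by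
    refine ⟨_, fun p => rfl, ?_⟩
    simp only [vTwo_five]
    have hc : ContinuousAt (fun p : ℂ × ℂ × ℂ => -(p.2.2 + (ε
        + branchPoint (normalised a₀ c α₁ α₃) ε 1 p.1 * p.2.1
        + branchPoint (normalised a₀ c α₁ α₃) ε 2 p.1 * p.2.1 ^ 2
        + branchPoint (normalised a₀ c α₁ α₃) ε 3 p.1 * p.2.1 ^ 3
        + branchPoint (normalised a₀ c α₁ α₃) ε 4 p.1 * p.2.1 ^ 4 + p.2.1 ^ 5 * 0)) *
        (1 / 2 + p.1 * p.2.1 + α₃ p.1 / 3 * p.2.1 ^ 2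
        + (c + 2 * p.1 / 3 * α₃ p.1 - p.1 ^ 3) / 2 * p.2.1 ^ 3
        + α₁ p.1 * p.2.1 ^ 4) + p.2.1 ^ 3 * (1 / 2 - auxCoeff α₃ p.1 / 2 * p.2.1 - a₀))
        (z₀, 0, ε) := by fun_prop
    exact hc.tendsto.mono_right (le_of_eq (congrArg 𝓝 (by simp only; ring)))
  obtain ⟨Q, hQ, hQc⟩ : ∃ Q : ℂ × ℂ × ℂ → ℂ, (∀ p, Q p =
      branchQuot ε (branchPoint (normalised a₀ c α₁ α₃) ε 1 p.1)
        (branchPoint (normalised a₀ c α₁ α₃) ε 2 p.1) (branchPoint (normalised a₀ c α₁ α₃) ε 3 p.1)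
        (branchPoint (normalised a₀ c α₁ α₃) ε 4 p.1) p.1 a₀ (α₁ p.1)
        (c + 2 * p.1 / 3 * α₃ p.1 - p.1 ^ 3) (α₃ p.1) (auxCoeff α₃ p.1) p.2.1) ∧
      ContinuousAt Q (z₀, 0, ε) := by
    refine ⟨_, fun p => rfl, ?_⟩
    unfold branchQuot
    fun_prop
  have hFn : Tendsto (fun p => ‖F p‖) (𝓝 (z₀, 0, ε)) (𝓝 1) := by
    simpa [hε2] using hFc.norm
  have hv : Tendsto (fun p : ℂ × ℂ × ℂ => ‖p.2.2‖) (𝓝 (z₀, 0, ε)) (𝓝 1) := by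
    rw [← hε2]
    exact (continuous_snd.comp continuous_snd).norm.continuousAt
  have hu : Tendsto (fun p : ℂ × ℂ × ℂ => ‖p.2.1‖) (𝓝 (z₀, 0, ε)) (𝓝 0) := by
    rw [← norm_zero (E := ℂ)]
    exact (continuous_fst.comp continuous_snd).norm.continuousAt
  have hz : Tendsto (fun p : ℂ × ℂ × ℂ => p.1) (𝓝 (z₀, 0, ε)) (𝓝 z₀) := continuous_fst.continuousAt
  set M := ‖Q (z₀, 0, ε)‖ + 1 with hM
  have hM0 : 0 < M := by positivity
  refine ⟨8 + 2 * M + 12 * |T|, by positivity, ?_⟩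
  filter_upwards [hz.eventually hTR, hFn.eventually (Icc_mem_nhds (by norm_num : (1 / 2 : ℝ) < 1)
    (by norm_num : (1 : ℝ) < 2)), hv.eventually (Icc_mem_nhds (by norm_num : (3 / 4 : ℝ) < 1)
    (by norm_num : (1 : ℝ) < 5 / 4)), hQc.norm.eventually_lt continuousAt_const (lt_add_one _),
    hu.eventually_lt_const (show (0 : ℝ) < (|R| + 1)⁻¹ by positivity)] with p f1 f2 f3 f4 f5 hp
  obtain ⟨z, u, v⟩ := p
  simp only at f1 f3 f5 hp ⊢
  have hunorm : 0 < ‖u‖ := norm_pos_iff.2 hp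
  have hR : R ≤ ‖1 / u‖ := by
    rw [norm_div, norm_one, one_div]
    have := (lt_inv_comm₀ hunorm (by positivity)).1 f5
    linarith [le_abs_self R]
  have hv0 : v ≠ 0 := fun h => by rw [h, norm_zero] at f3; linarith [f3.1]
  obtain ⟨θ, κ, hθ, hκ, hEq⟩ := f1 (1 / (u ^ 2 * v)) (1 / u) hR
  set P := vTwo (normalised a₀ c α₁ α₃) ε 5 z (u, 0) with hP
  set e := E z (1 / (u ^ 2 * v), 1 / u) with he
  have hPoly := branchPoly_branchPoint hε a₀ c α₁ α₃ z u
  have hF' := hF (z, u, v)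
  have hQ' := hQ (z, u, v)
  simp only at hF' hQ'
  rw [← hQ'] at hPoly
  have hid : v ^ 2 * (u ^ 5 * e) = (v - P) * F (z, u, v) + u ^ 5 * (Q (z, u, v)
      + (v * θ + κ * v ^ 2)) := by
    rw [mul_add (u ^ 5), ← hPoly, hF', hEq, hamiltonian_normalised, ← hP]
    unfold branchPoly
    field_simp
    ring
  have hv2 : ‖v‖ ^ 2 ≤ 2 := by nlinarith [f3.1, f3.2]
  have hv2' : 1 / 2 ≤ ‖v‖ ^ 2 := by nlinarith [f3.1, f3.2]
  have hrest : ‖u ^ 5 * (Q (z, u, v) + (v * θ + κ * v ^ 2))‖ ≤ ‖u‖ ^ 5 * (M + 4 * |T|) := by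
    rw [norm_mul, norm_pow]
    refine mul_le_mul_of_nonneg_left ?_ (by positivity)
    refine (norm_add_le _ _).trans (add_le_add f4.le ((norm_add_le _ _).trans ?_))
    rw [norm_mul, norm_mul, norm_pow]
    have k1 : ‖v‖ * ‖θ‖ ≤ 2 * |T| :=
      mul_le_mul (by linarith [f3.2]) (hθ.trans (le_abs_self T)) (norm_nonneg _) (by norm_num)
    have k2 : ‖κ‖ * ‖v‖ ^ 2 ≤ |T| * 2 :=
      mul_le_mul (hκ.trans (le_abs_self T)) hv2 (by positivity) (abs_nonneg _)
    linarith
  have hl : ‖v ^ 2 * (u ^ 5 * e)‖ = ‖v‖ ^ 2 * (‖u‖ ^ 5 * ‖e‖) := by simp only [norm_mul, norm_pow]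
  have hr : ‖(v - P) * F (z, u, v)‖ = ‖v - P‖ * ‖F (z, u, v)‖ := norm_mul _ _
  have hd := norm_nonneg (v - P)
  have hU5 : 0 ≤ ‖u‖ ^ 5 := by positivity
  have he5 : 0 ≤ ‖u‖ ^ 5 * ‖e‖ := by positivity
  have hT0 := abs_nonneg T
  have hup : ‖v ^ 2 * (u ^ 5 * e)‖ ≤ ‖v - P‖ * ‖F (z, u, v)‖ + ‖u‖ ^ 5 * (M + 4 * |T|) := by
    rw [hid, ← hr]
    exact (norm_add_le _ _).trans (add_le_add le_rfl hrest)
  have hlow : ‖v - P‖ * ‖F (z, u, v)‖ ≤ ‖v ^ 2 * (u ^ 5 * e)‖ + ‖u‖ ^ 5 * (M + 4 * |T|) := by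
    rw [← hr, show (v - P) * F (z, u, v) = v ^ 2 * (u ^ 5 * e)
      - u ^ 5 * (Q (z, u, v) + (v * θ + κ * v ^ 2)) by rw [hid]; ring]
    exact (norm_sub_le _ _).trans (add_le_add le_rfl hrest)
  rw [hl] at hup hlow
  have k1 := mul_le_mul_of_nonneg_left f2.1 hd
  have k2 := mul_le_mul_of_nonneg_left f2.2 hd
  have k3 := mul_le_mul_of_nonneg_right hv2 he5
  have k4 := mul_le_mul_of_nonneg_right hv2' he5
  have q1 : 0 ≤ M * (‖u‖ ^ 5 * ‖e‖) := by positivity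
  have q2 : 0 ≤ |T| * (‖u‖ ^ 5 * ‖e‖) := by positivity
  have q3 : 0 ≤ M * ‖v - P‖ := by positivity
  have q4 : 0 ≤ |T| * ‖v - P‖ := by positivity
  have q5 : 0 ≤ M * ‖u‖ ^ 5 := by positivity
  have q6 : 0 ≤ |T| * ‖u‖ ^ 5 := by positivity
  constructor
  · linarith
  · linarith

end

/-! ### Energies for bounded `y` -/

section

variable {a₀ c : ℂ} {α₁ α₃ : ℂ → ℂ} {z₀ y₀ : ℂ} {E : ℂ → ℂ × ℂ → ℂ}

/-- For `(z, y)` near `(z₀, y₀)`, the function `E` differs from the Hamiltonian by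
`x O(y²) + O(1)`. -/
def EnergyAt (a₀ c : ℂ) (α₁ α₃ : ℂ → ℂ) (z₀ y₀ : ℂ) (E : ℂ → ℂ × ℂ → ℂ) : Prop :=
  ∃ T : ℝ, ∀ᶠ r : ℂ × ℂ in 𝓝 (z₀, y₀), ∀ x : ℂ, ∃ θ κ : ℂ, ‖θ‖ ≤ T * ‖r.2‖ ^ 2 ∧ ‖κ‖ ≤ T ∧
    E r.1 (x, r.2) = hamiltonian (normalised a₀ c α₁ α₃) r.1 (x, r.2) + (x * θ + κ)

/-- For bounded `y`, an energy is `x (x y - 2 a₀) / 2` up to `x O(y²) + O(1)`. -/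
theorem EnergyAt.approx (h1 : AnalyticAt ℂ α₁ z₀) (h3 : AnalyticAt ℂ α₃ z₀)
    (hE : EnergyAt a₀ c α₁ α₃ z₀ y₀ E) :
    ∃ C : ℝ, 0 < C ∧ ∀ᶠ r : ℂ × ℂ in 𝓝 (z₀, y₀), ∀ x : ℂ, ∃ θ : ℂ, ‖θ‖ ≤ C * ‖r.2‖ ^ 2 ∧
      ‖E r.1 (x, r.2) - 1 / 2 * x * (x * r.2 - 2 * a₀ + 2 * θ)‖ ≤ C := by
  obtain ⟨T, hT⟩ := hE
  obtain ⟨B, hB, hBc⟩ : ∃ B : ℂ × ℂ → ℂ, (∀ r, B r = 1 / 2 * r.2 ^ 5 + r.1 * r.2 ^ 4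
      + α₃ r.1 / 3 * r.2 ^ 3 + (c + 2 * r.1 / 3 * α₃ r.1 - r.1 ^ 3) / 2 * r.2 ^ 2 + α₁ r.1 * r.2) ∧
      ContinuousAt B (z₀, y₀) := by
    refine ⟨_, fun r => rfl, ?_⟩
    have h1' : ContinuousAt α₁ (z₀, y₀).1 := h1.continuousAt
    have h3' : ContinuousAt α₃ (z₀, y₀).1 := h3.continuousAt
    fun_prop
  refine ⟨|T| + (‖B (z₀, y₀)‖ + 1), by positivity, ?_⟩
  filter_upwards [hT, hBc.norm.eventually_lt continuousAt_const (lt_add_one _)] with r f1 f2 x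
  obtain ⟨θ, κ, hθ, hκ, hEq⟩ := f1 x
  refine ⟨θ, hθ.trans (mul_le_mul_of_nonneg_right ?_ (by positivity)), ?_⟩
  · linarith [le_abs_self T, norm_nonneg (B (z₀, y₀))]
  · rw [hEq, hamiltonian_normalised]
    have : 1 / 2 * x ^ 2 * r.2 - 1 / 2 * r.2 ^ 5 - r.1 * r.2 ^ 4 - α₃ r.1 / 3 * r.2 ^ 3
        - (c + 2 * r.1 / 3 * α₃ r.1 - r.1 ^ 3) / 2 * r.2 ^ 2 - α₁ r.1 * r.2 - a₀ * x + (x * θ + κ)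
        - 1 / 2 * x * (x * r.2 - 2 * a₀ + 2 * θ) = κ - B r := by rw [hB]; ring
    rw [this]
    exact (norm_sub_le _ _).trans (add_le_add (hκ.trans (le_abs_self T)) f2.le)

/-- Energies are large where `x` is large and `y` is bounded, if `y` is not small or `x y` stays
away from `2 a₀`. -/
theorem EnergyAt.lower (h1 : AnalyticAt ℂ α₁ z₀) (h3 : AnalyticAt ℂ α₃ z₀)
    (hE : EnergyAt a₀ c α₁ α₃ z₀ y₀ E) {ι : Type*} {l : Filter ι} {z x y : ι → ℂ}
    (hz : Tendsto z l (𝓝 z₀)) (hy : Tendsto y l (𝓝 y₀)) (hx : Tendsto (fun i => ‖x i‖) l atTop)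
    (hxy : y₀ ≠ 0 ∨ y₀ = 0 ∧ ∃ k > 0, ∀ᶠ i in l, k * (1 + ‖x i * y i‖) ≤ ‖x i * y i - 2 * a₀‖) :
    ∃ k' > 0, ∀ᶠ i in l, k' * (‖x i‖ * (1 + ‖x i * y i‖)) ≤ ‖E (z i) (x i, y i)‖ := by
  obtain ⟨C, hC, hCr⟩ := hE.approx h1 h3
  have hzy : Tendsto (fun i => (z i, y i)) l (𝓝 (z₀, y₀)) := hz.prodMk_nhds hy
  have hyn : Tendsto (fun i => ‖y i‖) l (𝓝 ‖y₀‖) := hy.norm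
  have key : ∃ k > 0, ∀ᶠ i in l, ∀ θ : ℂ, ‖θ‖ ≤ C * ‖y i‖ ^ 2 →
      k * (1 + ‖x i * y i‖) ≤ ‖x i * y i - 2 * a₀ + 2 * θ‖ := by
    rcases hxy with h0 | ⟨h0, k, hk, hki⟩
    · have hm : Tendsto (fun i => ‖x i * y i‖) l atTop := by
        simp only [norm_mul]
        exact hx.atTop_mul_pos (norm_pos_iff.2 h0) hyn
      have hb : Tendsto (fun i => C * ‖y i‖ ^ 2) l (𝓝 (C * ‖y₀‖ ^ 2)) := (hyn.pow 2).const_mul C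
      refine ⟨1 / 2, by norm_num, ?_⟩
      filter_upwards [hm.eventually_ge_atTop (1 + 4 * ‖a₀‖ + 4 * (C * ‖y₀‖ ^ 2 + 1)),
        hb.eventually_lt_const (lt_add_one _)] with i f1 f2 θ hθ
      have e1 : ‖x i * y i‖ ≤ ‖x i * y i - 2 * a₀ + 2 * θ‖ + (2 * ‖a₀‖ + 2 * ‖θ‖) := by
        have : x i * y i = (x i * y i - 2 * a₀ + 2 * θ) + (2 * a₀ - 2 * θ) := by ring
        calc ‖x i * y i‖ = ‖(x i * y i - 2 * a₀ + 2 * θ) + (2 * a₀ - 2 * θ)‖ := by rw [← this]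
          _ ≤ _ := (norm_add_le _ _).trans (add_le_add le_rfl ((norm_sub_le _ _).trans (by simp)))
      linarith
    · have hb : Tendsto (fun i => C * ‖y i‖ ^ 2) l (𝓝 (C * ‖y₀‖ ^ 2)) := (hyn.pow 2).const_mul C
      rw [h0, norm_zero, zero_pow two_ne_zero, mul_zero] at hb
      refine ⟨k / 2, by positivity, ?_⟩
      filter_upwards [hki, hb.eventually_lt_const (show 0 < k / 4 by positivity)] with i f1 f2 θ hθ
      have e1 : ‖x i * y i - 2 * a₀‖ ≤ ‖x i * y i - 2 * a₀ + 2 * θ‖ + 2 * ‖θ‖ := by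
        calc ‖x i * y i - 2 * a₀‖ = ‖(x i * y i - 2 * a₀ + 2 * θ) - 2 * θ‖ := by ring_nf
          _ ≤ _ := (norm_sub_le _ _).trans (by simp)
      have e2 : 0 ≤ k * ‖x i * y i‖ := by positivity
      linarith
  obtain ⟨k, hk, hki⟩ := key
  refine ⟨k / 4, by positivity, ?_⟩
  filter_upwards [hki, hzy.eventually hCr, hx.eventually_ge_atTop (4 * C / k)] with i f1 f2 f3
  obtain ⟨θ, hθ, hEq⟩ := f2 (x i)
  have f4 := f1 θ hθ
  have e1 : ‖1 / 2 * x i * (x i * y i - 2 * a₀ + 2 * θ)‖ ≤ ‖E (z i) (x i, y i)‖ + C := by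
    have := norm_sub_norm_le (1 / 2 * x i * (x i * y i - 2 * a₀ + 2 * θ)) (E (z i) (x i, y i))
    rw [norm_sub_rev] at this
    linarith
  rw [norm_mul, norm_mul] at e1
  have e2 : ‖(1 / 2 : ℂ)‖ = 1 / 2 := by norm_num
  rw [e2] at e1
  have e3 := mul_le_mul_of_nonneg_left f4 (norm_nonneg (x i))
  rw [div_le_iff₀ hk] at f3
  have e4 : 0 ≤ k * ‖x i‖ * ‖x i * y i‖ := by positivity
  linarith

theorem tendsto_norm_div_atTop {ι : Type*} {l : Filter ι} {N D : ι → ℂ} {n₀ : ℂ}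
    (hN : Tendsto N l (𝓝 n₀)) (hn : n₀ ≠ 0) (hD : Tendsto D l (𝓝 0)) (hD0 : ∀ᶠ i in l, D i ≠ 0) :
    Tendsto (fun i => ‖N i / D i‖) l atTop := by
  have h1 : Tendsto (fun i => ‖D i‖) l (𝓝[>] 0) := by
    refine tendsto_nhdsWithin_iff.2 ⟨by simpa using hD.norm, hD0.mono fun i h => norm_pos_iff.2 h⟩
  simp_rw [norm_div, div_eq_mul_inv]
  exact Tendsto.pos_mul_atTop (norm_pos_iff.2 hn) hN.norm (tendsto_inv_nhdsGT_zero.comp h1)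

/-- Functions with a nonzero limit dominate functions with a limit. -/
theorem exists_separated {ι : Type*} {l : Filter ι} {A B : ι → ℂ} {a b : ℂ} (ha : Tendsto A l (𝓝 a))
    (hb : Tendsto B l (𝓝 b)) (hab : b ≠ 0) : ∃ k > 0, ∀ᶠ i in l, k * ‖A i‖ ≤ ‖B i‖ := by
  have hb0 : 0 < ‖b‖ := norm_pos_iff.2 hab
  refine ⟨‖b‖ / 2 / (‖a‖ + 1), by positivity, ?_⟩
  filter_upwards [ha.norm.eventually_lt_const (lt_add_one _),
    hb.norm.eventually_const_lt (half_lt_self hb0)] with i f1 f2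
  rw [div_mul_eq_mul_div, div_le_iff₀ (by positivity)]
  exact mul_le_mul f2.le f1.le (norm_nonneg _) (norm_nonneg _)

/-- The ratio `w = P / Q` stays away from `1` and `-1`. -/
theorem exists_ratio_separated {ι : Type*} {l : Filter ι} {P Q : ι → ℂ} {p q : ℂ}
    (hP : Tendsto P l (𝓝 p)) (hQ : Tendsto Q l (𝓝 q)) (hpq : p ^ 2 ≠ q ^ 2)
    (hQ0 : ∀ᶠ i in l, Q i ≠ 0) :
    ∃ k > 0, ∀ᶠ i in l, k * (1 + ‖P i / Q i‖) ≤ ‖(P i / Q i) ^ 2 - 1‖ := by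
  have hn : Tendsto (fun i => (((‖Q i‖ + ‖P i‖) * ‖Q i‖ : ℝ) : ℂ)) l
      (𝓝 (((‖q‖ + ‖p‖) * ‖q‖ : ℝ) : ℂ)) :=
    (Complex.continuous_ofReal.tendsto _).comp ((hQ.norm.add hP.norm).mul hQ.norm)
  obtain ⟨k, hk, hki⟩ := exists_separated hn ((hP.pow 2).sub (hQ.pow 2)) (sub_ne_zero.2 hpq)
  refine ⟨k, hk, ?_⟩
  filter_upwards [hki, hQ0] with i f1 f2
  have hq : 0 < ‖Q i‖ := norm_pos_iff.2 f2
  have e1 : (P i / Q i) ^ 2 - 1 = (P i ^ 2 - Q i ^ 2) / Q i ^ 2 := by field_simp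
  rw [Complex.norm_real, Real.norm_of_nonneg (by positivity)] at f1
  rw [e1, norm_div, norm_div, norm_pow, le_div_iff₀ (by positivity)]
  refine le_trans (le_of_eq ?_) f1
  field_simp

/-- The product `P / Q` stays away from `b`. -/
theorem exists_product_separated {ι : Type*} {l : Filter ι} {P Q : ι → ℂ} {p q b : ℂ}
    (hP : Tendsto P l (𝓝 p)) (hQ : Tendsto Q l (𝓝 q)) (hpq : p ≠ b * q)
    (hQ0 : ∀ᶠ i in l, Q i ≠ 0) :
    ∃ k > 0, ∀ᶠ i in l, k * (1 + ‖P i / Q i‖) ≤ ‖P i / Q i - b‖ := by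
  have hn : Tendsto (fun i => ((‖Q i‖ + ‖P i‖ : ℝ) : ℂ)) l (𝓝 ((‖q‖ + ‖p‖ : ℝ) : ℂ)) :=
    (Complex.continuous_ofReal.tendsto _).comp (hQ.norm.add hP.norm)
  obtain ⟨k, hk, hki⟩ := exists_separated hn (hP.sub (hQ.const_mul b)) (sub_ne_zero.2 hpq)
  refine ⟨k, hk, ?_⟩
  filter_upwards [hki, hQ0] with i f1 f2
  have hq : 0 < ‖Q i‖ := norm_pos_iff.2 f2
  have e1 : P i / Q i - b = (P i - b * Q i) / Q i := by field_simp
  rw [Complex.norm_real, Real.norm_of_nonneg (by positivity)] at f1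
  rw [e1, norm_div, norm_div, le_div_iff₀ hq]
  refine le_trans (le_of_eq ?_) f1
  field_simp

/-- The position of `v₂` in the `n`-th chart of a branch, relative to the branch itself. -/
theorem exists_vTwo_sub {α : Fin 5 → ℂ → ℂ} (hα : ∀ i, AnalyticAt ℂ (α i) z₀) (ε : ℂ) {n : ℕ}
    (hn : 1 ≤ n) (hn' : n ≤ 4) :
    ∃ t : ℂ × ℂ → ℂ, ContinuousAt t (z₀, 0) ∧ t (z₀, 0) = branchPoint α ε n z₀ ∧
      ∀ z u v, vTwo α ε n z (u, v) - vTwo α ε 5 z (u, 0) = u ^ n * (v - t (z, u)) := by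
  have cb : ∀ n, ContinuousAt (branchPoint α ε n) (z₀, (0 : ℂ)).1 :=
    fun n => (analyticAt_branchPoint hα ε n).continuousAt
  have c1 := cb 1
  have c2 := cb 2
  have c3 := cb 3
  have c4 := cb 4
  interval_cases n
  · refine ⟨fun r => branchPoint α ε 1 r.1 + branchPoint α ε 2 r.1 * r.2
      + branchPoint α ε 3 r.1 * r.2 ^ 2 + branchPoint α ε 4 r.1 * r.2 ^ 3, by fun_prop, by simp, ?_⟩
    intro z u v
    simp only [vTwo_five]; simp only [vTwo, branchPoint]; ring
  · refine ⟨fun r => branchPoint α ε 2 r.1 + branchPoint α ε 3 r.1 * r.2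
      + branchPoint α ε 4 r.1 * r.2 ^ 2, by fun_prop, by simp, ?_⟩
    intro z u v
    simp only [vTwo_five]; simp only [vTwo, branchPoint]; ring
  · refine ⟨fun r => branchPoint α ε 3 r.1 + branchPoint α ε 4 r.1 * r.2, by fun_prop, by simp, ?_⟩
    intro z u v
    simp only [vTwo_five]; simp only [vTwo, branchPoint]; ring
  · refine ⟨fun r => branchPoint α ε 4 r.1, by fun_prop, by simp, ?_⟩
    intro z u v
    simp only [vTwo_five]; simp only [vTwo, branchPoint]; ring

theorem vTwo_zero {α : Fin 5 → ℂ → ℂ} {ε : ℂ} {n : ℕ} (hn : 1 ≤ n) (z v : ℂ) :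
    vTwo α ε n z (0, v) = ε := by
  induction n, hn using Nat.le_induction generalizing v with
  | base => simp [vTwo, branchPoint]
  | succ n hn ih => simp [vTwo, ih]

end

/-! ### The approach to the intermediate curves -/

section

variable {a₀ c : ℂ} {α₁ α₃ : ℂ → ℂ} {z₀ : ℂ} {E : ℂ → ℂ × ℂ → ℂ}

theorem tendsto_approach {κ : Chart} {q : ℂ × ℂ} {f : ℂ × ℂ × ℂ → ℂ} {a : ℂ}
    (hf : ContinuousAt f (z₀, q)) (ha : f (z₀, q) = a) : Tendsto f (approach κ z₀ q) (𝓝 a) :=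
  ha ▸ hf.tendsto.mono_left inf_le_left

theorem eventually_approach {κ : Chart} {q : ℂ × ℂ} :
    ∀ᶠ p in approach κ z₀ q, p ∈ finitePart κ := mem_inf_of_right (mem_principal_self _)

theorem affine_fst {κ : Chart} {p : ℂ × ℂ × ℂ} :
    (affine κ p).1 = (κ p.1 p.2).2.1 / (κ p.1 p.2).1 := rfl

theorem affine_snd {κ : Chart} {p : ℂ × ℂ × ℂ} :
    (affine κ p).2 = (κ p.1 p.2).2.2 / (κ p.1 p.2).1 := rfl

theorem chartE1_apply (z u v : ℂ) : chartE1 z (u, v) = (u, 1, u * v) := by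
  simp [chartE1, blowUp, chart0]

theorem chartE1'_apply (z U V : ℂ) : chartE1' z (U, V) = (U * V, 1, V) := by
  simp [chartE1', blowUp', chart0]

theorem chartE2'_apply (z U V : ℂ) : chartE2' z (U, V) = (U * V * V, 1, V) := by
  simp [chartE2', blowUp', chartE1'_apply]

theorem chartE8'_apply (z U V : ℂ) : chartE8' z (U, V) = (U * V, 1, U * V * V) := by
  simp [chartE8', blowUp', chartE1_apply]

/-- The approach to a point where `y` is infinite and `w = x / y²` is different from `1`
and `-1`. -/
def AtInfinity (κ : Chart) (z₀ : ℂ) (q : ℂ × ℂ) : Prop :=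
  Tendsto (fun p => ‖(affine κ p).2‖) (approach κ z₀ q) atTop ∧
    ∃ k > 0, ∀ᶠ p in approach κ z₀ q, k * (1 + ‖(affine κ p).1 * (affine κ p).2⁻¹ ^ 2‖) ≤
      ‖((affine κ p).1 * (affine κ p).2⁻¹ ^ 2) ^ 2 - 1‖

/-- The approach to a point of the curves over `E₂` at a branch `ε`. -/
def OnBranch (α : Fin 5 → ℂ → ℂ) (ε : ℂ) (κ : Chart) (z₀ : ℂ) (q : ℂ × ℂ) : Prop :=
  ∃ u v : ℂ × ℂ × ℂ → ℂ, Tendsto u (approach κ z₀ q) (𝓝 0) ∧ Tendsto v (approach κ z₀ q) (𝓝 ε) ∧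
    (∀ᶠ p in approach κ z₀ q, u p ≠ 0 ∧ affine κ p = (1 / (u p ^ 2 * v p), 1 / u p)) ∧
    ∃ k > 0, ∀ᶠ p in approach κ z₀ q, k * ‖u p‖ ^ 4 ≤ ‖v p - vTwo α ε 5 p.1 (u p, 0)‖

/-- The approach to a point where `x` is infinite, `y` takes the value `y₀`, and, if `y₀ = 0`, the
product `x y` stays away from `2 a₀`. -/
def AtFinite (a₀ y₀ : ℂ) (κ : Chart) (z₀ : ℂ) (q : ℂ × ℂ) : Prop :=
  Tendsto (fun p => (affine κ p).2) (approach κ z₀ q) (𝓝 y₀) ∧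
    Tendsto (fun p => ‖(affine κ p).1‖) (approach κ z₀ q) atTop ∧
    (y₀ ≠ 0 ∨ y₀ = 0 ∧ ∃ k > 0, ∀ᶠ p in approach κ z₀ q,
      k * (1 + ‖(affine κ p).1 * (affine κ p).2‖) ≤ ‖(affine κ p).1 * (affine κ p).2 - 2 * a₀‖)

/-- A sufficient condition for `AtInfinity`, with `w = P / Q` for continuous `P` and `Q`, where `Q` may
vanish at the limit point. -/
theorem atInfinity_of_ratio {κ : Chart} {q : ℂ × ℂ} {P Q : ℂ × ℂ × ℂ → ℂ}
    (hy : Tendsto (fun p => ‖(affine κ p).2‖) (approach κ z₀ q) atTop)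
    (hP : ContinuousAt P (z₀, q)) (hQ : ContinuousAt Q (z₀, q)) (hne : P (z₀, q) ^ 2 ≠ Q (z₀, q) ^ 2)
    (h : ∀ᶠ p in approach κ z₀ q, Q p ≠ 0 ∧ (affine κ p).1 * (affine κ p).2⁻¹ ^ 2 = P p / Q p) :
    AtInfinity κ z₀ q := by
  obtain ⟨k, hk, hki⟩ := exists_ratio_separated (tendsto_approach hP rfl) (tendsto_approach hQ rfl)
    hne (h.mono fun p h => h.1)
  refine ⟨hy, k, hk, ?_⟩
  filter_upwards [hki, h] with p f1 f2
  rwa [f2.2]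

/-- A quotient of continuous functions becomes infinite at a zero of its denominator. -/
theorem tendsto_affine_atTop {κ : Chart} {q : ℂ × ℂ} {f : ℂ × ℂ × ℂ → ℂ} {N D : ℂ × ℂ × ℂ → ℂ}
    (hN : ContinuousAt N (z₀, q)) (hD : ContinuousAt D (z₀, q)) (hN0 : N (z₀, q) ≠ 0)
    (hD0 : D (z₀, q) = 0) (h : ∀ᶠ p in approach κ z₀ q, D p ≠ 0 ∧ f p = N p / D p) :
    Tendsto (fun p => ‖f p‖) (approach κ z₀ q) atTop := by
  refine (tendsto_norm_div_atTop (tendsto_approach hN rfl) hN0 (tendsto_approach hD hD0)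
    (h.mono fun p h => h.1)).congr' ?_
  filter_upwards [h] with p hp
  rw [hp.2]

/-- The ways to approach the line at infinity and the intermediate curves: with `y` infinite and `w` off `±1`
(the line and `E₂`), with `w` near `±1` (`E₃^±` to `E₆^±`), and with `y` finite (`E₁` and `E₈`). -/
theorem IntermediatePoint.cases {α : Fin 5 → ℂ → ℂ} (hα : ∀ i, AnalyticAt ℂ (α i) z₀) {κ : Chart}
    {q : ℂ × ℂ} (h : IntermediatePoint α z₀ κ q) :
    AtInfinity κ z₀ q ∨ (∃ ε, (ε = 1 ∨ ε = -1) ∧ OnBranch α ε κ z₀ q) ∨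
      ∃ y₀, AtFinite (α 0 z₀) y₀ κ z₀ q := by
  have cu : ∀ q : ℂ × ℂ, ContinuousAt (fun p : ℂ × ℂ × ℂ => p.2.1) (z₀, q) := fun q =>
    (continuous_fst.comp continuous_snd).continuousAt
  have cv : ∀ q : ℂ × ℂ, ContinuousAt (fun p : ℂ × ℂ × ℂ => p.2.2) (z₀, q) := fun q =>
    (continuous_snd.comp continuous_snd).continuousAt
  have cuv : ∀ q : ℂ × ℂ, ContinuousAt (fun p : ℂ × ℂ × ℂ => p.2.1 * p.2.2) (z₀, q) := fun q =>
    (cu q).mul (cv q)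
  have cone : ∀ q : ℂ × ℂ, ContinuousAt (fun _ : ℂ × ℂ × ℂ => (1 : ℂ)) (z₀, q) := fun q =>
    continuousAt_const
  cases h with
  | line v hv =>
    have hv' : ∀ᶠ p in approach chart0 z₀ (0, v), p.2.2 ≠ 0 :=
      (tendsto_approach (cv (0, v)) rfl).eventually_ne hv
    left
    refine atInfinity_of_ratio (tendsto_affine_atTop (cv _) (cu _) hv rfl ?_) (cu _)
      ((cv _).pow 2) (fun h => hv (by simpa using h.symm)) ?_
    · filter_upwards [eventually_approach] with p hp using ⟨hp, rfl⟩
    · filter_upwards [eventually_approach, hv'] with p hp hpv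
      refine ⟨pow_ne_zero 2 hpv, ?_⟩
      have hp' : p.2.1 ≠ 0 := hp
      simp only [affine_fst, affine_snd, chart0, Pi.pow_apply]
      field_simp
  | line' U =>
    left
    refine atInfinity_of_ratio (tendsto_affine_atTop (cone _) (cv _) one_ne_zero rfl ?_)
      (cuv _) (cone _) (by simp) ?_
    · filter_upwards [eventually_approach] with p hp using ⟨hp, rfl⟩
    · filter_upwards [eventually_approach] with p hp
      refine ⟨one_ne_zero, ?_⟩
      have hp' : p.2.2 ≠ 0 := hp
      simp only [affine_fst, affine_snd, chart0']
      field_simp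
  | E1 v hv =>
    right; right
    refine ⟨v, ?_, ?_, Or.inl hv⟩
    · refine (tendsto_approach (cv (0, v)) rfl).congr' ?_
      filter_upwards [eventually_approach] with ⟨z, u, w⟩ hp
      have hp' : u ≠ 0 := by simpa [finitePart, chartE1_apply] using hp
      simp only [affine_snd, chartE1_apply]
      field_simp
    · refine tendsto_affine_atTop (cone _) (cu _) one_ne_zero rfl ?_
      filter_upwards [eventually_approach] with ⟨z, u, w⟩ hp
      have hp' : u ≠ 0 := by simpa [finitePart, chartE1_apply] using hp
      exact ⟨hp', by simp only [affine_fst, chartE1_apply]⟩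
  | E1' U hU =>
    right; right
    refine ⟨1 / U, ?_, ?_, Or.inl (one_div_ne_zero hU)⟩
    · refine (tendsto_approach (f := fun p => 1 / p.2.1) (q := (U, 0))
        (continuousAt_const.div (cu _) hU) rfl).congr' ?_
      filter_upwards [eventually_approach] with ⟨z, u, w⟩ hp
      have hp' : u ≠ 0 ∧ w ≠ 0 := by simpa [finitePart, chartE1'_apply] using hp
      obtain ⟨h1, h2⟩ := hp'
      simp only [affine_snd, chartE1'_apply]
      field_simp
    · refine tendsto_affine_atTop (cone _) (cuv _) one_ne_zero (mul_zero _) ?_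
      filter_upwards [eventually_approach] with ⟨z, u, w⟩ hp
      have hp' : u * w ≠ 0 := by simpa [finitePart, chartE1'_apply] using hp
      exact ⟨hp', by simp only [affine_fst, chartE1'_apply]⟩
  | E2 v hv hv' =>
    left
    have hfin : ∀ᶠ p in approach chartE2 z₀ (0, v), p.2.1 ≠ 0 ∧ p.2.2 ≠ 0 := by
      filter_upwards [eventually_approach] with ⟨z, u, w⟩ hp
      simpa [finitePart, chartE2_apply] using hp
    refine atInfinity_of_ratio (tendsto_affine_atTop (cone _) (cu _) one_ne_zero rfl ?_) (cone _)
      (cv _) (fun h => ?_) ?_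
    · filter_upwards [hfin] with ⟨z, u, w⟩ ⟨h1, h2⟩
      refine ⟨h1, ?_⟩
      simp only at h1 h2
      simp only [affine_snd, chartE2_apply]
      field_simp
    · have : v ^ 2 = 1 := by simpa using h.symm
      rcases sq_eq_sq_iff_eq_or_eq_neg.1 (this.trans (one_pow 2).symm) with h | h
      exacts [hv h, hv' h]
    · filter_upwards [hfin] with ⟨z, u, w⟩ ⟨h1, h2⟩
      refine ⟨h2, ?_⟩
      simp only at h1 h2
      simp only [affine_fst, affine_snd, chartE2_apply]
      field_simp
  | E2' U hU hU' =>
    left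
    have hfin : ∀ᶠ p in approach chartE2' z₀ (U, 0), p.2.1 ≠ 0 ∧ p.2.2 ≠ 0 := by
      filter_upwards [eventually_approach] with ⟨z, u, w⟩ hp
      simpa [finitePart, chartE2'_apply] using hp
    refine atInfinity_of_ratio (tendsto_affine_atTop (cone _) (cuv _) one_ne_zero
      (mul_zero _) ?_) (cu _) (cone _) (fun h => ?_) ?_
    · filter_upwards [hfin] with ⟨z, u, w⟩ ⟨h1, h2⟩
      refine ⟨mul_ne_zero h1 h2, ?_⟩
      simp only at h1 h2
      simp only [affine_snd, chartE2'_apply]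
      field_simp
    · have : U ^ 2 = 1 := by simpa using h
      rcases sq_eq_sq_iff_eq_or_eq_neg.1 (this.trans (one_pow 2).symm) with h | h
      exacts [hU h, hU' h]
    · filter_upwards [hfin] with ⟨z, u, w⟩ ⟨h1, h2⟩
      refine ⟨one_ne_zero, ?_⟩
      simp only at h1 h2
      simp only [affine_fst, affine_snd, chartE2'_apply]
      field_simp
  | branch ε hε n hn hn' v hv =>
    right; left
    obtain ⟨t, ht, ht0, hts⟩ := exists_vTwo_sub hα ε hn hn'
    have ht' : ContinuousAt (fun p : ℂ × ℂ × ℂ => t (p.1, p.2.1)) (z₀, (0 : ℂ), v) :=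
      ContinuousAt.comp (f := fun p : ℂ × ℂ × ℂ => (p.1, p.2.1)) ht (by fun_prop)
    refine ⟨ε, hε, fun p => p.2.1, fun p => vTwo α ε n p.1 p.2, tendsto_approach (cu _) rfl,
      tendsto_approach (contDiffAt_vTwo hα ε n (0, v)).continuousAt (vTwo_zero hn _ _), ?_, ?_⟩
    · filter_upwards [eventually_approach] with ⟨z, q⟩ hp
      exact ⟨(mem_finitePart_branchChart.1 hp).1, affine_branchChart hp⟩
    · obtain ⟨k, hk, hki⟩ := exists_separated (tendsto_approach (κ := branchChart α ε n) (cone (0, v))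
        rfl) (tendsto_approach ((cv _).sub ht') rfl) (by simpa [ht0, sub_eq_zero] using hv)
      refine ⟨k, hk, ?_⟩
      filter_upwards [hki, (tendsto_approach (cu (0, v)) rfl).norm.eventually_lt_const
        (show ‖(0 : ℂ)‖ < 1 by simp)] with ⟨z, u, w⟩ f1 f2
      simp only at f1 f2 ⊢
      rw [hts, norm_mul, norm_pow, mul_comm k]
      have : ‖u‖ ^ 4 ≤ ‖u‖ ^ n := pow_le_pow_of_le_one (norm_nonneg u) f2.le hn'
      refine mul_le_mul this ?_ hk.le (by positivity)
      simpa using f1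
  | branch' ε hε n hn hn' U hU =>
    right; left
    obtain ⟨t, ht, ht0, hts⟩ := exists_vTwo_sub hα ε hn hn'
    obtain ⟨m, rfl⟩ : ∃ m, n = m + 1 := ⟨n - 1, by omega⟩
    simp only [Nat.add_sub_cancel]
    have ht' : ContinuousAt (fun p : ℂ × ℂ × ℂ => t (p.1, p.2.1 * p.2.2)) (z₀, U, (0 : ℂ)) :=
      ContinuousAt.comp_of_eq (f := fun p : ℂ × ℂ × ℂ => (p.1, p.2.1 * p.2.2)) ht (by fun_prop)
        (by simp)
    have hfin : ∀ᶠ p in approach (branchChart' α ε m) z₀ (U, 0), p.2.1 ≠ 0 ∧ p.2.2 ≠ 0 := by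
      filter_upwards [eventually_approach] with ⟨z, u, w⟩ hp
      have := hp
      simp only [finitePart, mem_ofPred_eq, branchChart'_eq, chartE2_apply] at this
      exact ⟨left_ne_zero_of_mul (left_ne_zero_of_mul this),
        right_ne_zero_of_mul (left_ne_zero_of_mul this)⟩
    have cb : ContinuousAt (branchPoint α ε m) (z₀, U, (0 : ℂ)).1 :=
      (analyticAt_branchPoint hα ε m).continuousAt
    have hvc : ContinuousAt (fun p : ℂ × ℂ × ℂ =>
        vTwo α ε m p.1 (p.2.1 * p.2.2, p.2.2 + branchPoint α ε m p.1)) (z₀, U, (0 : ℂ)) :=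
      ContinuousAt.comp_of_eq (g := fun r : ℂ × ℂ × ℂ => vTwo α ε m r.1 r.2)
        (f := fun p : ℂ × ℂ × ℂ => (p.1, p.2.1 * p.2.2, p.2.2 + branchPoint α ε m p.1))
        (contDiffAt_vTwo hα ε m (0, branchPoint α ε m z₀)).continuousAt (by fun_prop) (by simp)
    refine ⟨ε, hε, fun p => p.2.1 * p.2.2, fun p => vTwo α ε m p.1 (p.2.1 * p.2.2,
      p.2.2 + branchPoint α ε m p.1), tendsto_approach (cuv _) (mul_zero _),
      tendsto_approach hvc ?_, ?_, ?_⟩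
    · simp only [mul_zero, zero_add]
      rcases m with - | m
      · rfl
      · exact vTwo_zero (by omega) _ _
    · filter_upwards [hfin, eventually_approach] with ⟨z, u, w⟩ ⟨h1, h2⟩ hp
      have h3 : vTwo α ε m z (u * w, w + branchPoint α ε m z) ≠ 0 := by
        have := hp
        simp only [finitePart, mem_ofPred_eq, branchChart'_eq, chartE2_apply] at this
        exact right_ne_zero_of_mul (right_ne_zero_of_mul this)
      refine ⟨mul_ne_zero h1 h2, ?_⟩
      simp only at h1 h2
      simp only [affine, branchChart'_eq, chartE2_apply, Prod.mk.injEq]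
      constructor <;> field_simp
    · obtain ⟨k, hk, hki⟩ := exists_separated
        (tendsto_approach (κ := branchChart' α ε m) (cu (U, 0)) rfl)
        (tendsto_approach ((cone _).sub ((cu _).mul ht')) rfl)
        (by
          simp only [Pi.sub_apply, Pi.mul_apply, mul_zero, ht0]
          exact sub_ne_zero.2 (Ne.symm hU))
      refine ⟨k, hk, ?_⟩
      filter_upwards [hki, hfin, (tendsto_approach (cuv (U, 0))
        (mul_zero _)).norm.eventually_lt_const (show ‖(0 : ℂ)‖ < 1 by simp)]
        with ⟨z, u, w⟩ f1 ⟨h1, h2⟩ f2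
      simp only at f1 f2 h1 h2 ⊢
      have e1 : vTwo α ε m z (u * w, w + branchPoint α ε m z) = vTwo α ε (m + 1) z (u * w, 1 / u) := by
        simp only [vTwo]
        congr 2
        field_simp
      rw [e1, hts, norm_mul ((u * w) ^ (m + 1)), norm_pow, mul_comm k]
      have : ‖u * w‖ ^ 4 ≤ ‖u * w‖ ^ (m + 1) := pow_le_pow_of_le_one (norm_nonneg _) f2.le hn'
      refine mul_le_mul this ?_ hk.le (by positivity)
      have e2 : 1 / u - t (z, u * w) = (1 - u * t (z, u * w)) / u := by field_simp
      rw [e2, norm_div, le_div_iff₀ (norm_pos_iff.2 h1)]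
      exact f1
  | E8 v hv =>
    right; right
    have hfin : ∀ᶠ p in approach chartE8 z₀ (0, v), p.2.1 ≠ 0 := by
      filter_upwards [eventually_approach] with ⟨z, u, w⟩ hp
      simpa [finitePart, chartE8_apply] using hp
    obtain ⟨k, hk, hki⟩ := exists_product_separated (b := 2 * α 0 z₀) (tendsto_approach
      (κ := chartE8) (cv (0, v)) rfl) (tendsto_approach (cone _) rfl) (by simpa using hv)
      (Eventually.of_forall fun _ => one_ne_zero)
    refine ⟨0, ?_, ?_, Or.inr ⟨rfl, k, hk, ?_⟩⟩
    · refine (tendsto_approach (f := fun p => p.2.1 * p.2.2) (q := (0, v))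
        (cuv _) (zero_mul _)).congr' ?_
      filter_upwards [hfin] with ⟨z, u, w⟩ hp
      simp only at hp
      simp only [affine_snd, chartE8_apply]
      field_simp
    · refine tendsto_affine_atTop (cone _) (cu _) one_ne_zero rfl ?_
      filter_upwards [hfin] with ⟨z, u, w⟩ hp
      exact ⟨hp, by simp only [affine_fst, chartE8_apply]⟩
    · filter_upwards [hki, hfin] with ⟨z, u, w⟩ f1 hp
      simp only at hp
      have : (affine chartE8 (z, u, w)).1 * (affine chartE8 (z, u, w)).2 = w / 1 := by
        simp only [affine_fst, affine_snd, chartE8_apply]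
        field_simp
      rw [this]
      exact f1
  | E8' U hU =>
    right; right
    have hfin : ∀ᶠ p in approach chartE8' z₀ (U, 0), p.2.1 ≠ 0 ∧ p.2.2 ≠ 0 := by
      filter_upwards [eventually_approach] with ⟨z, u, w⟩ hp
      simpa [finitePart, chartE8'_apply] using hp
    obtain ⟨k, hk, hki⟩ := exists_product_separated (b := 2 * α 0 z₀) (tendsto_approach
      (κ := chartE8') (cone (U, 0)) rfl) (tendsto_approach (cu _) rfl)
      (by simpa [mul_comm] using hU.symm) (hfin.mono fun _ h => h.1)
    refine ⟨0, ?_, ?_, Or.inr ⟨rfl, k, hk, ?_⟩⟩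
    · refine (tendsto_approach (cv (U, 0)) rfl).congr' ?_
      filter_upwards [hfin] with ⟨z, u, w⟩ ⟨h1, h2⟩
      simp only at h1 h2
      simp only [affine_snd, chartE8'_apply]
      field_simp
    · refine tendsto_affine_atTop (cone _) (cuv _) one_ne_zero (mul_zero _) ?_
      filter_upwards [hfin] with ⟨z, u, w⟩ ⟨h1, h2⟩
      exact ⟨mul_ne_zero h1 h2, by simp only [affine_fst, chartE8'_apply]⟩
    · filter_upwards [hki, hfin] with ⟨z, u, w⟩ f1 ⟨h1, h2⟩
      simp only at h1 h2
      have : (affine chartE8' (z, u, w)).1 * (affine chartE8' (z, u, w)).2 = 1 / u := by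
        simp only [affine_fst, affine_snd, chartE8'_apply]
        field_simp
      rw [this]
      exact f1

end

/-! ### Energies at the exceptional curves -/

section

variable {a₀ c : ℂ} {α₁ α₃ : ℂ → ℂ} {z₀ : ℂ} {E : ℂ → ℂ × ℂ → ℂ}

theorem tendsto_approach_fst {κ : Chart} {q : ℂ × ℂ} :
    Tendsto (fun p : ℂ × ℂ × ℂ => p.1) (approach κ z₀ q) (𝓝 z₀) :=
  tendsto_approach continuous_fst.continuousAt rfl

/-- Lower bounds for energies near the line at infinity and the intermediate exceptional curves. -/
theorem IntermediatePoint.lower (h1 : AnalyticAt ℂ α₁ z₀) (h3 : AnalyticAt ℂ α₃ z₀)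
    {κ : Chart} {q : ℂ × ℂ} (h : IntermediatePoint (normalised a₀ c α₁ α₃) z₀ κ q)
    (hE : EnergyAtInfinity a₀ c α₁ α₃ z₀ E)
    (hE' : ∀ y₀, Tendsto (fun p => (affine κ p).2) (approach κ z₀ q) (𝓝 y₀) →
      EnergyAt a₀ c α₁ α₃ z₀ y₀ E) :
    ∃ k > 0, (Tendsto (fun p => ‖(affine κ p).2‖) (approach κ z₀ q) atTop ∧
      ∀ᶠ p in approach κ z₀ q, k * (‖(affine κ p).2‖ *
        (1 + ‖(affine κ p).1 * (affine κ p).2⁻¹ ^ 2‖)) ≤ ‖E p.1 (affine κ p)‖) ∨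
      ∃ y₀, Tendsto (fun p => (affine κ p).2) (approach κ z₀ q) (𝓝 y₀) ∧
        Tendsto (fun p => ‖(affine κ p).1‖) (approach κ z₀ q) atTop ∧
        ∀ᶠ p in approach κ z₀ q, k * (‖(affine κ p).1‖ *
          (1 + ‖(affine κ p).1 * (affine κ p).2‖)) ≤ ‖E p.1 (affine κ p)‖ := by
  rcases h.cases (analyticAt_normalised h1 h3 a₀ c) with ⟨hy, k, hk, hw⟩ | ⟨ε, hε, u, v, hu, hv, ha, k, hk, hd⟩
    | ⟨y₀, hy, hx, hxy⟩
  · obtain ⟨k', hk', h5⟩ := hE.lower h1 h3 tendsto_approach_fst hy hk hw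
    exact ⟨k', hk', Or.inl ⟨hy, h5⟩⟩
  · obtain ⟨C, hC, hCE⟩ := hE.branch h1 h3 hε
    have hp : Tendsto (fun p : ℂ × ℂ × ℂ => (p.1, u p, v p)) (approach κ z₀ q) (𝓝 (z₀, 0, ε)) :=
      tendsto_approach_fst.prodMk_nhds (hu.prodMk_nhds hv)
    have hy : Tendsto (fun p => ‖(affine κ p).2‖) (approach κ z₀ q) atTop := by
      refine (tendsto_norm_div_atTop (tendsto_const_nhds (x := (1 : ℂ))) one_ne_zero hu
        (ha.mono fun p h => h.1)).congr' ?_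
      filter_upwards [ha] with p hp
      rw [hp.2]
    have hε2 : ‖ε‖ = 1 := by rcases hε with rfl | rfl <;> simp
    have hvn := hv.norm
    rw [hε2] at hvn
    refine ⟨k / (8 * C), by positivity, Or.inl ⟨hy, ?_⟩⟩
    filter_upwards [hp.eventually hCE, ha, hd, hy.eventually_ge_atTop (2 * C / k),
      hvn.eventually_const_lt (show (1 / 2 : ℝ) < 1 by norm_num)] with p f1 f2 f3 f4 f5
    obtain ⟨hu0, hxy⟩ := f2
    obtain ⟨f6, -⟩ := f1 hu0
    rw [hxy] at f4 ⊢
    simp only at f4 f6 ⊢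
    have hun : 0 < ‖u p‖ := norm_pos_iff.2 hu0
    have hw : ‖1 / (u p ^ 2 * v p) * (1 / u p)⁻¹ ^ 2‖ ≤ 2 := by
      have e1 : 1 / (u p ^ 2 * v p) * (1 / u p)⁻¹ ^ 2 = (v p)⁻¹ := by
        rcases eq_or_ne (v p) 0 with h | h
        · simp [h]
        · field_simp
      rw [e1, norm_inv]
      exact inv_le_of_inv_le₀ (by norm_num) (by linarith)
    -- `k |u|⁴ ≤ |v₂ - branch| ≤ C |u|⁵ (1 + |E|)`, so that `|E|` is at least of the order of `1 / |u|`
    have f7 := f3.trans f6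
    set e := ‖E p.1 (1 / (u p ^ 2 * v p), 1 / u p)‖ with he
    rw [norm_div, norm_one] at f4 ⊢
    have f8 : k ≤ C * ‖u p‖ * (1 + e) := by
      have h4 : 0 < ‖u p‖ ^ 4 := by positivity
      refine le_of_mul_le_mul_right ?_ h4
      linarith
    have f9 : k * (1 / ‖u p‖) ≤ C * (1 + e) := by
      rw [mul_one_div, div_le_iff₀ hun]
      linarith
    rw [div_le_iff₀ hk] at f4
    have f10 : k / (8 * C) * (1 / ‖u p‖ * (1 + ‖1 / (u p ^ 2 * v p) * (1 / u p)⁻¹ ^ 2‖)) ≤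
        k / (8 * C) * (1 / ‖u p‖ * 3) := by gcongr; linarith
    refine f10.trans ?_
    rw [div_mul_eq_mul_div, div_le_iff₀ (by positivity)]
    have : 0 ≤ C * e := by positivity
    linarith
  · obtain ⟨k', hk', h5⟩ := (hE' y₀ hy).lower h1 h3 tendsto_approach_fst hy hx hxy
    exact ⟨k', hk', Or.inr ⟨y₀, hy, hx, h5⟩⟩

/-- Energies become infinite at the line at infinity and at the intermediate curves. -/
theorem IntermediatePoint.tendsto_atTop (h1 : AnalyticAt ℂ α₁ z₀) (h3 : AnalyticAt ℂ α₃ z₀)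
    {κ : Chart} {q : ℂ × ℂ} (h : IntermediatePoint (normalised a₀ c α₁ α₃) z₀ κ q)
    (hE : EnergyAtInfinity a₀ c α₁ α₃ z₀ E)
    (hE' : ∀ y₀, Tendsto (fun p => (affine κ p).2) (approach κ z₀ q) (𝓝 y₀) →
      EnergyAt a₀ c α₁ α₃ z₀ y₀ E) :
    Tendsto (fun p => ‖E p.1 (affine κ p)‖) (approach κ z₀ q) atTop := by
  obtain ⟨k, hk, ⟨hy, h5⟩ | ⟨y₀, -, hx, h5⟩⟩ := h.lower h1 h3 hE hE'
  · refine tendsto_atTop_mono' _ ?_ (hy.const_mul_atTop hk)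
    filter_upwards [h5] with p hp
    exact (mul_le_mul_of_nonneg_left (le_mul_of_one_le_right (norm_nonneg _)
      (le_add_of_nonneg_right (norm_nonneg _))) hk.le).trans hp
  · refine tendsto_atTop_mono' _ ?_ (hx.const_mul_atTop hk)
    filter_upwards [h5] with p hp
    exact (mul_le_mul_of_nonneg_left (le_mul_of_one_le_right (norm_nonneg _)
      (le_add_of_nonneg_right (norm_nonneg _))) hk.le).trans hp

/-- Energies become infinite at the points where a final curve meets the preceding one: in the second charts
they are of the size of `1 / U`, because `v₇ = 1 / U` on `E₇^ε`, and `v₉ = 1 / U` on `E₉`. -/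
theorem CornerPoint.tendsto_atTop (h1 : AnalyticAt ℂ α₁ z₀) (h3 : AnalyticAt ℂ α₃ z₀)
    {κ : Chart} {q : ℂ × ℂ} (h : CornerPoint (normalised a₀ c α₁ α₃) κ q)
    (hE : EnergyAtInfinity a₀ c α₁ α₃ z₀ E) (hE' : EnergyAt a₀ c α₁ α₃ z₀ 0 E) :
    Tendsto (fun p => ‖E p.1 (affine κ p)‖) (approach κ z₀ q) atTop := by
  set α := normalised a₀ c α₁ α₃ with hα
  have hαa := analyticAt_normalised h1 h3 a₀ c
  have cu : ContinuousAt (fun p : ℂ × ℂ × ℂ => p.2.1) (z₀, 0, 0) :=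
    (continuous_fst.comp continuous_snd).continuousAt
  have cv : ContinuousAt (fun p : ℂ × ℂ × ℂ => p.2.2) (z₀, 0, 0) :=
    (continuous_snd.comp continuous_snd).continuousAt
  cases h with
  | E7 ε hε =>
    obtain ⟨C, hC, hCE⟩ := hE.branch h1 h3 hε
    rw [← hα] at hCE
    have hfin : ∀ᶠ p in approach (chartE7' α ε) z₀ (0, 0), p.2.1 ≠ 0 ∧ p.2.2 ≠ 0 ∧
        affine (chartE7' α ε) p = (1 / ((p.2.1 * p.2.2) ^ 2 * vTwo α ε 5 p.1 (p.2.1 * p.2.2, 1 / p.2.1)),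
          1 / (p.2.1 * p.2.2)) := by
      filter_upwards [eventually_approach] with ⟨z, U, V⟩ hp
      have h4 := hp
      simp only [finitePart, mem_ofPred_eq, chartE7', branchChart'_eq, chartE2_apply] at h4
      have hU : U ≠ 0 := left_ne_zero_of_mul (left_ne_zero_of_mul h4)
      have hV : V ≠ 0 := right_ne_zero_of_mul (left_ne_zero_of_mul h4)
      refine ⟨hU, hV, ?_⟩
      have h5 : affine (chartE7' α ε) (z, U, V) = affine (branchChart α ε 5) (z, U * V, 1 / U) := by
        simp only [affine, chartE7', branchChart'_eq_branchChart α ε 4 z hU]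
      rw [h5, affine_branchChart]
      have h6 := hp
      simp only [finitePart, mem_ofPred_eq, chartE7', branchChart'_eq_branchChart α ε 4 z hU] at h6
      exact h6
    have cb : ∀ n, ContinuousAt (branchPoint α ε n) (z₀, (0 : ℂ), (0 : ℂ)).1 :=
      fun n => (analyticAt_branchPoint hαa ε n).continuousAt
    have hv : Tendsto (fun p : ℂ × ℂ × ℂ => vTwo α ε 5 p.1 (p.2.1 * p.2.2, 1 / p.2.1))
        (approach (chartE7' α ε) z₀ (0, 0)) (𝓝 ε) := by
      have b1 := cb 1
      have b2 := cb 2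
      have b3 := cb 3
      have b4 := cb 4
      have hc : ContinuousAt (fun p : ℂ × ℂ × ℂ => ε + branchPoint α ε 1 p.1 * (p.2.1 * p.2.2)
          + branchPoint α ε 2 p.1 * (p.2.1 * p.2.2) ^ 2 + branchPoint α ε 3 p.1 * (p.2.1 * p.2.2) ^ 3
          + branchPoint α ε 4 p.1 * (p.2.1 * p.2.2) ^ 4 + p.2.1 ^ 4 * p.2.2 ^ 5) (z₀, 0, 0) := by
        fun_prop
      refine (tendsto_approach (κ := chartE7' α ε) hc (a := ε) (by simp)).congr' ?_
      filter_upwards [hfin] with p hp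
      rw [vTwo_five]
      have := hp.1
      field_simp
    have hp : Tendsto (fun p : ℂ × ℂ × ℂ => (p.1, p.2.1 * p.2.2,
        vTwo α ε 5 p.1 (p.2.1 * p.2.2, 1 / p.2.1))) (approach (chartE7' α ε) z₀ (0, 0))
        (𝓝 (z₀, 0, ε)) :=
      tendsto_approach_fst.prodMk_nhds ((tendsto_approach (cu.mul cv) (mul_zero _)).prodMk_nhds hv)
    have hU : Tendsto (fun p : ℂ × ℂ × ℂ => ‖1 / p.2.1‖) (approach (chartE7' α ε) z₀ (0, 0)) atTop :=
      tendsto_norm_div_atTop tendsto_const_nhds one_ne_zero (tendsto_approach cu rfl)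
        (hfin.mono fun p h => h.1)
    refine tendsto_atTop_mono' _ ?_ (tendsto_atTop_add_const_right _ (-1)
      (hU.const_mul_atTop (inv_pos.2 hC)))
    filter_upwards [hp.eventually hCE, hfin] with p f1 ⟨hU0, hV0, hxy⟩
    obtain ⟨f2, -⟩ := f1 (mul_ne_zero hU0 hV0)
    rw [hxy]
    simp only [vTwo_five, mul_zero, add_zero, add_sub_cancel_left] at f2 ⊢
    rw [norm_mul ((p.2.1 * p.2.2) ^ 5), norm_pow, mul_left_comm] at f2
    have f3 := le_of_mul_le_mul_left f2 (pow_pos (norm_pos_iff.2 (mul_ne_zero hU0 hV0)) 5)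
    have f4 := (inv_mul_le_iff₀ hC).2 f3
    linarith
  | E9 =>
    obtain ⟨C, hC, hCE⟩ := hE'.approx h1 h3
    have hfin : ∀ᶠ p in approach (chartE9' α) z₀ (0, 0), p.2.1 ≠ 0 ∧ p.2.2 ≠ 0 ∧
        affine (chartE9' α) p = (1 / (p.2.1 * p.2.2), p.2.1 * p.2.2 * (p.2.2 + 2 * a₀)) := by
      filter_upwards [eventually_approach] with ⟨z, U, V⟩ hp
      have h4 : U ≠ 0 ∧ V ≠ 0 := by simpa [finitePart, chartE9'_apply] using hp
      obtain ⟨hU, hV⟩ := h4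
      refine ⟨hU, hV, ?_⟩
      have h0 : α 0 z = a₀ := rfl
      simp only [affine, chartE9'_apply, h0, Prod.mk.injEq, true_and]
      field_simp
    have hU : Tendsto (fun p : ℂ × ℂ × ℂ => ‖1 / p.2.1‖) (approach (chartE9' α) z₀ (0, 0)) atTop :=
      tendsto_norm_div_atTop tendsto_const_nhds one_ne_zero (tendsto_approach cu rfl)
        (hfin.mono fun p h => h.1)
    have hy : Tendsto (fun p : ℂ × ℂ × ℂ => p.2.1 * p.2.2 * (p.2.2 + 2 * a₀))
        (approach (chartE9' α) z₀ (0, 0)) (𝓝 0) :=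
      tendsto_approach ((cu.mul cv).mul (cv.add continuousAt_const)) (by simp)
    have hm : Tendsto (fun p : ℂ × ℂ × ℂ => p.2.2 + 2 * a₀)
        (approach (chartE9' α) z₀ (0, 0)) (𝓝 (2 * a₀)) :=
      tendsto_approach (cv.add continuousAt_const) (by simp)
    have hb := ((hm.norm.mul hy.norm).const_mul C)
    rw [norm_zero, mul_zero, mul_zero] at hb
    refine tendsto_atTop_mono' _ ?_ (tendsto_atTop_add_const_right _ (-(C + 1))
      (hU.const_mul_atTop (show (0 : ℝ) < 1 / 2 by norm_num)))
    filter_upwards [(tendsto_approach_fst.prodMk_nhds hy).eventually hCE, hfin,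
      hb.eventually_lt_const one_pos] with p f1 ⟨hU0, hV0, hxy⟩ f2
    rw [hxy]
    obtain ⟨θ, hθ, hEq⟩ := f1 (1 / (p.2.1 * p.2.2))
    set y := p.2.1 * p.2.2 * (p.2.2 + 2 * a₀) with hy
    set x := 1 / (p.2.1 * p.2.2) with hx
    have hxy' : x * y = p.2.2 + 2 * a₀ := by rw [hx, hy]; field_simp
    have e1 : 1 / 2 * x * (x * y - 2 * a₀ + 2 * θ) = 1 / 2 * (1 / p.2.1) + x * θ := by
      rw [hxy', hx]; field_simp; ring
    have e2 : ‖x * θ‖ ≤ 1 := by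
      rw [norm_mul]
      refine (mul_le_mul_of_nonneg_left hθ (norm_nonneg x)).trans ?_
      have : ‖x‖ * (C * ‖y‖ ^ 2) = C * (‖x * y‖ * ‖y‖) := by rw [norm_mul x y]; ring
      rw [this, hxy']
      exact f2.le
    rw [e1] at hEq
    have e3 : ‖1 / 2 * (1 / p.2.1)‖ = 1 / 2 * ‖1 / p.2.1‖ := by rw [norm_mul]; norm_num
    have e4 : 1 / 2 * (1 / p.2.1) = E p.1 (x, y) - (E p.1 (x, y) - (1 / 2 * (1 / p.2.1) + x * θ))
        - x * θ := by ring
    have e5 : ‖1 / 2 * (1 / p.2.1)‖ ≤ ‖E p.1 (x, y)‖ + C + 1 := by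
      rw [e4]
      exact (norm_sub_le _ _).trans (add_le_add ((norm_sub_le _ _).trans (add_le_add le_rfl hEq)) e2)
    rw [e3] at e5
    linarith

/-- Energies are bounded near the points of the final curves `E₇^ε`. -/
theorem EnergyAtInfinity.bounded_e7 (h1 : AnalyticAt ℂ α₁ z₀) (h3 : AnalyticAt ℂ α₃ z₀)
    (hE : EnergyAtInfinity a₀ c α₁ α₃ z₀ E) {ε : ℂ} (hε : ε = 1 ∨ ε = -1) (v₀ : ℂ) :
    ∃ K : ℝ, ∀ᶠ p in approach (chartE7 (normalised a₀ c α₁ α₃) ε) z₀ (0, v₀),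
      ‖E p.1 (affine (chartE7 (normalised a₀ c α₁ α₃) ε) p)‖ ≤ K := by
  set α := normalised a₀ c α₁ α₃ with hα
  have hαa := analyticAt_normalised h1 h3 a₀ c
  obtain ⟨C, hC, hCE⟩ := hE.branch h1 h3 hε
  rw [← hα] at hCE
  have cu : ContinuousAt (fun p : ℂ × ℂ × ℂ => p.2.1) (z₀, 0, v₀) :=
    (continuous_fst.comp continuous_snd).continuousAt
  have cv : ContinuousAt (fun p : ℂ × ℂ × ℂ => p.2.2) (z₀, 0, v₀) :=
    (continuous_snd.comp continuous_snd).continuousAt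
  have hp : Tendsto (fun p : ℂ × ℂ × ℂ => (p.1, p.2.1, vTwo α ε 5 p.1 p.2))
      (approach (chartE7 α ε) z₀ (0, v₀)) (𝓝 (z₀, 0, ε)) :=
    tendsto_approach_fst.prodMk_nhds ((tendsto_approach cu rfl).prodMk_nhds
      (tendsto_approach (contDiffAt_vTwo hαa ε 5 (0, v₀)).continuousAt (vTwo_zero (by norm_num) _ _)))
  refine ⟨C * (‖v₀‖ + 1 + 1), ?_⟩
  filter_upwards [hp.eventually hCE, eventually_approach,
    (tendsto_approach cv rfl).norm.eventually_lt_const (lt_add_one _)] with ⟨z, u, v⟩ f1 f2 f3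
  rw [chartE7, affine_branchChart f2]
  have hu : u ≠ 0 := (mem_finitePart_branchChart.1 f2).1
  obtain ⟨-, f4⟩ := f1 hu
  simp only [vTwo_five, mul_zero, add_zero, add_sub_cancel_left] at f3 f4 ⊢
  have h5 : 0 < ‖u‖ ^ 5 := pow_pos (norm_pos_iff.2 hu) 5
  rw [norm_mul, norm_pow] at f4
  refine le_of_mul_le_mul_left (f4.trans ?_) h5
  have : C * (‖u‖ ^ 5 * ‖v‖ + ‖u‖ ^ 5) = ‖u‖ ^ 5 * (C * (‖v‖ + 1)) := by ring
  rw [this]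
  gcongr

/-- Energies are bounded near the points of the final curve `E₉`. -/
theorem EnergyAt.bounded_e9 (h1 : AnalyticAt ℂ α₁ z₀) (h3 : AnalyticAt ℂ α₃ z₀)
    (hE : EnergyAt a₀ c α₁ α₃ z₀ 0 E) (v₀ : ℂ) :
    ∃ K : ℝ, ∀ᶠ p in approach (chartE9 (normalised a₀ c α₁ α₃)) z₀ (0, v₀),
      ‖E p.1 (affine (chartE9 (normalised a₀ c α₁ α₃)) p)‖ ≤ K := by
  set α := normalised a₀ c α₁ α₃ with hα
  obtain ⟨C, hC, hCE⟩ := hE.approx h1 h3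
  have cu : ContinuousAt (fun p : ℂ × ℂ × ℂ => p.2.1) (z₀, 0, v₀) :=
    (continuous_fst.comp continuous_snd).continuousAt
  have cv : ContinuousAt (fun p : ℂ × ℂ × ℂ => p.2.2) (z₀, 0, v₀) :=
    (continuous_snd.comp continuous_snd).continuousAt
  have cm : ContinuousAt (fun p : ℂ × ℂ × ℂ => p.2.1 * p.2.2 + 2 * a₀) (z₀, 0, v₀) :=
    (cu.mul cv).add continuousAt_const
  have hm : Tendsto (fun p : ℂ × ℂ × ℂ => p.2.1 * p.2.2 + 2 * a₀) (approach (chartE9 α) z₀ (0, v₀))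
      (𝓝 (2 * a₀)) := tendsto_approach cm (by simp)
  have hy : Tendsto (fun p : ℂ × ℂ × ℂ => p.2.1 * (p.2.1 * p.2.2 + 2 * a₀))
      (approach (chartE9 α) z₀ (0, v₀)) (𝓝 0) := tendsto_approach (cu.mul cm) (by simp)
  have hb := ((hm.norm.mul hy.norm).const_mul C)
  rw [norm_zero, mul_zero, mul_zero] at hb
  refine ⟨C + 1 / 2 * (‖v₀‖ + 1) + 1, ?_⟩
  filter_upwards [(tendsto_approach_fst.prodMk_nhds hy).eventually hCE, eventually_approach,
    hb.eventually_lt_const one_pos,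
    (tendsto_approach cv rfl).norm.eventually_lt_const (lt_add_one _)] with p f1 f2 f3 f4
  have hu := mem_finitePart_e9.1 f2
  have h0 : α 0 p.1 = a₀ := rfl
  rw [affine_e9 hu, h0]
  obtain ⟨θ, hθ, hEq⟩ := f1 (1 / p.2.1)
  set y := p.2.1 * (p.2.1 * p.2.2 + 2 * a₀) with hy
  set x := 1 / p.2.1 with hx
  have hxy' : x * y = p.2.1 * p.2.2 + 2 * a₀ := by rw [hx, hy]; field_simp
  have e1 : 1 / 2 * x * (x * y - 2 * a₀ + 2 * θ) = 1 / 2 * p.2.2 + x * θ := by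
    rw [hxy', hx]; field_simp; ring
  have e2 : ‖x * θ‖ ≤ 1 := by
    rw [norm_mul]
    refine (mul_le_mul_of_nonneg_left hθ (norm_nonneg x)).trans ?_
    have : ‖x‖ * (C * ‖y‖ ^ 2) = C * (‖x * y‖ * ‖y‖) := by rw [norm_mul x y]; ring
    rw [this, hxy']
    exact f3.le
  rw [e1] at hEq
  have e3 : ‖1 / 2 * p.2.2‖ ≤ 1 / 2 * (‖v₀‖ + 1) := by
    rw [norm_mul]
    have : ‖(1 / 2 : ℂ)‖ = 1 / 2 := by norm_num
    rw [this]
    linarith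
  have e4 : E p.1 (x, y) = (E p.1 (x, y) - (1 / 2 * p.2.2 + x * θ)) + 1 / 2 * p.2.2 + x * θ := by
    ring
  rw [e4]
  exact (norm_add₃_le).trans (add_le_add (add_le_add hEq e3) e2)

end

/-! ### Inaccessibility -/

section

variable {a₀ c : ℂ} {α₁ α₃ : ℂ → ℂ} {z₀ : ℂ}

theorem energyAtInfinity_modifiedEnergy (h1 : AnalyticAt ℂ α₁ z₀) (h3 : AnalyticAt ℂ α₃ z₀)
    (a₀ c : ℂ) : EnergyAtInfinity a₀ c α₁ α₃ z₀ (modifiedEnergy a₀ c α₁ α₃) := by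
  obtain ⟨M, hM, e1⟩ := exists_coeff_bound h1 h3 a₀ c
  refine ⟨M, 2, ?_⟩
  filter_upwards [e1] with z ⟨_, hg, hk, _⟩ x y hy
  have hu : ‖y⁻¹‖ ≤ 1 := by rw [norm_inv]; exact inv_le_one_of_one_le₀ (by linarith)
  refine ⟨gCoeff c α₁ α₃ z * y⁻¹, kCoeff a₀ α₃ z * y⁻¹, ?_, ?_, ?_⟩
  · rw [norm_mul]; exact (mul_le_of_le_one_right (norm_nonneg _) hu).trans hg
  · rw [norm_mul]; exact (mul_le_of_le_one_right (norm_nonneg _) hu).trans hk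
  · rw [modifiedEnergy_of_le_norm (by simp only; nlinarith), outerEnergy, outerTerm]
    ring

theorem energyAt_modifiedEnergy (h1 : AnalyticAt ℂ α₁ z₀) (h3 : AnalyticAt ℂ α₃ z₀) (a₀ c y₀ : ℂ) :
    EnergyAt a₀ c α₁ α₃ z₀ y₀ (modifiedEnergy a₀ c α₁ α₃) := by
  obtain ⟨M, hM, e1⟩ := exists_coeff_bound h1 h3 a₀ c
  refine ⟨2 * M, ?_⟩
  filter_upwards [(continuous_fst.tendsto (z₀, y₀)).eventually e1] with ⟨z, y⟩ ⟨hA, hg, hk, _⟩ x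
  simp only at hA hg hk ⊢
  rcases le_or_gt (‖y‖ ^ 2) 1 with hy | hy
  · refine ⟨0, 0, by rw [norm_zero]; positivity, by rw [norm_zero]; positivity, ?_⟩
    rw [modifiedEnergy_of_norm_le hy]
    ring
  · have hy1 : 1 ≤ ‖y‖ := (one_le_sq_iff₀ (norm_nonneg y)).1 hy.le
    have hu : ‖y⁻¹‖ ≤ 1 := by rw [norm_inv]; exact inv_le_one_of_one_le₀ hy1
    have hχ : ‖(Real.smoothTransition (‖y‖ ^ 2 - 1) : ℂ)‖ ≤ 1 := by
      rw [Complex.norm_real, Real.norm_of_nonneg (Real.smoothTransition.nonneg _)]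
      exact Real.smoothTransition.le_one _
    refine ⟨(Real.smoothTransition (‖y‖ ^ 2 - 1) : ℂ) * (1 / 2 - auxCoeff α₃ z / 2 * y⁻¹
      + gCoeff c α₁ α₃ z * y⁻¹ ^ 3), (Real.smoothTransition (‖y‖ ^ 2 - 1) : ℂ) * (kCoeff a₀ α₃ z * y⁻¹),
      ?_, ?_, ?_⟩
    · rw [norm_mul]
      refine (mul_le_of_le_one_left (norm_nonneg _) hχ).trans ?_
      exact (norm_outer_coeff_le hM hA hg hu).trans (le_mul_of_one_le_right (by positivity) hy.le)
    · rw [norm_mul, norm_mul]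
      exact (mul_le_of_le_one_left (by positivity) hχ).trans
        ((mul_le_of_le_one_right (norm_nonneg _) hu).trans (by linarith))
    · rw [modifiedEnergy, outerTerm]
      ring

theorem auxDenom_normalised (z : ℂ) (p : ℂ × ℂ) :
    auxDenom (normalised a₀ c α₁ α₃) z p = p.2 ^ 2 + auxCoeff α₃ z * p.2 - 1 := rfl

/-- The fraction in the auxiliary function has the expansion `x (1/2 - A₁/(2y) + O(y⁻²))` as well. -/
theorem energyAtInfinity_aux (h1 : AnalyticAt ℂ α₁ z₀) (h3 : AnalyticAt ℂ α₃ z₀) (a₀ c : ℂ) :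
    EnergyAtInfinity a₀ c α₁ α₃ z₀ (aux (normalised a₀ c α₁ α₃)) := by
  obtain ⟨M, hM, e1⟩ := exists_coeff_bound h1 h3 a₀ c
  refine ⟨M ^ 2 + 1 + M, 4 * M, ?_⟩
  filter_upwards [e1] with z ⟨hA, _⟩ x y hy
  have hy0 : y ≠ 0 := fun h => by rw [h, norm_zero] at hy; linarith
  have hu : ‖y⁻¹‖ ≤ 1 := by rw [norm_inv]; exact inv_le_one_of_one_le₀ (by linarith)
  have hu4 : ‖y⁻¹‖ ≤ 1 / 4 := by
    rw [norm_inv]; exact inv_le_of_inv_le₀ (by norm_num) (by linarith)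
  set A := auxCoeff α₃ z with hAdef
  have hAu : ‖A * y⁻¹‖ ≤ 1 / 4 := by
    have hypos : 0 < ‖y‖ := norm_pos_iff.2 hy0
    rw [norm_mul, norm_inv, ← div_eq_mul_inv, div_le_iff₀ hypos]
    linarith
  have hd : 1 / 2 ≤ ‖1 + A * y⁻¹ - y⁻¹ ^ 2‖ := by
    have h2 : ‖y⁻¹ ^ 2‖ ≤ 1 / 4 := by
      rw [norm_pow]; nlinarith [norm_nonneg y⁻¹]
    have h4 : (1 : ℂ) = (1 + A * y⁻¹ - y⁻¹ ^ 2) - A * y⁻¹ + y⁻¹ ^ 2 := by ring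
    have h5 : ‖(1 : ℂ)‖ ≤ ‖1 + A * y⁻¹ - y⁻¹ ^ 2‖ + ‖A * y⁻¹‖ + ‖y⁻¹ ^ 2‖ := by
      conv_lhs => rw [h4]
      exact (norm_add_le _ _).trans (add_le_add (norm_sub_le _ _) le_rfl)
    rw [norm_one] at h5
    linarith
  have hd0 : 1 + A * y⁻¹ - y⁻¹ ^ 2 ≠ 0 := fun h => by rw [h, norm_zero] at hd; linarith
  have hD0 : y ^ 2 + A * y - 1 ≠ 0 := by
    have : y ^ 2 + A * y - 1 = y ^ 2 * (1 + A * y⁻¹ - y⁻¹ ^ 2) := by field_simp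
    rw [this]
    exact mul_ne_zero (pow_ne_zero 2 hy0) hd0
  refine ⟨1 / 2 * (A ^ 2 + 1 - A * y⁻¹) / (1 + A * y⁻¹ - y⁻¹ ^ 2), 0, ?_, by simp; positivity, ?_⟩
  · rw [norm_div, norm_mul, div_le_iff₀ (by linarith)]
    have h2 : ‖(1 / 2 : ℂ)‖ = 1 / 2 := by norm_num
    have h4 : ‖A ^ 2 + 1 - A * y⁻¹‖ ≤ M ^ 2 + 1 + M := by
      refine (norm_sub_le _ _).trans (add_le_add ((norm_add_le _ _).trans ?_) ?_)
      · rw [norm_pow, norm_one]; gcongr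
      · linarith
    rw [h2]
    have : (M ^ 2 + 1 + M) * (1 / 2) ≤ (M ^ 2 + 1 + M) * ‖1 + A * y⁻¹ - y⁻¹ ^ 2‖ :=
      mul_le_mul_of_nonneg_left hd (by positivity)
    linarith
  · rw [aux, auxDenom_normalised, ← hAdef, add_zero]
    congr 1
    have hdD : 1 + A * y⁻¹ - y⁻¹ ^ 2 = (y ^ 2 + A * y - 1) / y ^ 2 := by field_simp
    rw [hdD]
    obtain ⟨D, hD⟩ : ∃ D, y ^ 2 + A * y - 1 = D := ⟨_, rfl⟩
    rw [hD] at hD0 ⊢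
    field_simp
    rw [← hD]
    ring

/-- Off the zeros of its denominator, the fraction in the auxiliary function is `x O(y²)`. -/
theorem energyAt_aux (h3 : AnalyticAt ℂ α₃ z₀) {y₀ : ℂ} (hD : y₀ ^ 2 + auxCoeff α₃ z₀ * y₀ - 1 ≠ 0)
    (a₀ c : ℂ) (α₁ : ℂ → ℂ) : EnergyAt a₀ c α₁ α₃ z₀ y₀ (aux (normalised a₀ c α₁ α₃)) := by
  set d := ‖y₀ ^ 2 + auxCoeff α₃ z₀ * y₀ - 1‖ with hd
  have hd0 : 0 < d := norm_pos_iff.2 hD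
  have hc : ContinuousAt (fun r : ℂ × ℂ => r.2 ^ 2 + auxCoeff α₃ r.1 * r.2 - 1) (z₀, y₀) := by
    have h3' : ContinuousAt (auxCoeff α₃) (z₀, y₀).1 := (analyticAt_auxCoeff h3).continuousAt
    fun_prop
  refine ⟨1 / d, ?_⟩
  filter_upwards [hc.norm.eventually_const_lt (half_lt_self hd0)] with ⟨z, y⟩ f1 x
  simp only at f1 ⊢
  refine ⟨1 / 2 * (y ^ 2 / (y ^ 2 + auxCoeff α₃ z * y - 1)), 0, ?_, by simp; positivity, ?_⟩
  · have h2 : ‖(1 / 2 : ℂ)‖ = 1 / 2 := by norm_num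
    rw [norm_mul, h2, norm_div, norm_pow, div_mul_div_comm, one_mul, div_mul_eq_mul_div, one_mul,
      div_le_div_iff₀ (by linarith) hd0, mul_comm]
    have := mul_le_mul_of_nonneg_right f1.le (sq_nonneg ‖y‖)
    linarith
  · rw [aux, auxDenom_normalised, add_zero]
    ring

/-- The line at infinity, the intermediate exceptional curves and the corners are inaccessible,
because the modified Hamiltonian is infinite there but bounded along the path. -/
theorem inaccessible {U : Set ℂ} (hU : IsOpen U) (h1 : DifferentiableOn ℂ α₁ U)
    (h3 : DifferentiableOn ℂ α₃ U) (hz : z₀ ∈ U) {κ : Chart} {q : ℂ × ℂ}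
    (h : IntermediatePoint (normalised a₀ c α₁ α₃) z₀ κ q ∨ CornerPoint (normalised a₀ c α₁ α₃) κ q) :
    Inaccessible U (normalised a₀ c α₁ α₃) κ z₀ q := by
  have ha1 := h1.analyticAt (hU.mem_nhds hz)
  have ha3 := h3.analyticAt (hU.mem_nhds hz)
  have hlim : Tendsto (fun p => ‖modifiedEnergy a₀ c α₁ α₃ p.1 (affine κ p)‖) (approach κ z₀ q)
      atTop := by
    rcases h with h | h
    · exact h.tendsto_atTop ha1 ha3 (energyAtInfinity_modifiedEnergy ha1 ha3 a₀ c)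
        fun y₀ _ => energyAt_modifiedEnergy ha1 ha3 a₀ c y₀
    · exact h.tendsto_atTop ha1 ha3 (energyAtInfinity_modifiedEnergy ha1 ha3 a₀ c)
        (energyAt_modifiedEnergy ha1 ha3 a₀ c 0)
  intro γ x y r hγ hγ1 hcont hr hrq
  obtain ⟨B, hB⟩ := exists_bound_modifiedEnergy hU h1 h3 hγ hcont
  have hγt := hγ.tendsto
  rw [hγ1] at hγt
  have hpos : Tendsto (fun τ => (γ τ, r τ)) (𝓝[<] (1 : ℝ)) (approach κ z₀ q) :=
    tendsto_inf.2 ⟨hγt.prodMk_nhds hrq, tendsto_principal.2 (hr.mono fun τ h => h.1)⟩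
  obtain ⟨τ, f1, f2, f3⟩ := (((hlim.comp hpos).eventually_gt_atTop B).and (hB.and hr)).exists
  rw [← f3.2] at f2
  exact absurd f2 (not_le.2 f1)

end

/-! ### The logarithmic derivative of the auxiliary function -/

section

variable {a₀ c : ℂ} {α₁ α₃ Z X Y : ℂ → ℂ} {t z₀ : ℂ}

/-- The total derivative of the auxiliary function, computed along any curve that is tangent to the
system. -/
theorem auxDeriv_eq {p : ℂ × ℂ} (h1 : AnalyticAt ℂ α₁ z₀) (h3 : AnalyticAt ℂ α₃ z₀)
    (hD : p.2 ^ 2 + auxCoeff α₃ z₀ * p.2 - 1 ≠ 0) {d : ℂ}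
    (h : ∀ Z X Y : ℂ → ℂ, Tangent a₀ c α₁ α₃ Z X Y 0 → Z 0 = z₀ → X 0 = p.1 → Y 0 = p.2 →
      HasDerivAt (fun t => aux (normalised a₀ c α₁ α₃) (Z t) (X t, Y t)) d 0) :
    auxDeriv (normalised a₀ c α₁ α₃) z₀ p = d := by
  obtain ⟨x, y⟩ := p
  simp only at hD h
  set α := normalised a₀ c α₁ α₃ with hα
  have hαa := analyticAt_normalised h1 h3 a₀ c
  have hdiff : DifferentiableAt ℂ (fun r : ℂ × ℂ × ℂ => aux α r.1 r.2) (z₀, x, y) := by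
    have d0 : ∀ i, DifferentiableAt ℂ (α i) (z₀, x, y).1 := fun i => (hαa i).differentiableAt
    have dA : DifferentiableAt ℂ (auxCoeff α₃) (z₀, x, y).1 := (analyticAt_auxCoeff h3).differentiableAt
    unfold aux hamiltonian
    simp only [hα, auxDenom_normalised]
    simp only [← hα]
    fun_prop (disch := exact hD)
  set F := field α z₀ (x, y) with hF
  have hl : HasDerivAt (fun t : ℂ => ((z₀ + t, x + t * F.1, y + t * F.2) : ℂ × ℂ × ℂ)) (1, F.1, F.2) 0 := by
    have e1 : HasDerivAt (fun t : ℂ => z₀ + t) 1 0 := (hasDerivAt_id 0).const_add z₀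
    have e2 : HasDerivAt (fun t : ℂ => x + t * F.1) F.1 0 := by
      simpa using ((hasDerivAt_id (0 : ℂ)).mul_const F.1).const_add x
    have e3 : HasDerivAt (fun t : ℂ => y + t * F.2) F.2 0 := by
      simpa using ((hasDerivAt_id (0 : ℂ)).mul_const F.2).const_add y
    exact e1.prodMk (e2.prodMk e3)
  have hcomp := HasFDerivAt.comp_hasDerivAt_of_eq (0 : ℂ) hdiff.hasFDerivAt hl (by simp)
  have hT : Tangent a₀ c α₁ α₃ (fun t => z₀ + t) (fun t => x + t * F.1) (fun t => y + t * F.2) 0 := by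
    have hF0 : field (normalised a₀ c α₁ α₃) (z₀ + 0) (x + 0 * F.1, y + 0 * F.2) = F := by
      simp [hF, hα]
    refine ⟨(hasDerivAt_id 0).const_add z₀, ?_, ?_, by simpa using h1, by simpa using h3⟩
    · rw [hF0]
      simpa using ((hasDerivAt_id (0 : ℂ)).mul_const F.1).const_add x
    · rw [hF0]
      simpa using ((hasDerivAt_id (0 : ℂ)).mul_const F.2).const_add y
  exact hcomp.unique (h _ _ _ hT (by simp) (by simp) (by simp))

/-- The derivative of the auxiliary function, as a polynomial in the product `x y`. -/
theorem Tangent.aux_finite (h : Tangent a₀ c α₁ α₃ Z X Y t)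
    (hD : Y t ^ 2 + auxCoeff α₃ (Z t) * Y t - 1 ≠ 0) :
    HasDerivAt (fun s => aux (normalised a₀ c α₁ α₃) (Z s) (X s, Y s))
      (-(Y t ^ 4 + deriv α₃ (Z t) / 3 * Y t ^ 3 + (2 / 3 * α₃ (Z t) + 2 / 3 * Z t * deriv α₃ (Z t)
        - 3 * Z t ^ 2) / 2 * Y t ^ 2 + deriv α₁ (Z t) * Y t)
        + 1 / 2 * (Y t ^ 2 * (5 / 2 * Y t ^ 4 + 4 * Z t * Y t ^ 3 + α₃ (Z t) * Y t ^ 2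
          + (c + 2 * Z t / 3 * α₃ (Z t) - Z t ^ 3) * Y t + α₁ (Z t)) /
            (Y t ^ 2 + auxCoeff α₃ (Z t) * Y t - 1))
        + X t * Y t * (1 / 2 * (-2 * a₀ / (Y t ^ 2 + auxCoeff α₃ (Z t) * Y t - 1)
          - Y t * (deriv (auxCoeff α₃) (Z t) * Y t - a₀ * (2 * Y t + auxCoeff α₃ (Z t))) /
            (Y t ^ 2 + auxCoeff α₃ (Z t) * Y t - 1) ^ 2))
        + (X t * Y t) ^ 2 * (1 / 2 * (3 / 2 / (Y t ^ 2 + auxCoeff α₃ (Z t) * Y t - 1)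
          - Y t * (2 * Y t + auxCoeff α₃ (Z t)) /
            (Y t ^ 2 + auxCoeff α₃ (Z t) * Y t - 1) ^ 2))) t := by
  have hA := h.comp (analyticAt_auxCoeff h.analytic₃)
  have hH := h.hamiltonian
  obtain ⟨dZ, dX, dY, -, -⟩ := h
  rw [field_normalised] at dX dY
  have hden := ((dY.pow 2).add (hA.mul dY)).sub_const 1
  have e := hH.add (((dX.mul (dY.pow 2)).div hden hD).const_mul (1 / 2))
  refine (e.congr_deriv ?_).congr_of_eventuallyEq (Eventually.of_forall fun s => rfl)
  simp only [Pi.mul_apply, Pi.pow_apply, Pi.add_apply]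
  generalize deriv (auxCoeff α₃) (Z t) = A' at *
  obtain ⟨D, hDd⟩ : ∃ D, Y t ^ 2 + auxCoeff α₃ (Z t) * Y t - 1 = D := ⟨_, rfl⟩
  rw [hDd] at hD ⊢
  push_cast
  field_simp
  ring

/-- For bounded `y` the derivative of the auxiliary function is at most quadratic in `x y`. -/
theorem exists_auxDeriv_le_finite (h1 : AnalyticAt ℂ α₁ z₀) (h3 : AnalyticAt ℂ α₃ z₀) {y₀ : ℂ}
    (hD : y₀ ^ 2 + auxCoeff α₃ z₀ * y₀ - 1 ≠ 0) (a₀ c : ℂ) :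
    ∃ C > 0, ∀ᶠ r : ℂ × ℂ in 𝓝 (z₀, y₀), ∀ x,
      ‖auxDeriv (normalised a₀ c α₁ α₃) r.1 (x, r.2)‖ ≤
        C * (1 + ‖x * r.2‖ + ‖x * r.2‖ ^ 2) := by
  have c1 : ContinuousAt α₁ (z₀, y₀).1 := h1.continuousAt
  have c1' : ContinuousAt (deriv α₁) (z₀, y₀).1 := h1.deriv.continuousAt
  have c3 : ContinuousAt α₃ (z₀, y₀).1 := h3.continuousAt
  have c3' : ContinuousAt (deriv α₃) (z₀, y₀).1 := h3.deriv.continuousAt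
  have cA : ContinuousAt (auxCoeff α₃) (z₀, y₀).1 := (analyticAt_auxCoeff h3).continuousAt
  have cA' : ContinuousAt (deriv (auxCoeff α₃)) (z₀, y₀).1 := (analyticAt_auxCoeff h3).deriv.continuousAt
  obtain ⟨D, hDr, hDc⟩ : ∃ D : ℂ × ℂ → ℂ, (∀ r, D r = r.2 ^ 2 + auxCoeff α₃ r.1 * r.2 - 1) ∧
      ContinuousAt D (z₀, y₀) := ⟨_, fun r => rfl, by fun_prop⟩
  have hD0 : D (z₀, y₀) ≠ 0 := by rw [hDr]; exact hD
  obtain ⟨f, hf, hfc⟩ : ∃ f : ℂ × ℂ → ℂ, (∀ r, f r =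
      -(r.2 ^ 4 + deriv α₃ r.1 / 3 * r.2 ^ 3 + (2 / 3 * α₃ r.1 + 2 / 3 * r.1 * deriv α₃ r.1
        - 3 * r.1 ^ 2) / 2 * r.2 ^ 2 + deriv α₁ r.1 * r.2)
        + 1 / 2 * (r.2 ^ 2 * (5 / 2 * r.2 ^ 4 + 4 * r.1 * r.2 ^ 3 + α₃ r.1 * r.2 ^ 2
          + (c + 2 * r.1 / 3 * α₃ r.1 - r.1 ^ 3) * r.2 + α₁ r.1) / D r)) ∧ ContinuousAt f (z₀, y₀) :=
    ⟨_, fun r => rfl, by fun_prop (disch := assumption)⟩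
  obtain ⟨g, hg, hgc⟩ : ∃ g : ℂ × ℂ → ℂ, (∀ r, g r =
      1 / 2 * (-2 * a₀ / D r - r.2 * (deriv (auxCoeff α₃) r.1 * r.2
        - a₀ * (2 * r.2 + auxCoeff α₃ r.1)) / D r ^ 2)) ∧ ContinuousAt g (z₀, y₀) :=
    ⟨_, fun r => rfl, by fun_prop (disch := first | assumption | exact pow_ne_zero 2 hD0)⟩
  obtain ⟨k, hk, hkc⟩ : ∃ k : ℂ × ℂ → ℂ, (∀ r, k r =
      1 / 2 * (3 / 2 / D r - r.2 * (2 * r.2 + auxCoeff α₃ r.1) / D r ^ 2)) ∧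
        ContinuousAt k (z₀, y₀) :=
    ⟨_, fun r => rfl, by fun_prop (disch := first | assumption | exact pow_ne_zero 2 hD0)⟩
  refine ⟨(‖f (z₀, y₀)‖ + 1) + (‖g (z₀, y₀)‖ + 1) + (‖k (z₀, y₀)‖ + 1), by positivity, ?_⟩
  filter_upwards [hfc.norm.eventually_lt continuousAt_const (lt_add_one _),
    hgc.norm.eventually_lt continuousAt_const (lt_add_one _),
    hkc.norm.eventually_lt continuousAt_const (lt_add_one _), hDc.eventually_ne hD0,
    (continuous_fst.tendsto (z₀, y₀)).eventually h1.eventually_analyticAt,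
    (continuous_fst.tendsto (z₀, y₀)).eventually h3.eventually_analyticAt]
    with ⟨z, y⟩ f1 f2 f3 f4 f5 f6 x
  simp only at f1 f2 f3 f4 f5 f6 ⊢
  rw [hDr] at f4
  have hval : auxDeriv (normalised a₀ c α₁ α₃) z (x, y) =
      f (z, y) + x * y * g (z, y) + (x * y) ^ 2 * k (z, y) := by
    refine auxDeriv_eq (p := (x, y)) f5 f6 f4 fun Z X Y hT hZ hX hY => ?_
    have := hT.aux_finite (by rw [hZ, hY]; exact f4)
    rw [hZ, hX, hY] at this
    rw [hf, hg, hk, hDr]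
    exact this
  rw [hval]
  refine (norm_add₃_le).trans ?_
  rw [norm_mul (x * y), norm_mul ((x * y) ^ 2), norm_pow]
  have hm := norm_nonneg (x * y)
  have k1 := mul_le_mul_of_nonneg_left f2.le hm
  have k2 := mul_le_mul_of_nonneg_left f3.le (sq_nonneg ‖x * y‖)
  have m1 := norm_nonneg (f (z₀, y₀))
  have m2 := norm_nonneg (g (z₀, y₀))
  have m3 := norm_nonneg (k (z₀, y₀))
  have p1 : 0 ≤ (‖f (z₀, y₀)‖ + 1 + (‖k (z₀, y₀)‖ + 1)) * ‖x * y‖ := by positivity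
  have p2 : 0 ≤ (‖f (z₀, y₀)‖ + 1 + (‖g (z₀, y₀)‖ + 1)) * ‖x * y‖ ^ 2 := by positivity
  linarith

end

/-- In terms of `u = 1 / y` and `w = x / y²`, the auxiliary function exceeds the modified Hamiltonian
`outerEnergy` by `w ψ - k u`, with `ψ` the following function. -/
noncomputable def auxPsi (A g u : ℂ) : ℂ :=
  1 / 2 * (A ^ 2 + 1 - A * u) / (1 + A * u - u ^ 2) - g * u

/-- The derivative of `auxPsi` through its coefficients `A` and `g`, as functions of `z`. -/
noncomputable def auxPsi₀ (A A' g' u : ℂ) : ℂ :=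
  1 / 2 * ((2 * A * A' - A' * u) * (1 + A * u - u ^ 2) - (A ^ 2 + 1 - A * u) * (A' * u)) /
    (1 + A * u - u ^ 2) ^ 2 - g' * u

/-- The derivative of `auxPsi` with respect to `u`. -/
noncomputable def auxPsi₁ (A g u : ℂ) : ℂ :=
  1 / 2 * (-A * (1 + A * u - u ^ 2) - (A ^ 2 + 1 - A * u) * (A - 2 * u)) /
    (1 + A * u - u ^ 2) ^ 2 - g

theorem hasDerivAt_auxPsi {A g u : ℂ → ℂ} {A' g' u' t : ℂ} (hA : HasDerivAt A A' t)
    (hg : HasDerivAt g g' t) (hu : HasDerivAt u u' t) (hq : 1 + A t * u t - u t ^ 2 ≠ 0) :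
    HasDerivAt (fun s => auxPsi (A s) (g s) (u s))
      (auxPsi₀ (A t) A' g' (u t) + auxPsi₁ (A t) (g t) (u t) * u') t := by
  have e1 := ((((hA.pow 2).add_const 1).sub (hA.mul hu)).const_mul (1 / 2)).div
    (((hA.mul hu).const_add 1).sub (hu.pow 2)) hq
  refine ((e1.sub (hg.mul hu)).congr_deriv ?_)
  simp only [Pi.mul_apply, Pi.pow_apply, Pi.sub_apply, auxPsi₀, auxPsi₁]
  obtain ⟨q, hqd⟩ : ∃ q, 1 + A t * u t - u t ^ 2 = q := ⟨_, rfl⟩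
  rw [hqd] at hq ⊢
  push_cast
  field_simp
  ring

theorem aux_eq_outerEnergy {a₀ c z x y : ℂ} {α₁ α₃ : ℂ → ℂ} (hy : y ≠ 0)
    (hq : 1 + auxCoeff α₃ z * y⁻¹ - y⁻¹ ^ 2 ≠ 0) :
    aux (normalised a₀ c α₁ α₃) z (x, y) = outerEnergy a₀ c α₁ α₃ z (x, y)
      + (x * y⁻¹ ^ 2 * auxPsi (auxCoeff α₃ z) (gCoeff c α₁ α₃ z) y⁻¹ - kCoeff a₀ α₃ z * y⁻¹) := by
  rw [aux, outerEnergy, outerTerm, auxDenom_normalised, auxPsi]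
  simp only
  set A := auxCoeff α₃ z
  have hdD : y ^ 2 + A * y - 1 = y ^ 2 * (1 + A * y⁻¹ - y⁻¹ ^ 2) := by field_simp
  have hqd : 1 + A * y⁻¹ - y⁻¹ ^ 2 = (y ^ 2 + A * y - 1) / y ^ 2 := by field_simp
  rw [hdD]
  obtain ⟨q, hqq⟩ : ∃ q, 1 + A * y⁻¹ - y⁻¹ ^ 2 = q := ⟨_, rfl⟩
  rw [hqq] at hq ⊢
  field_simp
  rw [← hqq]
  field_simp
  ring

section

variable {a₀ c : ℂ} {α₁ α₃ Z X Y : ℂ → ℂ} {t z₀ : ℂ}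

/-- The derivative of the auxiliary function for large `y`, as that of the modified Hamiltonian plus that of
`w ψ - k u`. The only terms of order `y²` carry the factor `1 - w²`. -/
theorem Tangent.aux_infinity (h : Tangent a₀ c α₁ α₃ Z X Y t) (hy : Y t ≠ 0) {A g k u w : ℂ}
    (hA : auxCoeff α₃ (Z t) = A) (hg : gCoeff c α₁ α₃ (Z t) = g) (hk : kCoeff a₀ α₃ (Z t) = k)
    (hu : (Y t)⁻¹ = u) (hw : X t * (Y t)⁻¹ ^ 2 = w) (hq : 1 + A * u - u ^ 2 ≠ 0) :
    HasDerivAt (fun s => aux (normalised a₀ c α₁ α₃) (Z s) (X s, Y s))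
      (rateM g (deriv α₃ (Z t)) (Z t) u * (aux (normalised a₀ c α₁ α₃) (Z t) (X t, Y t)
          - (w * auxPsi A g u - k * u))
        + (rateN₀ a₀ c g k (deriv (kCoeff a₀ α₃) (Z t)) (α₁ (Z t)) (α₃ (Z t)) (deriv α₃ (Z t)) (Z t) u
          + w * rateN₁ a₀ g (deriv (gCoeff c α₁ α₃) (Z t)) (deriv α₃ (Z t)) (Z t) u)
        + ((Y t ^ 2 * (5 / 2 * (1 - w ^ 2)) + Y t * (4 * Z t + α₃ (Z t) * u
            + (c + 2 * Z t / 3 * α₃ (Z t) - Z t ^ 3) * u ^ 2 + α₁ (Z t) * u ^ 3) + 2 * a₀ * w * u)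
            * auxPsi A g u
          + (w * auxPsi₀ A (deriv (auxCoeff α₃) (Z t)) (deriv (gCoeff c α₁ α₃) (Z t)) u
            + auxPsi₁ A g u * (-(w ^ 2 * Y t) + a₀ * w * u ^ 2))
          - (deriv (kCoeff a₀ α₃) (Z t) * u + k * (-(w * Y t) + a₀ * u ^ 2)))) t := by
  have dA := h.comp (analyticAt_auxCoeff h.analytic₃)
  have dg := h.comp (analyticAt_gCoeff h.analytic₁ h.analytic₃ c)
  have dk := h.comp (analyticAt_kCoeff h.analytic₃ a₀)
  have dO := h.outerEnergy hy
  obtain ⟨dZ, dX, dY, -, -⟩ := h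
  rw [field_normalised] at dX dY
  have du := dY.inv hy
  have hq' : 1 + auxCoeff α₃ (Z t) * (Y t)⁻¹ - (Y t)⁻¹ ^ 2 ≠ 0 := by rw [hA, hu]; exact hq
  have dψ := hasDerivAt_auxPsi dA dg du hq'
  have e := dO.add (((dX.mul (du.pow 2)).mul dψ).sub (dk.mul du))
  have hev : ∀ᶠ s in 𝓝 t, aux (normalised a₀ c α₁ α₃) (Z s) (X s, Y s) =
      QP4.outerEnergy a₀ c α₁ α₃ (Z s) (X s, Y s) + (X s * (Y s)⁻¹ ^ 2 *
        auxPsi (auxCoeff α₃ (Z s)) (gCoeff c α₁ α₃ (Z s)) (Y s)⁻¹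
          - kCoeff a₀ α₃ (Z s) * (Y s)⁻¹) := by
    have hqc : ContinuousAt (fun s => 1 + auxCoeff α₃ (Z s) * (Y s)⁻¹ - (Y s)⁻¹ ^ 2) t :=
      (continuousAt_const.add (dA.continuousAt.mul du.continuousAt)).sub (du.continuousAt.pow 2)
    filter_upwards [hqc.eventually_ne hq', dY.continuousAt.eventually_ne hy] with s f1 f2
    exact aux_eq_outerEnergy f2 f1
  refine (e.congr_deriv ?_).congr_of_eventuallyEq (hev.mono fun s hs => hs)
  rw [aux_eq_outerEnergy hy hq']
  simp only [Pi.mul_apply, Pi.pow_apply, Pi.inv_apply]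
  rw [hA, hg, hk]
  have hu' : -(X t * Y t - a₀) / Y t ^ 2 = -(w * Y t) + a₀ * u ^ 2 := by
    rw [← hw, ← hu]; field_simp; ring
  rw [hu']
  have hX : X t = w * Y t ^ 2 := by rw [← hw]; field_simp
  have hw' : X t * u ^ 2 = w := by rw [← hw, ← hu]
  rw [hu, hw']
  generalize auxPsi A g u = ψ
  generalize auxPsi₀ A (deriv (auxCoeff α₃) (Z t)) (deriv (gCoeff c α₁ α₃) (Z t)) u = ψ₀
  generalize auxPsi₁ A g u = ψ₁
  rw [hX]
  have hY : Y t * u = 1 := by rw [← hu]; exact mul_inv_cancel₀ hy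
  have key : (5 / 2 * Y t ^ 4 - 1 / 2 * (w * Y t ^ 2) ^ 2 + 4 * Z t * Y t ^ 3 + α₃ (Z t) * Y t ^ 2
        + (c + 2 * Z t / 3 * α₃ (Z t) - Z t ^ 3) * Y t + α₁ (Z t)) * u ^ 2
      + (w * Y t ^ 2) * (2 * u * (-(w * Y t) + a₀ * u ^ 2)) =
      Y t ^ 2 * (5 / 2 * (1 - w ^ 2)) + Y t * (4 * Z t + α₃ (Z t) * u
            + (c + 2 * Z t / 3 * α₃ (Z t) - Z t ^ 3) * u ^ 2 + α₁ (Z t) * u ^ 3) + 2 * a₀ * w * u := by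
    rw [← hu]; field_simp; ring
  rw [← key]
  push_cast
  ring

end

section

variable {a₀ c : ℂ} {α₁ α₃ : ℂ → ℂ} {z₀ : ℂ}

theorem exists_eventually_norm_le {F : ℂ × ℂ → ℂ} {r₀ : ℂ × ℂ} (hF : ContinuousAt F r₀) :
    ∃ M : ℝ, 0 ≤ M ∧ ∀ᶠ r in 𝓝 r₀, ‖F r‖ ≤ M :=
  ⟨‖F r₀‖ + 1, by positivity,
    (hF.norm.eventually_lt continuousAt_const (lt_add_one _)).mono fun _ h => h.le⟩

/-- The estimate that turns the formula for the derivative of the auxiliary function `W` into a bound;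
here `u = 1 / y` and `w = x / y²`, and `hr` expresses that `w²` is close to `1` unless `W` is large. -/
theorem norm_aux_rate_le {M C : ℝ} (hM : 1 ≤ M) (hC : 0 ≤ C)
    {W w u y ψ ψ₀ ψ₁ k k' a₀ m₁ n₀ n₁ B : ℂ} (hyu : y * u = 1) (hu : ‖u‖ ≤ 1)
    (bψ : ‖ψ‖ ≤ M) (bψ₀ : ‖ψ₀‖ ≤ M) (bψ₁ : ‖ψ₁‖ ≤ M) (bk : ‖k‖ ≤ M) (bk' : ‖k'‖ ≤ M)
    (ba : ‖a₀‖ ≤ M) (bm : ‖m₁‖ ≤ M) (bn₀ : ‖n₀‖ ≤ M) (bn₁ : ‖n₁‖ ≤ M) (bB : ‖B‖ ≤ M)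
    (hr : ‖w ^ 2 - 1‖ ≤ C * (‖u‖ * (1 + ‖w‖) + ‖u‖ ^ 5 * ‖W‖)) :
    ‖m₁ * (W - (w * ψ - k * u)) + (n₀ + w * n₁)
      + ((y ^ 2 * (5 / 2 * (1 - w ^ 2)) + y * B + 2 * a₀ * w * u) * ψ
        + (w * ψ₀ + ψ₁ * (-(w ^ 2 * y) + a₀ * w * u ^ 2))
        - (k' * u + k * (-(w * y) + a₀ * u ^ 2)))‖ ≤
      (20 * M ^ 2 * (1 + C)) * (‖y‖ * (1 + ‖w‖) + ‖W‖) := by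
  have hy1 : 1 ≤ ‖y‖ := by
    have : ‖y‖ * ‖u‖ = 1 := by rw [← norm_mul, hyu, norm_one]
    by_contra! h
    nlinarith [norm_nonneg u, norm_nonneg y]
  have hyun : ‖y‖ * ‖u‖ = 1 := by rw [← norm_mul, hyu, norm_one]
  set S := ‖y‖ * (1 + ‖w‖) + ‖W‖ with hS
  have hw0 := norm_nonneg w
  have hW0 := norm_nonneg W
  have hu0 := norm_nonneg u
  have hS1 : 1 + ‖w‖ ≤ S := by
    have : 1 + ‖w‖ ≤ ‖y‖ * (1 + ‖w‖) := le_mul_of_one_le_left (by linarith) hy1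
    linarith
  have hSy : ‖y‖ * (1 + ‖w‖) ≤ S := by linarith
  have hS0 : 0 ≤ S := by linarith
  have hM0 : 0 ≤ M := by linarith
  have hMM : M ≤ M ^ 2 := by nlinarith
  -- `y² (w² - 1)` and `y w²` are controlled by the closeness of `w²` to `1`
  have q1 : ‖y‖ ^ 2 * ‖w ^ 2 - 1‖ ≤ C * S := by
    have e1 := mul_le_mul_of_nonneg_left hr (sq_nonneg ‖y‖)
    have e2 : ‖y‖ ^ 2 * (C * (‖u‖ * (1 + ‖w‖) + ‖u‖ ^ 5 * ‖W‖)) =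
        C * ((‖y‖ * ‖u‖) * (‖y‖ * (1 + ‖w‖)) + (‖y‖ * ‖u‖) ^ 2 * ‖u‖ ^ 3 * ‖W‖) := by ring
    rw [e2, hyun, one_mul, one_pow, one_mul] at e1
    refine e1.trans (mul_le_mul_of_nonneg_left ?_ hC)
    rw [hS]
    gcongr
    exact mul_le_of_le_one_left hW0 (pow_le_one₀ hu0 hu)
  have q2 : ‖w ^ 2 * y‖ ≤ (1 + C) * S := by
    have e1 : w ^ 2 * y = (w ^ 2 - 1) * y + y := by ring
    have e2 : ‖(w ^ 2 - 1) * y‖ ≤ C * S := by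
      rw [norm_mul, mul_comm]
      refine le_trans (mul_le_mul_of_nonneg_right ?_ (norm_nonneg _)) q1
      nlinarith
    have e3 : ‖y‖ ≤ S := (le_mul_of_one_le_right (by linarith) (by linarith)).trans hSy
    rw [e1]
    refine (norm_add_le _ _).trans ?_
    linarith
  have t : ∀ {a b : ℂ} {r : ℝ}, ‖a‖ ≤ M → ‖b‖ ≤ r → ‖a * b‖ ≤ M * r := fun {a b r} ha hb => by
    rw [norm_mul]; exact mul_le_mul ha hb (norm_nonneg _) hM0
  have hwS : ‖w‖ ≤ S := by linarith
  have huS : ‖u‖ ≤ S := by linarith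
  have hwy : ‖w * y‖ ≤ S := by rw [norm_mul, mul_comm]; linarith
  have hyS : ‖y‖ ≤ S := (le_mul_of_one_le_right (by linarith) (by linarith)).trans hSy
  have hWS : ‖W‖ ≤ S := by
    have : 0 ≤ ‖y‖ * (1 + ‖w‖) := by positivity
    linarith
  have hwu : ‖w * u‖ ≤ S := by
    rw [norm_mul]; exact (mul_le_of_le_one_right hw0 hu).trans hwS
  have hwu2 : ‖w * u ^ 2‖ ≤ S := by
    rw [norm_mul, norm_pow]; exact (mul_le_of_le_one_right hw0 (pow_le_one₀ hu0 hu)).trans hwS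
  have hu2 : ‖u ^ 2‖ ≤ S := by
    rw [norm_pow]; exact (pow_le_one₀ hu0 hu).trans (by linarith)
  have hMS : M * S ≤ M ^ 2 * S := mul_le_mul_of_nonneg_right hMM hS0
  have hCS : 0 ≤ C * S := mul_nonneg hC hS0
  have hMCS : M * (C * S) ≤ M ^ 2 * (C * S) := mul_le_mul_of_nonneg_right hMM hCS
  have b1 : ‖m₁ * (W - (w * ψ - k * u))‖ ≤ M * (S + (M * S + M * S)) := by
    refine t bm ((norm_sub_le _ _).trans (add_le_add hWS ((norm_sub_le _ _).trans ?_)))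
    rw [mul_comm w]
    exact add_le_add (t bψ hwS) (t bk huS)
  have b2 : ‖n₀ + w * n₁‖ ≤ M + M * S := by
    rw [mul_comm]
    exact (norm_add_le _ _).trans (add_le_add bn₀ (t bn₁ hwS))
  have b3 : ‖(y ^ 2 * (5 / 2 * (1 - w ^ 2)) + y * B + 2 * a₀ * w * u) * ψ‖ ≤
      M * (5 / 2 * (C * S) + M * S + 2 * (M * S)) := by
    rw [mul_comm]
    refine t bψ ((norm_add₃_le).trans (add_le_add (add_le_add ?_ ?_) ?_))
    · have e1 : y ^ 2 * (5 / 2 * (1 - w ^ 2)) = 5 / 2 * (y ^ 2 * (1 - w ^ 2)) := by ring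
      have e2 : ‖(5 / 2 : ℂ)‖ = 5 / 2 := by norm_num
      rw [e1, norm_mul, e2, norm_mul, norm_pow, norm_sub_rev]
      linarith
    · rw [mul_comm]; exact t bB hyS
    · rw [mul_assoc, mul_assoc, norm_mul, Complex.norm_ofNat]
      exact mul_le_mul_of_nonneg_left (t ba hwu) zero_le_two
  have b4 : ‖w * ψ₀ + ψ₁ * (-(w ^ 2 * y) + a₀ * w * u ^ 2)‖ ≤ M * S + M * ((1 + C) * S + M * S) := by
    refine (norm_add_le _ _).trans (add_le_add ?_ (t bψ₁ ((norm_add_le _ _).trans (add_le_add ?_ ?_))))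
    · rw [mul_comm]; exact t bψ₀ hwS
    · rw [norm_neg]; exact q2
    · rw [mul_assoc]; exact t ba hwu2
  have b5 : ‖k' * u + k * (-(w * y) + a₀ * u ^ 2)‖ ≤ M * S + M * (S + M * S) := by
    refine (norm_add_le _ _).trans (add_le_add (t bk' huS) (t bk ((norm_add_le _ _).trans
      (add_le_add ?_ (t ba hu2)))))
    rw [norm_neg]; exact hwy
  have hMS' : M ≤ M * S := le_mul_of_one_le_right hM0 (by linarith)
  refine (norm_add₃_le).trans ?_
  refine (add_le_add (add_le_add b1 b2) ((norm_sub_le _ _).trans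
    (add_le_add ((norm_add_le _ _).trans (add_le_add b3 b4)) b5))).trans ?_
  have p1 : 0 ≤ M ^ 2 * S := by positivity
  have p2 : 0 ≤ M ^ 2 * (C * S) := by positivity
  linarith

/-- A bound for the derivative of the auxiliary function for large `y`, with `r.2 = 1 / y`. -/
theorem exists_auxDeriv_le_infinity (h1 : AnalyticAt ℂ α₁ z₀) (h3 : AnalyticAt ℂ α₃ z₀) (a₀ c : ℂ) :
    ∃ C > 0, ∀ᶠ r : ℂ × ℂ in 𝓝 (z₀, 0), r.2 ≠ 0 → ∀ x,
      ‖auxDeriv (normalised a₀ c α₁ α₃) r.1 (x, r.2⁻¹)‖ ≤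
        C * (‖r.2⁻¹‖ * (1 + ‖x * r.2 ^ 2‖) + ‖aux (normalised a₀ c α₁ α₃) r.1 (x, r.2⁻¹)‖) := by
  obtain ⟨C, R, hC, hR, hCR⟩ := (energyAtInfinity_aux h1 h3 a₀ c).ratio h1 h3
  have c1 : ContinuousAt α₁ (z₀, (0 : ℂ)).1 := h1.continuousAt
  have c3 : ContinuousAt α₃ (z₀, (0 : ℂ)).1 := h3.continuousAt
  have c3' : ContinuousAt (deriv α₃) (z₀, (0 : ℂ)).1 := h3.deriv.continuousAt
  have cA : ContinuousAt (auxCoeff α₃) (z₀, (0 : ℂ)).1 := (analyticAt_auxCoeff h3).continuousAt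
  have cA' : ContinuousAt (deriv (auxCoeff α₃)) (z₀, (0 : ℂ)).1 :=
    (analyticAt_auxCoeff h3).deriv.continuousAt
  have cg : ContinuousAt (gCoeff c α₁ α₃) (z₀, (0 : ℂ)).1 := (analyticAt_gCoeff h1 h3 c).continuousAt
  have cg' : ContinuousAt (deriv (gCoeff c α₁ α₃)) (z₀, (0 : ℂ)).1 :=
    (analyticAt_gCoeff h1 h3 c).deriv.continuousAt
  have ck : ContinuousAt (kCoeff a₀ α₃) (z₀, (0 : ℂ)).1 := (analyticAt_kCoeff h3 a₀).continuousAt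
  have ck' : ContinuousAt (deriv (kCoeff a₀ α₃)) (z₀, (0 : ℂ)).1 :=
    (analyticAt_kCoeff h3 a₀).deriv.continuousAt
  have hq0 : 1 + auxCoeff α₃ (z₀, (0 : ℂ)).1 * (z₀, (0 : ℂ)).2 - (z₀, (0 : ℂ)).2 ^ 2 ≠ 0 := by simp
  have hq0' : (1 + auxCoeff α₃ (z₀, (0 : ℂ)).1 * (z₀, (0 : ℂ)).2 - (z₀, (0 : ℂ)).2 ^ 2) ^ 2 ≠ 0 :=
    pow_ne_zero 2 hq0
  obtain ⟨M₁, -, hψ⟩ := exists_eventually_norm_le (r₀ := (z₀, 0)) (F := fun r =>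
    auxPsi (auxCoeff α₃ r.1) (gCoeff c α₁ α₃ r.1) r.2) (by
      unfold auxPsi; fun_prop (disch := assumption))
  obtain ⟨M₂, -, hψ₀⟩ := exists_eventually_norm_le (r₀ := (z₀, 0)) (F := fun r =>
    auxPsi₀ (auxCoeff α₃ r.1) (deriv (auxCoeff α₃) r.1) (deriv (gCoeff c α₁ α₃) r.1) r.2) (by
      unfold auxPsi₀; fun_prop (disch := assumption))
  obtain ⟨M₃, -, hψ₁⟩ := exists_eventually_norm_le (r₀ := (z₀, 0)) (F := fun r =>
    auxPsi₁ (auxCoeff α₃ r.1) (gCoeff c α₁ α₃ r.1) r.2) (by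
      unfold auxPsi₁; fun_prop (disch := assumption))
  obtain ⟨M₄, -, hm⟩ := exists_eventually_norm_le (r₀ := (z₀, 0)) (F := fun r =>
    rateM (gCoeff c α₁ α₃ r.1) (deriv α₃ r.1) r.1 r.2) (by unfold rateM; fun_prop)
  obtain ⟨M₅, -, hn₀⟩ := exists_eventually_norm_le (r₀ := (z₀, 0)) (F := fun r =>
    rateN₀ a₀ c (gCoeff c α₁ α₃ r.1) (kCoeff a₀ α₃ r.1) (deriv (kCoeff a₀ α₃) r.1) (α₁ r.1) (α₃ r.1)
      (deriv α₃ r.1) r.1 r.2) (by unfold rateN₀; fun_prop)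
  obtain ⟨M₆, -, hn₁⟩ := exists_eventually_norm_le (r₀ := (z₀, 0)) (F := fun r =>
    rateN₁ a₀ (gCoeff c α₁ α₃ r.1) (deriv (gCoeff c α₁ α₃) r.1) (deriv α₃ r.1) r.1 r.2) (by
      unfold rateN₁; fun_prop)
  obtain ⟨M₇, -, hB⟩ := exists_eventually_norm_le (r₀ := (z₀, 0)) (F := fun r =>
    4 * r.1 + α₃ r.1 * r.2 + (c + 2 * r.1 / 3 * α₃ r.1 - r.1 ^ 3) * r.2 ^ 2 + α₁ r.1 * r.2 ^ 3)
    (by fun_prop)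
  obtain ⟨M₈, -, hk⟩ := exists_eventually_norm_le (r₀ := (z₀, 0)) (F := fun r => kCoeff a₀ α₃ r.1)
    (by fun_prop)
  obtain ⟨M₉, -, hk'⟩ := exists_eventually_norm_le (r₀ := (z₀, 0))
    (F := fun r => deriv (kCoeff a₀ α₃) r.1) (by fun_prop)
  obtain ⟨M, hM⟩ : ∃ M : ℝ, ∀ i ∈ ({1, M₁, M₂, M₃, M₄, M₅, M₆, M₇, M₈, M₉, ‖a₀‖} : Finset ℝ), i ≤ M :=
    Finset.exists_le _
  simp only [Finset.mem_insert, Finset.mem_singleton, forall_eq_or_imp, forall_eq] at hM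
  obtain ⟨k0, k1, k2, k3, k4, k5, k6, k7, k8, k9, k10⟩ := hM
  have hqc : ContinuousAt (fun r : ℂ × ℂ => 1 + auxCoeff α₃ r.1 * r.2 - r.2 ^ 2) (z₀, 0) := by fun_prop
  have hR0 : (0 : ℝ) < R⁻¹ := by positivity
  have cu : Tendsto (fun r : ℂ × ℂ => ‖r.2‖) (𝓝 (z₀, 0)) (𝓝 0) := by
    have := (continuous_snd.norm).tendsto (z₀, (0 : ℂ))
    simpa using this
  refine ⟨20 * M ^ 2 * (1 + C), by positivity, ?_⟩
  have hz := continuous_fst.tendsto (z₀, (0 : ℂ))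
  filter_upwards [hψ, hψ₀, hψ₁, hm, hn₀, hn₁, hB, hk.and hk', hqc.eventually_ne hq0,
    cu.eventually_lt_const hR0, hz.eventually hCR, hz.eventually h1.eventually_analyticAt,
    hz.eventually h3.eventually_analyticAt]
    with ⟨z, u⟩ g1 g2 g3 g4 g5 g6 g7 g8 g9 g10 g11 g12 g13 hu x
  simp only at g1 g2 g3 g4 g5 g6 g7 g8 g9 g10 g11 g12 g13 hu ⊢
  have hun : 0 < ‖u‖ := norm_pos_iff.2 hu
  have hy : R ≤ ‖u⁻¹‖ := by
    rw [norm_inv, le_inv_comm₀ (by linarith) hun]; exact g10.le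
  have g14 := g11 x u⁻¹ hy
  rw [inv_inv] at g14
  have hD : (x, u⁻¹).2 ^ 2 + auxCoeff α₃ z * (x, u⁻¹).2 - 1 ≠ 0 := by
    have : u⁻¹ ^ 2 + auxCoeff α₃ z * u⁻¹ - 1 = u⁻¹ ^ 2 * (1 + auxCoeff α₃ z * u - u ^ 2) := by
      field_simp
    simp only
    rw [this]
    exact mul_ne_zero (pow_ne_zero 2 (inv_ne_zero hu)) g9
  have hu1 : ‖u‖ ≤ 1 := g10.le.trans (inv_le_one_of_one_le₀ hR)
  rw [auxDeriv_eq (p := (x, u⁻¹)) g12 g13 hD fun Z X Y hT hZ hX hY => by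
    have e := hT.aux_infinity (w := x * u ^ 2) (u := u) (by rw [hY]; exact inv_ne_zero hu)
      rfl rfl rfl (by rw [hY, inv_inv]) (by rw [hY, hX, inv_inv]) (by rw [hZ]; exact g9)
    rw [hZ, hX, hY] at e
    exact e]
  exact norm_aux_rate_le k0 hC.le (inv_mul_cancel₀ hu) hu1 (g1.trans k1) (g2.trans k2) (g3.trans k3)
    (g8.1.trans k8) (g8.2.trans k9) k10 (g4.trans k4) (g5.trans k5) (g6.trans k6) (g7.trans k7) g14

/-- If the denominator of the auxiliary function does not tend to zero, its limit at a finite value of `y` is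
not zero. -/
theorem IntermediatePoint.auxDenom_ne_zero (h3 : AnalyticAt ℂ α₃ z₀) {κ : Chart} {q : ℂ × ℂ}
    (hne : ¬ Tendsto (fun p => auxDenom (normalised a₀ c α₁ α₃) p.1 (affine κ p)) (approach κ z₀ q)
      (𝓝 0)) {y₀ : ℂ} (hy : Tendsto (fun p => (affine κ p).2) (approach κ z₀ q) (𝓝 y₀)) :
    y₀ ^ 2 + auxCoeff α₃ z₀ * y₀ - 1 ≠ 0 := by
  intro h0
  apply hne
  have hA := (analyticAt_auxCoeff h3).continuousAt.tendsto.comp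
    (tendsto_approach_fst (κ := κ) (z₀ := z₀) (q := q))
  have := ((hy.pow 2).add (hA.mul hy)).sub_const 1
  rw [h0] at this
  exact this

/-- Off the zeros of its denominator, the logarithmic derivative of the auxiliary function is bounded
near the line at infinity and the intermediate exceptional curves. -/
theorem IntermediatePoint.exists_auxDeriv_le (h1 : AnalyticAt ℂ α₁ z₀) (h3 : AnalyticAt ℂ α₃ z₀)
    {κ : Chart} {q : ℂ × ℂ} (h : IntermediatePoint (normalised a₀ c α₁ α₃) z₀ κ q)
    (hne : ¬ Tendsto (fun p => auxDenom (normalised a₀ c α₁ α₃) p.1 (affine κ p)) (approach κ z₀ q)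
      (𝓝 0)) :
    ∃ K : ℝ, ∀ᶠ p in approach κ z₀ q, ‖auxDeriv (normalised a₀ c α₁ α₃) p.1 (affine κ p)‖ ≤
      K * ‖aux (normalised a₀ c α₁ α₃) p.1 (affine κ p)‖ := by
  obtain ⟨k, hk, ⟨hy, h5⟩ | ⟨y₀, hy, hx, h5⟩⟩ := h.lower h1 h3 (energyAtInfinity_aux h1 h3 a₀ c)
    fun y₀ hy => energyAt_aux h3 (auxDenom_ne_zero h3 hne hy) a₀ c α₁
  · obtain ⟨C, hC, hCr⟩ := exists_auxDeriv_le_infinity h1 h3 a₀ c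
    have hu : Tendsto (fun p => (affine κ p).2⁻¹) (approach κ z₀ q) (𝓝 0) :=
      tendsto_inv₀_cobounded.comp (tendsto_norm_atTop_iff_cobounded.1 hy)
    refine ⟨C * (1 / k + 1), ?_⟩
    filter_upwards [(tendsto_approach_fst.prodMk_nhds hu).eventually hCr, h5,
      hy.eventually_gt_atTop 0] with p f1 f2 f3
    have f4 := f1 (inv_ne_zero (norm_pos_iff.1 f3)) (affine κ p).1
    simp only [inv_inv, Prod.mk.eta] at f4
    refine f4.trans ?_
    rw [mul_assoc]
    refine mul_le_mul_of_nonneg_left ?_ hC.le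
    rw [add_mul, one_mul, one_div, ← div_eq_inv_mul]
    gcongr
    rw [le_div_iff₀ hk]
    linarith
  · obtain ⟨C, hC, hCr⟩ := exists_auxDeriv_le_finite (α₁ := α₁) h1 h3 (auxDenom_ne_zero h3 hne hy) a₀ c
    refine ⟨C * ((1 + ‖y₀‖ + 1) / k), ?_⟩
    filter_upwards [(tendsto_approach_fst.prodMk_nhds hy).eventually hCr, h5,
      hx.eventually_ge_atTop 1, hy.norm.eventually_lt_const (lt_add_one _)] with p f1 f2 f3 f4
    have f5 := f1 (affine κ p).1
    simp only [Prod.mk.eta] at f5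
    refine f5.trans ?_
    rw [mul_assoc]
    refine mul_le_mul_of_nonneg_left ?_ hC.le
    rw [div_mul_eq_mul_div, le_div_iff₀ hk]
    have hm : ‖(affine κ p).1 * (affine κ p).2‖ = ‖(affine κ p).1‖ * ‖(affine κ p).2‖ := norm_mul _ _
    set m := ‖(affine κ p).1 * (affine κ p).2‖
    have hm0 : 0 ≤ m := norm_nonneg _
    have g1 : m ≤ ‖(affine κ p).1‖ * (‖y₀‖ + 1) := by
      rw [hm]; exact mul_le_mul_of_nonneg_left f4.le (norm_nonneg _)
    have g2 : 1 + m + m ^ 2 ≤ (1 + ‖y₀‖ + 1) * (‖(affine κ p).1‖ * (1 + m)) := by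
      have e1 : m ^ 2 ≤ ‖(affine κ p).1‖ * (‖y₀‖ + 1) * m := by
        rw [sq]; exact mul_le_mul_of_nonneg_right g1 hm0
      have e2 : 1 + m ≤ ‖(affine κ p).1‖ * (1 + m) := le_mul_of_one_le_left (by linarith) f3
      have e3 : 0 ≤ (‖y₀‖ + 1) * ‖(affine κ p).1‖ := by positivity
      linarith
    calc (1 + m + m ^ 2) * k ≤ (1 + ‖y₀‖ + 1) * (‖(affine κ p).1‖ * (1 + m)) * k := by gcongr
      _ = (1 + ‖y₀‖ + 1) * (k * (‖(affine κ p).1‖ * (1 + m))) := by ring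
      _ ≤ _ := by gcongr

theorem IntermediatePoint.tendsto_aux (h1 : AnalyticAt ℂ α₁ z₀) (h3 : AnalyticAt ℂ α₃ z₀)
    {κ : Chart} {q : ℂ × ℂ} (h : IntermediatePoint (normalised a₀ c α₁ α₃) z₀ κ q)
    (hne : ¬ Tendsto (fun p => auxDenom (normalised a₀ c α₁ α₃) p.1 (affine κ p)) (approach κ z₀ q)
      (𝓝 0)) :
    Tendsto (fun p => ‖aux (normalised a₀ c α₁ α₃) p.1 (affine κ p)‖) (approach κ z₀ q) atTop :=
  h.tendsto_atTop h1 h3 (energyAtInfinity_aux h1 h3 a₀ c)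
    fun _ hy => energyAt_aux h3 (auxDenom_ne_zero h3 hne hy) a₀ c α₁

/-- The auxiliary function is bounded near the points of the final curves. -/
theorem exists_bound_aux (h1 : AnalyticAt ℂ α₁ z₀) (h3 : AnalyticAt ℂ α₃ z₀) (v₀ : ℂ) {κ : Chart}
    (hκ : κ = chartE7 (normalised a₀ c α₁ α₃) 1 ∨ κ = chartE7 (normalised a₀ c α₁ α₃) (-1) ∨
      κ = chartE9 (normalised a₀ c α₁ α₃)) :
    ∃ K : ℝ, ∀ᶠ p in approach κ z₀ (0, v₀), ‖aux (normalised a₀ c α₁ α₃) p.1 (affine κ p)‖ ≤ K := by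
  rcases hκ with rfl | rfl | rfl
  · exact (energyAtInfinity_aux h1 h3 a₀ c).bounded_e7 h1 h3 (Or.inl rfl) v₀
  · exact (energyAtInfinity_aux h1 h3 a₀ c).bounded_e7 h1 h3 (Or.inr rfl) v₀
  · exact (energyAt_aux h3 (by simp) a₀ c α₁).bounded_e9 h1 h3 v₀

end

/-! ### The end points of continuations -/

section

variable {α : Fin 5 → ℂ → ℂ} {U : Set ℂ} {γ : ℝ → ℂ} {x y : ℝ → ℂ → ℂ}

theorem FinitePath.continuousAt (hγ : FinitePath U γ) {τ : ℝ} (hτ : τ ∈ Ioo (0 : ℝ) 1) :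
    ContinuousAt γ τ :=
  hγ.1.continuousAt (mem_of_superset (Ioo_mem_nhds hτ.1 hτ.2) Ioo_subset_Icc_self)

theorem exists_forall_Ico {p : ℝ → Prop} (h : ∀ᶠ τ in 𝓝[<] (1 : ℝ), p τ) :
    ∃ τ₁ ∈ Ico (0 : ℝ) 1, ∀ τ ∈ Ico τ₁ 1, p τ := by
  obtain ⟨τ₁, hτ₁, hgood⟩ := (mem_nhdsLT_iff_exists_Ico_subset).1 h
  exact ⟨max τ₁ 0, ⟨le_max_right _ _, max_lt hτ₁ one_pos⟩,
    fun τ hτ => hgood ⟨(le_max_left _ _).trans hτ.1, hτ.2⟩⟩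

theorem exists_mem_Ico {F : Filter ℝ} [F.NeBot] (hF : F ≤ 𝓝[<] (1 : ℝ)) {τ₁ : ℝ} (hτ₁ : τ₁ < 1)
    {p : ℝ → Prop} (h : ∀ᶠ τ in F, p τ) : ∃ τ ∈ Ico τ₁ 1, p τ := by
  have h1 : ∀ᶠ τ in F, τ ∈ Ico τ₁ 1 := hF (Ico_mem_nhdsLT hτ₁)
  exact (h1.and h).exists

theorem eventually_mem_Ioo {τ₀ : ℝ} (hτ₀ : τ₀ ∈ Ico (0 : ℝ) 1) :
    ∀ᶠ τ in 𝓝[<] (1 : ℝ), τ ∈ Ico τ₀ 1 ∧ τ ∈ Ioo (0 : ℝ) 1 := by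
  filter_upwards [Ioo_mem_nhdsLT hτ₀.2] with τ h
  exact ⟨⟨h.1.le, h.2⟩, hτ₀.1.trans_lt h.1, h.2⟩

/-- A continuation that has a finite cluster point in phase space extends analytically: the solutions
with nearby initial values exist on a disc of fixed size. -/
theorem IsContinuation.endsRegularly (h : IsContinuation α γ x y) (hγ : FinitePath U γ)
    (hα : ∀ i, AnalyticAt ℂ (α i) (γ 1)) {w₀ : ℂ × ℂ} {F : Filter ℝ} [F.NeBot]
    (hF : F ≤ 𝓝[<] (1 : ℝ)) (hw : Tendsto (fun τ => (x τ (γ τ), y τ (γ τ))) F (𝓝 w₀)) :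
    EndsRegularly γ x y := by
  obtain ⟨ρ₁, hρ₁, hsol⟩ := exists_holomorphic_solution (F := fun r : ℂ × ℂ × ℂ => field α r.1 r.2)
    (analyticAt_field hα w₀) (N := univ) univ_mem
  obtain ⟨ρ₂, hρ₂, hball⟩ := Metric.eventually_nhds_iff_ball.1
    (eventually_all.2 fun i => (hα i).eventually_analyticAt)
  set ρ := min ρ₁ ρ₂ with hρdef
  have hρ : 0 < ρ := lt_min hρ₁ hρ₂
  obtain ⟨τ₁, hτ₁, hnear⟩ := exists_forall_Ico
    (hγ.tendsto.eventually (Metric.closedBall_mem_nhds (γ 1) (half_pos hρ)))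
  obtain ⟨τ₀, hτ₀, w, hw0, hwd⟩ := exists_mem_Ico hF hτ₁.2
    (((hγ.tendsto.mono_left hF).prodMk_nhds hw).eventually hsol)
  have hτ₀' : τ₀ ∈ Ico (0 : ℝ) 1 := ⟨hτ₁.1.trans hτ₀.1, hτ₀.2⟩
  simp only at hw0
  have hd : ∀ z ∈ Metric.ball (γ 1) ρ, HasDerivAt w (field α z (w z)) z := fun z hz =>
    (hwd z (Metric.ball_subset_ball (min_le_left _ _) hz)).1
  have hsub : Metric.closedBall (γ 1) (ρ / 2) ⊆ Metric.ball (γ 1) ρ :=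
    Metric.closedBall_subset_ball (half_lt_self hρ)
  have hαb : ∀ z ∈ Metric.ball (γ 1) ρ, ∀ i, AnalyticAt ℂ (α i) z := fun z hz =>
    hball z (Metric.ball_subset_ball (min_le_right _ _) hz)
  have hP : ∀ z ∈ Metric.ball (γ 1) ρ, HasDerivAt w (deriv id z • field α (id z) (w z)) z := by
    intro z hz
    rw [deriv_id, one_smul]
    exact hd z hz
  have hpar := h.exists_param hγ.1 (Z := id) (P := w) Metric.isOpen_ball
    (isCompact_closedBall (γ 1) (ρ / 2)) continuousOn_id
    (fun z _ => ⟨analyticAt_id, by rw [deriv_id]; exact one_ne_zero⟩) hP hαb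
    (fun z hz => absurd (hsub hz.1) hz.2) hτ₀'
    (fun τ hτ z _ hz' => by
      rw [id] at hz'
      rw [hz']
      exact hnear τ ⟨hτ₀.1.trans hτ.1, hτ.2⟩)
    ⟨γ τ₀, hsub (hnear τ₀ hτ₀), rfl, hw0⟩
  have hwA : AnalyticAt ℂ w (γ 1) := DifferentiableOn.analyticAt (s := Metric.ball (γ 1) ρ)
    (fun z hz => (hd z hz).differentiableAt.differentiableWithinAt) (Metric.ball_mem_nhds _ hρ)
  refine ⟨fun z => (w z).1, fun z => (w z).2, (analyticAt_fst (p := w (γ 1))).comp_of_eq hwA rfl,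
    (analyticAt_snd (p := w (γ 1))).comp_of_eq hwA rfl, ?_⟩
  filter_upwards [eventually_mem_Ioo hτ₀'] with τ ⟨hτ, hτ'⟩
  obtain ⟨u, hu, hu1, hu2⟩ := hpar τ hτ
  have := h.eventually_eq ⟨hτ'.1.le, hτ'.2⟩ (Z := id) analyticAt_id (hαb u hu)
    ((Metric.isOpen_ball.eventually_mem hu).mono hP) hu1 hu2
  rw [← hu1]
  exact ⟨this.mono fun v hv => congrArg Prod.fst hv, this.mono fun v hv => congrArg Prod.snd hv⟩

/-- A continuation that becomes infinite and has a cluster point on `E₇^ε` ends in a series in powers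
of the square root: from a nearby point on, it is the solution in the chart through that point. -/
theorem IsContinuation.endsInSeries_e7 (h : IsContinuation α γ x y) (hγ : FinitePath U γ)
    (hα : ∀ i, AnalyticAt ℂ (α i) (γ 1)) {ε : ℂ} (hε : ε = 1 ∨ ε = -1)
    (hres : ∀ᶠ z in 𝓝 (γ 1), resonance α ε z = 0)
    (hinf : Tendsto (fun τ => ‖(x τ (γ τ), y τ (γ τ))‖) (𝓝[<] 1) atTop)
    {F : Filter ℝ} [F.NeBot] (hF : F ≤ 𝓝[<] (1 : ℝ)) {a b : ℝ → ℂ} {v₀ : ℂ}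
    (ha : Tendsto a F (𝓝 0)) (hb : Tendsto b F (𝓝 v₀))
    (hab : ∀ᶠ τ in F, (γ τ, a τ, b τ) ∈ finitePart (chartE7 α ε) ∧
      affine (chartE7 α ε) (γ τ, a τ, b τ) = (x τ (γ τ), y τ (γ τ))) :
    EndsInSeries α (chartE7 α ε) 2 γ x y := by
  obtain ⟨ρ, hρ, hcur⟩ := exists_e7_curve hε hα hres v₀
    (N := {q : ℂ × ℂ | ∀ i, AnalyticAt ℂ (α i) q.1})
    ((continuous_fst.tendsto (γ 1, v₀)).eventually
      (eventually_all.2 fun i => (hα i).eventually_analyticAt))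
  obtain ⟨τ₁, hτ₁, hnear⟩ := exists_forall_Ico
    (hγ.tendsto.eventually (Metric.ball_mem_nhds (γ 1) (show 0 < ρ ^ 2 / 64 by positivity)))
  obtain ⟨τ₀, hτ₀, ⟨Z, V, g, hZ0, hV0, hc, hZα⟩, ⟨hfin, haff⟩, ha0⟩ := exists_mem_Ico hF hτ₁.2
    (((ha.prodMk_nhds ((hγ.tendsto.mono_left hF).prodMk_nhds hb)).eventually hcur).and
      (hab.and (ha.eventually (Metric.ball_mem_nhds (0 : ℂ) (show 0 < ρ / 8 by positivity)))))
  have hτ₀' : τ₀ ∈ Ico (0 : ℝ) 1 := ⟨hτ₁.1.trans hτ₀.1, hτ₀.2⟩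
  simp only at hZ0 hV0
  rw [dist_zero_right] at ha0
  set P : ℂ → ℂ × ℂ := fun u => affine (chartE7 α ε) (Z u, u, V u) with hPdef
  set R : Set ℂ := Metric.ball 0 ρ \ {0} with hRdef
  have hR : IsOpen R := Metric.isOpen_ball.sdiff isClosed_singleton
  have hsub : Metric.closedBall (0 : ℂ) (ρ / 2) ⊆ Metric.ball 0 ρ :=
    Metric.closedBall_subset_ball (half_lt_self hρ)
  have hP2 : ∀ u ∈ R, (P u).2 = 1 / u := fun u hu => by
    rw [hPdef]
    simp only
    rw [chartE7, affine_branchChart (hc.mem u hu.1 hu.2)]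
  have ha0' : a τ₀ ∈ R := by
    refine ⟨?_, (mem_finitePart_branchChart.1 hfin).1⟩
    rw [mem_ball_zero_iff]
    linarith
  have hPd : ∀ u ∈ R, HasDerivAt P (deriv Z u • field α (Z u) (P u)) u := fun u hu =>
    hc.solves u hu.1 hu.2
  have hZR : ∀ u ∈ R, AnalyticAt ℂ Z u ∧ deriv Z u ≠ 0 := fun u hu =>
    ⟨hc.analytic_Z u hu.1, (hc.deriv_ne_zero hu.1 hu.2).2⟩
  -- `|u|² / 4 ≤ |γ τ - Z 0| ≤ 2 ρ² / 64 + (ρ / 8)²`, so that `u` does not leave the smaller disc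
  have hG : ∀ τ ∈ Ico τ₀ 1, ∀ u ∈ R, Z u = γ τ → u ∈ Metric.closedBall (0 : ℂ) (ρ / 2) := by
    intro τ hτ u hu hZu
    have e1 := (hc.norm_sub hu.1).1
    have e2 := (hc.norm_sub ha0'.1).2
    have e3 := hnear τ ⟨hτ₀.1.trans hτ.1, hτ.2⟩
    have e4 := hnear τ₀ hτ₀
    rw [dist_eq_norm] at e3 e4
    rw [hZu] at e1
    rw [hZ0] at e2
    have e5 : γ τ - Z 0 = (γ τ - γ 1) - (γ τ₀ - γ 1) + (γ τ₀ - Z 0) := by ring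
    rw [e5] at e1
    have e6 := (norm_add_le ((γ τ - γ 1) - (γ τ₀ - γ 1)) (γ τ₀ - Z 0)).trans
      (add_le_add (norm_sub_le _ _) e2)
    have e7 : ‖a τ₀‖ ^ 2 ≤ (ρ / 8) ^ 2 := by gcongr
    rw [mem_closedBall_zero_iff]
    refine (sq_le_sq₀ (norm_nonneg u) (by positivity)).1 ?_
    have e8 : 0 < ρ ^ 2 := by positivity
    linarith
  have hpar := h.exists_param hγ.1 (Z := Z) (P := P) (K := Metric.closedBall 0 (ρ / 2)) hR
    (isCompact_closedBall _ _)
    (fun u hu => (hc.analytic_Z u (hsub hu)).continuousAt.continuousWithinAt) hZR hPd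
    (fun u hu => hZα u hu.1)
    (by
      rintro u ⟨hu, huR⟩
      have hu0 : u = 0 := by
        by_contra h0
        exact huR ⟨hsub hu, h0⟩
      rw [hu0]
      have h1 : Tendsto (fun v : ℂ => ‖(1 : ℂ) / v‖) (𝓝[R] 0) atTop :=
        tendsto_norm_div_atTop tendsto_const_nhds one_ne_zero
          (tendsto_id.mono_left nhdsWithin_le_nhds)
          (mem_of_superset self_mem_nhdsWithin fun v hv => hv.2)
      refine tendsto_atTop_mono' _ ?_ h1
      filter_upwards [self_mem_nhdsWithin] with v hv
      rw [← hP2 v hv]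
      exact norm_snd_le _) hτ₀'
    hG
    ⟨a τ₀, ha0', hZ0, by rw [hPdef]; simp only; rw [hZ0, hV0]; exact haff⟩
  -- the coordinate `u` along the path
  set μ : ℝ → ℂ := fun τ => (y τ (γ τ))⁻¹ with hμdef
  have hμ : ∀ τ ∈ Ico τ₀ 1, μ τ ∈ R ∧ Z (μ τ) = γ τ ∧ P (μ τ) = (x τ (γ τ), y τ (γ τ)) := by
    intro τ hτ
    obtain ⟨u, hu, hu1, hu2⟩ := hpar τ hτ
    have e1 := hP2 u hu
    rw [hu2] at e1
    have e2 : μ τ = u := by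
      rw [hμdef]
      simp only at e1 ⊢
      rw [e1, one_div, inv_inv]
    rw [e2]
    exact ⟨hu, hu1, hu2⟩
  -- `P` is bounded away from `u = 0`, and the solution becomes infinite
  have hμ0 : Tendsto μ (𝓝[<] 1) (𝓝 0) := by
    refine Metric.tendsto_nhds.2 fun η hη => ?_
    have hS : ∀ u ∈ Metric.closedBall (0 : ℂ) (ρ / 2) \ Metric.ball 0 η, u ∈ R := fun u hu =>
      ⟨hsub hu.1, fun h0 => hu.2 (by rw [mem_singleton_iff.1 h0]; exact Metric.mem_ball_self hη)⟩
    obtain ⟨C, hC⟩ := ((isCompact_closedBall (0 : ℂ) (ρ / 2)).diff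
      Metric.isOpen_ball).exists_bound_of_continuousOn (f := P)
      fun u hu => (hPd u (hS u hu)).continuousAt.continuousWithinAt
    filter_upwards [hinf.eventually_gt_atTop C, eventually_mem_Ioo hτ₀'] with τ f1 ⟨f2, _⟩
    obtain ⟨e1, e2, e3⟩ := hμ τ f2
    by_contra hcon
    have := hC (μ τ) ⟨hG τ f2 _ e1 e2, hcon⟩
    rw [e3] at this
    linarith
  have h0ρ : (0 : ℂ) ∈ Metric.ball (0 : ℂ) ρ := Metric.mem_ball_self hρ
  have hZ1 : Z 0 = γ 1 := by
    refine tendsto_nhds_unique (((hc.analytic_Z 0 h0ρ).continuousAt.tendsto.comp hμ0).congr' ?_)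
      hγ.tendsto
    filter_upwards [eventually_mem_Ioo hτ₀'] with τ ⟨f2, _⟩ using (hμ τ f2).2.1
  have hg0 : g 0 ≠ 0 := by
    intro hg
    have h1 := hc.norm_g 0 h0ρ
    have hε1 : ‖ε‖ = 1 := by rcases hε with rfl | rfl <;> simp
    rw [hg, zero_add, hε1] at h1
    norm_num at h1
  obtain ⟨s, T, hs, hT, hs0, hT0, hsT, hZT⟩ := exists_sqrt_coordinate (hc.analytic_Z 0 h0ρ)
    (hc.analytic_g 0 h0ρ) (mem_of_superset (Metric.ball_mem_nhds (0 : ℂ) hρ) hc.deriv_Z) hg0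
  have hser := hc.seriesThrough hT hT0 hs0 hZT (by rwa [hZ1])
  rw [hZ1] at hser
  have hst : Tendsto (fun τ => s (μ τ)) (𝓝[<] 1) (𝓝 0) := by
    have := hs.continuousAt.tendsto.comp hμ0
    rwa [hs0] at this
  refine ⟨V 0, _, _, hser, fun τ => s (μ τ), hst, ?_⟩
  filter_upwards [eventually_mem_Ioo hτ₀', hμ0.eventually hs.eventually_analyticAt,
    hμ0.eventually hsT, hst.eventually hZT.eventually_nhds, hst.eventually hT.eventually_analyticAt]
    with τ ⟨f1, f2⟩ f3 f4 f5 f6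
  obtain ⟨e1, e2, e3⟩ := hμ τ f1
  refine ⟨?_, by rw [f4.1, e2, hZ1], ?_⟩
  · have hpc := (h.continuousOn hγ.1).continuousAt
      (mem_of_superset (Ioo_mem_nhds f2.1 f2.2) Ioo_subset_Ico_self)
    have hyc : ContinuousAt (fun τ => y τ (γ τ)) τ := hpc.snd
    have hy0 : y τ (γ τ) ≠ 0 := fun h0 => e1.2 (by
      rw [mem_singleton_iff, hμdef]; simp only; rw [h0, inv_zero])
    exact ContinuousAt.comp (g := s) (f := μ) f3.continuousAt (hyc.inv₀ hy0)
  · have hgerm := h.eventually_eq ⟨f2.1.le, f2.2⟩ (hZR _ e1).1 (hZα _ e1.1)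
      ((hR.eventually_mem e1).mono hPd) e2 e3
    have hTc : Tendsto T (𝓝 (s (μ τ))) (𝓝 (μ τ)) := by
      have := f6.continuousAt.tendsto
      rwa [f4.2] at this
    filter_upwards [hTc.eventually hgerm, f5] with w g1 g2
    rw [← hZ1, ← g2.1]
    exact ⟨congrArg Prod.fst g1, congrArg Prod.snd g1⟩

/-- A continuation that becomes infinite and has a cluster point on `E₉` ends in a Laurent series. -/
theorem IsContinuation.endsInSeries_e9 (h : IsContinuation α γ x y) (hγ : FinitePath U γ)
    (hα : ∀ i, AnalyticAt ℂ (α i) (γ 1)) (hres : ∀ᶠ z in 𝓝 (γ 1), deriv (α 0) z = 0)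
    (hinf : Tendsto (fun τ => ‖(x τ (γ τ), y τ (γ τ))‖) (𝓝[<] 1) atTop)
    {F : Filter ℝ} [F.NeBot] (hF : F ≤ 𝓝[<] (1 : ℝ)) {a b : ℝ → ℂ} {v₀ : ℂ}
    (ha : Tendsto a F (𝓝 0)) (hb : Tendsto b F (𝓝 v₀))
    (hab : ∀ᶠ τ in F, a τ ≠ 0 ∧
      affine (chartE9 α) (γ τ, a τ, b τ) = (x τ (γ τ), y τ (γ τ))) :
    EndsInSeries α (chartE9 α) 1 γ x y := by
  obtain ⟨ρ₁, hρ₁, hcur⟩ := exists_e9_curve hα hres v₀ univ_mem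
  obtain ⟨ρ₂, hρ₂, hball⟩ := Metric.eventually_nhds_iff_ball.1
    (eventually_all.2 fun i => (hα i).eventually_analyticAt)
  set ρ := min ρ₁ ρ₂ with hρdef
  have hρ : 0 < ρ := lt_min hρ₁ hρ₂
  obtain ⟨τ₁, hτ₁, hnear⟩ := exists_forall_Ico
    (hγ.tendsto.eventually (Metric.closedBall_mem_nhds (γ 1) (half_pos hρ)))
  obtain ⟨τ₀, hτ₀, ⟨u, v, hu0, hv0, hc, -⟩, ha0, haff⟩ := exists_mem_Ico hF hτ₁.2
    ((((hγ.tendsto.mono_left hF).prodMk_nhds (ha.prodMk_nhds hb)).eventually hcur).and hab)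
  have hτ₀' : τ₀ ∈ Ico (0 : ℝ) 1 := ⟨hτ₁.1.trans hτ₀.1, hτ₀.2⟩
  simp only at hu0 hv0
  have hsub : Metric.closedBall (γ 1) (ρ / 2) ⊆ Metric.ball (γ 1) ρ :=
    Metric.closedBall_subset_ball (half_lt_self hρ)
  have hsub₁ : ∀ z ∈ Metric.ball (γ 1) ρ, z ∈ Metric.ball (γ 1) ρ₁ := fun z hz =>
    Metric.ball_subset_ball (min_le_left _ _) hz
  set P : ℂ → ℂ × ℂ := fun z => affine (chartE9 α) (z, u z, v z) with hPdef
  set R : Set ℂ := {z | z ∈ Metric.ball (γ 1) ρ ∧ u z ≠ 0} with hRdef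
  have hR : IsOpen R := isOpen_iff_mem_nhds.2 fun z hz =>
    (Metric.isOpen_ball.eventually_mem hz.1).and
      ((hc.analytic_u z (hsub₁ z hz.1)).continuousAt.eventually_ne hz.2)
  have hP1 : ∀ z ∈ R, (P z).1 = 1 / u z := fun z hz => by
    rw [hPdef]
    simp only
    rw [affine_e9 hz.2]
  have hPd : ∀ z ∈ R, HasDerivAt P (deriv id z • field α (id z) (P z)) z := fun z hz => by
    rw [deriv_id, one_smul]
    exact hc.solves z (hsub₁ z hz.1) hz.2
  have hαb : ∀ z ∈ R, ∀ i, AnalyticAt ℂ (α i) z := fun z hz =>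
    hball z (Metric.ball_subset_ball (min_le_right _ _) hz.1)
  have hball₀ := hsub (hnear τ₀ hτ₀)
  have hpar := h.exists_param hγ.1 (Z := id) (P := P) hR (isCompact_closedBall (γ 1) (ρ / 2))
    continuousOn_id (fun z _ => ⟨analyticAt_id, by rw [deriv_id]; exact one_ne_zero⟩) hPd hαb
    (by
      rintro z ⟨hz, hzR⟩
      have hu : u z = 0 := by
        by_contra h0
        exact hzR ⟨hsub hz, h0⟩
      have h1 : Tendsto (fun t => ‖(1 : ℂ) / u t‖) (𝓝[R] z) atTop := by
        refine tendsto_norm_div_atTop tendsto_const_nhds one_ne_zero ?_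
          (mem_of_superset self_mem_nhdsWithin fun t ht => ht.2)
        rw [← hu]
        exact (hc.analytic_u z (hsub₁ z (hsub hz))).continuousAt.tendsto.mono_left
          nhdsWithin_le_nhds
      refine tendsto_atTop_mono' _ ?_ h1
      filter_upwards [self_mem_nhdsWithin] with t ht
      rw [← hP1 t ht]
      exact norm_fst_le _) hτ₀'
    (fun τ hτ z _ hz' => by
      rw [id] at hz'
      rw [hz']
      exact hnear τ ⟨hτ₀.1.trans hτ.1, hτ.2⟩)
    ⟨γ τ₀, ⟨hball₀, by rw [hu0]; exact ha0⟩, rfl, by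
      rw [hPdef]; simp only; rw [hu0, hv0]; exact haff⟩
  have hμ : ∀ τ ∈ Ico τ₀ 1, γ τ ∈ R ∧ P (γ τ) = (x τ (γ τ), y τ (γ τ)) := by
    intro τ hτ
    obtain ⟨z, hz, hz1, hz2⟩ := hpar τ hτ
    rw [← hz1] at hz2 ⊢
    exact ⟨hz, hz2⟩
  have h1ρ : γ 1 ∈ Metric.ball (γ 1) ρ := Metric.mem_ball_self hρ
  have hu1 : u (γ 1) = 0 := by
    by_contra h0
    have h1 := ((hPd (γ 1) ⟨h1ρ, h0⟩).continuousAt.tendsto.comp hγ.tendsto).norm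
    refine not_tendsto_atTop_of_tendsto_nhds (h1.congr' ?_) hinf
    filter_upwards [eventually_mem_Ioo hτ₀'] with τ ⟨f2, _⟩
    rw [Function.comp, (hμ τ f2).2]
  refine ⟨v (γ 1), _, _, hc.seriesThrough hu1 hα, fun τ => γ τ - γ 1, ?_, ?_⟩
  · have := hγ.tendsto.sub_const (γ 1)
    rwa [sub_self] at this
  filter_upwards [eventually_mem_Ioo hτ₀'] with τ ⟨f1, f2⟩
  obtain ⟨e1, e2⟩ := hμ τ f1
  refine ⟨(hγ.continuousAt f2).sub continuousAt_const, pow_one _, ?_⟩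
  have hgerm := h.eventually_eq ⟨f2.1.le, f2.2⟩ (Z := id) analyticAt_id (hαb _ e1)
    ((hR.eventually_mem e1).mono hPd) rfl e2
  have hTc : Tendsto (fun w => γ 1 + w) (𝓝 (γ τ - γ 1)) (𝓝 (γ τ)) := by
    have : ContinuousAt (fun w => γ 1 + w) (γ τ - γ 1) := by fun_prop
    have := this.tendsto
    rwa [add_sub_cancel] at this
  filter_upwards [hTc.eventually hgerm] with w g1
  rw [pow_one]
  exact ⟨congrArg Prod.fst g1, congrArg Prod.snd g1⟩

end

/-! ### Cluster points on the final curves -/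

section

variable {a₀ c : ℂ} {α₁ α₃ : ℂ → ℂ} {z₀ : ℂ} {E : ℂ → ℂ × ℂ → ℂ} {ι : Type*}

/-- A function that is bounded along an ultrafilter has a limit along it. -/
theorem Ultrafilter.exists_tendsto {X : Type*} [NormedAddCommGroup X] [ProperSpace X]
    (F : Ultrafilter ι) {f : ι → X} {B : ℝ} (hB : ∀ᶠ i in (F : Filter ι), ‖f i‖ ≤ B) :
    ∃ a, Tendsto f F (𝓝 a) := by
  have h1 : ((F.map f : Ultrafilter X) : Filter X) ≤ 𝓟 (Metric.closedBall 0 B) := by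
    rw [le_principal_iff, Ultrafilter.coe_map, mem_map]
    exact hB.mono fun i hi => by simpa using hi
  obtain ⟨a, -, ha⟩ := (isCompact_closedBall (0 : X) B).ultrafilter_le_nhds _ h1
  exact ⟨a, ha⟩

/-- Along an ultrafilter on which `y` is infinite and the energy bounded, one of the two branches is
selected, and `v₇` is bounded there. -/
theorem EnergyAtInfinity.exists_e7_limit (h1 : AnalyticAt ℂ α₁ z₀) (h3 : AnalyticAt ℂ α₃ z₀)
    (hE : EnergyAtInfinity a₀ c α₁ α₃ z₀ E) (F : Ultrafilter ι) {z x y : ι → ℂ}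
    (hz : Tendsto z F (𝓝 z₀)) (hy : Tendsto (fun i => ‖y i‖) F atTop) {B : ℝ}
    (hB : ∀ᶠ i in (F : Filter ι), ‖E (z i) (x i, y i)‖ ≤ B) :
    ∃ ε : ℂ, (ε = 1 ∨ ε = -1) ∧ ∃ (a b : ι → ℂ) (v₀ : ℂ), Tendsto a F (𝓝 0) ∧ Tendsto b F (𝓝 v₀) ∧
      ∀ᶠ i in (F : Filter ι), (z i, a i, b i) ∈ finitePart (chartE7 (normalised a₀ c α₁ α₃) ε) ∧
        affine (chartE7 (normalised a₀ c α₁ α₃) ε) (z i, a i, b i) = (x i, y i) := by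
  obtain ⟨C, R, hC, hR, hCR⟩ := hE.ratio h1 h3
  have hu : Tendsto (fun i => (y i)⁻¹) F (𝓝 0) :=
    tendsto_inv₀_cobounded.comp (tendsto_norm_atTop_iff_cobounded.1 hy)
  have hun : Tendsto (fun i => ‖(y i)⁻¹‖) F (𝓝 0) := by simpa using hu.norm
  set w : ι → ℂ := fun i => x i * (y i)⁻¹ ^ 2 with hw
  -- `w² - 1` is at most `C (|u| (1 + |w|) + |u|⁵ B)`
  have hmain : ∀ᶠ i in (F : Filter ι),
      ‖w i ^ 2 - 1‖ ≤ C * (‖(y i)⁻¹‖ * (1 + ‖w i‖) + ‖(y i)⁻¹‖ ^ 5 * B) := by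
    filter_upwards [hz.eventually hCR, hy.eventually_ge_atTop R, hB] with i f1 f2 f3
    refine (f1 (x i) (y i) f2).trans ?_
    gcongr
  have hs : Tendsto (fun i => C * ‖(y i)⁻¹‖) F (𝓝 0) := by simpa using hun.const_mul C
  have hs5 : Tendsto (fun i => C * (‖(y i)⁻¹‖ ^ 5 * B)) F (𝓝 0) := by
    have := ((hun.pow 5).mul_const B).const_mul C
    simpa using this
  have hw2 : ∀ᶠ i in (F : Filter ι), ‖w i‖ ≤ 4 := by
    filter_upwards [hmain, hs.eventually_le_const one_pos, hs5.eventually_le_const one_pos]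
      with i f1 f2 f3
    have e1 : ‖w i‖ ^ 2 ≤ ‖w i ^ 2 - 1‖ + 1 := by
      have := norm_add_le (w i ^ 2 - 1) 1
      rwa [sub_add_cancel, norm_pow, norm_one] at this
    have e2 : C * ‖(y i)⁻¹‖ * (1 + ‖w i‖) ≤ 1 * (1 + ‖w i‖) := by gcongr
    by_contra! h4
    have e3 : ‖w i‖ * 4 ≤ ‖w i‖ * ‖w i‖ := mul_le_mul_of_nonneg_left h4.le (norm_nonneg _)
    linarith
  obtain ⟨ε, hε⟩ := Ultrafilter.exists_tendsto F hw2
  have hε2 : ε ^ 2 - 1 = 0 := by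
    have e1 : Tendsto (fun i => ‖w i ^ 2 - 1‖) F (𝓝 0) := by
      refine squeeze_zero' (Eventually.of_forall fun i => norm_nonneg _) (hmain.mono fun i hi => hi) ?_
      have := ((hun.mul (hε.norm.const_add 1)).add ((hun.pow 5).mul_const B)).const_mul C
      simpa using this
    exact norm_eq_zero.1 (tendsto_nhds_unique ((hε.pow 2).sub_const 1).norm e1)
  have hε1 : ε = 1 ∨ ε = -1 := mul_self_eq_one_iff.1 (by rw [← sq]; exact sub_eq_zero.1 hε2)
  have hε0 : ε ≠ 0 := by rcases hε1 with rfl | rfl <;> norm_num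
  have hεinv : ε⁻¹ = ε := by rcases hε1 with rfl | rfl <;> norm_num
  set α := normalised a₀ c α₁ α₃ with hα
  obtain ⟨C', hC', hCE⟩ := hE.branch h1 h3 hε1
  have hv : Tendsto (fun i => (w i)⁻¹) F (𝓝 ε) := by
    have := hε.inv₀ hε0
    rwa [hεinv] at this
  set b : ι → ℂ := fun i => ((w i)⁻¹ - vTwo α ε 5 (z i) ((y i)⁻¹, 0)) / (y i)⁻¹ ^ 5 with hb
  have hy0 : ∀ᶠ i in (F : Filter ι), y i ≠ 0 :=
    (hy.eventually_gt_atTop 0).mono fun i hi => norm_pos_iff.1 hi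
  have hxy : ∀ᶠ i in (F : Filter ι), (1 / ((y i)⁻¹ ^ 2 * (w i)⁻¹), 1 / (y i)⁻¹) = (x i, y i) := by
    filter_upwards [hy0, hε.eventually_ne hε0] with i f1 f2
    have hx : x i ≠ 0 := fun h0 => f2 (by rw [hw]; simp only; rw [h0, zero_mul])
    refine Prod.ext ?_ ?_
    · simp only [hw]; field_simp
    · simp only; rw [one_div, inv_inv]
  -- bounded energy puts `v₂` within a multiple of `|u|⁵` of the branch
  have hbb : ∀ᶠ i in (F : Filter ι), ‖b i‖ ≤ C' * (1 + B) := by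
    filter_upwards [(hz.prodMk_nhds (hu.prodMk_nhds hv)).eventually hCE, hxy, hB, hy0]
      with i f1 f2 f3 f4
    obtain ⟨f5, -⟩ := f1 (inv_ne_zero f4)
    rw [f2] at f5
    have h5 : 0 < ‖(y i)⁻¹‖ ^ 5 := pow_pos (norm_pos_iff.2 (inv_ne_zero f4)) 5
    rw [hb]
    simp only
    rw [norm_div, norm_pow, div_le_iff₀ h5]
    refine f5.trans ?_
    have : C' * (‖(y i)⁻¹‖ ^ 5 * (1 + ‖E (z i) (x i, y i)‖)) ≤
        C' * (‖(y i)⁻¹‖ ^ 5 * (1 + B)) := by gcongr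
    linarith
  obtain ⟨v₀, hv₀⟩ := Ultrafilter.exists_tendsto F hbb
  refine ⟨ε, hε1, fun i => (y i)⁻¹, b, v₀, hu, hv₀, ?_⟩
  filter_upwards [hxy, hy0, hv.eventually_ne hε0] with i f1 f2 f3
  have hvT : vTwo α ε 5 (z i) ((y i)⁻¹, b i) = (w i)⁻¹ := by
    have e1 : (y i)⁻¹ ^ 5 * b i = (w i)⁻¹ - vTwo α ε 5 (z i) ((y i)⁻¹, 0) := by
      rw [hb]; simp only; exact mul_div_cancel₀ _ (pow_ne_zero 5 (inv_ne_zero f2))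
    rw [vTwo_five] at e1 ⊢
    rw [e1]
    ring
  have hmem : (z i, (y i)⁻¹, b i) ∈ finitePart (chartE7 α ε) :=
    mem_finitePart_branchChart.2 ⟨inv_ne_zero f2, by rw [hvT]; exact f3⟩
  refine ⟨hmem, ?_⟩
  rw [chartE7, affine_branchChart hmem, hvT]
  exact f1

/-- Along an ultrafilter on which `x` is infinite, `y` finite and the energy bounded, `x y` tends to
`2 a₀`, and `v₉` is bounded. -/
theorem EnergyAt.exists_e9_limit {y₀ : ℂ} (h1 : AnalyticAt ℂ α₁ z₀) (h3 : AnalyticAt ℂ α₃ z₀)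
    (hE : EnergyAt a₀ c α₁ α₃ z₀ y₀ E) (F : Ultrafilter ι) {z x y : ι → ℂ}
    (hz : Tendsto z F (𝓝 z₀)) (hy : Tendsto y F (𝓝 y₀)) (hx : Tendsto (fun i => ‖x i‖) F atTop)
    {B : ℝ} (hB : ∀ᶠ i in (F : Filter ι), ‖E (z i) (x i, y i)‖ ≤ B) :
    ∃ (a b : ι → ℂ) (v₀ : ℂ), Tendsto a F (𝓝 0) ∧ Tendsto b F (𝓝 v₀) ∧
      ∀ᶠ i in (F : Filter ι), a i ≠ 0 ∧
        affine (chartE9 (normalised a₀ c α₁ α₃)) (z i, a i, b i) = (x i, y i) := by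
  obtain ⟨C, hC, hCr⟩ := hE.approx h1 h3
  have hu : Tendsto (fun i => (x i)⁻¹) F (𝓝 0) :=
    tendsto_inv₀_cobounded.comp (tendsto_norm_atTop_iff_cobounded.1 hx)
  have hyn : ∀ᶠ i in (F : Filter ι), ‖y i‖ ≤ ‖y₀‖ + 1 := hy.norm.eventually_le_const (lt_add_one _)
  have hmain : ∀ᶠ i in (F : Filter ι), ∃ θ : ℂ, ‖θ‖ ≤ C * ‖y i‖ ^ 2 ∧
      ‖x i * (x i * y i - 2 * a₀ + 2 * θ)‖ ≤ 2 * (B + C) := by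
    filter_upwards [(hz.prodMk_nhds hy).eventually hCr, hB] with i f1 f2
    obtain ⟨θ, hθ, f3⟩ := f1 (x i)
    refine ⟨θ, hθ, ?_⟩
    have e1 := norm_sub_norm_le (1 / 2 * x i * (x i * y i - 2 * a₀ + 2 * θ)) (E (z i) (x i, y i))
    rw [norm_sub_rev, mul_assoc, norm_mul] at e1
    have e2 : ‖(1 / 2 : ℂ)‖ = 1 / 2 := by norm_num
    rw [e2] at e1
    rw [mul_assoc] at f3
    linarith
  have hx0 : ∀ᶠ i in (F : Filter ι), x i ≠ 0 :=
    (hx.eventually_gt_atTop 0).mono fun i hi => norm_pos_iff.1 hi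
  -- `x y` is bounded, hence `y` is of the order of `1 / x`
  obtain ⟨N, hN⟩ : ∃ N : ℝ, ∀ᶠ i in (F : Filter ι), ‖x i * y i‖ ≤ N := by
    refine ⟨2 * (B + C) + 2 * ‖a₀‖ + 2 * (C * (‖y₀‖ + 1) ^ 2), ?_⟩
    filter_upwards [hmain, hyn, hx.eventually_ge_atTop 1] with i ⟨θ, hθ, f1⟩ f2 f3
    rw [norm_mul] at f1
    have e1 : ‖x i * y i - 2 * a₀ + 2 * θ‖ ≤ 2 * (B + C) :=
      (le_mul_of_one_le_left (norm_nonneg _) f3).trans f1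
    have e2 : x i * y i = (x i * y i - 2 * a₀ + 2 * θ) + 2 * a₀ - 2 * θ := by ring
    have e3 : ‖θ‖ ≤ C * (‖y₀‖ + 1) ^ 2 := hθ.trans (by gcongr)
    rw [e2]
    refine (norm_sub_le _ _).trans ?_
    refine (add_le_add (norm_add_le _ _) le_rfl).trans ?_
    rw [norm_mul, norm_mul, Complex.norm_ofNat]
    linarith
  set b : ι → ℂ := fun i => x i * (x i * y i - 2 * a₀) with hb
  have hbb : ∀ᶠ i in (F : Filter ι), ‖b i‖ ≤ 2 * (B + C) + 2 * (C * (N * (‖y₀‖ + 1))) := by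
    filter_upwards [hmain, hyn, hN] with i ⟨θ, hθ, f1⟩ f2 f3
    have e1 : b i = x i * (x i * y i - 2 * a₀ + 2 * θ) - 2 * (x i * θ) := by rw [hb]; ring
    have e2 : ‖x i * θ‖ ≤ C * (N * (‖y₀‖ + 1)) := by
      rw [norm_mul]
      refine (mul_le_mul_of_nonneg_left hθ (norm_nonneg _)).trans ?_
      have e3 : ‖x i‖ * (C * ‖y i‖ ^ 2) = C * (‖x i * y i‖ * ‖y i‖) := by rw [norm_mul]; ring
      rw [e3]
      have hN0 : 0 ≤ N := (norm_nonneg _).trans f3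
      gcongr
    rw [e1]
    refine (norm_sub_le _ _).trans ?_
    rw [norm_mul 2, Complex.norm_ofNat]
    linarith
  obtain ⟨v₀, hv₀⟩ := Ultrafilter.exists_tendsto F hbb
  refine ⟨fun i => (x i)⁻¹, b, v₀, hu, hv₀, ?_⟩
  filter_upwards [hx0] with i f1
  refine ⟨inv_ne_zero f1, ?_⟩
  rw [affine_e9 (inv_ne_zero f1)]
  have h0 : normalised a₀ c α₁ α₃ 0 (z i) = a₀ := rfl
  simp only [hb, h0, one_div, inv_inv, Prod.mk.injEq, true_and]
  field_simp
  ring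

theorem conditions_normalised {U : Set ℂ} (hU : IsOpen U) (hU' : IsPreconnected U)
    (h1 : DifferentiableOn ℂ α₁ U) (h3 : DifferentiableOn ℂ α₃ U) (a₀ c : ℂ) :
    (∀ i, DifferentiableOn ℂ (normalised a₀ c α₁ α₃ i) U) ∧
      Conditions U (normalised a₀ c α₁ α₃) := by
  have hd : ∀ i, DifferentiableOn ℂ (normalised a₀ c α₁ α₃ i) U := fun i z hz =>
    (analyticAt_normalised (h1.analyticAt (hU.mem_nhds hz)) (h3.analyticAt (hU.mem_nhds hz)) a₀ c
      i).differentiableAt.differentiableWithinAt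
  exact ⟨hd, (conditions_iff_normalised hU hU' hd fun z hz => rfl).2 ⟨a₀, c, fun z hz i => rfl⟩⟩

/-- The only singularities of solutions, continued along paths of finite length, are those on the
final curves. -/
theorem IsContinuation.ends {U : Set ℂ} (hU : IsOpen U) (hU' : IsPreconnected U)
    (h1 : DifferentiableOn ℂ α₁ U) (h3 : DifferentiableOn ℂ α₃ U) {γ : ℝ → ℂ} {x y : ℝ → ℂ → ℂ}
    (hγ : FinitePath U γ) (h : IsContinuation (normalised a₀ c α₁ α₃) γ x y) :
    EndsRegularly γ x y ∨ EndsInSeries (normalised a₀ c α₁ α₃)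
        (chartE7 (normalised a₀ c α₁ α₃) 1) 2 γ x y ∨
      EndsInSeries (normalised a₀ c α₁ α₃) (chartE7 (normalised a₀ c α₁ α₃) (-1)) 2 γ x y ∨
      EndsInSeries (normalised a₀ c α₁ α₃) (chartE9 (normalised a₀ c α₁ α₃)) 1 γ x y := by
  have hend : γ 1 ∈ U := hγ.2.1 ⟨zero_le_one, le_rfl⟩
  have ha1 := h1.analyticAt (hU.mem_nhds hend)
  have ha3 := h3.analyticAt (hU.mem_nhds hend)
  have hαa := analyticAt_normalised ha1 ha3 a₀ c
  obtain ⟨hd, hcond⟩ := conditions_normalised hU hU' h1 h3 a₀ c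
  have hres := (conditions_iff hU hU' hd).1 hcond
  have hev := fun {p : ℂ → Prop} (hp : ∀ z ∈ U, p z) =>
    (hU.eventually_mem hend).mono fun z hz => hp z hz
  obtain ⟨B, hB⟩ := exists_bound_modifiedEnergy hU h1 h3 hγ h
  -- either there is a finite cluster point, or the solution becomes infinite
  by_cases hcl : ∃ w₀ : ℂ × ℂ, MapClusterPt w₀ (𝓝[<] (1 : ℝ)) (fun τ => (x τ (γ τ), y τ (γ τ)))
  · obtain ⟨w₀, hw₀⟩ := hcl
    obtain ⟨F, hF, hFw⟩ := mapClusterPt_iff_ultrafilter.1 hw₀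
    exact Or.inl (h.endsRegularly hγ hαa hF hFw)
  have hinf : Tendsto (fun τ => ‖(x τ (γ τ), y τ (γ τ))‖) (𝓝[<] 1) atTop := by
    refine tendsto_atTop.2 fun r => ?_
    by_contra hr
    refine hcl ?_
    obtain ⟨w₀, -, hw₀⟩ := (isCompact_closedBall (0 : ℂ × ℂ) r).exists_mapClusterPt_of_frequently
      (l := 𝓝[<] (1 : ℝ)) (f := fun τ => (x τ (γ τ), y τ (γ τ)))
      ((not_eventually.1 hr).mono fun τ hτ => by
        rw [mem_closedBall_zero_iff]; exact (not_le.1 hτ).le)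
    exact ⟨w₀, hw₀⟩
  have hF : ((Ultrafilter.of (𝓝[<] (1 : ℝ)) : Ultrafilter ℝ) : Filter ℝ) ≤ 𝓝[<] 1 :=
    Ultrafilter.of_le _
  set F := Ultrafilter.of (𝓝[<] (1 : ℝ))
  have hz := hγ.tendsto.mono_left hF
  by_cases hyb : ∃ N : ℝ, ∀ᶠ τ in (F : Filter ℝ), ‖y τ (γ τ)‖ ≤ N
  · obtain ⟨N, hN⟩ := hyb
    obtain ⟨y₀, hy₀⟩ := Ultrafilter.exists_tendsto F hN
    have hx : Tendsto (fun τ => ‖x τ (γ τ)‖) F atTop := by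
      refine tendsto_atTop.2 fun r => ?_
      filter_upwards [(hinf.mono_left hF).eventually_gt_atTop (max r N), hN] with τ f1 f2
      rw [Prod.norm_mk] at f1
      rcases lt_max_iff.1 f1 with f3 | f3
      · exact (le_max_left _ _).trans f3.le
      · exact absurd f2 (not_le.2 ((le_max_right _ _).trans_lt f3))
    obtain ⟨a, b, v₀, ha, hb, hab⟩ := (energyAt_modifiedEnergy ha1 ha3 a₀ c y₀).exists_e9_limit
      ha1 ha3 F hz hy₀ hx (hB.filter_mono hF)
    exact Or.inr (Or.inr (Or.inr (h.endsInSeries_e9 hγ hαa (hev fun z hz => (hres z hz).2.2) hinf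
      hF ha hb hab)))
  · have hy : Tendsto (fun τ => ‖y τ (γ τ)‖) F atTop := by
      refine tendsto_atTop.2 fun r => ?_
      have := fun h => hyb ⟨r, h⟩
      exact (Ultrafilter.eventually_not.2 this).mono fun τ hτ => (not_le.1 hτ).le
    obtain ⟨ε, hε, a, b, v₀, ha, hb, hab⟩ := (energyAtInfinity_modifiedEnergy ha1 ha3 a₀ c).exists_e7_limit
      ha1 ha3 F hz hy (hB.filter_mono hF)
    rcases hε with rfl | rfl
    · exact Or.inr (Or.inl (h.endsInSeries_e7 hγ hαa (Or.inl rfl) (hev fun z hz => (hres z hz).1)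
        hinf hF ha hb hab))
    · exact Or.inr (Or.inr (Or.inl (h.endsInSeries_e7 hγ hαa (Or.inr rfl)
        (hev fun z hz => (hres z hz).2.1) hinf hF ha hb hab)))

end

end QP4

theorem mainTheorem3 (U : Set ℂ) (hU : IsOpen U) (hU' : IsPreconnected U) :
    -- the conditions for the blow-ups to regularise the system and to give algebraic series
    (∀ α : Fin 5 → ℂ → ℂ, (∀ i, DifferentiableOn ℂ (α i) U) →
      (Regularises U α ↔ Conditions U α) ∧ (HasAlgebraicSeries U α ↔ Conditions U α)) ∧
    -- normalisation: for `α₄ = 4 z` and constant `α₀` the conditions fix `α₂` up to a constant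
    (∀ α : Fin 5 → ℂ → ℂ, (∀ i, DifferentiableOn ℂ (α i) U) → (∀ z ∈ U, α 4 z = 4 * z) →
      (Conditions U α ↔ ∃ a₀ c : ℂ, ∀ z ∈ U, ∀ i, α i z = normalised a₀ c (α 1) (α 3) i z)) ∧
    -- normalisation: if `α₄` is not constant, shifting and re-scaling gives the normalised system
    (∀ α : Fin 5 → ℂ → ℂ, (∀ i, DifferentiableOn ℂ (α i) U) → Conditions U α →
      (∃ z ∈ U, deriv (α 4) z ≠ 0) →
      ∃ (μ ν lam a₀ c : ℂ) (β₁ β₃ : ℂ → ℂ), μ ≠ 0 ∧ lam ≠ 0 ∧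
        DifferentiableOn ℂ β₁ {Z | μ * Z + ν ∈ U} ∧ DifferentiableOn ℂ β₃ {Z | μ * Z + ν ∈ U} ∧
        ∀ S ⊆ U, ∀ x y : ℂ → ℂ, SolvesOn α S x y ↔
          SolvesOn (normalised a₀ c β₁ β₃) {Z | μ * Z + ν ∈ S}
            (fun Z => μ * x (μ * Z + ν)) (fun Z => lam⁻¹ * y (μ * Z + ν))) ∧
    -- the normalised system, with arbitrary analytic `α₁` and `α₃`
    (∀ (a₀ c : ℂ) (α₁ α₃ : ℂ → ℂ), DifferentiableOn ℂ α₁ U → DifferentiableOn ℂ α₃ U →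
      ∀ α : Fin 5 → ℂ → ℂ, α = normalised a₀ c α₁ α₃ →
      -- it is equivalent, for `y ≠ 0`, to the second-order equation
      (∀ S ⊆ U, IsOpen S → ∀ x y : ℂ → ℂ, SolvesOn α S x y → ∀ z ∈ S, y z ≠ 0 →
        deriv (deriv y) z = deriv y z ^ 2 / (2 * y z) + 5 / 2 * y z ^ 5 + 4 * z * y z ^ 4
          + α₃ z * y z ^ 3 + (c + 2 * z / 3 * α₃ z - z ^ 3) * y z ^ 2 + α₁ z * y z
          - a₀ ^ 2 / (2 * y z)) ∧
      (∀ S ⊆ U, IsOpen S → ∀ y : ℂ → ℂ, DifferentiableOn ℂ y S →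
        (∀ z ∈ S, y z ≠ 0 ∧
          deriv (deriv y) z = deriv y z ^ 2 / (2 * y z) + 5 / 2 * y z ^ 5 + 4 * z * y z ^ 4
            + α₃ z * y z ^ 3 + (c + 2 * z / 3 * α₃ z - z ^ 3) * y z ^ 2 + α₁ z * y z
            - a₀ ^ 2 / (2 * y z)) →
        SolvesOn α S (fun z => (deriv y z + a₀) / y z) y) ∧
      -- square-root algebraic poles: at every `z₀`, through every point of the curves `E₇^±`
      (∀ ε : ℂ, ε = 1 ∨ ε = -1 → ∀ z₀ ∈ U, ∀ v₀ : ℂ,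
        (∃ X Y, SeriesThrough α (chartE7 α ε) 2 z₀ v₀ X Y) ∧
        ∀ X Y, SeriesThrough α (chartE7 α ε) 2 z₀ v₀ X Y →
          Tendsto (fun s => s ^ 2 * X s) (𝓝[≠] 0) (𝓝 (-(1 / 2))) ∧
          ∃ σ : ℂ, σ ^ 2 = -ε ∧
            Tendsto (fun s => s * Y s) (𝓝[≠] 0) (𝓝 (σ / (Real.sqrt 2 : ℂ)))) ∧
      -- ordinary poles: at every `z₀`, through every point of the curve `E₉`
      (∀ z₀ ∈ U, ∀ v₀ : ℂ,
        (∃ X Y, SeriesThrough α (chartE9 α) 1 z₀ v₀ X Y) ∧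
        ∀ X Y, SeriesThrough α (chartE9 α) 1 z₀ v₀ X Y →
          Tendsto (fun s => s * X s) (𝓝[≠] 0) (𝓝 2) ∧
          Tendsto (fun s => Y s / s) (𝓝[≠] 0) (𝓝 a₀) ∧
          meromorphicOrderAt X 0 = -1 ∧ (a₀ ≠ 0 → meromorphicOrderAt Y 0 = 1)) ∧
      -- continuation along finite-length paths meets no other singularities
      (∀ (γ : ℝ → ℂ) (x y : ℝ → ℂ → ℂ), FinitePath U γ → IsContinuation α γ x y →
        EndsRegularly γ x y ∨ EndsInSeries α (chartE7 α 1) 2 γ x y ∨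
          EndsInSeries α (chartE7 α (-1)) 2 γ x y ∨ EndsInSeries α (chartE9 α) 1 γ x y) ∧
      -- the line at infinity and the intermediate exceptional curves are inaccessible
      (∀ z₀ ∈ U, ∀ (κ : Chart) (q : ℂ × ℂ),
        IntermediatePoint α z₀ κ q ∨ CornerPoint α κ q → Inaccessible U α κ z₀ q) ∧
      -- there the auxiliary function is infinite and its logarithmic derivative is bounded,
      -- except where its denominator vanishes
      (∀ z₀ ∈ U, ∀ (κ : Chart) (q : ℂ × ℂ), IntermediatePoint α z₀ κ q →
        ¬ Tendsto (fun p => auxDenom α p.1 (affine κ p)) (approach κ z₀ q) (𝓝 0) →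
        Tendsto (fun p => ‖aux α p.1 (affine κ p)‖) (approach κ z₀ q) atTop ∧
        ∃ K : ℝ, ∀ᶠ p in approach κ z₀ q,
          ‖auxDeriv α p.1 (affine κ p)‖ ≤ K * ‖aux α p.1 (affine κ p)‖) ∧
      -- on the final curves the auxiliary function is bounded
      (∀ z₀ ∈ U, ∀ v₀ : ℂ, ∀ κ : Chart, κ = chartE7 α 1 ∨ κ = chartE7 α (-1) ∨ κ = chartE9 α →
        ∃ K : ℝ, ∀ᶠ p in approach κ z₀ (0, v₀), ‖aux α p.1 (affine κ p)‖ ≤ K)) := by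
  refine ⟨fun α hα => ⟨regularises_iff hU hU' hα, hasAlgebraicSeries_iff hU hU' hα⟩,
    fun α hα h4 => conditions_iff_normalised hU hU' hα h4,
    fun α hα hc hne => exists_normalisation hU hU' hα hc hne, ?_⟩
  rintro a₀ c α₁ α₃ h1 h3 α rfl
  have ha1 : ∀ z ∈ U, AnalyticAt ℂ α₁ z := fun z hz => h1.analyticAt (hU.mem_nhds hz)
  have ha3 : ∀ z ∈ U, AnalyticAt ℂ α₃ z := fun z hz => h3.analyticAt (hU.mem_nhds hz)
  have hαa := fun z hz => analyticAt_normalised (ha1 z hz) (ha3 z hz) a₀ c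
  obtain ⟨hd, hcond⟩ := conditions_normalised hU hU' h1 h3 a₀ c
  have hser := (hasAlgebraicSeries_iff hU hU' hd).2 hcond
  refine ⟨fun S _ hS x y hxy z hz hy => second_order_of_solvesOn hS hxy hz hy,
    fun S _ hS y hy h => solvesOn_of_second_order hS hy h,
    fun ε hε z₀ hz v₀ => ⟨(hser z₀ hz v₀).1 ε hε, fun X Y h => (h.e7 hε (hαa z₀ hz)).2⟩,
    fun z₀ hz v₀ => ⟨(hser z₀ hz v₀).2, fun X Y h => (h.e9 (hαa z₀ hz)).2⟩,
    fun γ x y hγ h => h.ends hU hU' h1 h3 hγ,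
    fun z₀ hz κ q h => inaccessible hU h1 h3 hz h,
    fun z₀ hz κ q h hne => ⟨h.tendsto_aux (ha1 z₀ hz) (ha3 z₀ hz) hne,
      h.exists_auxDeriv_le (ha1 z₀ hz) (ha3 z₀ hz) hne⟩,
    fun z₀ hz v₀ κ hκ => exists_bound_aux (ha1 z₀ hz) (ha3 z₀ hz) v₀ hκ⟩
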